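/- **Conventions.** Let $R\neq 0$ be a commutative Noetherian ring; $M^*=\operatorname{Hom}_R(M,R)$. For a free module $M$ of finite rank and $n\in\mathbb Z$ let $\bigwedge^nM$, $\operatorname{Sym}_nM$ and $D_n(M^*)=(\operatorname{Sym}_nM)^*$ be the exterior, symmetric and divided powers (all zero for $n<0$). $\operatorname{Sym}_\bullet M$ acts on $D_\bullet(M^*)$ by the transpose of multiplication, and $\bigwedge^\bullet (M^*)$ acts on $\bigwedge^\bullet M$, with $\varphi\in M^*$ acting as the antiderivation of degree $-1$ extending $\varphi$ and $(\varphi\wedge\psi)(x)=\varphi(\psi(x))$. For a basis $e_1,\dots,e_n$ of $M$ with dual basis $e_\ell^*$ one has the canonical elements $\sum_\ell e_\ell^*\otimes e_\ell\in M^*\otimes M$ and $\sum_m m^*\otimes m=\sum_{s_1<\dots<s_k}(e_{s_k}^*\wedge\dots\wedge e_{s_1}^*)\otimes (e_{s_1}\wedge\dots\wedge e_{s_k})\in\bigwedge^k(M^*)\otimes\bigwedge^kM$; they do not depend on the basis. Complexes are indexed by $j\in\mathbb Z$ with differentials of degree $-1$; $A[n]_j=A_{n+j}$ with the same differentials. For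 a map of complexes $\theta:A\to B$ let $\operatorname{Tot}(\theta)_j=A_{j-1}\oplus B_j$ with differential $(x,y)\mapsto(d x,\theta x-d y)$. **The complexes.** Let $G$, $F$ be free of finite ranks $\mathfrak g$, $\mathfrak f$ and let $\Phi:G^*\to F$ be linear. Let $e_\ell$ run over a basis of $G$. Put $$L^p_qG=\ker\Big(\kappa:\bigwedge^pG\otimes\operatorname{Sym}_qG\to\bigwedge^{p-1}G\otimes\operatorname{Sym}_{q+1}G,\ x\otimes y\mapsto\sum_\ell e_\ell^*(x)\otimes e_\ell y\Big),$$ $$K^p_q(G^*)=\ker\Big(\bigwedge^p(G^*)\otimes D_q(G^*)\to\bigwedge^{p+1}(G^*)\otimes D_{q-1}(G^*),\ x\otimes y\mapsto\sum_\ell x\wedge e_\ell^*\otimes e_\ell y\Big).$$ For $N,p\in\mathbb Z$ let $\mathbb K^{N,p}_\Phi$ be the complex with $[\mathbb K^{N,p}_\Phi]_j=\bigwedge^{N-j}F\otimes K^p_j(G^*)$, and let $\mathbb L^{N,p}_\Phi$ be the complex with $[\mathbb L^{N,p}_\Phi]_j=\bigwedge^{\mathfrak f-j}F\otimes L^p_{\mathfrak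 f-N-j}G$ if $\mathfrak f-N-j\ge1$ and $0$ otherwise; both differentials are $u\otimes x\mapsto\sum_\ell u\wedge\Phi(e_\ell^*)\otimes e_\ell x$ (they are denoted $\eta_\Phi$ and $\mathrm{Kos}_\Phi$). For $i,a\in\mathbb Z$ let $\mathcal C^{i,a}_\Phi$ be the complex $$0\to\mathbb K^{\mathfrak f-\mathfrak g-i-1,a}_\Phi[-i-2]\to\bigwedge^{\mathfrak f-\mathfrak g+a-i-1}F\to\mathbb L^{\mathfrak f-i-1,\mathfrak g-a}_\Phi\to0$$ with $\bigwedge^{\mathfrak f-\mathfrak g+a-i-1}F$ in position $i+1$, the first part in the positions $j\ge i+2$ and the last part in the positions $j\le i$; the differential from position $i+2$ is $u\otimes\gamma\mapsto u\wedge(\bigwedge^a\Phi)(\gamma)$ for $\gamma\in K^a_0(G^*)=\bigwedge^a(G^*)$, and the one from position $i+1$ is $u\mapsto\sum_m u\wedge(\bigwedge^{\mathfrak g+1-a}\Phi)(m^*)\otimes\kappa(m\otimes1)$, with $\sum_m m^*\otimes m\in\bigwedge^{\mathfrak g+1-a}(G^*)\otimes\bigwedge^{\mathfrak g+1-a}G$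 the canonical element. **Lemma.** Let $F=F'\oplus F''$ and $G=G'\oplus G''$, where $F',F'',G',G''$ are free $R$-modules of finite rank with $\operatorname{rank}F''=\operatorname{rank}G''=1$, let $\mathfrak f=\operatorname{rank}F$ and $\mathfrak g=\operatorname{rank}G$ with $\mathfrak g\le\mathfrak f$, and let $\Phi=\Phi'\oplus\Phi'':G^*=G'^*\oplus G''^*\to F'\oplus F''$, where $\Phi':G'^*\to F'$ is linear and $\Phi'':G''^*\to F''$ is an isomorphism. Let $\pi':F\to F'$ be the projection. Let $i$ and $a$ be integers with $1\le a\le\mathfrak g-1$. Let $e$ be a basis element of $G''$, $e^*$ the dual one, and let $\mathrm{Kos}_{\Phi''}:R\to F''\otimes G''$ be $1\mapsto\Phi''(e^*)\otimes e$. Then there are a complex $\mathcal D$ of free $R$-modules and short exact sequences of complexes $$0\to\operatorname{Tot}\Big(\mathbb L^{\mathfrak f-i-1,\mathfrak g-a}_{\pi'\Phi}\otimes R\xrightarrow{1\otimes\mathrm{Kos}_{\Phi''}}\mathbb L^{\mathfrak f-i-1,\mathfrak g-a}_{\pi'\Phi}\otimes F''\otimes G''\Big)\xrightarrow{\operatorname{incl}^\dagger}\mathcal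 C^{i,a}_\Phi\xrightarrow{\operatorname{quot}^\dagger}\mathcal D\to0,$$ $$0\to\mathcal C^{i,a}_{\Phi'}\oplus\big(\mathcal C^{i,a-1}_{\Phi'}\otimes G''^*\big)\xrightarrow{\operatorname{incl}^\ddagger}\mathcal D\xrightarrow{\operatorname{quot}^\ddagger}\operatorname{Tot}\Big(\mathbb K^{\mathfrak f-\mathfrak g-i-2,a}_{\pi'\Phi}[-i-2]\otimes G''^*\xrightarrow{1\otimes\Phi''}\mathbb K^{\mathfrak f-\mathfrak g-i-2,a}_{\pi'\Phi}[-i-2]\otimes F''\Big)\to0,$$ in which the two total complexes are exact, and which are canonical in the following sense. In position $j$ the module $\mathcal D_j$ is identified with the direct sum of $[\mathbb K^{\mathfrak f-\mathfrak g-i-1,a}_\Phi[-i-2]]_j$, of $\bigwedge^{\mathfrak f-\mathfrak g+a-i-1}F$ (if $j=i+1$), of $[\mathbb L^{\mathfrak f-i-2,\mathfrak g-a}_{\Phi'}]_j\otimes F''$ and of $[\mathbb L^{\mathfrak f-i-2,\mathfrak g-a-1}_{\Phi'}]_j\otimes F''\otimes G''$, and the maps are: * $\operatorname{incl}^\dagger$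 has values in the $\mathbb L$-part; it is $(u\otimes x)\otimes r\mapsto r\,u\otimes x$ on the first summand of $\operatorname{Tot}$ and $(u\otimes x)\otimes v\otimes w\mapsto (u\wedge v)\otimes wx$ on the second; * $\operatorname{quot}^\dagger$ is the identity on the $\mathbb K$-part and on the exterior power in position $i+1$; on the $\mathbb L$-part its two components are induced by the projections $\bigwedge^nF\to\bigwedge^{n-1}F'\otimes F''$, $\operatorname{Sym}_qG\to\operatorname{Sym}_qG'$ and, respectively, $\bigwedge^pG\to\bigwedge^pG'$ and $\bigwedge^pG\to\bigwedge^{p-1}G'\otimes G''$; * $\operatorname{incl}^\ddagger$ on $\mathcal C^{i,a}_{\Phi'}$ is given by the inclusions in the positions $j\ge i+1$ and by $y\mapsto(-1)^{\mathfrak g-a+i-j}\,y\otimes\mathrm{Kos}_{\Phi''}(1)$ in the positions $j\le i$; on $\mathcal C^{i,a-1}_{\Phi'}\otimes G''^*$ it is $u\otimes x\otimes\gamma\mapsto u\otimes(x\wedge\gamma)$ in the positions $j\ge i+2$ (with $\gamma$ multiplied on the exterior factor of $x$), $y\otimes\gamma\mapsto y\wedge\Phi''(\gamma)$ in position $i+1$,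 and $y\otimes\gamma\mapsto(-1)^{\mathfrak g-a+1+i-j}\,y\otimes\Phi''(\gamma)$ in the positions $j\le i$; * $\operatorname{quot}^\ddagger$ is zero in the positions $j\le i+1$; in the positions $j\ge i+2$ its components are $u\otimes x\mapsto(\bigwedge\pi')(u)\otimes ex\otimes e^*$ and the map induced by the projection $\bigwedge^nF\to\bigwedge^{n-1}F'\otimes F''$. In particular, for every integer $j$ there is an isomorphism $$\operatorname{H}_j(\mathcal C^{i,a}_{\Phi'})\oplus\big(\operatorname{H}_j(\mathcal C^{i,a-1}_{\Phi'})\otimes G''^*\big)\cong\operatorname{H}_j(\mathcal C^{i,a}_\Phi),$$ canonical in that its composition with $\operatorname{H}_j(\operatorname{quot}^\dagger)$ sends $(x,y\otimes\gamma)$ to $\operatorname{H}_j(\operatorname{incl}^\ddagger)(x,\,y\otimes\gamma)$, where $y\otimes\gamma$ is the image of $y$ under the map induced on homology by $-\otimes\gamma:\mathcal C^{i,a-1}_{\Phi'}\to\mathcal C^{i,a-1}_{\Phi'}\otimes G''^*$. -/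

import Mathlib

open TensorProduct CategoryTheory

universe u v w

set_option linter.unusedSectionVars false

noncomputable section

namespace HookEN

section Pieces
variable (R : Type u) [CommRing R] (M : Type v) [AddCommGroup M] [Module R M]

/-- The exterior power of degree `n`, for an integer `n` (zero if `n < 0`), as a submodule of the
exterior algebra. -/
def extPiece (n : ℤ) : Submodule R (ExteriorAlgebra R M) :=
  if 0 ≤ n then ⋀[R]^n.toNat M else ⊥

/-- The symmetric power of degree `n`, for an integer `n` (zero if `n < 0`), as a submodule of the
symmetric algebra. -/
def symPiece (n : ℤ) : Submodule R (SymmetricAlgebra R M) :=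
  if 0 ≤ n then LinearMap.range (SymmetricAlgebra.ι R M) ^ n.toNat else ⊥

/-- `⋀ⁿ M`. -/
abbrev ExtPow (n : ℤ) : Type (max u v) := extPiece R M n

/-- `Symₙ M`. -/
abbrev SymPow (n : ℤ) : Type (max u v) := symPiece R M n

/-- `Dₙ (M*)`, for `M` free of finite rank: the degree `n` component of the graded dual of
`Sym M`. -/
abbrev DivPow (n : ℤ) : Type (max u v) := Module.Dual R (SymPow R M n)

variable {R M}

lemma extPiece_coe (k : ℕ) : extPiece R M (k : ℤ) = ⋀[R]^k M := by simp [extPiece]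

lemma symPiece_coe (k : ℕ) :
    symPiece R M (k : ℤ) = LinearMap.range (SymmetricAlgebra.ι R M) ^ k := by simp [symPiece]

lemma extPiece_neg {n : ℤ} (h : n < 0) : extPiece R M n = ⊥ := by
  simp [extPiece, not_le.mpr h]

lemma symPiece_neg {n : ℤ} (h : n < 0) : symPiece R M n = ⊥ := by
  simp [symPiece, not_le.mpr h]

lemma ι_mem_extPiece (x : M) : ExteriorAlgebra.ι R x ∈ extPiece R M 1 := by
  have := extPiece_coe (R := R) (M := M) 1
  rw [Nat.cast_one] at this
  rw [this, ExteriorAlgebra.exteriorPower, pow_one]; exact ⟨x, rfl⟩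

lemma ι_mem_symPiece (x : M) : SymmetricAlgebra.ι R M x ∈ symPiece R M 1 := by
  have := symPiece_coe (R := R) (M := M) 1
  rw [Nat.cast_one] at this
  rw [this, pow_one]; exact ⟨x, rfl⟩

lemma one_mem_extPiece : (1 : ExteriorAlgebra R M) ∈ extPiece R M 0 := by
  have := extPiece_coe (R := R) (M := M) 0
  rw [Nat.cast_zero] at this
  rw [this, ExteriorAlgebra.exteriorPower, pow_zero]; exact Submodule.one_le.mp le_rfl

lemma one_mem_symPiece : (1 : SymmetricAlgebra R M) ∈ symPiece R M 0 := by
  have := symPiece_coe (R := R) (M := M) 0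
  rw [Nat.cast_zero] at this
  rw [this, pow_zero]; exact Submodule.one_le.mp le_rfl

lemma mul_mem_extPiece {n m k : ℤ} (h : k = n + m) {x y : ExteriorAlgebra R M}
    (hx : x ∈ extPiece R M n) (hy : y ∈ extPiece R M m) : x * y ∈ extPiece R M k := by
  rcases lt_or_ge n 0 with hn | hn
  · rw [extPiece_neg hn, Submodule.mem_bot] at hx; simp [hx]
  rcases lt_or_ge m 0 with hm | hm
  · rw [extPiece_neg hm, Submodule.mem_bot] at hy; simp [hy]
  lift n to ℕ using hn
  lift m to ℕ using hm
  rw [h, ← Nat.cast_add, extPiece_coe, ExteriorAlgebra.exteriorPower, pow_add]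
  rw [extPiece_coe] at hx hy
  exact Submodule.mul_mem_mul hx hy

lemma mul_mem_symPiece {n m k : ℤ} (h : k = n + m) {x y : SymmetricAlgebra R M}
    (hx : x ∈ symPiece R M n) (hy : y ∈ symPiece R M m) : x * y ∈ symPiece R M k := by
  rcases lt_or_ge n 0 with hn | hn
  · rw [symPiece_neg hn, Submodule.mem_bot] at hx; simp [hx]
  rcases lt_or_ge m 0 with hm | hm
  · rw [symPiece_neg hm, Submodule.mem_bot] at hy; simp [hy]
  lift n to ℕ using hn
  lift m to ℕ using hm
  rw [h, ← Nat.cast_add, symPiece_coe, pow_add]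
  rw [symPiece_coe] at hx hy
  exact Submodule.mul_mem_mul hx hy

lemma contractLeft_mem_extPiece {n m : ℤ} (h : m = n - 1) (φ : Module.Dual R M)
    {x : ExteriorAlgebra R M} (hx : x ∈ extPiece R M n) :
    CliffordAlgebra.contractLeft φ x ∈ extPiece R M m := by
  rcases lt_or_ge n 0 with hn | hn
  · rw [extPiece_neg hn, Submodule.mem_bot] at hx; simp [hx]
  lift n to ℕ using hn
  rw [extPiece_coe] at hx
  induction hx using Submodule.pow_induction_on_left' generalizing m with
  | algebraMap r => rw [show algebraMap R (ExteriorAlgebra R M) r = algebraMap R (CliffordAlgebra 0) r from rfl, CliffordAlgebra.contractLeft_algebraMap]; exact zero_mem _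
  | add x y i hx hy hx' hy' => rw [map_add]; exact add_mem (hx' h) (hy' h)
  | mem_mul v hv i x hx ih =>
    obtain ⟨v, rfl⟩ := hv
    rw [show ExteriorAlgebra.ι R v * x = CliffordAlgebra.ι 0 v * x from rfl,
      CliffordAlgebra.contractLeft_ι_mul]
    have hm : m = i := by rw [h]; push_cast; ring
    refine sub_mem (Submodule.smul_mem _ _ ?_) (mul_mem_extPiece (n := 1) (m := m - 1) (by ring) (ι_mem_extPiece v) (ih ?_))
    · rw [hm, extPiece_coe]; exact hx
    · rw [hm]

variable {N : Type w} [AddCommGroup N] [Module R N]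

lemma map_mem_extPiece (f : M →ₗ[R] N) {n : ℤ} {x : ExteriorAlgebra R M}
    (hx : x ∈ extPiece R M n) : ExteriorAlgebra.map f x ∈ extPiece R N n := by
  rcases lt_or_ge n 0 with hn | hn
  · rw [extPiece_neg hn, Submodule.mem_bot] at hx; simp [hx]
  lift n to ℕ using hn
  rw [extPiece_coe] at hx ⊢
  induction hx using Submodule.pow_induction_on_left' with
  | algebraMap r => rw [AlgHom.commutes]; exact Submodule.algebraMap_mem r
  | add x y i hx hy hx' hy' => rw [map_add]; exact add_mem hx' hy'
  | mem_mul v hv i x hx ih =>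
    obtain ⟨v, rfl⟩ := hv
    rw [map_mul, ExteriorAlgebra.map_apply_ι, ExteriorAlgebra.exteriorPower, pow_succ']
    exact Submodule.mul_mem_mul ⟨_, rfl⟩ ih

/-- The homomorphism of symmetric algebras induced by a linear map. -/
def symAlgMap (f : M →ₗ[R] N) : SymmetricAlgebra R M →ₐ[R] SymmetricAlgebra R N :=
  SymmetricAlgebra.lift (SymmetricAlgebra.ι R N ∘ₗ f)

lemma map_mem_symPiece (f : M →ₗ[R] N) {n : ℤ} {x : SymmetricAlgebra R M}
    (hx : x ∈ symPiece R M n) : symAlgMap f x ∈ symPiece R N n := by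
  rcases lt_or_ge n 0 with hn | hn
  · rw [symPiece_neg hn, Submodule.mem_bot] at hx; simp [hx]
  lift n to ℕ using hn
  rw [symPiece_coe] at hx ⊢
  induction hx using Submodule.pow_induction_on_left' with
  | algebraMap r => rw [AlgHom.commutes]; exact Submodule.algebraMap_mem r
  | add x y i hx hy hx' hy' => rw [map_add]; exact add_mem hx' hy'
  | mem_mul v hv i x hx ih =>
    obtain ⟨v, rfl⟩ := hv
    rw [map_mul, symAlgMap, SymmetricAlgebra.lift_ι_apply, pow_succ']
    exact Submodule.mul_mem_mul ⟨_, rfl⟩ ih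

instance extPow_free [Module.Free R M] (n : ℤ) : Module.Free R (ExtPow R M n) := by
  change Module.Free R (extPiece R M n)
  rcases lt_or_ge n 0 with hn | hn
  · rw [extPiece_neg hn]; infer_instance
  · lift n to ℕ using hn
    rw [extPiece_coe]; infer_instance

lemma extPow_subsingleton [Nontrivial R] [Module.Free R M] [Module.Finite R M] {n : ℤ}
    (h : n < 0 ∨ (Module.finrank R M : ℤ) < n) : Subsingleton (ExtPow R M n) := by
  change Subsingleton (extPiece R M n)
  rcases lt_or_ge n 0 with hn | hn
  · rw [extPiece_neg hn]; infer_instance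
  · lift n to ℕ using hn
    rw [extPiece_coe]
    have hlt : Module.finrank R M < n := by omega
    have : Module.finrank R (⋀[R]^n M) = 0 := by
      rw [exteriorPower.finrank_eq, Nat.choose_eq_zero_of_lt hlt]
    exact (Module.finrank_eq_zero_iff_of_free R _).mp this

end Pieces

section Operators
variable {R : Type u} [CommRing R] {M : Type v} [AddCommGroup M] [Module R M]
  {N : Type w} [AddCommGroup N] [Module R N]

/-- Multiplication `⋀ⁿ M × ⋀ᵐ M → ⋀ⁿ⁺ᵐ M`. -/
def wedge {n m k : ℤ} (h : k = n + m) : ExtPow R M n →ₗ[R] ExtPow R M m →ₗ[R] ExtPow R M k :=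
  LinearMap.mk₂ R (fun x y => ⟨x.1 * y.1, mul_mem_extPiece h x.2 y.2⟩)
    (fun _ _ _ => Subtype.ext (add_mul _ _ _)) (fun _ _ _ => Subtype.ext (smul_mul_assoc _ _ _))
    (fun _ _ _ => Subtype.ext (mul_add _ _ _)) (fun _ _ _ => Subtype.ext (mul_smul_comm _ _ _))

/-- `M → ⋀¹ M`. -/
def extι : M →ₗ[R] ExtPow R M 1 := (ExteriorAlgebra.ι R).codRestrict _ ι_mem_extPiece

/-- Right multiplication `x ↦ x ∧ v`, from `⋀ⁿ M` to `⋀ⁿ⁺¹ M`, as a linear function of `v`. -/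
def wedgeVec {n k : ℤ} (h : k = n + 1) : M →ₗ[R] ExtPow R M n →ₗ[R] ExtPow R M k :=
  (wedge h).flip ∘ₗ extι

/-- The action of `φ ∈ M*` on `⋀ M`: the antiderivation of degree `-1` which is `φ` on `M`. -/
def contr {n k : ℤ} (h : k = n - 1) : Module.Dual R M →ₗ[R] ExtPow R M n →ₗ[R] ExtPow R M k :=
  LinearMap.mk₂ R (fun φ x => ⟨CliffordAlgebra.contractLeft φ x.1, contractLeft_mem_extPiece h φ x.2⟩)
    (fun _ _ _ => Subtype.ext (by simp)) (fun _ _ _ => Subtype.ext (by simp))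
    (fun _ _ _ => Subtype.ext (by simp)) (fun _ _ _ => Subtype.ext (by simp))

/-- The contraction of `φ ∈ M*` against the last factor, `x ∧ v ↦ φ(v) x` if `φ` vanishes on the
factors of `x`: it is `(-1)ⁿ⁻¹` times the action of `φ` on `⋀ⁿ M`. -/
def contrR {n k : ℤ} (h : k = n - 1) : Module.Dual R M →ₗ[R] ExtPow R M n →ₗ[R] ExtPow R M k :=
  (k.negOnePow : ℤ) • contr h

/-- `⋀ⁿ f`; the two degrees are kept apart so that equal degrees need not be syntactically equal. -/
def extMap (f : M →ₗ[R] N) {n k : ℤ} (h : k = n) : ExtPow R M n →ₗ[R] ExtPow R N k :=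
  (ExteriorAlgebra.map f).toLinearMap.restrict (fun _ hx => h ▸ map_mem_extPiece f hx)

/-- `Symₙ f`. -/
def symMap (f : M →ₗ[R] N) {n k : ℤ} (h : k = n) : SymPow R M n →ₗ[R] SymPow R N k :=
  (symAlgMap f).toLinearMap.restrict (fun _ hx => h ▸ map_mem_symPiece f hx)

/-- Multiplication by `v ∈ M` on `Sym M`. -/
def symMul {n k : ℤ} (h : k = n + 1) : M →ₗ[R] SymPow R M n →ₗ[R] SymPow R M k :=
  LinearMap.mk₂ R (fun v x => ⟨SymmetricAlgebra.ι R M v * x.1,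
      mul_mem_symPiece (by omega) (ι_mem_symPiece v) x.2⟩)
    (fun _ _ _ => Subtype.ext (by simp [add_mul])) (fun _ _ _ => Subtype.ext (by simp))
    (fun _ _ _ => Subtype.ext (by simp [mul_add])) (fun _ _ _ => Subtype.ext (by simp))

/-- The module action of `v ∈ M` on `D(M*)`: the dual of multiplication by `v` on `Sym M`. -/
def divAct {n k : ℤ} (h : k = n - 1) : M →ₗ[R] DivPow R M n →ₗ[R] DivPow R M k :=
  LinearMap.mk₂ R (fun v φ => φ ∘ₗ symMul (by omega) v)
    (fun _ _ _ => by ext; simp) (fun _ _ _ => by ext; simp)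
    (fun _ _ _ => by ext; simp) (fun _ _ _ => by ext; simp)

/-- The map `Dₙ(N*) → Dₙ(M*)` induced by `f : M → N`. -/
def divMap (f : M →ₗ[R] N) {n k : ℤ} (h : k = n) : DivPow R N n →ₗ[R] DivPow R M k :=
  (symMap f h.symm).dualMap

/-- The identification `D₀(M*) = R`, extended by zero to the other degrees. -/
def divEval {n : ℤ} : DivPow R M n →ₗ[R] R :=
  if h : n = 0 then LinearMap.applyₗ ⟨1, h ▸ one_mem_symPiece⟩ else 0

@[simp] lemma wedge_coe {n m k : ℤ} (h : k = n + m) (x : ExtPow R M n) (y : ExtPow R M m) :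
    (wedge h x y : ExteriorAlgebra R M) = x.1 * y.1 := rfl
@[simp] lemma wedgeVec_coe {n k : ℤ} (h : k = n + 1) (v : M) (x : ExtPow R M n) :
    (wedgeVec h v x : ExteriorAlgebra R M) = x.1 * ExteriorAlgebra.ι R v := rfl
@[simp] lemma contr_coe {n k : ℤ} (h : k = n - 1) (φ : Module.Dual R M) (x : ExtPow R M n) :
    (contr h φ x : ExteriorAlgebra R M) = CliffordAlgebra.contractLeft φ x.1 := rfl
@[simp] lemma extMap_coe (f : M →ₗ[R] N) {n k : ℤ} (h : k = n) (x : ExtPow R M n) :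
    (extMap f h x : ExteriorAlgebra R N) = ExteriorAlgebra.map f x.1 := rfl
@[simp] lemma symMap_coe (f : M →ₗ[R] N) {n k : ℤ} (h : k = n) (x : SymPow R M n) :
    (symMap f h x : SymmetricAlgebra R N) = symAlgMap f x.1 := rfl
@[simp] lemma symMul_coe {n k : ℤ} (h : k = n + 1) (v : M) (x : SymPow R M n) :
    (symMul h v x : SymmetricAlgebra R M) = SymmetricAlgebra.ι R M v * x.1 := rfl
@[simp] lemma divAct_apply {n k : ℤ} (h : k = n - 1) (v : M) (φ : DivPow R M n)
    (x : SymPow R M k) : divAct h v φ x = φ (symMul (by omega) v x) := rfl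

lemma wedgeVec_wedgeVec_self {n k l : ℤ} (h : k = n + 1) (h' : l = k + 1) (v : M)
    (x : ExtPow R M n) : wedgeVec h' v (wedgeVec h v x) = 0 :=
  Subtype.ext (by simp [mul_assoc])

lemma wedgeVec_wedgeVec_add {n k l : ℤ} (h : k = n + 1) (h' : l = k + 1) (v w : M)
    (x : ExtPow R M n) :
    wedgeVec h' v (wedgeVec h w x) + wedgeVec h' w (wedgeVec h v x) = 0 :=
  Subtype.ext (by
    simp only [Submodule.coe_add, wedgeVec_coe, mul_assoc, ← mul_add,
      ExteriorAlgebra.ι_add_mul_swap, mul_zero, ZeroMemClass.coe_zero])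

lemma contr_contr_self {n k l : ℤ} (h : k = n - 1) (h' : l = k - 1) (v : Module.Dual R M)
    (x : ExtPow R M n) : contr h' v (contr h v x) = 0 :=
  Subtype.ext (CliffordAlgebra.contractLeft_contractLeft _ _)

lemma contr_contr_add {n k l : ℤ} (h : k = n - 1) (h' : l = k - 1) (v w : Module.Dual R M)
    (x : ExtPow R M n) : contr h' v (contr h w x) + contr h' w (contr h v x) = 0 :=
  Subtype.ext (by
    rw [Submodule.coe_add, contr_coe, contr_coe, contr_coe, contr_coe,
      CliffordAlgebra.contractLeft_comm]
    simp)

lemma symMul_comm {n k l : ℤ} (h : k = n + 1) (h' : l = k + 1) (v w : M) (x : SymPow R M n) :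
    symMul h' v (symMul h w x) = symMul h' w (symMul h v x) :=
  Subtype.ext (mul_left_comm _ _ _)

lemma divAct_comm {n k l : ℤ} (h : k = n - 1) (h' : l = k - 1) (v w : M) (x : DivPow R M n) :
    divAct h' v (divAct h w x) = divAct h' w (divAct h v x) := by
  ext y
  simp only [divAct_apply]
  rw [symMul_comm]

end Operators

section Canonical
variable {R : Type u} [CommRing R] {V : Type v} [AddCommGroup V] [Module R V]
  [Module.Free R V] [Module.Finite R V]

variable (R V) in
/-- The canonical element `ev*(1) = ∑ e_ℓ* ⊗ e_ℓ` of `V* ⊗ V`, that is, the element corresponding to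
the identity of `V`. -/
def evStar : Module.Dual R V ⊗[R] V := (dualTensorHomEquiv R V V).symm LinearMap.id

/-- `∑ T(e_ℓ*, e_ℓ)`, the value on `ev*(1)` of the linear map given by a bilinear map `T`. -/
def evSum {P : Type*} [AddCommMonoid P] [Module R P] (T : Module.Dual R V →ₗ[R] V →ₗ[R] P) : P :=
  TensorProduct.lift T (evStar R V)

lemma evStar_eq_sum {I : Type*} [Fintype I] [DecidableEq I] (b : Module.Basis I R V) :
    evStar R V = ∑ i, b.coord i ⊗ₜ[R] b i := by
  rw [evStar, LinearEquiv.symm_apply_eq]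
  ext x
  have h : dualTensorHomEquiv R V V (∑ i, b.coord i ⊗ₜ[R] b i)
      = dualTensorHom R V V (∑ i, b.coord i ⊗ₜ[R] b i) := rfl
  rw [h, map_sum, LinearMap.sum_apply]
  simp [b.sum_repr]

lemma evSum_eq_sum {P : Type*} [AddCommMonoid P] [Module R P]
    (T : Module.Dual R V →ₗ[R] V →ₗ[R] P) {I : Type*} [Fintype I] [DecidableEq I]
    (b : Module.Basis I R V) : evSum T = ∑ i, T (b.coord i) (b i) := by
  simp [evSum, evStar_eq_sum b]

variable {P P' Q Q' : Type*} [AddCommMonoid P] [Module R P] [AddCommMonoid P'] [Module R P']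
  [AddCommMonoid Q] [Module R Q] [AddCommMonoid Q'] [Module R Q']

/-- The composition `P ⊗ Q → P ⊗ V* ⊗ V ⊗ Q → P' ⊗ Q'` in which the first map inserts `ev*(1)` and
the second one is given by `A : P ⊗ V* → P'` and `B : V ⊗ Q → Q'`. In a basis it is
`x ⊗ y ↦ ∑ A(e_ℓ*) x ⊗ B(e_ℓ) y`. -/
def evMap (A : Module.Dual R V →ₗ[R] P →ₗ[R] P') (B : V →ₗ[R] Q →ₗ[R] Q') :
    P ⊗[R] Q →ₗ[R] P' ⊗[R] Q' :=
  evSum ((TensorProduct.mapBilinear (RingHom.id R) P Q P' Q').compl₁₂ A B)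

lemma evMap_eq_sum (A : Module.Dual R V →ₗ[R] P →ₗ[R] P') (B : V →ₗ[R] Q →ₗ[R] Q')
    {I : Type*} [Fintype I] [DecidableEq I] (b : Module.Basis I R V) :
    evMap A B = ∑ i, TensorProduct.map (A (b.coord i)) (B (b i)) := by
  rw [evMap, evSum_eq_sum _ b]; rfl

lemma evMap_tmul (A : Module.Dual R V →ₗ[R] P →ₗ[R] P') (B : V →ₗ[R] Q →ₗ[R] Q')
    {I : Type*} [Fintype I] [DecidableEq I] (b : Module.Basis I R V) (x : P) (y : Q) :
    evMap A B (x ⊗ₜ y) = ∑ i, A (b.coord i) x ⊗ₜ[R] B (b i) y := by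
  rw [evMap_eq_sum A B b, LinearMap.sum_apply]; rfl

lemma sum_sum_eq_zero {S I : Type*} [AddCommMonoid S] [Fintype I] [DecidableEq I] (a : I → I → S)
    (h0 : ∀ i, a i i = 0) (h1 : ∀ i j, a i j + a j i = 0) : ∑ i, ∑ j, a i j = 0 := by
  rw [← Fintype.sum_prod_type']
  refine Finset.sum_involution (fun x _ => (x.2, x.1)) (fun x _ => h1 _ _) ?_ (fun _ _ => Finset.mem_univ _)
    (fun _ _ => rfl)
  rintro ⟨i, j⟩ _ hne heq
  simp only [Prod.mk.injEq] at heq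
  obtain ⟨rfl, -⟩ := heq
  exact hne (h0 _)

lemma evMap_evMap {P'' Q'' : Type*} [AddCommMonoid P''] [Module R P''] [AddCommMonoid Q'']
    [Module R Q''] (A : Module.Dual R V →ₗ[R] P →ₗ[R] P') (B : V →ₗ[R] Q →ₗ[R] Q')
    (A' : Module.Dual R V →ₗ[R] P' →ₗ[R] P'') (B' : V →ₗ[R] Q' →ₗ[R] Q'')
    (hA : ∀ φ x, A' φ (A φ x) = 0) (hA' : ∀ φ ψ x, A' φ (A ψ x) + A' ψ (A φ x) = 0)
    (hB : ∀ v w y, B' v (B w y) = B' w (B v y)) (z : P ⊗[R] Q) :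
    evMap A' B' (evMap A B z) = 0 := by
  classical
  induction z using TensorProduct.induction_on with
  | zero => simp
  | add x y hx hy => simp [hx, hy]
  | tmul x y =>
    rw [evMap_tmul _ _ (Module.Free.chooseBasis R V), map_sum]
    simp_rw [evMap_tmul _ _ (Module.Free.chooseBasis R V)]
    apply sum_sum_eq_zero
    · intro i; rw [hA, zero_tmul]
    · intro i j; rw [hB, ← add_tmul, hA', zero_tmul]

end Canonical

section Hooks
variable {R : Type u} [CommRing R] {G : Type v} [AddCommGroup G] [Module R G]
  [Module.Free R G] [Module.Finite R G]

/-- `κ : ⋀ᵖ G ⊗ Sym_q G → ⋀ᵖ⁻¹ G ⊗ Sym_{q+1} G`. -/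
def kappa {p p' q q' : ℤ} (hp : p' = p - 1) (hq : q' = q + 1) :
    ExtPow R G p ⊗[R] SymPow R G q →ₗ[R] ExtPow R G p' ⊗[R] SymPow R G q' :=
  evMap (contr hp) (symMul hq)

/-- The map `η : ⋀ᵖ (G*) ⊗ D_q (G*) → ⋀ᵖ⁺¹ (G*) ⊗ D_{q-1} (G*)`. -/
def eta {p p' q q' : ℤ} (hp : p' = p + 1) (hq : q' = q - 1) :
    ExtPow R (Module.Dual R G) p ⊗[R] DivPow R G q →ₗ[R]
      ExtPow R (Module.Dual R G) p' ⊗[R] DivPow R G q' :=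
  evMap (wedgeVec hp) (divAct hq)

variable (R G)

/-- The Schur module `L^p_q G = ker κ`. -/
def schurL (p q : ℤ) : Submodule R (ExtPow R G p ⊗[R] SymPow R G q) :=
  LinearMap.ker (kappa (R := R) (G := G) (p := p) (q := q) rfl rfl)

/-- The Weyl module `K^p_q (G*) = ker η`. -/
def weylK (p q : ℤ) : Submodule R (ExtPow R (Module.Dual R G) p ⊗[R] DivPow R G q) :=
  LinearMap.ker (eta (R := R) (G := G) (p := p) (q := q) rfl rfl)

/-- `L^p_q G` for `1 ≤ q`, and zero for `q ≤ 0`. -/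
def schurLPos (p q : ℤ) : Submodule R (ExtPow R G p ⊗[R] SymPow R G q) :=
  if 1 ≤ q then schurL R G p q else ⊥

variable {R G}

lemma mem_schurL {p q p' q' : ℤ} (hp : p' = p - 1) (hq : q' = q + 1)
    {x : ExtPow R G p ⊗[R] SymPow R G q} : x ∈ schurL R G p q ↔ kappa hp hq x = 0 := by
  subst hp hq; rfl

lemma mem_weylK {p q p' q' : ℤ} (hp : p' = p + 1) (hq : q' = q - 1)
    {x : ExtPow R (Module.Dual R G) p ⊗[R] DivPow R G q} :
    x ∈ weylK R G p q ↔ eta hp hq x = 0 := by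
  subst hp hq; rfl

lemma mem_schurLPos {p q p' q' : ℤ} (hp : p' = p - 1) (hq : q' = q + 1)
    {x : ExtPow R G p ⊗[R] SymPow R G q} :
    x ∈ schurLPos R G p q ↔ (if 1 ≤ q then kappa hp hq x = 0 else x = 0) := by
  unfold schurLPos
  split_ifs
  · exact mem_schurL hp hq
  · exact Submodule.mem_bot R

lemma kappa_kappa {p p' p'' q q' q'' : ℤ} (hp : p' = p - 1) (hq : q' = q + 1) (hp' : p'' = p' - 1)
    (hq' : q'' = q' + 1) (x : ExtPow R G p ⊗[R] SymPow R G q) :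
    kappa hp' hq' (kappa hp hq x) = 0 :=
  evMap_evMap _ _ _ _ (fun _ _ => contr_contr_self _ _ _ _) (fun _ _ _ => contr_contr_add _ _ _ _ _)
    (fun _ _ _ => symMul_comm _ _ _ _ _) x

lemma kappa_symMul {p p' q q' l l' : ℤ} (hp : p' = p - 1) (hq : q' = q + 1) (hl : l = q + 1)
    (hl' : l' = l + 1) (hl'' : l' = q' + 1) (v : G) (x : ExtPow R G p ⊗[R] SymPow R G q) :
    kappa hp hl' (LinearMap.lTensor _ (symMul hl v) x) =
      LinearMap.lTensor _ (symMul hl'' v) (kappa hp hq x) := by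
  classical
  induction x using TensorProduct.induction_on with
  | zero => simp
  | add x y hx hy => simp [hx, hy]
  | tmul x y =>
    simp only [kappa, LinearMap.lTensor_tmul]
    rw [evMap_tmul _ _ (Module.Free.chooseBasis R G), evMap_tmul _ _ (Module.Free.chooseBasis R G),
      map_sum]
    refine Finset.sum_congr rfl fun i _ => ?_
    rw [LinearMap.lTensor_tmul]
    congr 1
    exact Subtype.ext (mul_left_comm _ _ _)

lemma eta_divAct {p p' q q' l l' : ℤ} (hp : p' = p + 1) (hq : q' = q - 1) (hl : l = q - 1)
    (hl' : l' = l - 1) (hl'' : l' = q' - 1) (v : G)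
    (x : ExtPow R (Module.Dual R G) p ⊗[R] DivPow R G q) :
    eta hp hl' (LinearMap.lTensor _ (divAct hl v) x) =
      LinearMap.lTensor _ (divAct hl'' v) (eta hp hq x) := by
  classical
  obtain rfl : q' = l := by omega
  induction x using TensorProduct.induction_on with
  | zero => simp
  | add x y hx hy => simp [hx, hy]
  | tmul x y =>
    simp only [eta, LinearMap.lTensor_tmul]
    rw [evMap_tmul _ _ (Module.Free.chooseBasis R G), evMap_tmul _ _ (Module.Free.chooseBasis R G),
      map_sum]
    refine Finset.sum_congr rfl fun i _ => ?_
    rw [LinearMap.lTensor_tmul, divAct_comm]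

lemma symMul_mem_schurLPos {p q l : ℤ} (hl : l = q + 1) (v : G)
    {x : ExtPow R G p ⊗[R] SymPow R G q} (hx : x ∈ schurLPos R G p q) :
    LinearMap.lTensor _ (symMul hl v) x ∈ schurLPos R G p l := by
  rw [mem_schurLPos (p' := p - 1) (q' := q + 1) rfl rfl] at hx
  rw [mem_schurLPos (p' := p - 1) (q' := l + 1) rfl rfl]
  by_cases h : 1 ≤ q
  · rw [if_pos h] at hx
    rw [if_pos (by omega), kappa_symMul rfl rfl hl rfl (by omega), hx, map_zero]
  · rw [if_neg h] at hx
    subst hx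
    simp

lemma divAct_mem_weylK {p q l : ℤ} (hl : l = q - 1) (v : G)
    {x : ExtPow R (Module.Dual R G) p ⊗[R] DivPow R G q} (hx : x ∈ weylK R G p q) :
    LinearMap.lTensor _ (divAct hl v) x ∈ weylK R G p l := by
  rw [mem_weylK (p' := p + 1) (q' := q - 1) rfl rfl] at hx
  rw [mem_weylK (p' := p + 1) (q' := l - 1) rfl rfl, eta_divAct rfl rfl hl rfl (by omega), hx,
    map_zero]

/-- Multiplication by `v ∈ G` on the Schur modules. -/
def schurAct {p q l : ℤ} (hl : l = q + 1) :
    G →ₗ[R] schurLPos R G p q →ₗ[R] schurLPos R G p l :=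
  LinearMap.mk₂ R (fun v x => ⟨LinearMap.lTensor _ (symMul hl v) x.1, symMul_mem_schurLPos hl v x.2⟩)
    (fun _ _ _ => Subtype.ext (by simp [LinearMap.lTensor_add]))
    (fun _ _ _ => Subtype.ext (by simp [LinearMap.lTensor_smul]))
    (fun _ _ _ => Subtype.ext (by simp)) (fun _ _ _ => Subtype.ext (by simp))

/-- The action of `v ∈ G` on the Weyl modules. -/
def weylAct {p q l : ℤ} (hl : l = q - 1) :
    G →ₗ[R] weylK R G p q →ₗ[R] weylK R G p l :=
  LinearMap.mk₂ R (fun v x => ⟨LinearMap.lTensor _ (divAct hl v) x.1, divAct_mem_weylK hl v x.2⟩)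
    (fun _ _ _ => Subtype.ext (by simp [LinearMap.lTensor_add]))
    (fun _ _ _ => Subtype.ext (by simp [LinearMap.lTensor_smul]))
    (fun _ _ _ => Subtype.ext (by simp)) (fun _ _ _ => Subtype.ext (by simp))

lemma lTensor_comp_comm {A B C D E : Type*} [AddCommGroup A] [Module R A] [AddCommGroup B] [Module R B]
    [AddCommGroup C] [Module R C] [AddCommGroup D] [Module R D] [AddCommGroup E] [Module R E]
    (f : B →ₗ[R] C) (g : C →ₗ[R] D) (f' : B →ₗ[R] E) (g' : E →ₗ[R] D)
    (h : ∀ x, g (f x) = g' (f' x)) (x : A ⊗[R] B) :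
    LinearMap.lTensor A g (LinearMap.lTensor A f x)
      = LinearMap.lTensor A g' (LinearMap.lTensor A f' x) := by
  rw [← LinearMap.lTensor_comp_apply, ← LinearMap.lTensor_comp_apply]
  congr 2
  exact LinearMap.ext h

lemma schurAct_comm {p n k l : ℤ} (h : k = n + 1) (h' : l = k + 1) (v w : G)
    (x : schurLPos R G p n) :
    schurAct h' v (schurAct h w x) = schurAct h' w (schurAct h v x) :=
  Subtype.ext (lTensor_comp_comm _ _ _ _ (fun _ => symMul_comm _ _ _ _ _) _)

lemma weylAct_comm {p n k l : ℤ} (h : k = n - 1) (h' : l = k - 1) (v w : G)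
    (x : weylK R G p n) :
    weylAct h' v (weylAct h w x) = weylAct h' w (weylAct h v x) :=
  Subtype.ext (lTensor_comp_comm _ _ _ _ (fun _ => divAct_comm _ _ _ _ _) _)

variable {F : Type w} [AddCommGroup F] [Module R F]

/-- `Kos_Φ : ⋀ʳ F ⊗ L^p_q G → ⋀ʳ⁺¹ F ⊗ L^p_{q+1} G`, `f ⊗ x ↦ ∑ f ∧ Φ(e_ℓ*) ⊗ e_ℓ x`. -/
def kosPhi (Φ : Module.Dual R G →ₗ[R] F) {p r r' q q' : ℤ} (hr : r' = r + 1) (hq : q' = q + 1) :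
    ExtPow R F r ⊗[R] schurLPos R G p q →ₗ[R] ExtPow R F r' ⊗[R] schurLPos R G p q' :=
  evMap (wedgeVec hr ∘ₗ Φ) (schurAct hq)

/-- `η_Φ : ⋀ʳ F ⊗ K^p_q (G*) → ⋀ʳ⁺¹ F ⊗ K^p_{q-1} (G*)`, `f ⊗ x ↦ ∑ f ∧ Φ(e_ℓ*) ⊗ e_ℓ x`. -/
def etaPhi (Φ : Module.Dual R G →ₗ[R] F) {p r r' q q' : ℤ} (hr : r' = r + 1) (hq : q' = q - 1) :
    ExtPow R F r ⊗[R] weylK R G p q →ₗ[R] ExtPow R F r' ⊗[R] weylK R G p q' :=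
  evMap (wedgeVec hr ∘ₗ Φ) (weylAct hq)

lemma kosPhi_kosPhi (Φ : Module.Dual R G →ₗ[R] F) {p r r' r'' q q' q'' : ℤ} (hr : r' = r + 1)
    (hq : q' = q + 1) (hr' : r'' = r' + 1) (hq' : q'' = q' + 1)
    (x : ExtPow R F r ⊗[R] schurLPos R G p q) :
    kosPhi Φ hr' hq' (kosPhi Φ hr hq x) = 0 := by
  unfold kosPhi
  refine evMap_evMap _ _ _ _ ?_ ?_ ?_ x
  · intro φ y
    simp only [LinearMap.comp_apply]
    exact wedgeVec_wedgeVec_self _ _ _ _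
  · intro φ ψ y
    simp only [LinearMap.comp_apply]
    exact wedgeVec_wedgeVec_add _ _ _ _ _
  · intro v w y
    exact schurAct_comm _ _ _ _ _

lemma etaPhi_etaPhi (Φ : Module.Dual R G →ₗ[R] F) {p r r' r'' q q' q'' : ℤ} (hr : r' = r + 1)
    (hq : q' = q - 1) (hr' : r'' = r' + 1) (hq' : q'' = q' - 1)
    (x : ExtPow R F r ⊗[R] weylK R G p q) :
    etaPhi Φ hr' hq' (etaPhi Φ hr hq x) = 0 := by
  unfold etaPhi
  refine evMap_evMap _ _ _ _ ?_ ?_ ?_ x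
  · intro φ y
    simp only [LinearMap.comp_apply]
    exact wedgeVec_wedgeVec_self _ _ _ _
  · intro φ ψ y
    simp only [LinearMap.comp_apply]
    exact wedgeVec_wedgeVec_add _ _ _ _ _
  · intro v w y
    exact weylAct_comm _ _ _ _ _

end Hooks

section Complexes
variable {R : Type u} [CommRing R]

/-- A chain complex of `R`-modules from a family of modules indexed by `ℤ` and differentials
`X i → X j` for `i = j + 1`. -/
def mkComplex (X : ℤ → Type u) [∀ j, AddCommGroup (X j)] [∀ j, Module R (X j)]
    (d : ∀ i j : ℤ, j + 1 = i → (X i →ₗ[R] X j))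
    (hd : ∀ (i j k : ℤ) (hij : j + 1 = i) (hjk : k + 1 = j) (x : X i),
      d j k hjk (d i j hij x) = 0) : ChainComplex (ModuleCat.{u} R) ℤ where
  X j := ModuleCat.of R (X j)
  d i j := if h : j + 1 = i then ModuleCat.ofHom (d i j h) else 0
  shape i j h := dif_neg h
  d_comp_d' i j k hij hjk := by
    rw [dif_pos (show j + 1 = i from hij), dif_pos (show k + 1 = j from hjk)]
    ext x
    exact hd i j k hij hjk x

/-- The shifted complex `A[n]`, with `A[n]_j = A_{n+j}`. -/
def shiftC (A : ChainComplex (ModuleCat.{u} R) ℤ) (n : ℤ) : ChainComplex (ModuleCat.{u} R) ℤ :=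
  mkComplex (fun j => A.X (n + j)) (fun i j _ => (A.d (n + i) (n + j)).hom) (fun _ _ _ _ _ x => by
    rw [← ModuleCat.comp_apply, A.d_comp_d]; rfl)

/-- `A ⊗ P`. -/
def tensorC (A : ChainComplex (ModuleCat.{u} R) ℤ) (P : Type u) [AddCommGroup P] [Module R P] :
    ChainComplex (ModuleCat.{u} R) ℤ :=
  mkComplex (fun j => A.X j ⊗[R] P) (fun i j _ => LinearMap.rTensor P (A.d i j).hom)
    (fun i j k _ _ x => by
      rw [← LinearMap.rTensor_comp_apply, ← ModuleCat.hom_comp, A.d_comp_d]; simp)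

/-- The map of complexes `A ⊗ u : A ⊗ P → A ⊗ Q`. -/
def tensorMapC (A : ChainComplex (ModuleCat.{u} R) ℤ) {P Q : Type u} [AddCommGroup P] [Module R P]
    [AddCommGroup Q] [Module R Q] (u : P →ₗ[R] Q) : tensorC A P ⟶ tensorC A Q where
  f j := ModuleCat.ofHom (LinearMap.lTensor (A.X j) u)
  comm' i j h := by
    have h' : j + 1 = i := h
    simp only [tensorC, mkComplex, dif_pos h', ← ModuleCat.ofHom_comp]
    rw [LinearMap.rTensor_comp_lTensor, LinearMap.lTensor_comp_rTensor]

/-- The map of complexes `A → A ⊗ P`, `x ↦ x ⊗ p`. -/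
def tensorBy (A : ChainComplex (ModuleCat.{u} R) ℤ) {P : Type u} [AddCommGroup P] [Module R P]
    (p : P) : A ⟶ tensorC A P where
  f j := ModuleCat.ofHom ((TensorProduct.mk R (A.X j) P).flip p)
  comm' i j h := by
    have h' : j + 1 = i := h
    simp only [tensorC, mkComplex, dif_pos h']
    ext x
    rfl

/-- The direct sum of two complexes. -/
def prodC (A B : ChainComplex (ModuleCat.{u} R) ℤ) : ChainComplex (ModuleCat.{u} R) ℤ :=
  mkComplex (fun j => A.X j × B.X j) (fun i j _ => (A.d i j).hom.prodMap (B.d i j).hom)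
    (fun i j k _ _ x => by
      have h1 : (A.d j k).hom ((A.d i j).hom x.1) = 0 := by
        rw [← ModuleCat.comp_apply, A.d_comp_d]; rfl
      have h2 : (B.d j k).hom ((B.d i j).hom x.2) = 0 := by
        rw [← ModuleCat.comp_apply, B.d_comp_d]; rfl
      exact Prod.ext h1 h2)

/-- The inclusion of the first summand. -/
def prodInl (A B : ChainComplex (ModuleCat.{u} R) ℤ) : A ⟶ prodC A B where
  f j := ModuleCat.ofHom (LinearMap.inl R (A.X j) (B.X j))
  comm' i j h := by
    have h' : j + 1 = i := h
    simp only [prodC, mkComplex, dif_pos h']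
    refine ModuleCat.hom_ext (LinearMap.ext fun x => Prod.ext ?_ ?_)
    · rfl
    · exact map_zero (B.d i j).hom

/-- The inclusion of the second summand. -/
def prodInr (A B : ChainComplex (ModuleCat.{u} R) ℤ) : B ⟶ prodC A B where
  f j := ModuleCat.ofHom (LinearMap.inr R (A.X j) (B.X j))
  comm' i j h := by
    have h' : j + 1 = i := h
    simp only [prodC, mkComplex, dif_pos h']
    refine ModuleCat.hom_ext (LinearMap.ext fun x => Prod.ext ?_ ?_)
    · exact map_zero (A.d i j).hom
    · rfl

/-- The total complex (mapping cone) of `θ : A → B`: it is `A_{j-1} ⊕ B_j` in degree `j`, with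
differential `(x, y) ↦ (a x, θ x - b y)`. -/
def Tot {A B : ChainComplex (ModuleCat.{u} R) ℤ} (θ : A ⟶ B) :
    ChainComplex (ModuleCat.{u} R) ℤ :=
  mkComplex (fun j => A.X (j - 1) × B.X j)
    (fun i j h => LinearMap.prod ((A.d (i - 1) (j - 1)).hom ∘ₗ LinearMap.fst R _ _)
      (((A.XIsoOfEq (show i - 1 = j by omega)).hom ≫ θ.f j).hom ∘ₗ LinearMap.fst R _ _
        - (B.d i j).hom ∘ₗ LinearMap.snd R _ _))
    (fun i j k hij hjk x => by
      obtain ⟨x, y⟩ := x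
      have h1 : (A.d (j - 1) (k - 1)).hom ((A.d (i - 1) (j - 1)).hom x) = 0 := by
        rw [← ModuleCat.comp_apply, A.d_comp_d]; rfl
      have h2 : (B.d j k).hom ((B.d i j).hom y) = 0 := by
        rw [← ModuleCat.comp_apply, B.d_comp_d]; rfl
      have e : A.d (i - 1) (j - 1) ≫ (A.XIsoOfEq (show j - 1 = k by omega)).hom ≫ θ.f k
          = ((A.XIsoOfEq (show i - 1 = j by omega)).hom ≫ θ.f j) ≫ B.d j k := by
        rw [Category.assoc, θ.comm, HomologicalComplex.XIsoOfEq_hom_comp_d_assoc,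
          HomologicalComplex.d_comp_XIsoOfEq_hom_assoc]
      have h3 := congrArg (fun f => f.hom x) e
      simp only [ModuleCat.hom_comp, LinearMap.comp_apply] at h3
      refine Prod.ext h1 ?_
      change (θ.f k).hom ((A.XIsoOfEq (show j - 1 = k by omega)).hom.hom
        ((A.d (i - 1) (j - 1)).hom x)) - (B.d j k).hom ((θ.f j).hom
        ((A.XIsoOfEq (show i - 1 = j by omega)).hom.hom x) - (B.d i j).hom y) = 0
      rw [map_sub, h2, h3, sub_zero, sub_self])

end Complexes

section CanonicalExt
variable (R : Type u) [CommRing R] (M : Type v) [AddCommGroup M] [Module R M]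

open Classical in
variable {M} in
/-- The product `v₁ ∧ ⋯ ∧ vₖ ∈ ⋀ᵏ M` of a list of length `k`. -/
def extProd (k : ℤ) (l : List M) : ExtPow R M k :=
  if h : (l.map (ExteriorAlgebra.ι R)).prod ∈ extPiece R M k then ⟨_, h⟩ else 0

variable {R M}

lemma extProd_mem : ∀ (l : List M), (l.map (ExteriorAlgebra.ι R)).prod ∈ extPiece R M (l.length : ℤ)
  | [] => by simpa using one_mem_extPiece
  | v :: l => by
    rw [List.map_cons, List.prod_cons]
    exact mul_mem_extPiece (n := 1) (m := l.length) (by simp [add_comm]) (ι_mem_extPiece v)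
      (extProd_mem l)

lemma extProd_coe {k : ℤ} {l : List M} (h : (l.length : ℤ) = k) :
    (extProd R k l : ExteriorAlgebra R M) = (l.map (ExteriorAlgebra.ι R)).prod := by
  have := extProd_mem (R := R) l
  rw [h] at this
  rw [extProd, dif_pos this]

/-- Let `(φ₁, v₁), …, (φₙ, vₙ)` be a list of pairs in `V* × V`. This is
`∑ φ_{s_k} ∧ ⋯ ∧ φ_{s_1} ⊗ v_{s_1} ∧ ⋯ ∧ v_{s_k}`, the sum over all `s_1 < ⋯ < s_k`. -/
def evExtList (k : ℤ) (l : List (Module.Dual R M × M)) :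
    ExtPow R (Module.Dual R M) k ⊗[R] ExtPow R M k :=
  ((l.sublistsLen k.toNat).map fun s =>
    extProd R k (s.map Prod.fst).reverse ⊗ₜ[R] extProd R k (s.map Prod.snd)).sum

variable [Nontrivial R] [Module.Free R M] [Module.Finite R M]

variable (R M) in
/-- The canonical element `ev*(1) = ∑ m_ℓ* ⊗ m_ℓ` of `⋀ᵏ (M*) ⊗ ⋀ᵏ M`, where `{m_ℓ}` is the basis of
`⋀ᵏ M` given by a basis of `M` and `{m_ℓ*}` is the dual basis of `⋀ᵏ (M*)` for the pairing
that comes from the module action of `⋀ (M*)` on `⋀ M`: as `(φ ∧ ψ)(x) = φ(ψ(x))`, the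
element dual to `v₁ ∧ ⋯ ∧ vₖ` is `vₖ* ∧ ⋯ ∧ v₁*`. -/
def evExt (k : ℤ) : ExtPow R (Module.Dual R M) k ⊗[R] ExtPow R M k :=
  evExtList k (List.ofFn fun i =>
    ((Module.finBasis R M).coord i, Module.finBasis R M i))

end CanonicalExt

section Middle
variable {R : Type u} [CommRing R] {G : Type v} [AddCommGroup G] [Module R G]
  {F : Type w} [AddCommGroup F] [Module R F]

variable (R F) in
/-- `⋀ⁿ F` placed in the single degree `i + 1`. -/
def midPiece (i n j : ℤ) : Submodule R (ExteriorAlgebra R F) :=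
  if j = i + 1 then extPiece R F n else ⊥

/-- The map `⋀ᵃ (G*) ⊗ D_q (G*) → ⋀ᵃ F`, `γ ⊗ φ ↦ φ(1) (⋀ᵃ Φ)(γ)`, which is `⋀ᵃ Φ` for `q = 0` and
zero for `q ≠ 0`. -/
def extPhi (Φ : Module.Dual R G →ₗ[R] F) {a q : ℤ} :
    ExtPow R (Module.Dual R G) a ⊗[R] DivPow R G q →ₗ[R] ExtPow R F a :=
  TensorProduct.lift ((LinearMap.lsmul R (ExtPow R F a)).flip.compl₁₂ (extMap Φ rfl) divEval)

lemma extPhi_tmul (Φ : Module.Dual R G →ₗ[R] F) {a q : ℤ} (γ : ExtPow R (Module.Dual R G) a)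
    (φ : DivPow R G q) : extPhi Φ (γ ⊗ₜ[R] φ) = divEval φ • extMap Φ rfl γ := rfl

lemma divEval_ne {q : ℤ} (hq : q ≠ 0) : (divEval : DivPow R G q →ₗ[R] R) = 0 := dif_neg hq

lemma extPhi_ne (Φ : Module.Dual R G →ₗ[R] F) {a q : ℤ} (hq : q ≠ 0)
    (x : ExtPow R (Module.Dual R G) a ⊗[R] DivPow R G q) : extPhi Φ x = 0 := by
  induction x using TensorProduct.induction_on with
  | zero => simp
  | add x y hx hy => simp [hx, hy]
  | tmul x y => rw [extPhi_tmul, divEval_ne hq]; simp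

lemma ι_mul_extPiece (v : G) {n : ℤ} {x : ExteriorAlgebra R G} (hx : x ∈ extPiece R G n) :
    ExteriorAlgebra.ι R v * x = (n.negOnePow : ℤ) • (x * ExteriorAlgebra.ι R v) := by
  rcases lt_or_ge n 0 with hn | hn
  · rw [extPiece_neg hn, Submodule.mem_bot] at hx; simp [hx]
  lift n to ℕ using hn
  rw [extPiece_coe] at hx
  induction hx using Submodule.pow_induction_on_left' with
  | algebraMap r => simp [Algebra.commutes]
  | add x y i hx hy hx' hy' => rw [mul_add, add_mul, smul_add, hx', hy']
  | mem_mul w hw i x hx ih =>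
    obtain ⟨w, rfl⟩ := hw
    have h : ExteriorAlgebra.ι R v * ExteriorAlgebra.ι R w
        = - (ExteriorAlgebra.ι R w * ExteriorAlgebra.ι R v) :=
      eq_neg_of_add_eq_zero_left (ExteriorAlgebra.ι_add_mul_swap v w)
    rw [← mul_assoc, h, neg_mul, mul_assoc, ih, Nat.cast_succ, Int.negOnePow_succ]
    rw [mul_smul_comm, Units.val_neg, neg_smul, ← mul_assoc]

variable [Module.Free R G] [Module.Finite R G]

/-- The map `⋀ʳ F ⊗ K^a_0 (G*) = ⋀ʳ F ⊗ ⋀ᵃ (G*) → ⋀ʳ⁺ᵃ F`, `f ⊗ γ ↦ f ∧ (⋀ᵃ Φ)(γ)`, extended by zero to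
`⋀ʳ F ⊗ K^a_q (G*)` for `q ≠ 0`. -/
def muAmb (Φ : Module.Dual R G →ₗ[R] F) {r a q : ℤ} :
    ExtPow R F r ⊗[R] weylK R G a q →ₗ[R] ExtPow R F (r + a) :=
  TensorProduct.lift ((wedge rfl).compl₂ (extPhi Φ ∘ₗ (weylK R G a q).subtype))

lemma muAmb_ne (Φ : Module.Dual R G →ₗ[R] F) {r a q : ℤ} (hq : q ≠ 0)
    (x : ExtPow R F r ⊗[R] weylK R G a q) : muAmb Φ x = 0 := by
  induction x using TensorProduct.induction_on with
  | zero => simp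
  | add x y hx hy => simp [hx, hy]
  | tmul x y => simp [muAmb, extPhi_ne Φ hq]

lemma muAmb_mem (Φ : Module.Dual R G →ₗ[R] F) {r a q i n j : ℤ} (hn : q = 0 → n = r + a)
    (hj : q = 0 → j = i + 1) (x : ExtPow R F r ⊗[R] weylK R G a q) :
    (muAmb Φ x : ExteriorAlgebra R F) ∈ midPiece R F i n j := by
  by_cases hq : q = 0
  · rw [midPiece, if_pos (hj hq), hn hq]
    exact (muAmb Φ x).2
  · rw [muAmb_ne Φ hq]; exact zero_mem _

/-- The previous map, with values in the component of degree `j`. -/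
def mu (Φ : Module.Dual R G →ₗ[R] F) {r a q i n j : ℤ} (hn : q = 0 → n = r + a)
    (hj : q = 0 → j = i + 1) : ExtPow R F r ⊗[R] weylK R G a q →ₗ[R] midPiece R F i n j :=
  LinearMap.codRestrict _ ((extPiece R F (r + a)).subtype ∘ₗ muAmb Φ) (muAmb_mem Φ hn hj)

lemma extPhi_eta (Φ : Module.Dual R G →ₗ[R] F) {a a' q q' : ℤ} (ha : a' = a + 1) (hq : q' = q - 1)
    {I : Type*} [Fintype I] [DecidableEq I] (b : Module.Basis I R G)
    (x : ExtPow R (Module.Dual R G) a ⊗[R] DivPow R G q) :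
    ∑ i, ExteriorAlgebra.ι R (Φ (b.coord i)) *
      (extPhi Φ (LinearMap.lTensor _ (divAct hq (b i)) x) : ExteriorAlgebra R F) =
      (a.negOnePow : ℤ) • (extPhi Φ (eta ha hq x) : ExteriorAlgebra R F) := by
  induction x using TensorProduct.induction_on with
  | zero => simp
  | add x y hx hy => simp only [map_add, Submodule.coe_add, mul_add, Finset.sum_add_distrib, hx, hy,
      smul_add]
  | tmul x y =>
    simp only [eta, LinearMap.lTensor_tmul]
    rw [evMap_tmul _ _ b, map_sum, AddSubmonoidClass.coe_finsetSum, Finset.smul_sum]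
    refine Finset.sum_congr rfl fun i _ => ?_
    rw [extPhi_tmul, extPhi_tmul]
    simp only [Submodule.coe_smul, extMap_coe, wedgeVec_coe, map_mul, ExteriorAlgebra.map_apply_ι]
    rw [mul_smul_comm, ι_mul_extPiece _ (map_mem_extPiece Φ x.2), smul_comm]

lemma muAmb_etaPhi (Φ : Module.Dual R G →ₗ[R] F) {a r r' q q' : ℤ} (hr : r' = r + 1)
    (hq : q' = q - 1) (x : ExtPow R F r ⊗[R] weylK R G a q) :
    muAmb Φ (etaPhi Φ hr hq x) = 0 := by
  classical
  induction x using TensorProduct.induction_on with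
  | zero => simp
  | add x y hx hy => simp [hx, hy]
  | tmul f x =>
    rw [etaPhi, evMap_tmul _ _ (Module.Free.chooseBasis R G), map_sum]
    apply Subtype.ext
    rw [AddSubmonoidClass.coe_finsetSum]
    have h := extPhi_eta Φ (a := a) rfl hq (Module.Free.chooseBasis R G) x.1
    rw [(mem_weylK (p' := a + 1) rfl hq).mp x.2] at h
    have h' := congrArg (fun t => (f : ExteriorAlgebra R F) * t) h
    simp only [Finset.mul_sum, map_zero, ZeroMemClass.coe_zero, smul_zero, mul_zero,
      ← mul_assoc] at h'
    exact h'

/-- The map `⋀ᵏ G → L^{k-1}_1 G`, `m ↦ κ(m ⊗ 1)`. -/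
def kappaOne {k p q : ℤ} (hp : p = k - 1) (hq : q = 1) : ExtPow R G k →ₗ[R] schurLPos R G p q :=
  LinearMap.codRestrict _
    (kappa hp (show q = 0 + 1 by omega) ∘ₗ
      (TensorProduct.mk R (ExtPow R G k) (SymPow R G 0)).flip ⟨1, one_mem_symPiece⟩)
    (fun x => by
      rw [mem_schurLPos (p' := p - 1) (q' := q + 1) rfl rfl, if_pos (by omega)]
      exact kappa_kappa _ _ _ _ _)

/-- `f ↦ ∑ (f ∧ (⋀ᵏ Φ)(m_ℓ*)) ⊗ κ(m_ℓ)` for an element `∑ m_ℓ* ⊗ m_ℓ` of `⋀ᵏ (G*) ⊗ ⋀ᵏ G`. -/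
def epsOf (Φ : Module.Dual R G →ₗ[R] F) {n k r p q : ℤ} (hr : r = n + k) (hp : p = k - 1)
    (hq : q = 1) (w : ExtPow R (Module.Dual R G) k ⊗[R] ExtPow R G k) :
    ExtPow R F n →ₗ[R] ExtPow R F r ⊗[R] schurLPos R G p q :=
  LinearMap.applyₗ w ∘ₗ (TensorProduct.mapBilinear (RingHom.id R) _ _ _ _).flip (kappaOne hp hq) ∘ₗ
    (wedge hr).compl₂ (extMap Φ rfl)

lemma epsOf_apply (Φ : Module.Dual R G →ₗ[R] F) {n k r p q : ℤ} (hr : r = n + k) (hp : p = k - 1)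
    (hq : q = 1) (w : ExtPow R (Module.Dual R G) k ⊗[R] ExtPow R G k) (f : ExtPow R F n) :
    epsOf Φ hr hp hq w f =
      TensorProduct.map (wedge hr f ∘ₗ extMap Φ rfl) (kappaOne hp hq) w := rfl

variable [Nontrivial R]

/-- The map `⋀ⁿ F → ⋀ⁿ⁺ᵏ F ⊗ L^{k-1}_1 G`, `f ↦ ∑ (f ∧ (⋀ᵏ Φ)(m_ℓ*)) ⊗ κ(m_ℓ)` with
`ev*(1) = ∑ m_ℓ* ⊗ m_ℓ ∈ ⋀ᵏ (G*) ⊗ ⋀ᵏ G`, from the component of degree `j'`. -/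
def eps (Φ : Module.Dual R G →ₗ[R] F) {i n j' k r p q : ℤ} (hr : j' = i + 1 → r = n + k)
    (hp : p = k - 1) (hq : j' = i + 1 → q = 1) :
    midPiece R F i n j' →ₗ[R] ExtPow R F r ⊗[R] schurLPos R G p q :=
  if h : j' = i + 1 then
    epsOf Φ (hr h) hp (hq h) (evExt R G k) ∘ₗ
      Submodule.inclusion (show midPiece R F i n j' ≤ extPiece R F n by rw [midPiece, if_pos h])
  else 0

end Middle

section Squares
variable {R : Type u} [CommRing R] {G : Type v} [AddCommGroup G] [Module R G]
  {F : Type w} [AddCommGroup F] [Module R F]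

lemma extProd_snoc {k k' : ℤ} (hk : k' = k + 1) (l : List G) (hl : (l.length : ℤ) = k) (v : G) :
    extProd R k' (l ++ [v]) = wedgeVec hk v (extProd R k l) := by
  apply Subtype.ext
  rw [extProd_coe (by simp; omega), wedgeVec_coe, extProd_coe hl]
  simp

/-- Left multiplication `x ↦ v ∧ x`. -/
def wedgeLeft {n k : ℤ} (h : k = n + 1) : G →ₗ[R] ExtPow R G n →ₗ[R] ExtPow R G k :=
  wedge (n := 1) (by omega) ∘ₗ extι

lemma extProd_cons {k k' : ℤ} (hk : k' = k + 1) (l : List G) (hl : (l.length : ℤ) = k) (v : G) :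
    extProd R k' (v :: l) = wedgeLeft hk v (extProd R k l) := by
  apply Subtype.ext
  have h : (wedgeLeft hk v (extProd R k l) : ExteriorAlgebra R G)
    = ExteriorAlgebra.ι R v * (extProd R k l).1 := rfl
  rw [extProd_coe (by simp; omega), h, extProd_coe hl]
  simp

lemma evExtList_cons {k k' : ℤ} (hk : 0 ≤ k) (h : k' = k + 1) (a : Module.Dual R G × G)
    (l : List (Module.Dual R G × G)) :
    evExtList k' (a :: l) = evExtList k' l +
      TensorProduct.map (wedgeVec h a.1) (wedgeLeft h a.2) (evExtList k l) := by
  lift k to ℕ using hk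
  subst h
  simp only [evExtList]
  rw [show ((k : ℤ) + 1).toNat = k + 1 by omega, show ((k : ℤ)).toNat = k by omega,
    List.sublistsLen_succ_cons, List.map_append, List.sum_append, List.map_map]
  congr 1
  rw [map_list_sum, List.map_map]
  congr 1
  refine List.map_congr_left fun s hs => ?_
  have hl := List.length_of_sublistsLen hs
  simp only [Function.comp_apply, List.map_cons, List.reverse_cons, TensorProduct.map_tmul]
  rw [extProd_snoc rfl _ (by simp [hl]), extProd_cons rfl _ (by simp [hl])]

lemma evExtList_nil {k : ℤ} (hk : 0 < k) :
    evExtList k ([] : List (Module.Dual R G × G)) = 0 := by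
  obtain ⟨n, rfl⟩ : ∃ n : ℕ, k = n + 1 := ⟨(k - 1).toNat, by omega⟩
  simp only [evExtList]
  rw [show ((n : ℤ) + 1).toNat = n + 1 by omega]
  simp

lemma contr_wedgeLeft {n k k' : ℤ} (h : k = n + 1) (h' : n = k - 1) (hk : k' = n - 1)
    (hk' : n = k' + 1) (v : G) (φ : Module.Dual R G) (x : ExtPow R G n) :
    contr h' φ (wedgeLeft h v x) = φ v • x - wedgeLeft hk' v (contr hk φ x) :=
  Subtype.ext (CliffordAlgebra.contractLeft_ι_mul _ _ _)

variable (R G) in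
/-- `v ∈ Sym₁ G`. -/
def symOne : G →ₗ[R] SymPow R G 1 := (SymmetricAlgebra.ι R G).codRestrict _ ι_mem_symPiece

/-- Right multiplication by `∑ φ ⊗ v`, the sum over a list of pairs `(φ, v)`. -/
def tOp {k k' : ℤ} (h : k' = k + 1) (l : List (Module.Dual R G × G)) :
    ExtPow R (Module.Dual R G) k ⊗[R] ExtPow R G k →ₗ[R]
      ExtPow R (Module.Dual R G) k' ⊗[R] (ExtPow R G k ⊗[R] SymPow R G 1) :=
  (l.map fun a => TensorProduct.map (wedgeVec h a.1)
    ((TensorProduct.mk R (ExtPow R G k) (SymPow R G 1)).flip (symOne R G a.2))).sum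

lemma tOp_cons {k k' : ℤ} (h : k' = k + 1) (a : Module.Dual R G × G)
    (l : List (Module.Dual R G × G)) (w : ExtPow R (Module.Dual R G) k ⊗[R] ExtPow R G k) :
    tOp h (a :: l) w = TensorProduct.map (wedgeVec h a.1)
      ((TensorProduct.mk R (ExtPow R G k) (SymPow R G 1)).flip (symOne R G a.2)) w
      + tOp h l w := by
  simp [tOp]

lemma tOp_wedge {n k k' : ℤ} (hk : k = n + 1) (h : k' = k + 1) (a : Module.Dual R G × G)
    (l : List (Module.Dual R G × G)) (w : ExtPow R (Module.Dual R G) n ⊗[R] ExtPow R G n) :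
    tOp h l (TensorProduct.map (wedgeVec hk a.1) (wedgeLeft hk a.2) w) +
      TensorProduct.map (wedgeVec h a.1) (LinearMap.rTensor _ (wedgeLeft hk a.2)) (tOp hk l w)
      = 0 := by
  induction l with
  | nil => simp [tOp]
  | cons b l ih =>
    rw [tOp_cons, tOp_cons, map_add, add_add_add_comm, ih, add_zero]
    clear ih
    induction w using TensorProduct.induction_on with
    | zero => simp
    | add x y hx hy =>
      simp only [map_add]
      rw [add_add_add_comm, hx, hy, add_zero]
    | tmul x y =>
      simp only [TensorProduct.map_tmul, LinearMap.flip_apply, TensorProduct.mk_apply,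
        LinearMap.rTensor_tmul]
      rw [← add_tmul, wedgeVec_wedgeVec_add, zero_tmul]

lemma mapmk_wedge {n k k' : ℤ} (hk : k = n + 1) (h : k' = k + 1) (a : Module.Dual R G × G)
    (w : ExtPow R (Module.Dual R G) n ⊗[R] ExtPow R G n) :
    TensorProduct.map (wedgeVec h a.1)
      ((TensorProduct.mk R (ExtPow R G k) (SymPow R G 1)).flip (symOne R G a.2))
      (TensorProduct.map (wedgeVec hk a.1) (wedgeLeft hk a.2) w) = 0 := by
  induction w using TensorProduct.induction_on with
  | zero => simp
  | add x y hx hy => simp only [map_add, hx, hy, add_zero]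
  | tmul x y =>
    simp only [TensorProduct.map_tmul]
    rw [wedgeVec_wedgeVec_self, zero_tmul]

variable [Module.Free R G] [Module.Finite R G]

/-- `m ↦ κ(m ⊗ 1)`. -/
def kappaAux {k k' : ℤ} (h : k' = k - 1) : ExtPow R G k →ₗ[R] ExtPow R G k' ⊗[R] SymPow R G 1 :=
  kappa h (show (1 : ℤ) = 0 + 1 by omega) ∘ₗ
      (TensorProduct.mk R (ExtPow R G k) (SymPow R G 0)).flip ⟨1, one_mem_symPiece⟩

lemma symMul_one (v : G) : symMul (show (1 : ℤ) = 0 + 1 by omega) v ⟨1, one_mem_symPiece⟩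
      = symOne R G v := Subtype.ext (mul_one _)

lemma kappaAux_eq_sum {k k' : ℤ} (h : k' = k - 1) (x : ExtPow R G k)
    {I : Type*} [Fintype I] [DecidableEq I] (b : Module.Basis I R G) :
    kappaAux h x = ∑ i, contr h (b.coord i) x ⊗ₜ[R] symOne R G (b i) := by
  simp only [kappaAux, LinearMap.comp_apply, LinearMap.flip_apply, TensorProduct.mk_apply, kappa]
  rw [evMap_tmul _ _ b]
  simp_rw [symMul_one]

lemma kappaAux_wedgeLeft {n k k' : ℤ} (h : k = n + 1) (h' : n = k - 1) (hk : k' = n - 1)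
    (hk' : n = k' + 1) (v : G) (x : ExtPow R G n) :
    kappaAux h' (wedgeLeft h v x) + LinearMap.rTensor _ (wedgeLeft hk' v) (kappaAux hk x)
      = x ⊗ₜ symOne R G v := by
  classical
  set b := Module.Free.chooseBasis R G
  rw [kappaAux_eq_sum _ _ b, kappaAux_eq_sum _ _ b, map_sum, ← Finset.sum_add_distrib]
  simp_rw [LinearMap.rTensor_tmul, contr_wedgeLeft h h' hk hk', ← add_tmul, sub_add_cancel,
    smul_tmul]
  rw [← tmul_sum]
  simp_rw [← map_smul]
  rw [← map_sum]
  congr 2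
  exact b.sum_repr v

lemma map_kappaAux_wedge {n k k' : ℤ} (h : k = n + 1) (h' : n = k - 1) (hk : k' = n - 1)
    (hk' : n = k' + 1) (a : Module.Dual R G × G)
    (w : ExtPow R (Module.Dual R G) n ⊗[R] ExtPow R G n) :
    LinearMap.lTensor _ (kappaAux h') (TensorProduct.map (wedgeVec h a.1) (wedgeLeft h a.2) w) +
      TensorProduct.map (wedgeVec h a.1) (LinearMap.rTensor _ (wedgeLeft hk' a.2))
        (LinearMap.lTensor _ (kappaAux hk) w) =
    TensorProduct.map (wedgeVec h a.1)
      ((TensorProduct.mk R (ExtPow R G n) (SymPow R G 1)).flip (symOne R G a.2)) w := by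
  induction w using TensorProduct.induction_on with
  | zero => simp
  | add x y hx hy =>
    simp only [map_add]
    rw [add_add_add_comm, hx, hy]
  | tmul x y =>
    simp only [TensorProduct.map_tmul, LinearMap.lTensor_tmul, LinearMap.flip_apply,
      TensorProduct.mk_apply]
    rw [← tmul_add, kappaAux_wedgeLeft]

lemma kappaAux_evExtList (l : List (Module.Dual R G × G)) :
    ∀ {k k' : ℤ} (_ : 0 ≤ k) (h : k = k' - 1) (h' : k' = k + 1),
      LinearMap.lTensor _ (kappaAux h) (evExtList k' l) = tOp h' l (evExtList k l) := by
  induction l with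
  | nil => intro k k' hk h h'; rw [evExtList_nil (by omega)]; simp [tOp]
  | cons a l ih =>
    intro k k' hk h h'
    rw [evExtList_cons hk h', map_add, ih hk h h', tOp_cons]
    have key := map_kappaAux_wedge h' h (k' := k - 1) rfl (by omega) a (evExtList k l)
    rcases hk.eq_or_lt with rfl | hk'
    · have h0 : evExtList 0 (a :: l) = evExtList 0 l := by
        simp [evExtList]
      have hs : Subsingleton (ExtPow R G (0 - 1)) := by
        change Subsingleton (extPiece R G _)
        rw [extPiece_neg (by omega)]; infer_instance
      have hz : LinearMap.lTensor (ExtPow R (Module.Dual R G) 0)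
          (kappaAux (R := R) (G := G) (show (0 : ℤ) - 1 = 0 - 1 from rfl))
          (evExtList 0 l) = 0 := by
        have : Subsingleton (ExtPow R G (0 - 1) ⊗[R] SymPow R G 1) :=
          ⟨fun x y => by
            have hx : ∀ z : ExtPow R G (0 - 1) ⊗[R] SymPow R G 1, z = 0 := fun z => by
              induction z using TensorProduct.induction_on with
              | zero => rfl
              | add x y hx hy => rw [hx, hy, add_zero]
              | tmul x y => rw [Subsingleton.elim x 0, zero_tmul]
            rw [hx x, hx y]⟩
        rw [show kappaAux (R := R) (G := G) (show (0 : ℤ) - 1 = 0 - 1 from rfl)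
          = 0 from LinearMap.ext fun _ => Subsingleton.elim _ _]
        simp
      rw [hz, map_zero, add_zero] at key
      rw [h0, key]
      exact add_comm _ _
    · have hk1 : 0 ≤ k - 1 := by omega
      have h1 : k = (k - 1) + 1 := by omega
      rw [evExtList_cons hk1 h1, map_add, map_add, mapmk_wedge h1 h', add_zero]
      rw [ih hk1 rfl h1] at key
      have k2 := tOp_wedge h1 h' a l (evExtList (k - 1) l)
      rw [← key, add_add_add_comm, add_comm (TensorProduct.map _ _ _) (tOp _ _ _), k2, add_zero]
      exact add_comm _ _

end Squares

section SquareZero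
variable {R : Type u} [CommRing R] [Nontrivial R] {G : Type v} [AddCommGroup G] [Module R G]
  [Module.Free R G] [Module.Finite R G]
  {F : Type w} [AddCommGroup F] [Module R F] [Module.Free R F]

lemma subtype_schurAct {p q q' : ℤ} (hq : q' = q + 1) (v : G) (x : schurLPos R G p q) :
    (schurLPos R G p q').subtype (schurAct hq v x) =
      LinearMap.lTensor _ (symMul hq v) ((schurLPos R G p q).subtype x) := rfl

lemma kosPhi_epsOf_coe (Φ : Module.Dual R G →ₗ[R] F) {n k r r' p q q' : ℤ} (hr : r = n + k)
    (hp : p = k - 1) (hq : q = 1) (hr' : r' = r + 1) (hq' : q' = q + 1) (f : ExtPow R F n)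
    (w : ExtPow R (Module.Dual R G) k ⊗[R] ExtPow R G k) {I : Type*} [Fintype I] [DecidableEq I]
    (b : Module.Basis I R G) :
    LinearMap.lTensor (ExtPow R F r') (schurLPos R G p q').subtype
      (kosPhi Φ hr' hq' (epsOf Φ hr hp hq w f)) =
    ∑ i, TensorProduct.map (wedgeVec hr' (Φ (b.coord i)) ∘ₗ wedge hr f ∘ₗ extMap Φ rfl)
      (LinearMap.lTensor _ (symMul (show q' = 1 + 1 by omega) (b i)))
      (LinearMap.lTensor _ (kappaAux hp) w) := by
  subst hq
  induction w using TensorProduct.induction_on with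
  | zero => simp [epsOf]
  | add x y hx hy =>
    have h : epsOf Φ hr hp rfl (x + y) f = epsOf Φ hr hp rfl x f + epsOf Φ hr hp rfl y f := by
      simp only [epsOf_apply, map_add]
    rw [h, map_add, map_add, hx, hy]
    simp only [map_add]
    rw [← Finset.sum_add_distrib]
  | tmul x y =>
    rw [epsOf_apply, TensorProduct.map_tmul, kosPhi, evMap_tmul _ _ b, map_sum]
    refine Finset.sum_congr rfl fun i _ => ?_
    rfl

lemma wedge_extMap_wedgeVec (Φ : Module.Dual R G →ₗ[R] F) {n k k' r r' : ℤ} (hk : k' = k + 1)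
    (hr' : r' = n + k') (hr : r = n + k) (h : r' = r + 1) (f : ExtPow R F n)
    (φ : Module.Dual R G) (γ : ExtPow R (Module.Dual R G) k) :
    wedge hr' f (extMap Φ rfl (wedgeVec hk φ γ)) =
      wedgeVec h (Φ φ) (wedge hr f (extMap Φ rfl γ)) := by
  apply Subtype.ext
  simp [mul_assoc]

lemma schurLPos_subsingleton {p q : ℤ} (hp : p < 0) : Subsingleton (schurLPos R G p q) := by
  have : Subsingleton (ExtPow R G p) := by
    change Subsingleton (extPiece R G _)
    rw [extPiece_neg hp]; infer_instance
  have hx : ∀ z : ExtPow R G p ⊗[R] SymPow R G q, z = 0 := fun z => by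
    induction z using TensorProduct.induction_on with
    | zero => rfl
    | add x y hx hy => rw [hx, hy, add_zero]
    | tmul x y => rw [Subsingleton.elim x 0, zero_tmul]
  exact ⟨fun x y => Subtype.ext (by rw [hx x.1, hx y.1])⟩

lemma kosPhi_epsOf (Φ : Module.Dual R G →ₗ[R] F) {n k r r' p q q' : ℤ} (hr : r = n + k)
    (hp : p = k - 1) (hq : q = 1) (hr' : r' = r + 1) (hq' : q' = q + 1) (f : ExtPow R F n) :
    kosPhi Φ hr' hq' (epsOf Φ hr hp hq (evExt R G k) f) = 0 := by
  rcases lt_or_ge p 0 with hp0 | hp0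
  · have := schurLPos_subsingleton (R := R) (G := G) (q := q) hp0
    have h0 : kappaOne (R := R) (G := G) hp hq = 0 := LinearMap.ext fun _ => Subsingleton.elim _ _
    rw [epsOf_apply, h0, TensorProduct.map_zero_right, LinearMap.zero_apply, map_zero]
  have hinj : Function.Injective
      (LinearMap.lTensor (ExtPow R F r') (schurLPos R G p q').subtype) :=
    Module.Flat.lTensor_preserves_injective_linearMap _ (Submodule.injective_subtype _)
  apply hinj
  rw [map_zero, kosPhi_epsOf_coe Φ hr hp hq hr' hq' f _ (Module.finBasis R G), evExt,
    kappaAux_evExtList _ hp0 hp (by omega)]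
  set b := Module.finBasis R G
  generalize evExtList p (List.ofFn fun i => (b.coord i, b i)) = w
  have hr1 : r - 1 = n + p := by omega
  have e : ∀ i, (TensorProduct.map (wedgeVec hr' (Φ (b.coord i)) ∘ₗ wedge hr f ∘ₗ extMap Φ rfl)
      (LinearMap.lTensor (ExtPow R G p) (symMul (show q' = 1 + 1 by omega) (b i))))
      (tOp (show k = p + 1 by omega) (List.ofFn fun i => (b.coord i, b i)) w) =
      ∑ j, TensorProduct.map (wedgeVec hr' (Φ (b.coord i)) ∘ₗ
          wedgeVec (show r = (r - 1) + 1 by omega) (Φ (b.coord j)) ∘ₗ wedge hr1 f ∘ₗ extMap Φ rfl)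
        ((TensorProduct.mk R (ExtPow R G p) (SymPow R G q')).flip
          (symMul (show q' = 1 + 1 by omega) (b i) (symOne R G (b j)))) w := by
    intro i
    rw [tOp, List.map_ofFn, List.sum_ofFn, LinearMap.sum_apply, map_sum]
    refine Finset.sum_congr rfl fun j _ => ?_
    induction w using TensorProduct.induction_on with
    | zero => simp
    | add x y hx hy => simp only [map_add, hx, hy]
    | tmul x y =>
      simp only [Function.comp_apply, TensorProduct.map_tmul, LinearMap.comp_apply,
        LinearMap.flip_apply, TensorProduct.mk_apply, LinearMap.lTensor_tmul]
      rw [wedge_extMap_wedgeVec Φ _ hr hr1 (by omega)]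
  simp_rw [e]
  have comm : ∀ i j, symMul (show q' = 1 + 1 by omega) (b i) (symOne R G (b j))
      = symMul (show q' = 1 + 1 by omega) (b j) (symOne R G (b i)) :=
    fun i j => Subtype.ext (mul_comm _ _)
  clear e
  refine sum_sum_eq_zero _ ?_ ?_
  · intro i
    induction w using TensorProduct.induction_on with
    | zero => simp
    | add x y hx hy => simp only [map_add, hx, hy, add_zero]
    | tmul x y =>
      simp only [TensorProduct.map_tmul, LinearMap.comp_apply]
      rw [wedgeVec_wedgeVec_self, zero_tmul]
  · intro i j
    rw [comm j i]
    induction w using TensorProduct.induction_on with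
    | zero => simp
    | add x y hx hy =>
      simp only [map_add]
      rw [add_add_add_comm, hx, hy, add_zero]
    | tmul x y =>
      simp only [TensorProduct.map_tmul, LinearMap.comp_apply]
      rw [← add_tmul, wedgeVec_wedgeVec_add, zero_tmul]

lemma epsOf_wedge (Φ : Module.Dual R G →ₗ[R] F) {n k r p q m a : ℤ} (hn : n = m + a)
    (hr : r = n + k) (hp : p = k - 1) (hq : q = 1) (hk : k + a = Module.finrank R G + 1)
    (w : ExtPow R (Module.Dual R G) k ⊗[R] ExtPow R G k) (f : ExtPow R F m)
    (γ : ExtPow R (Module.Dual R G) a) :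
    epsOf Φ hr hp hq w (wedge hn f (extMap Φ rfl γ)) = 0 := by
  rw [epsOf_apply]
  have hs : Subsingleton (ExtPow R (Module.Dual R G) (a + k)) := by
    apply extPow_subsingleton
    right
    rw [Module.finrank_linearMap_self]
    omega
  have h0 : wedge hr (wedge hn f (extMap Φ rfl γ)) ∘ₗ extMap Φ rfl = 0 := by
    ext δ
    have h := congrArg (fun t : ExtPow R (Module.Dual R G) (a + k) =>
      f.1 * ExteriorAlgebra.map Φ t.1) (Subsingleton.elim (wedge rfl γ δ) 0)
    simpa [mul_assoc] using h
  rw [h0, TensorProduct.map_zero_left, LinearMap.zero_apply]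

lemma eps_mu (Φ : Module.Dual R G →ₗ[R] F) {r a q i n j k r' p q' : ℤ} (hn : q = 0 → n = r + a)
    (hj : q = 0 → j = i + 1) (hr : j = i + 1 → r' = n + k)
    (hp : p = k - 1) (hq : j = i + 1 → q' = 1) (hk : k + a = Module.finrank R G + 1)
    (x : ExtPow R F r ⊗[R] weylK R G a q) :
    eps Φ hr hp hq (mu Φ hn hj x) = 0 := by
  by_cases h : q = 0
  · obtain rfl := hn h
    obtain rfl := hj h
    rw [eps, dif_pos rfl, LinearMap.comp_apply]
    have e : Submodule.inclusion (show midPiece R F i (r + a) (i + 1) ≤ extPiece R F (r + a) by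
        rw [midPiece, if_pos rfl]) (mu Φ hn hj x) = muAmb Φ x := rfl
    rw [e]
    induction x using TensorProduct.induction_on with
    | zero => simp
    | add x y hx hy => rw [map_add, map_add, hx rfl, hy rfl, add_zero]
    | tmul f x =>
      have e' : muAmb Φ (f ⊗ₜ x) = wedge rfl f (extPhi Φ x.1) := rfl
      rw [e']
      generalize x.1 = y
      induction y using TensorProduct.induction_on with
      | zero => simp
      | add x y hx hy => rw [map_add, map_add, map_add, hx, hy, add_zero]
      | tmul γ φ =>
        rw [extPhi_tmul, map_smul, map_smul, epsOf_wedge _ _ _ _ _ hk, smul_zero]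
  · have h0 : mu Φ hn hj x = 0 := Subtype.ext (by
      change (muAmb Φ x : ExteriorAlgebra R F) = 0
      rw [muAmb_ne Φ h]; rfl)
    rw [h0, map_zero]

lemma kosPhi_eps (Φ : Module.Dual R G →ₗ[R] F) {i n j k r r' p q q' : ℤ}
    (hr : j = i + 1 → r = n + k) (hp : p = k - 1) (hq : j = i + 1 → q = 1)
    (hr' : r' = r + 1) (hq' : q' = q + 1) (x : midPiece R F i n j) :
    kosPhi Φ hr' hq' (eps Φ hr hp hq x) = 0 := by
  unfold eps
  split_ifs with h
  · rw [LinearMap.comp_apply, kosPhi_epsOf]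
  · rw [LinearMap.zero_apply, map_zero]

lemma mu_etaPhi (Φ : Module.Dual R G →ₗ[R] F) {a r r' q q' i n j : ℤ} (hr : r' = r + 1)
    (hq : q' = q - 1) (hn : q' = 0 → n = r' + a) (hj : q' = 0 → j = i + 1)
    (x : ExtPow R F r ⊗[R] weylK R G a q) : mu Φ hn hj (etaPhi Φ hr hq x) = 0 :=
  Subtype.ext (by
    change (muAmb Φ _ : ExteriorAlgebra R F) = 0
    rw [muAmb_etaPhi Φ hr hq]; rfl)

end SquareZero

lemma add_eq_zero' {S : Type*} [AddMonoid S] {x y : S} (hx : x = 0) (hy : y = 0) : x + y = 0 := by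
  rw [hx, hy, add_zero]

section TheComplexes
variable {R : Type u} [CommRing R] {G F : Type u} [AddCommGroup G] [Module R G]
  [Module.Free R G] [Module.Finite R G] [AddCommGroup F] [Module R F]

variable (R G F) in
/-- The module `⋀^{N-j} F ⊗ K^p_j (G*)`. -/
abbrev KMod (N p j : ℤ) : Type u := ExtPow R F (N - j) ⊗[R] weylK R G p j

variable (R G F) in
/-- The module `⋀^{𝔣-j} F ⊗ L^p_{𝔣-N-j} G`, which is zero unless `1 ≤ 𝔣-N-j`. -/
abbrev LMod (N p j : ℤ) : Type u :=
  ExtPow R F (Module.finrank R F - j) ⊗[R] schurLPos R G p (Module.finrank R F - N - j)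

/-- The complex `𝕂^{N,p}_Φ`. -/
def KComplex (Φ : Module.Dual R G →ₗ[R] F) (N p : ℤ) : ChainComplex (ModuleCat.{u} R) ℤ :=
  mkComplex (KMod R G F N p) (fun i j h => etaPhi Φ (by omega) (by omega))
    (fun _ _ _ _ _ x => etaPhi_etaPhi Φ _ _ _ _ x)

/-- The complex `𝕃^{N,p}_Φ`. -/
def LComplex (Φ : Module.Dual R G →ₗ[R] F) (N p : ℤ) : ChainComplex (ModuleCat.{u} R) ℤ :=
  mkComplex (LMod R G F N p) (fun i j h => kosPhi Φ (by omega) (by omega))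
    (fun _ _ _ _ _ x => kosPhi_kosPhi Φ _ _ _ _ x)

variable (R G F) in
/-- The module `C^{i,a}_j`, the direct sum of `𝕂^{𝔣-𝔤-i-1,a}[-i-2]_j` (zero for `j ≤ i + 1`), of
`⋀^{𝔣-𝔤+a-i-1} F` if `j = i + 1`, and of `𝕃^{𝔣-i-1,𝔤-a}_j` (zero for `j ≥ i + 1`). -/
abbrev CMod (i a j : ℤ) : Type u :=
  KMod R G F (Module.finrank R F - Module.finrank R G - i - 1) a (-i - 2 + j) ×
  midPiece R F i (Module.finrank R F - Module.finrank R G + a - i - 1) j ×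
  LMod R G F (Module.finrank R F - i - 1) (Module.finrank R G - a) j

variable [Nontrivial R] [Module.Free R F]

/-- The differential of `C^{i,a}_Φ`. -/
def cDiff (Φ : Module.Dual R G →ₗ[R] F) (i a j' j : ℤ) (h : j + 1 = j') :
    CMod R G F i a j' →ₗ[R] CMod R G F i a j :=
  LinearMap.prod (etaPhi Φ (by omega) (by omega) ∘ₗ LinearMap.fst R _ _)
    (LinearMap.prod (mu Φ (by omega) (by omega) ∘ₗ LinearMap.fst R _ _)
      (eps Φ (k := Module.finrank R G + 1 - a) (by omega) (by omega) (by omega) ∘ₗ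
          LinearMap.fst R _ _ ∘ₗ LinearMap.snd R _ _ +
        kosPhi Φ (by omega) (by omega) ∘ₗ LinearMap.snd R _ _ ∘ₗ LinearMap.snd R _ _))

/-- The complex `C^{i,a}_Φ`. -/
def CComplex (Φ : Module.Dual R G →ₗ[R] F) (i a : ℤ) : ChainComplex (ModuleCat.{u} R) ℤ :=
  mkComplex (CMod R G F i a) (cDiff Φ i a)
    (fun j'' j' j h h' x => by
      obtain ⟨x, y, z⟩ := x
      refine Prod.ext ?_ (Prod.ext ?_ ?_)
      · exact etaPhi_etaPhi Φ _ _ _ _ x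
      · exact mu_etaPhi Φ _ _ (by omega) (by omega) x
      · refine add_eq_zero' (eps_mu Φ (by omega) (by omega) _ _ _ (by omega) x) ((map_add _ _ _).trans
          (add_eq_zero' (kosPhi_eps Φ _ _ _ _ _ y) (kosPhi_kosPhi Φ _ _ _ _ z))))

end TheComplexes

section Functoriality
variable {R : Type u} [CommRing R] {G : Type v} [AddCommGroup G] [Module R G]
  {G₁ : Type w} [AddCommGroup G₁] [Module R G₁]

lemma contractLeft_extMap (ψ : G →ₗ[R] G₁) (φ : Module.Dual R G₁) (x : ExteriorAlgebra R G) :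
    CliffordAlgebra.contractLeft φ (ExteriorAlgebra.map ψ x) =
      ExteriorAlgebra.map ψ (CliffordAlgebra.contractLeft (φ ∘ₗ ψ) x) := by
  induction x using CliffordAlgebra.left_induction with
  | algebraMap r =>
    have h : ExteriorAlgebra.map ψ (algebraMap R (CliffordAlgebra 0) r) =
      algebraMap R (CliffordAlgebra 0) r := (ExteriorAlgebra.map ψ).commutes r
    rw [h, CliffordAlgebra.contractLeft_algebraMap, CliffordAlgebra.contractLeft_algebraMap]
    exact (map_zero (ExteriorAlgebra.map ψ)).symm
  | add x y hx hy =>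
    have h : ExteriorAlgebra.map ψ (x + y) = ExteriorAlgebra.map ψ x + ExteriorAlgebra.map ψ y :=
      map_add _ _ _
    rw [h, map_add, map_add, hx, hy]
    exact (map_add (ExteriorAlgebra.map ψ) _ _).symm
  | ι_mul x v hx =>
    have h : ExteriorAlgebra.map ψ (CliffordAlgebra.ι 0 v * x) =
        CliffordAlgebra.ι 0 (ψ v) * ExteriorAlgebra.map ψ x := by
      have h1 : ExteriorAlgebra.map ψ (CliffordAlgebra.ι 0 v * x) =
        ExteriorAlgebra.map ψ (CliffordAlgebra.ι 0 v) * ExteriorAlgebra.map ψ x := map_mul _ _ _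
      rw [h1]
      congr 1
      exact ExteriorAlgebra.map_apply_ι ψ v
    rw [h, CliffordAlgebra.contractLeft_ι_mul, CliffordAlgebra.contractLeft_ι_mul, hx]
    have h2 : ∀ a b : ExteriorAlgebra R G, ExteriorAlgebra.map ψ (φ (ψ v) • a - CliffordAlgebra.ι 0 v * b) =
        φ (ψ v) • ExteriorAlgebra.map ψ a - CliffordAlgebra.ι 0 (ψ v) * ExteriorAlgebra.map ψ b := by
      intro a b
      rw [map_sub, map_smul]
      congr 1
      have h1 : ExteriorAlgebra.map ψ (CliffordAlgebra.ι 0 v * b) =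
        ExteriorAlgebra.map ψ (CliffordAlgebra.ι 0 v) * ExteriorAlgebra.map ψ b := map_mul _ _ _
      rw [h1]
      congr 1
      exact ExteriorAlgebra.map_apply_ι ψ v
    exact (h2 _ _).symm

variable [Module.Free R G] [Module.Finite R G] [Module.Free R G₁] [Module.Finite R G₁]

lemma evSum_natural (ψ : G →ₗ[R] G₁) {P : Type*} [AddCommMonoid P] [Module R P]
    (T : Module.Dual R G →ₗ[R] G₁ →ₗ[R] P) :
    evSum (T ∘ₗ ψ.dualMap) = evSum (T.compl₂ ψ) := by
  classical
  set b := Module.Free.chooseBasis R G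
  set b₁ := Module.Free.chooseBasis R G₁
  rw [evSum_eq_sum _ b, evSum_eq_sum _ b₁]
  have h1 : ∀ i, ψ.dualMap (b₁.coord i) = ∑ j, b₁.coord i (ψ (b j)) • b.coord j := by
    intro i
    refine b.ext fun k => ?_
    simp [LinearMap.sum_apply, Finsupp.single_apply]
  have h2 : ∀ j, ψ (b j) = ∑ i, b₁.coord i (ψ (b j)) • b₁ i := fun j => (b₁.sum_repr _).symm
  simp only [LinearMap.comp_apply, h1, map_sum, LinearMap.sum_apply, map_smul,
    LinearMap.smul_apply, LinearMap.compl₂_apply]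
  rw [Finset.sum_comm]
  refine Finset.sum_congr rfl fun j _ => ?_
  refine Eq.trans ?_ (congrArg (T (b.coord j)) (h2 j)).symm
  rw [map_sum]
  simp only [map_smul]

variable {P P' Q Q' S S' T T' : Type*} [AddCommMonoid P] [Module R P] [AddCommMonoid P']
  [Module R P'] [AddCommMonoid Q] [Module R Q] [AddCommMonoid Q'] [Module R Q']
  [AddCommMonoid S] [Module R S] [AddCommMonoid S'] [Module R S'] [AddCommMonoid T] [Module R T]
  [AddCommMonoid T'] [Module R T']

lemma evMap_eq_evSum (A : Module.Dual R G →ₗ[R] P →ₗ[R] P') (B : G →ₗ[R] Q →ₗ[R] Q')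
    (x : P) (y : Q) :
    evMap A B (x ⊗ₜ y) = evSum ((TensorProduct.mk R P' Q').compl₁₂ (A.flip x) (B.flip y)) := by
  classical
  rw [evMap_tmul _ _ (Module.Free.chooseBasis R G), evSum_eq_sum _ (Module.Free.chooseBasis R G)]
  rfl

lemma map_evSum {W : Type*} [AddCommMonoid W] [Module R W]
    (t : Module.Dual R G →ₗ[R] G →ₗ[R] P) (f : P →ₗ[R] W) :
    f (evSum t) = evSum (t.compr₂ f) := by
  classical
  rw [evSum_eq_sum _ (Module.Free.chooseBasis R G), evSum_eq_sum _ (Module.Free.chooseBasis R G),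
    map_sum]
  rfl

/-- Naturality of `evMap` for maps that are covariant in `G`. -/
lemma evMap_push (ψ : G →ₗ[R] G₁) (A : Module.Dual R G →ₗ[R] P →ₗ[R] P') (B : G →ₗ[R] Q →ₗ[R] Q')
    (A₁ : Module.Dual R G₁ →ₗ[R] S →ₗ[R] S') (B₁ : G₁ →ₗ[R] T →ₗ[R] T')
    (f : P →ₗ[R] S) (f' : P' →ₗ[R] S') (g : Q →ₗ[R] T) (g' : Q' →ₗ[R] T')
    (hA : ∀ φ x, A₁ φ (f x) = f' (A (ψ.dualMap φ) x)) (hB : ∀ v y, B₁ (ψ v) (g y) = g' (B v y))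
    (z : P ⊗[R] Q) :
    evMap A₁ B₁ (TensorProduct.map f g z) = TensorProduct.map f' g' (evMap A B z) := by
  induction z using TensorProduct.induction_on with
  | zero => simp
  | add x y hx hy => simp only [map_add, hx, hy]
  | tmul x y =>
    rw [TensorProduct.map_tmul, evMap_eq_evSum, evMap_eq_evSum, map_evSum]
    have h := evSum_natural ψ ((TensorProduct.mk R S' T').compl₁₂ (f' ∘ₗ A.flip x) (B₁.flip (g y)))
    refine (congrArg evSum ?_).trans (h.trans (congrArg evSum ?_))
    · ext φ v; simp [hA]
    · ext φ v; simp [hB]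

/-- Naturality of `evMap` for maps that are contravariant in `G`. -/
lemma evMap_pull (ψ : G →ₗ[R] G₁) (A : Module.Dual R G →ₗ[R] P →ₗ[R] P') (B : G →ₗ[R] Q →ₗ[R] Q')
    (A₁ : Module.Dual R G₁ →ₗ[R] S →ₗ[R] S') (B₁ : G₁ →ₗ[R] T →ₗ[R] T')
    (f : S →ₗ[R] P) (f' : S' →ₗ[R] P') (g : T →ₗ[R] Q) (g' : T' →ₗ[R] Q')
    (hA : ∀ φ x, A (ψ.dualMap φ) (f x) = f' (A₁ φ x)) (hB : ∀ v y, B v (g y) = g' (B₁ (ψ v) y))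
    (z : S ⊗[R] T) :
    evMap A B (TensorProduct.map f g z) = TensorProduct.map f' g' (evMap A₁ B₁ z) := by
  induction z using TensorProduct.induction_on with
  | zero => simp
  | add x y hx hy => simp only [map_add, hx, hy]
  | tmul x y =>
    rw [TensorProduct.map_tmul, evMap_eq_evSum, evMap_eq_evSum, map_evSum]
    have h := evSum_natural ψ ((TensorProduct.mk R P' Q').compl₁₂ (A.flip (f x)) (g' ∘ₗ B₁.flip y))
    refine (congrArg evSum ?_).trans (h.symm.trans (congrArg evSum ?_))
    · ext φ v; simp [hB]
    · ext φ v; simp [hA]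

lemma map_mem_schurLPos {p p₁ q q₁ : ℤ} (f : ExtPow R G p →ₗ[R] ExtPow R G₁ p₁)
    (g : SymPow R G q →ₗ[R] SymPow R G₁ q₁) (hq : q₁ = q)
    (h : ∀ x, kappa (p := p) (p' := p - 1) (q := q) (q' := q + 1) rfl rfl x = 0 →
      kappa (p := p₁) (p' := p₁ - 1) (q := q₁) (q' := q₁ + 1) rfl rfl (TensorProduct.map f g x) = 0)
    (x : schurLPos R G p q) : TensorProduct.map f g x.1 ∈ schurLPos R G₁ p₁ q₁ := by
  have hx := x.2
  rw [mem_schurLPos (p' := p - 1) (q' := q + 1) rfl rfl] at hx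
  rw [mem_schurLPos (p' := p₁ - 1) (q' := q₁ + 1) rfl rfl]
  by_cases h1 : 1 ≤ q
  · rw [if_pos h1] at hx
    rw [if_pos (by omega), h _ hx]
  · rw [if_neg h1] at hx
    rw [if_neg (by omega), hx, map_zero]

/-- The map `L^p_q G → L^p_q G₁` induced by `ψ : G → G₁`. -/
def schurMap (ψ : G →ₗ[R] G₁) {p p₁ q q₁ : ℤ} (hp : p₁ = p) (hq : q₁ = q) :
    schurLPos R G p q →ₗ[R] schurLPos R G₁ p₁ q₁ :=
  (TensorProduct.map (extMap ψ hp) (symMap ψ hq) ∘ₗ (schurLPos R G p q).subtype).codRestrict _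
    (map_mem_schurLPos _ _ hq fun x hx => by
      rw [kappa, evMap_push ψ (contr rfl) (symMul rfl) _ _ _ (extMap ψ (by omega)) _
        (symMap ψ (by omega)), ← kappa, hx, map_zero]
      · intro φ x
        exact Subtype.ext (contractLeft_extMap _ _ _)
      · intro v y
        apply Subtype.ext
        simp [symAlgMap])

/-- The map `L^p_q G → L^{p-1}_q G` given by contraction of `δ ∈ G*` against the last factor of
`⋀ᵖ G`. -/
def schurContr {p p₁ q q₁ : ℤ} (hp : p₁ = p - 1) (hq : q₁ = q) :
    Module.Dual R G →ₗ[R] schurLPos R G p q →ₗ[R] schurLPos R G p₁ q₁ :=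
  LinearMap.mk₂ R (fun δ x => ⟨TensorProduct.map (contrR hp δ) (symMap LinearMap.id hq) x.1,
      map_mem_schurLPos _ _ hq (fun x hx => by
        rw [kappa, evMap_push LinearMap.id (contr rfl) (symMul rfl) _ _ _ (contrR (by omega) δ) _
          (symMap LinearMap.id (by omega)), ← kappa, hx, map_zero]
        · intro φ x
          have h := contr_contr_add (show p - 1 = p - 1 from rfl) (show p₁ - 1 = (p - 1) - 1 by omega)
            φ δ x
          subst hp
          have hs : ((p - 1 - 1).negOnePow : ℤ) = -((p - 1).negOnePow : ℤ) := by
            conv_rhs => rw [show p - 1 = (p - 1 - 1) + 1 by omega, Int.negOnePow_succ]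
            simp
          simp only [contrR, LinearMap.smul_apply, map_zsmul, hs, neg_smul]
          rw [eq_neg_of_add_eq_zero_left h, smul_neg]
          rfl
        · intro v y
          apply Subtype.ext
          simp [symAlgMap]) x⟩)
    (fun _ _ _ => Subtype.ext (by simp [TensorProduct.map_add_left]))
    (fun _ _ _ => Subtype.ext (by simp [TensorProduct.map_smul_left]))
    (fun _ _ _ => Subtype.ext (by simp)) (fun _ _ _ => Subtype.ext (by simp))

/-- The map `K^p_q (G₁*) → K^p_q (G*)` induced by `ψ : G → G₁`. -/
def weylMap (ψ : G →ₗ[R] G₁) {p p₁ q q₁ : ℤ} (hp : p = p₁) (hq : q = q₁) :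
    weylK R G₁ p₁ q₁ →ₗ[R] weylK R G p q :=
  (TensorProduct.map (extMap ψ.dualMap hp) (divMap ψ hq) ∘ₗ (weylK R G₁ p₁ q₁).subtype).codRestrict _
    (fun x => by
      rw [mem_weylK (p' := p + 1) (q' := q - 1) rfl rfl]
      simp only [LinearMap.comp_apply]
      rw [eta, evMap_pull ψ _ _ (wedgeVec rfl) (divAct rfl) _ (extMap ψ.dualMap (by omega)) _
        (divMap ψ (by omega)), ← eta]
      · have := x.2
        rw [mem_weylK (p' := p₁ + 1) (q' := q₁ - 1) rfl rfl] at this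
        exact (congrArg _ this).trans (map_zero _)
      · intro φ x
        apply Subtype.ext
        simp
      · intro v y
        ext z
        simp only [divAct_apply, divMap, LinearMap.dualMap_apply]
        congr 1
        apply Subtype.ext
        simp [symAlgMap])

/-- The map `K^p_q (G*) → K^{p+1}_q (G*)`, `x ↦ x ∧ δ`, for `δ ∈ G*`. -/
def weylWedge {p p₁ q q₁ : ℤ} (hp : p₁ = p + 1) (hq : q₁ = q) :
    Module.Dual R G →ₗ[R] weylK R G p q →ₗ[R] weylK R G p₁ q₁ :=
  LinearMap.mk₂ R (fun δ x => ⟨TensorProduct.map (wedgeVec hp δ) (divMap LinearMap.id hq) x.1, by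
      have hx := x.2
      rw [mem_weylK (p' := p + 1) (q' := q - 1) rfl rfl] at hx
      rw [mem_weylK (p' := p₁ + 1) (q' := q₁ - 1) rfl rfl, eta,
        evMap_pull LinearMap.id _ _ (wedgeVec rfl) (divAct rfl) _ (-wedgeVec (by omega) δ) _
          (divMap LinearMap.id (by omega)), ← eta]
      · exact (congrArg _ hx).trans (map_zero _)
      · intro φ y
        rw [LinearMap.neg_apply]
        exact eq_neg_of_add_eq_zero_left (Subtype.ext (congrArg Subtype.val
          (wedgeVec_wedgeVec_add (show p₁ = p + 1 from hp) rfl φ δ y)))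
      · intro v y
        ext z
        simp only [divAct_apply, divMap, LinearMap.dualMap_apply]
        congr 1
        apply Subtype.ext
        simp [symAlgMap]⟩)
    (fun _ _ _ => Subtype.ext (by simp [TensorProduct.map_add_left]))
    (fun _ _ _ => Subtype.ext (by simp [TensorProduct.map_smul_left]))
    (fun _ _ _ => Subtype.ext (by simp)) (fun _ _ _ => Subtype.ext (by simp))

end Functoriality

section Decomposition
variable {R : Type u} [CommRing R] [Nontrivial R]
  {F' F'' G' G'' : Type u} [AddCommGroup F'] [Module R F'] [Module.Free R F'] [Module.Finite R F']
  [AddCommGroup F''] [Module R F''] [Module.Free R F''] [Module.Finite R F'']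
  [AddCommGroup G'] [Module R G'] [Module.Free R G'] [Module.Finite R G']
  [AddCommGroup G''] [Module R G''] [Module.Free R G''] [Module.Finite R G'']

lemma finrank_prod_one (h : Module.finrank R F'' = 1) :
    (Module.finrank R (F' × F'') : ℤ) = Module.finrank R F' + 1 := by
  rw [Module.finrank_prod, h]; push_cast; rfl

/-- The direct sum `Φ' ⊕ Φ'' : (G' ⊕ G'')* = G'* ⊕ G''* → F' ⊕ F''`. -/
def blockSum (Φ' : Module.Dual R G' →ₗ[R] F') (Φ'' : Module.Dual R G'' →ₗ[R] F'') :
    Module.Dual R (G' × G'') →ₗ[R] F' × F'' :=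
  LinearMap.prod (Φ' ∘ₗ (LinearMap.inl R G' G'').dualMap) (Φ'' ∘ₗ (LinearMap.inr R G' G'').dualMap)

/-- The map `Kos_{Φ''} : R → F'' ⊗ G''`, `1 ↦ ∑ Φ''(e_ℓ*) ⊗ e_ℓ`. -/
def kosTwist (Φ'' : Module.Dual R G'' →ₗ[R] F'') : R →ₗ[R] F'' ⊗[R] G'' :=
  LinearMap.toSpanSingleton R _ (evSum ((TensorProduct.mk R F'' G'') ∘ₗ Φ''))

/-- The projection `⋀ⁿ (F' ⊕ F'') → ⋀ⁿ⁻¹ F' ⊗ F''`, which is `f' ∧ f'' ↦ f' ⊗ f''` for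
`f' ∈ ⋀ⁿ⁻¹ F'` and `f'' ∈ F''`, and is zero on `⋀ⁿ F'`, if `F''` has rank one. -/
def extProj {n k : ℤ} (h : k = n - 1) : ExtPow R (F' × F'') n →ₗ[R] ExtPow R F' k ⊗[R] F'' :=
  evMap ((LinearMap.llcomp R _ _ _ (extMap (LinearMap.fst R F' F'') rfl)) ∘ₗ contrR h ∘ₗ
      (LinearMap.snd R F' F'').dualMap) (LinearMap.lsmul R F'').flip ∘ₗ
    (TensorProduct.rid R _).symm.toLinearMap

/-- The projection `L^p_q (G' ⊕ G'') → L^{p-1}_q G' ⊗ G''` induced by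
`⋀ᵖ (G' ⊕ G'') → ⋀ᵖ⁻¹ G' ⊗ G''` and `Sym_q (G' ⊕ G'') → Sym_q G'`. -/
def schurProj {p p₁ q q₁ : ℤ} (hp : p₁ = p - 1) (hq : q₁ = q) :
    schurLPos R (G' × G'') p q →ₗ[R] schurLPos R G' p₁ q₁ ⊗[R] G'' :=
  evMap ((LinearMap.llcomp R _ _ _ (schurMap (LinearMap.fst R G' G'') rfl hq)) ∘ₗ
      schurContr hp rfl ∘ₗ (LinearMap.snd R G' G'').dualMap) (LinearMap.lsmul R G'').flip ∘ₗ
    (TensorProduct.rid R _).symm.toLinearMap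

/-- The map `K^p_q ((G' ⊕ G'')*) → K^p_{q-1} ((G' ⊕ G'')*) ⊗ G''*`, `x ↦ ∑ e_ℓ x ⊗ e_ℓ*`, where
`∑ e_ℓ* ⊗ e_ℓ ∈ G''* ⊗ G''` is the canonical element. -/
def weylSplit {p q q₁ : ℤ} (hq : q₁ = q - 1) :
    weylK R (G' × G'') p q →ₗ[R] weylK R (G' × G'') p q₁ ⊗[R] Module.Dual R G'' :=
  (TensorProduct.comm R _ _).toLinearMap ∘ₗ
    evMap (LinearMap.lsmul R (Module.Dual R G'')).flip
      (weylAct hq ∘ₗ LinearMap.inr R G' G'') ∘ₗ (TensorProduct.lid R _).symm.toLinearMap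

variable (R F' F'' G' G'')

/-- The module `D_j`, the direct sum of the same pieces of `𝕂` and of `⋀ F` as in `C^{i,a}_j`, and of
`𝕃^{𝔣-i-2,𝔤-a}_j ⊗ F''` and `𝕃^{𝔣-i-2,𝔤-a-1}_j ⊗ (F'' ⊗ G'')`, formed for `Φ'`. -/
abbrev DMod (i a j : ℤ) : Type u :=
  KMod R (G' × G'') (F' × F'')
    (Module.finrank R (F' × F'') - Module.finrank R (G' × G'') - i - 1) a (-i - 2 + j) ×
  midPiece R (F' × F'') i
    (Module.finrank R (F' × F'') - Module.finrank R (G' × G'') + a - i - 1) j ×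
  (LMod R G' F' (Module.finrank R F' - i - 1) (Module.finrank R G' - (a - 1)) j ⊗[R] F'') ×
  (LMod R G' F' (Module.finrank R F' - i - 1) (Module.finrank R G' - a) j ⊗[R] (F'' ⊗[R] G''))

variable {R F' F'' G' G''}

/-- `⋀ʳ F' ⊗ L^p_q G → ⋀ʳ F ⊗ L^p_q G` and `⋀ʳ⁻¹ F' ⊗ L^p_{q-1} G ⊗ F'' ⊗ G'' → ⋀ʳ F ⊗ L^p_q G`,
`f' ⊗ x ↦ f' ⊗ x` and `f' ⊗ x ⊗ f'' ⊗ g'' ↦ f' ∧ f'' ⊗ g'' x`, in degree `j`. -/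
def inclDagger (hF : Module.finrank R F'' = 1) (i a j : ℤ) :
    (LMod R (G' × G'') F' (Module.finrank R (F' × F'') - i - 1)
        (Module.finrank R (G' × G'') - a) (j - 1) ⊗[R] R) ×
      (LMod R (G' × G'') F' (Module.finrank R (F' × F'') - i - 1)
        (Module.finrank R (G' × G'') - a) j ⊗[R] (F'' ⊗[R] G'')) →ₗ[R]
    CMod R (G' × G'') (F' × F'') i a j :=
  LinearMap.inr R _ _ ∘ₗ LinearMap.inr R _ _ ∘ₗ
    LinearMap.coprod
      (TensorProduct.map
          (extMap (LinearMap.inl R F' F'') (by have := finrank_prod_one (F' := F') hF; omega))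
          (schurMap LinearMap.id rfl (by have := finrank_prod_one (F' := F') hF; omega)) ∘ₗ
        (TensorProduct.rid R _).toLinearMap)
      (TensorProduct.map
          (TensorProduct.lift ((wedgeVec (by have := finrank_prod_one (F' := F') hF; omega) ∘ₗ
            LinearMap.inr R F' F'').flip ∘ₗ extMap (LinearMap.inl R F' F'') rfl))
          (TensorProduct.lift (schurAct (by have := finrank_prod_one (F' := F') hF; omega) ∘ₗ
            LinearMap.inr R G' G'').flip) ∘ₗ
        (TensorProduct.tensorTensorTensorComm R _ _ F'' G'').toLinearMap)

/-- The identity on the pieces of `𝕂` and of `⋀ F`, and the projections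
`⋀ʳ F ⊗ L^p_q G → ⋀ʳ⁻¹ F' ⊗ L^p_q G' ⊗ F''` and `⋀ʳ F ⊗ L^p_q G → ⋀ʳ⁻¹ F' ⊗ L^{p-1}_q G' ⊗ F'' ⊗ G''`. -/
def quotDagger (hF : Module.finrank R F'' = 1) (hG : Module.finrank R G'' = 1) (i a j : ℤ) :
    CMod R (G' × G'') (F' × F'') i a j →ₗ[R] DMod R F' F'' G' G'' i a j :=
  LinearMap.prodMap LinearMap.id (LinearMap.prodMap LinearMap.id (LinearMap.prod
    ((TensorProduct.rightComm R _ F'' _).toLinearMap ∘ₗ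
      TensorProduct.map (extProj (by have := finrank_prod_one (F' := F') hF; omega))
        (schurMap (LinearMap.fst R G' G'') (by have := finrank_prod_one (F' := G') hG; omega)
          (by have := finrank_prod_one (F' := F') hF; omega)))
    ((TensorProduct.tensorTensorTensorComm R _ F'' _ G'').toLinearMap ∘ₗ
      TensorProduct.map (extProj (by have := finrank_prod_one (F' := F') hF; omega))
        (schurProj (by have := finrank_prod_one (F' := G') hG; omega)
          (by have := finrank_prod_one (F' := F') hF; omega)))))

lemma mem_midPiece {F : Type*} [AddCommGroup F] [Module R F] {i n j : ℤ}
    {x : ExteriorAlgebra R F} :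
    x ∈ midPiece R F i n j ↔ (if j = i + 1 then x ∈ extPiece R F n else x = 0) := by
  unfold midPiece
  split_ifs
  · rfl
  · exact Submodule.mem_bot R

/-- The inclusion `⋀ⁿ F' → ⋀ⁿ F` placed in degree `i + 1`. -/
def midIncl {i n n₁ j : ℤ} (hn : n₁ = n) : midPiece R F' i n j →ₗ[R] midPiece R (F' × F'') i n₁ j :=
  (ExteriorAlgebra.map (LinearMap.inl R F' F'')).toLinearMap.restrict (fun x hx => by
    rw [mem_midPiece] at hx ⊢
    split_ifs at hx ⊢ with h
    · exact hn ▸ map_mem_extPiece _ hx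
    · rw [hx, map_zero])

/-- The map `⋀ⁿ F' → ⋀ⁿ⁺¹ F`, `x ↦ x ∧ v`, for `v ∈ F''`, placed in degree `i + 1`. -/
def midWedge {i n n₁ j : ℤ} (hn : n₁ = n + 1) :
    F'' →ₗ[R] midPiece R F' i n j →ₗ[R] midPiece R (F' × F'') i n₁ j :=
  LinearMap.mk₂ R (fun v x => ⟨ExteriorAlgebra.map (LinearMap.inl R F' F'') x.1 *
        ExteriorAlgebra.ι R (LinearMap.inr R F' F'' v), by
      have hx := x.2
      rw [mem_midPiece] at hx ⊢
      split_ifs at hx ⊢ with h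
      · exact mul_mem_extPiece hn (map_mem_extPiece _ hx) (ι_mem_extPiece _)
      · rw [hx, map_zero, zero_mul]⟩)
    (fun _ _ _ => Subtype.ext (by simp only [map_add, mul_add, Submodule.coe_add]))
    (fun _ _ _ => Subtype.ext (by simp only [map_smul, mul_smul_comm, Submodule.coe_smul]))
    (fun _ _ _ => Subtype.ext (by simp only [map_add, add_mul, Submodule.coe_add]))
    (fun _ _ _ => Subtype.ext (by simp only [map_smul, smul_mul_assoc, Submodule.coe_smul]))

/-- The restriction of `incl‡` to `C^{i,a}_{Φ'}` in degree `j`: the inclusions on the pieces of `𝕂` and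
of `⋀ F'`, and `y ↦ (-1)^{𝔤-a+i-j} y ⊗ Kos_{Φ''}(1)` on the piece of `𝕃`. The sign is there because the
differential on the pieces of `𝕃` in `D` is `-Kos_{Φ'}`. -/
def inclDdagger₁ (Φ'' : Module.Dual R G'' →ₗ[R] F'') (hF : Module.finrank R F'' = 1)
    (hG : Module.finrank R G'' = 1) (i a j : ℤ) :
    CMod R G' F' i a j →ₗ[R] DMod R F' F'' G' G'' i a j :=
  LinearMap.prodMap
    (TensorProduct.map
      (extMap (LinearMap.inl R F' F'') (by
        have := finrank_prod_one (F' := F') hF; have := finrank_prod_one (F' := G') hG; omega))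
      (weylMap (LinearMap.fst R G' G'') rfl rfl))
    (LinearMap.prodMap
      (midIncl (by
        have := finrank_prod_one (F' := F') hF; have := finrank_prod_one (F' := G') hG; omega))
      (LinearMap.prod 0
        (((Module.finrank R (G' × G'') - a + i - j).negOnePow : ℤ) •
          ((TensorProduct.mk R _ _).flip (kosTwist Φ'' 1)))))

/-- The restriction of `incl‡` to `C^{i,a-1}_{Φ'} ⊗ G''*` in degree `j`: it is
`f ⊗ x ⊗ γ ↦ f ⊗ (x ∧ γ)` on the piece of `𝕂`, `y ⊗ γ ↦ y ∧ Φ''(γ)` on the piece of `⋀ F'`, and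
`y ⊗ γ ↦ (-1)^{𝔤-a+1+i-j} y ⊗ Φ''(γ)` on the piece of `𝕃`. -/
def inclDdagger₂ (Φ'' : Module.Dual R G'' →ₗ[R] F'') (hF : Module.finrank R F'' = 1)
    (hG : Module.finrank R G'' = 1) (i a j : ℤ) :
    CMod R G' F' i (a - 1) j ⊗[R] Module.Dual R G'' →ₗ[R] DMod R F' F'' G' G'' i a j :=
  LinearMap.prod
    (TensorProduct.map
        (extMap (LinearMap.inl R F' F'') (by
          have := finrank_prod_one (F' := F') hF; have := finrank_prod_one (F' := G') hG; omega))
        (TensorProduct.lift ((weylWedge (by omega) rfl ∘ₗ (LinearMap.snd R G' G'').dualMap).flip ∘ₗ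
          weylMap (LinearMap.fst R G' G'') rfl rfl)) ∘ₗ
      (TensorProduct.assoc R _ _ _).toLinearMap ∘ₗ
      LinearMap.rTensor _ (LinearMap.fst R _ _))
    (LinearMap.prod
      (TensorProduct.lift (midWedge (by
          have := finrank_prod_one (F' := F') hF; have := finrank_prod_one (F' := G') hG; omega) ∘ₗ
            Φ'').flip ∘ₗ
        LinearMap.rTensor _ (LinearMap.fst R _ _ ∘ₗ LinearMap.snd R _ _))
      (LinearMap.prod
        (((Module.finrank R (G' × G'') - a + 1 + i - j).negOnePow : ℤ) •
          (LinearMap.lTensor _ Φ'' ∘ₗ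
            LinearMap.rTensor _ (LinearMap.snd R _ _ ∘ₗ LinearMap.snd R _ _))) 0))

/-- The map `quot‡` in degree `j`. On the piece of `𝕂` it is `f ⊗ x ↦ ∑ π'(f) ⊗ e_ℓ x ⊗ e_ℓ*`, where
`∑ e_ℓ* ⊗ e_ℓ ∈ G''* ⊗ G''` is the canonical element, together with the projection
`⋀ʳ F ⊗ K^a_q (G*) → ⋀ʳ⁻¹ F' ⊗ K^a_q (G*) ⊗ F''`; it is zero on the other pieces. -/
def quotDdagger (i a j : ℤ) :
    DMod R F' F'' G' G'' i a j →ₗ[R]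
      (KMod R (G' × G'') F' (Module.finrank R (F' × F'') - Module.finrank R (G' × G'') - i - 2) a
          (-i - 2 + (j - 1)) ⊗[R] Module.Dual R G'') ×
      (KMod R (G' × G'') F' (Module.finrank R (F' × F'') - Module.finrank R (G' × G'') - i - 2) a
          (-i - 2 + j) ⊗[R] F'') :=
  LinearMap.prod
    ((TensorProduct.assoc R _ _ _).symm.toLinearMap ∘ₗ
      TensorProduct.map (extMap (LinearMap.fst R F' F'') (by omega)) (weylSplit (by omega)))
    ((TensorProduct.rightComm R _ F'' _).toLinearMap ∘ₗ
      TensorProduct.map (extProj (by omega)) LinearMap.id) ∘ₗ LinearMap.fst R _ _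

end Decomposition

end HookEN

end

/-!
The ranks of `F''` and `G''` are one, so `F = F' ⊕ R f` and `G = G' ⊕ R e` with `f = Φ''(e*)`, and
every module in sight decomposes along `e` and `f`.

* Exterior powers: `⋀ⁿ F = ⋀ⁿ F' ⊕ ⋀ⁿ⁻¹ F' ∧ f` (`LineSplit.extSplit_bijective`).
* Schur modules: for `1 ≤ p` and `1 ≤ q` the sequence
  `0 → L^p_{q-1} G → L^p_q G → L^p_q G' ⊕ L^{p-1}_q G' → 0` is exact, where the first map is the
  multiplication by `e` and `L^p_0 G` is replaced by zero (`LineSplit.schurAct_injective`,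
  `LineSplit.exists_schurAct`, `LineSplit.exists_schur_proj`).
* Weyl modules: for `1 ≤ p` the sequence
  `0 → K^p_q (G'*) ⊕ K^{p-1}_q (G'*) → K^p_q (G*) → K^p_{q-1} (G*) → 0` is exact, where the last map
  is the action of `e` (`LineSplit.weylSum_injective`, `LineSplit.exists_weylSum`,
  `LineSplit.weylAct_surjective`).

The surjectivity in the last two items and the freeness of the Schur and Weyl modules
(`schurLPos_free`, `weylK_free`) come from the exactness of the Koszul complexes `⋀ G ⊗ Sym G` and
`⋀ (G*) ⊗ D (G*)` in positive total degrees (`kappa_exact`, `eta_exact`), proved by induction on the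
rank with the homotopy "multiply by `e` in the exterior factor, divide by `e` in the symmetric one"
and its dual (`kappa_homotopy`, `eta_homotopy`).

Tensoring with the decomposition of the exterior powers of `F`, the sequence of Schur modules
becomes the first short exact sequence in the positions where `𝕃` lives, and the sequence of Weyl
modules becomes the second one in the positions where `𝕂` lives. In position `i + 1`
the map `incl‡` is the decomposition of the exterior power of `F`.

For the differentials one splits the canonical element of `G* ⊗ G` as the canonical element of
`G'* ⊗ G'` plus `e* ⊗ e`, and the one of `⋀ᵏ (G*) ⊗ ⋀ᵏ G` accordingly (`LineSplit.evMap_split`,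
`LineSplit.evExt_split`). The components of each differential of `C^{i,a}_Φ` with respect to the
decompositions can then be read off. The differential of `D` is the one induced by `quot†`; as
`quot†` is surjective, `d ∘ d = 0` is inherited from `C^{i,a}_Φ` (`quotDagger_cDiff`, `dDiff_dDiff`).
Interchanging an element of `⋀ F'` with `f` contributes the sign in `dDiff` and hence the alternating
signs in `incl‡`.

Both total complexes are mapping cones of maps that are bijective in each position, as
`1 ↦ f ⊗ e` and `Φ''` are isomorphisms, so they are acyclic (`Tot_acyclic`), and `quot†` and `incl‡`
are bijective on homology. The comparison of homology is the inverse of the former after the latter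
(`exists_homology_equiv`).
-/

noncomputable section

namespace HookEN.Internal

/-! ### Decompositions of a module with a line as a summand -/

section Line

/-- A decomposition `P = M ⊕ R e`: the maps `ic` and `π` are the inclusion of `M` and the projection
to `M`, and `ε` is the coefficient of `e`. -/
structure LineSplit {R : Type u} [CommRing R] {M : Type v} [AddCommGroup M] [Module R M]
    {P : Type w} [AddCommGroup P] [Module R P] (ic : M →ₗ[R] P) (π : P →ₗ[R] M)
    (e : P) (ε : Module.Dual R P) : Prop where
  proj_incl : ∀ m, π (ic m) = m
  proj_e : π e = 0
  coeff_incl : ∀ m, ε (ic m) = 0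
  coeff_e : ε e = 1
  decomp : ∀ p, ic (π p) + ε p • e = p

variable {R : Type u} [CommRing R] {M : Type v} [AddCommGroup M] [Module R M]
  {P : Type w} [AddCommGroup P] [Module R P] {Q : Type*} [AddCommGroup Q] [Module R Q]

lemma symAlgMap_ι (f : M →ₗ[R] P) (x : M) :
    symAlgMap f (SymmetricAlgebra.ι R M x) = SymmetricAlgebra.ι R P (f x) := by
  simp [symAlgMap]

lemma symAlgMap_symAlgMap (g : P →ₗ[R] Q) (f : M →ₗ[R] P) (x : SymmetricAlgebra R M) :
    symAlgMap g (symAlgMap f x) = symAlgMap (g ∘ₗ f) x := by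
  have : (symAlgMap g).comp (symAlgMap f) = symAlgMap (g ∘ₗ f) :=
    SymmetricAlgebra.algHom_ext (LinearMap.ext fun m => by simp [symAlgMap])
  exact DFunLike.congr_fun this x

lemma symAlgMap_id (x : SymmetricAlgebra R M) : symAlgMap LinearMap.id x = x := by
  have : symAlgMap (LinearMap.id : M →ₗ[R] M) = AlgHom.id R _ :=
    SymmetricAlgebra.algHom_ext (LinearMap.ext fun m => by simp [symAlgMap])
  exact DFunLike.congr_fun this x

lemma symMap_symMap (g : P →ₗ[R] Q) (f : M →ₗ[R] P) {n k l : ℤ} (h : k = n) (h' : l = k)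
    (x : SymPow R M n) : symMap g h' (symMap f h x) = symMap (g ∘ₗ f) (h'.trans h) x :=
  Subtype.ext (symAlgMap_symAlgMap _ _ _)

lemma symMap_id {n : ℤ} (h : n = n) (x : SymPow R M n) : symMap LinearMap.id h x = x :=
  Subtype.ext (symAlgMap_id _)

lemma extMap_extMap (g : P →ₗ[R] Q) (f : M →ₗ[R] P) {n k l : ℤ} (h : k = n) (h' : l = k)
    (x : ExtPow R M n) : extMap g h' (extMap f h x) = extMap (g ∘ₗ f) (h'.trans h) x :=
  Subtype.ext (by
    simp only [extMap_coe]
    rw [← AlgHom.comp_apply, ExteriorAlgebra.map_comp_map])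

lemma extMap_id {n : ℤ} (h : n = n) (x : ExtPow R M n) : extMap LinearMap.id h x = x :=
  Subtype.ext (by simp)

lemma symMap_symMul (f : M →ₗ[R] P) {n n' k k' : ℤ} (h : k = n + 1) (hk : k' = k) (hn : n' = n)
    (h' : k' = n' + 1) (v : M) (x : SymPow R M n) :
    symMap f hk (symMul h v x) = symMul h' (f v) (symMap f hn x) :=
  Subtype.ext (by simp [symAlgMap_ι])

lemma extMap_wedgeVec (f : M →ₗ[R] P) {n n' k k' : ℤ} (h : k = n + 1) (hk : k' = k) (hn : n' = n)
    (h' : k' = n' + 1) (v : M) (x : ExtPow R M n) :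
    extMap f hk (wedgeVec h v x) = wedgeVec h' (f v) (extMap f hn x) :=
  Subtype.ext (by simp)

lemma negOnePow_smul_self {A : Type*} [AddCommGroup A] (n : ℤ) (x : A) :
    (n.negOnePow : ℤ) • (n.negOnePow : ℤ) • x = x := by
  rw [smul_smul, ← Units.val_mul, Int.units_mul_self, Units.val_one, one_smul]

lemma coe_zsmul_submodule {A : Type*} [AddCommGroup A] [Module R A] (S : Submodule R A) (n : ℤ)
    (x : S) : ((n • x : S) : A) = n • (x : A) := map_zsmul S.subtype n x

/-- `contrR` is a right antiderivation. -/
lemma contrR_wedgeVec {n k k' k'' : ℤ} (h : k = n + 1) (h' : k'' = k - 1) (hk : k' = n - 1)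
    (hk' : k'' = k' + 1) (hn : k'' = n) (φ : Module.Dual R M) (v : M) (x : ExtPow R M n) :
    contrR h' φ (wedgeVec h v x) =
      φ v • extMap LinearMap.id hn x - wedgeVec hk' v (contrR hk φ x) := by
  subst hn
  have h1 : (x : ExteriorAlgebra R M) * ExteriorAlgebra.ι R v =
      (k''.negOnePow : ℤ) • (ExteriorAlgebra.ι R v * x.1) := by
    rw [ι_mul_extPiece v x.2, negOnePow_smul_self]
  have h2 : CliffordAlgebra.contractLeft φ (ExteriorAlgebra.ι R v * x.1) =
      φ v • x.1 - ExteriorAlgebra.ι R v * CliffordAlgebra.contractLeft φ x.1 :=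
    CliffordAlgebra.contractLeft_ι_mul _ _ _
  have h3 := ι_mul_extPiece v (contractLeft_mem_extPiece hk φ x.2)
  apply Subtype.ext
  simp only [contrR, LinearMap.smul_apply, coe_zsmul_submodule, contr_coe, wedgeVec_coe,
    Submodule.coe_sub, Submodule.coe_smul, map_zsmul, extMap_coe, ExteriorAlgebra.map_id,
    AlgHom.id_apply]
  rw [h1, map_zsmul, negOnePow_smul_self, h2, h3]

lemma contrR_extMap (f : M →ₗ[R] P) {n k n' k' : ℤ} (h : k = n - 1) (h' : k' = n' - 1)
    (hn : n' = n) (hk : k' = k) (φ : Module.Dual R P) (x : ExtPow R M n) :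
    contrR h' φ (extMap f hn x) = extMap f hk (contrR h (f.dualMap φ) x) := by
  subst hk
  apply Subtype.ext
  simp only [contrR, LinearMap.smul_apply, coe_zsmul_submodule, contr_coe, extMap_coe,
    map_zsmul]
  rw [contractLeft_extMap]
  rfl

variable {ic : M →ₗ[R] P} {π : P →ₗ[R] M} {e : P} {ε : Module.Dual R P}

lemma LineSplit.proj_comp_incl (hs : LineSplit ic π e ε) : π ∘ₗ ic = LinearMap.id :=
  LinearMap.ext hs.proj_incl

/-- The decomposition `P* = M* ⊕ R ε` dual to `P = M ⊕ R e`. -/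
lemma LineSplit.dual (hs : LineSplit ic π e ε) :
    LineSplit π.dualMap ic.dualMap ε (Module.Dual.eval R P e) where
  proj_incl φ := LinearMap.ext fun m => by simp [hs.proj_incl]
  proj_e := LinearMap.ext fun m => by simp [hs.coeff_incl]
  coeff_incl φ := by simp [hs.proj_e]
  coeff_e := by simp [hs.coeff_e]
  decomp φ := LinearMap.ext fun p => by
    conv_rhs => rw [← hs.decomp p]
    simp [mul_comm]

/-! ### Splitting the symmetric powers of a direct sum with a line -/

lemma symMap_symMul_eq_zero (f : M →ₗ[R] P) {q q₁ q' : ℤ} (h : q = q₁ + 1) (h' : q' = q) {v : M}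
    (hv : f v = 0) (x : SymPow R M q₁) : symMap f h' (symMul h v x) = 0 := by
  rw [symMap_symMul _ h h' rfl (by omega), hv]
  simp

lemma extMap_wedgeVec_eq_zero (f : M →ₗ[R] P) {n k k' : ℤ} (h : k = n + 1) (hk : k' = k) {v : M}
    (hv : f v = 0) (x : ExtPow R M n) : extMap f hk (wedgeVec h v x) = 0 := by
  rw [extMap_wedgeVec f h hk rfl (by omega), hv]
  simp

lemma LineSplit.symMap_proj_incl (hs : LineSplit ic π e ε) {q q' q'' : ℤ} (h : q' = q)
    (h' : q'' = q') (x : SymPow R M q) :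
    symMap π h' (symMap ic h x) = symMap LinearMap.id (h'.trans h) x := by
  rw [symMap_symMap, hs.proj_comp_incl]

lemma LineSplit.extMap_proj_incl (hs : LineSplit ic π e ε) {q q' q'' : ℤ} (h : q' = q)
    (h' : q'' = q') (x : ExtPow R M q) :
    extMap π h' (extMap ic h x) = extMap LinearMap.id (h'.trans h) x := by
  rw [extMap_extMap, hs.proj_comp_incl]

/-- The homomorphism `Sym P → (Sym M)[X]` which is `π` on the summand `M` and sends `e` to `X`. -/
def symToPoly (π : P →ₗ[R] M) (ε : Module.Dual R P) :
    SymmetricAlgebra R P →ₐ[R] Polynomial (SymmetricAlgebra R M) :=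
  SymmetricAlgebra.lift
    ((Polynomial.CAlgHom (R := R)).toLinearMap ∘ₗ SymmetricAlgebra.ι R M ∘ₗ π +
    LinearMap.toSpanSingleton R _ Polynomial.X ∘ₗ ε)

lemma symToPoly_ι (π : P →ₗ[R] M) (ε : Module.Dual R P) (p : P) :
    symToPoly π ε (SymmetricAlgebra.ι R P p) =
      Polynomial.C (SymmetricAlgebra.ι R M (π p)) + ε p • Polynomial.X := by
  simp [symToPoly]

/-- Multiplication by `e` is injective: it becomes the multiplication by `X` in `(Sym M)[X]`. -/
lemma LineSplit.symMul_injective (hs : LineSplit ic π e ε) {q q₁ : ℤ} (h : q = q₁ + 1) :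
    Function.Injective (symMul (R := R) h e) := by
  let back : Polynomial (SymmetricAlgebra R M) →+* SymmetricAlgebra R P :=
    Polynomial.eval₂RingHom (symAlgMap ic).toRingHom (SymmetricAlgebra.ι R _ e)
  have hback : ∀ x, back (symToPoly π ε x) = x := by
    intro x
    induction x using SymmetricAlgebra.induction with
    | algebraMap r =>
      rw [AlgHom.commutes]
      simp [back, Polynomial.algebraMap_apply]
    | ι x =>
      rw [symToPoly_ι]
      conv_rhs => rw [← hs.decomp x, map_add, map_smul]
      rw [map_add, Algebra.smul_def (A := Polynomial _), map_mul, Algebra.smul_def]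
      simp [back, symAlgMap_ι, Polynomial.algebraMap_apply]
    | mul a b ha hb => rw [map_mul, map_mul, ha, hb]
    | add a b ha hb => rw [map_add, map_add, ha, hb]
  intro x y hxy
  have h1 := congrArg (fun t => symToPoly π ε t.1) hxy
  simp only [symMul_coe, map_mul] at h1
  rw [symToPoly_ι, hs.proj_e, hs.coeff_e, map_zero, map_zero, zero_add, one_smul] at h1
  apply Subtype.ext
  rw [← hback x.1, ← hback y.1]
  congr 1
  exact Polynomial.isRegular_X.left h1

/-- Every element of `Sym_k P` is the sum of a multiple of `e` and of its part in `Sym_k M`. -/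
lemma LineSplit.exists_symMul (hs : LineSplit ic π e ε) (k : ℕ)
    (x : SymmetricAlgebra R P) (hx : x ∈ symPiece R P k) :
    ∃ y ∈ symPiece R P ((k : ℤ) - 1),
      x = SymmetricAlgebra.ι R _ e * y + symAlgMap ic (symAlgMap π x) := by
  rw [symPiece_coe] at hx
  induction hx using Submodule.pow_induction_on_left' with
  | algebraMap r => exact ⟨0, zero_mem _, by simp⟩
  | add x y i hx hy hx' hy' =>
    obtain ⟨a, ha, hxa⟩ := hx'
    obtain ⟨b, hb, hyb⟩ := hy'
    refine ⟨a + b, add_mem ha hb, ?_⟩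
    conv_lhs => rw [hxa, hyb]
    simp only [map_add]
    ring
  | mem_mul v hv i x hx ih =>
    obtain ⟨p, rfl⟩ := hv
    obtain ⟨y, hy, hxy⟩ := ih
    refine ⟨ε p • x + SymmetricAlgebra.ι R _ (ic (π p)) * y, ?_, ?_⟩
    · refine add_mem (Submodule.smul_mem _ _ ?_) ?_
      · rw [Nat.cast_succ, add_sub_cancel_right, symPiece_coe]; exact hx
      · exact mul_mem_symPiece (n := 1) (m := (i : ℤ) - 1) (by push_cast; ring)
          (ι_mem_symPiece _) hy
    · rw [map_mul, map_mul, symAlgMap_ι, symAlgMap_ι]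
      conv_lhs => rw [← hs.decomp p, map_add, map_smul]
      generalize symAlgMap ic (symAlgMap π x) = z at *
      subst hxy
      simp only [Algebra.smul_def]
      ring

/-- The map `Sym_{q-1} P ⊕ Sym_q M → Sym_q P`, `(x, y) ↦ e x + y`. -/
def symSplit (ic : M →ₗ[R] P) (e : P) {q q₁ q₂ : ℤ} (h : q = q₁ + 1) (h₂ : q = q₂) :
    SymPow R P q₁ × SymPow R M q₂ →ₗ[R] SymPow R P q :=
  LinearMap.coprod (symMul h e) (symMap ic h₂)

/-- Every element of `Sym_q P` is `e x + y` for unique `x ∈ Sym_{q-1} P` and `y ∈ Sym_q M`. -/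
lemma LineSplit.symSplit_bijective (hs : LineSplit ic π e ε) {q q₁ q₂ : ℤ}
    (h : q = q₁ + 1) (h₂ : q = q₂) : Function.Bijective (symSplit ic e h h₂) := by
  constructor
  · rw [← LinearMap.ker_eq_bot, LinearMap.ker_eq_bot']
    rintro ⟨x, y⟩ hxy
    have hy := congrArg (symMap π h₂.symm) hxy
    simp only [symSplit, LinearMap.coprod_apply, map_add, zero_add, map_zero,
      symMap_symMul_eq_zero π h h₂.symm hs.proj_e] at hy
    rw [hs.symMap_proj_incl, symMap_id] at hy
    subst hy
    have hx : symMul h e x = symMul h e 0 := by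
      simpa [symSplit] using hxy
    rw [hs.symMul_injective h hx]
    rfl
  · intro x
    subst h₂
    rcases lt_or_ge q 0 with hq | hq
    · refine ⟨0, ?_⟩
      rw [map_zero]
      have h0 : (x : SymmetricAlgebra R P) ∈ symPiece R P q := x.2
      refine Subtype.ext (Eq.symm ?_)
      generalize (x : SymmetricAlgebra R P) = y at h0
      rwa [symPiece_neg hq, Submodule.mem_bot] at h0
    lift q to ℕ using hq
    obtain ⟨y, hy, hxy⟩ := hs.exists_symMul q x.1 x.2
    obtain rfl : q₁ = (q : ℤ) - 1 := by omega
    exact ⟨(⟨y, hy⟩, symMap π rfl x), Subtype.ext hxy.symm⟩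

/-- The division by `e` on `Sym P`, which discards the part in `Sym M`. -/
def symDiv (hs : LineSplit ic π e ε) {q q₁ : ℤ} (h : q = q₁ + 1) :
    SymPow R P q →ₗ[R] SymPow R P q₁ :=
  LinearMap.fst R _ _ ∘ₗ (LinearEquiv.ofBijective _ (hs.symSplit_bijective h rfl)).symm.toLinearMap

lemma symMul_symDiv (hs : LineSplit ic π e ε) {q q₁ q₂ : ℤ}
    (h : q = q₁ + 1) (h₂ : q₂ = q) (x : SymPow R P q) :
    symMul h e (symDiv hs h x) = x - symMap ic h₂.symm (symMap π h₂ x) := by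
  subst h₂
  obtain ⟨⟨a, b⟩, rfl⟩ := (hs.symSplit_bijective h rfl).2 x
  have h1 : symDiv hs h (symSplit ic e h rfl (a, b)) = a := by
    have := (LinearEquiv.ofBijective _ (hs.symSplit_bijective h rfl)).symm_apply_apply (a, b)
    exact congrArg Prod.fst this
  rw [h1]
  simp only [symSplit, LinearMap.coprod_apply, map_add]
  rw [symMap_symMul_eq_zero π h rfl hs.proj_e, map_zero, hs.symMap_proj_incl, symMap_id, zero_add,
    add_sub_cancel_right]

lemma symDiv_symMul_self (hs : LineSplit ic π e ε) {q q₁ q₂ : ℤ}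
    (h : q = q₁ + 1) (h₂ : q = q₂ + 1) (x : SymPow R P q₂) :
    symDiv hs h (symMul h₂ e x) = symMap LinearMap.id (by omega) x := by
  obtain rfl : q₁ = q₂ := by omega
  apply hs.symMul_injective h
  rw [symMul_symDiv hs h rfl, symMap_symMul_eq_zero π h₂ rfl hs.proj_e, map_zero, sub_zero,
    symMap_id]

lemma symDiv_symMul_incl (hs : LineSplit ic π e ε) {q q₁ q' q₁' : ℤ}
    (h : q = q₁ + 1) (h' : q' = q₁' + 1) (hq : q' = q + 1) (hq₁ : q₁' = q₁ + 1) (m : M)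
    (x : SymPow R P q) :
    symDiv hs h' (symMul hq (ic m) x) = symMul hq₁ (ic m) (symDiv hs h x) := by
  obtain rfl : q₁' = q := by omega
  apply hs.symMul_injective h'
  rw [symMul_symDiv hs h' rfl, symMul_comm hq₁ h', symMul_symDiv hs hq₁ rfl, map_sub,
    symMap_symMul _ hq rfl rfl hq, symMap_symMul _ hq rfl rfl hq, hs.proj_incl]

/-! ### Splitting the exterior powers of a direct sum with a line -/

/-- The projection `⋀ⁿ P → ⋀ⁿ⁻¹ M`, `x + y ∧ e ↦ y` for `x ∈ ⋀ⁿ M` and `y ∈ ⋀ⁿ⁻¹ M`. -/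
def extCo (π : P →ₗ[R] M) (ε : Module.Dual R P) {n k : ℤ} (h : k = n - 1) :
    ExtPow R P n →ₗ[R] ExtPow R M k :=
  extMap π rfl ∘ₗ contrR h ε

lemma extCo_wedgeVec (π : P →ₗ[R] M) (ε : Module.Dual R P) {n k n₁ k' : ℤ} (h : k = n + 1)
    (h' : k' = k - 1) (hn : n₁ = n - 1) (hk' : k' = n₁ + 1) (hk : k' = n) (v : P)
    (x : ExtPow R P n) :
    extCo π ε h' (wedgeVec h v x) =
      ε v • extMap π hk x - wedgeVec hk' (π v) (extCo π ε hn x) := by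
  simp only [extCo, LinearMap.comp_apply]
  rw [contrR_wedgeVec h h' hn hk' hk, map_sub, map_smul, extMap_extMap,
    extMap_wedgeVec _ hk' rfl rfl hk']
  rfl

lemma LineSplit.extCo_extMap_incl (hs : LineSplit ic π e ε) {n k n' : ℤ} (h : n' = n)
    (h' : k = n' - 1) (x : ExtPow R M n) : extCo π ε h' (extMap ic h x) = 0 := by
  simp only [extCo, LinearMap.comp_apply]
  rw [contrR_extMap _ (k := k) (by omega) h' h rfl]
  have : ic.dualMap ε = 0 := LinearMap.ext hs.coeff_incl
  rw [this]
  simp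

/-- The map `⋀ⁿ M ⊕ ⋀ⁿ⁻¹ M → ⋀ⁿ P`, `(x, y) ↦ x + y ∧ e`. -/
def extSplit (ic : M →ₗ[R] P) (e : P) {n n₁ n₂ : ℤ} (h : n = n₁) (h₂ : n = n₂ + 1) :
    ExtPow R M n₁ × ExtPow R M n₂ →ₗ[R] ExtPow R P n :=
  LinearMap.coprod (extMap ic h) (wedgeVec h₂ e ∘ₗ extMap ic rfl)

lemma LineSplit.exists_extSplit (hs : LineSplit ic π e ε) (k : ℕ)
    (x : ExteriorAlgebra R P) (hx : x ∈ extPiece R P k) :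
    ∃ y ∈ extPiece R M k, ∃ z ∈ extPiece R M ((k : ℤ) - 1),
      x = ExteriorAlgebra.map ic y + ExteriorAlgebra.map ic z * ExteriorAlgebra.ι R e := by
  rw [extPiece_coe] at hx
  induction hx using Submodule.pow_induction_on_left' with
  | algebraMap r =>
    refine ⟨algebraMap R _ r, ?_, 0, zero_mem _, by simp⟩
    rw [extPiece_coe]
    exact Submodule.algebraMap_mem r
  | add x y i hx hy hx' hy' =>
    obtain ⟨a, ha, b, hb, rfl⟩ := hx'
    obtain ⟨c, hc, d, hd, rfl⟩ := hy'
    refine ⟨a + c, add_mem ha hc, b + d, add_mem hb hd, ?_⟩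
    simp only [map_add, add_mul]
    abel
  | mem_mul v hv i x hx ih =>
    obtain ⟨p, rfl⟩ := hv
    obtain ⟨y, hy, z, hz, rfl⟩ := ih
    refine ⟨ExteriorAlgebra.ι R (π p) * y, ?_,
      ExteriorAlgebra.ι R (π p) * z + ε p • ((i : ℤ).negOnePow : ℤ) • y, ?_, ?_⟩
    · exact mul_mem_extPiece (n := 1) (m := i) (by push_cast; ring) (ι_mem_extPiece _) hy
    · refine add_mem (mul_mem_extPiece (n := 1) (m := (i : ℤ) - 1) (by push_cast; ring)
        (ι_mem_extPiece _) hz) (Submodule.smul_mem _ _ (zsmul_mem ?_ _))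
      rwa [Nat.cast_succ, add_sub_cancel_right]
    · have h3 := ι_mul_extPiece e (map_mem_extPiece ic hy)
      have h4 := ι_mul_extPiece e (map_mem_extPiece ic hz)
      conv_lhs => rw [← hs.decomp p]
      rw [map_add, map_smul, add_mul, smul_mul_assoc, mul_add, mul_add, h3, ← mul_assoc,
        ← mul_assoc, h4, smul_mul_assoc, mul_assoc _ (ExteriorAlgebra.ι R _),
        ExteriorAlgebra.ι_sq_zero]
      simp only [map_mul, map_add, map_smul, ExteriorAlgebra.map_apply_ι, add_mul,
        smul_mul_assoc, mul_zero, smul_zero, add_zero, map_zsmul]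
      abel

lemma LineSplit.extSplit_surjective (hs : LineSplit ic π e ε) {n n₁ n₂ : ℤ}
    (h : n = n₁) (h₂ : n = n₂ + 1) : Function.Surjective (extSplit ic e h h₂) := by
  intro x
  subst h
  rcases lt_or_ge n 0 with hq | hq
  · refine ⟨0, ?_⟩
    rw [map_zero]
    have h0 : (x : ExteriorAlgebra R P) ∈ extPiece R P n := x.2
    refine Subtype.ext (Eq.symm ?_)
    generalize (x : ExteriorAlgebra R P) = y at h0
    rwa [extPiece_neg hq, Submodule.mem_bot] at h0
  lift n to ℕ using hq
  obtain ⟨y, hy, z, hz, hxy⟩ := hs.exists_extSplit n x.1 x.2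
  obtain rfl : n₂ = (n : ℤ) - 1 := by omega
  exact ⟨(⟨y, hy⟩, ⟨z, hz⟩), Subtype.ext hxy.symm⟩

lemma LineSplit.extMap_proj_extSplit (hs : LineSplit ic π e ε) {n n₁ n₂ k : ℤ} (h : n = n₁)
    (h₂ : n = n₂ + 1) (hk : k = n) (x : ExtPow R M n₁ × ExtPow R M n₂) :
    extMap π hk (extSplit ic e h h₂ x) = extMap LinearMap.id (hk.trans h) x.1 := by
  simp only [extSplit, LinearMap.coprod_apply, map_add, LinearMap.comp_apply]
  rw [extMap_wedgeVec_eq_zero _ h₂ hk hs.proj_e, hs.extMap_proj_incl, add_zero]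

lemma LineSplit.extCo_extSplit (hs : LineSplit ic π e ε) {n n₁ n₂ k : ℤ}
    (h : n = n₁) (h₂ : n = n₂ + 1) (hk : k = n - 1) (x : ExtPow R M n₁ × ExtPow R M n₂) :
    extCo π ε hk (extSplit ic e h h₂ x) = extMap LinearMap.id (by omega) x.2 := by
  simp only [extSplit, LinearMap.coprod_apply, map_add, LinearMap.comp_apply]
  rw [hs.extCo_extMap_incl, extCo_wedgeVec π ε h₂ hk (n₁ := n₂ - 1) rfl (by omega) (by omega),
    hs.extMap_proj_incl, hs.coeff_e, hs.proj_e]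
  simp

/-- Every element of `⋀ⁿ P` is the sum of its components in `⋀ⁿ M` and in `⋀ⁿ⁻¹ M ∧ e`. -/
lemma LineSplit.ext_decomp (hs : LineSplit ic π e ε) {n n₁ n₂ : ℤ}
    (h : n = n₁) (h₂ : n = n₂ + 1) (x : ExtPow R P n) :
    extMap ic h (extMap π h.symm x) +
      wedgeVec h₂ e (extMap ic rfl (extCo π ε (show n₂ = n - 1 by omega) x)) = x := by
  obtain ⟨y, rfl⟩ := hs.extSplit_surjective h h₂ x
  rw [hs.extMap_proj_extSplit, hs.extCo_extSplit, extMap_id, extMap_id]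
  rfl

/-- The decomposition `⋀ⁿ P = ⋀ⁿ M ⊕ ⋀ⁿ⁻¹ M ∧ e`. -/
lemma LineSplit.extSplit_bijective (hs : LineSplit ic π e ε) {n n₁ n₂ : ℤ}
    (h : n = n₁) (h₂ : n = n₂ + 1) : Function.Bijective (extSplit ic e h h₂) := by
  refine ⟨?_, hs.extSplit_surjective h h₂⟩
  intro x y hxy
  have h1 := congrArg (extMap π h.symm) hxy
  have h3 := congrArg (extCo π ε (show n₂ = n - 1 by omega)) hxy
  rw [hs.extMap_proj_extSplit, hs.extMap_proj_extSplit, extMap_id, extMap_id] at h1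
  rw [hs.extCo_extSplit, hs.extCo_extSplit, extMap_id, extMap_id] at h3
  exact Prod.ext h1 h3

/-- The part of `x` in `⋀ⁿ M` is `x - c(x) ∧ e`, where `c` is the contraction by the coefficient
of `e`. -/
lemma LineSplit.extMap_incl_proj (hs : LineSplit ic π e ε) {n n₁ n₂ : ℤ}
    (h : n = n₁) (h₂ : n = n₂ + 1) (h₂' : n₂ = n - 1) (x : ExtPow R P n) :
    extMap ic h (extMap π h.symm x) = x - wedgeVec h₂ e (contrR h₂' ε x) := by
  have h1 := hs.ext_decomp (n₂ := n₂ - 1) (show n₂ = n₂ from rfl) (by omega) (contrR h₂' ε x)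
  have h3 := congrArg (wedgeVec h₂ e) h1
  rw [map_add, wedgeVec_wedgeVec_self, add_zero] at h3
  rw [← h3, eq_sub_iff_add_eq]
  exact hs.ext_decomp h h₂ x

end Line

/-! ### The canonical element of a direct sum with a line -/

section Canonical
variable {R : Type u} [CommRing R] {M : Type v} [AddCommGroup M] [Module R M]
  {P : Type w} [AddCommGroup P] [Module R P]
  [Module.Free R M] [Module.Finite R M] [Module.Free R P] [Module.Finite R P]
  {ic : M →ₗ[R] P} {π : P →ₗ[R] M} {e : P} {ε : Module.Dual R P}

/-- The canonical element of `P* ⊗ P` is the sum of the canonical element of `M* ⊗ M` and `ε ⊗ e`,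
in terms of the value `evSum T` at it of a bilinear map `T`. -/
lemma LineSplit.evSum_split (hs : LineSplit ic π e ε) {X : Type*} [AddCommMonoid X] [Module R X]
    (T : Module.Dual R P →ₗ[R] P →ₗ[R] X) :
    evSum T = evSum ((T ∘ₗ π.dualMap).compl₂ ic) + T ε e := by
  classical
  rw [← evSum_natural ic (T ∘ₗ π.dualMap)]
  set b := Module.Free.chooseBasis R P
  rw [evSum_eq_sum _ b, evSum_eq_sum _ b]
  have h1 : ∀ i, T (b.coord i) (b i) = T (π.dualMap (ic.dualMap (b.coord i))) (b i) +
      T ε (b.coord i e • b i) := by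
    intro i
    conv_lhs => rw [← hs.dual.decomp (b.coord i)]
    simp [map_add]
  simp_rw [h1]
  rw [Finset.sum_add_distrib, ← map_sum]
  congr 2
  exact b.sum_repr e

/-- The canonical element of `P* ⊗ P` is the sum of the canonical element of `M* ⊗ M` and
`ε ⊗ e`. -/
lemma LineSplit.evMap_split (hs : LineSplit ic π e ε) {X X' Y Y' : Type*} [AddCommMonoid X]
    [Module R X] [AddCommMonoid X'] [Module R X'] [AddCommMonoid Y] [Module R Y]
    [AddCommMonoid Y'] [Module R Y'] (A : Module.Dual R P →ₗ[R] X →ₗ[R] X')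
    (B : P →ₗ[R] Y →ₗ[R] Y') (z : X ⊗[R] Y) :
    evMap A B z = evMap (A ∘ₗ π.dualMap) (B ∘ₗ ic) z + TensorProduct.map (A ε) (B e) z := by
  rw [evMap, hs.evSum_split]
  rfl

/-- The case of a line, with dual bases `e` and `ε`. -/
lemma evSum_line {N : Type*} [AddCommGroup N] [Module R N] [Module.Free R N] [Module.Finite R N]
    {e : N} {ε : Module.Dual R N} (h : ε e = 1) (h' : ∀ n, ε n • e = n)
    {X : Type*} [AddCommMonoid X] [Module R X] (T : Module.Dual R N →ₗ[R] N →ₗ[R] X) :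
    evSum T = T ε e := by
  have hs : LineSplit (0 : PUnit.{1} →ₗ[R] N) 0 e ε :=
    ⟨fun _ => rfl, rfl, fun _ => by simp, h, fun n => by simp [h']⟩
  rw [hs.evSum_split]
  classical
  rw [evSum_eq_sum _ (Module.Free.chooseBasis R PUnit.{1})]
  simp

end Canonical

/-! ### Exactness of the Koszul complexes -/

section Koszul
variable {R : Type u} [CommRing R] {M : Type v} [AddCommGroup M] [Module R M]
  {P : Type w} [AddCommGroup P] [Module R P]
  [Module.Free R M] [Module.Finite R M] [Module.Free R P] [Module.Finite R P]

lemma kappa_map (f : M →ₗ[R] P) {p p' q q' p₁ p₁' q₁ q₁' : ℤ} (hp : p' = p - 1) (hq : q' = q + 1)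
    (hp₁ : p₁' = p₁ - 1) (hq₁ : q₁' = q₁ + 1) (h : p₁ = p) (h' : q₁ = q)
    (x : ExtPow R M p ⊗[R] SymPow R M q) :
    kappa hp₁ hq₁ (TensorProduct.map (extMap f h) (symMap f h') x) =
      TensorProduct.map (extMap f (by omega)) (symMap f (by omega)) (kappa hp hq x) := by
  refine evMap_push f _ _ _ _ _ _ _ _ ?_ ?_ x
  · intro φ x
    exact Subtype.ext (contractLeft_extMap _ _ _)
  · intro v y
    exact Subtype.ext (by simp [symAlgMap_ι])

lemma divAct_divMap (f : M →ₗ[R] P) {q q' q₁ q₁' : ℤ} (hq : q' = q - 1)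
    (hq₁ : q₁' = q₁ - 1) (h : q₁ = q) (h' : q₁' = q') (v : M) (x : DivPow R P q) :
    divAct hq₁ v (divMap f h x) = divMap f h' (divAct hq (f v) x) := by
  ext z
  simp only [divAct_apply, divMap, LinearMap.dualMap_apply]
  congr 1
  exact Subtype.ext (by simp [symAlgMap_ι])

lemma eta_map (f : M →ₗ[R] P) {p p' q q' p₁ p₁' q₁ q₁' : ℤ} (hp : p' = p + 1) (hq : q' = q - 1)
    (hp₁ : p₁' = p₁ + 1) (hq₁ : q₁' = q₁ - 1) (h : p₁ = p) (h' : q₁ = q)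
    (x : ExtPow R (Module.Dual R P) p ⊗[R] DivPow R P q) :
    eta hp₁ hq₁ (TensorProduct.map (extMap f.dualMap h) (divMap f h') x) =
      TensorProduct.map (extMap f.dualMap (by omega)) (divMap f (by omega)) (eta hp hq x) := by
  refine evMap_pull f _ _ _ _ _ _ _ _ ?_ ?_ x
  · intro φ x
    exact Subtype.ext (by simp)
  · intro v y
    exact divAct_divMap f hq hq₁ h' _ v y

variable {ic : M →ₗ[R] P} {π : P →ₗ[R] M} {e : P} {ε : Module.Dual R P}

/-- The map `φ ↦ φ ∘ (division by e)`, a right inverse of the action of `e` on the divided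
powers. -/
def divMul (hs : LineSplit ic π e ε) {q q₁ : ℤ} (h : q₁ = q + 1) :
    DivPow R P q →ₗ[R] DivPow R P q₁ :=
  (symDiv hs h).dualMap

lemma divAct_divMul_self (hs : LineSplit ic π e ε) {q q₁ q₂ : ℤ} (h : q₁ = q + 1)
    (h₂ : q₂ = q₁ - 1) (φ : DivPow R P q) :
    divAct h₂ e (divMul hs h φ) = divMap LinearMap.id (by omega) φ := by
  ext x
  simp only [divAct_apply, divMul, divMap, LinearMap.dualMap_apply]
  rw [symDiv_symMul_self]

lemma divMul_divAct_self (hs : LineSplit ic π e ε) {q q₁ : ℤ} (h : q = q₁ + 1)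
    (h₂ : q₁ = q - 1) (φ : DivPow R P q) :
    divMul hs h (divAct h₂ e φ) = φ - divMap π rfl (divMap ic rfl φ) := by
  ext x
  simp only [divAct_apply, divMul, divMap, LinearMap.dualMap_apply, LinearMap.sub_apply]
  rw [symMul_symDiv hs h rfl, map_sub]

lemma divMul_divAct_incl (hs : LineSplit ic π e ε) {q q₁ q' q₁' : ℤ} (h : q₁ = q + 1)
    (h₂ : q' = q - 1) (h' : q₁' = q' + 1) (h₂' : q₁' = q₁ - 1) (m : M) (φ : DivPow R P q) :
    divMul hs h' (divAct h₂ (ic m) φ) = divAct h₂' (ic m) (divMul hs h φ) := by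
  ext x
  simp only [divAct_apply, divMul, LinearMap.dualMap_apply]
  rw [symDiv_symMul_incl]

lemma wedgeLeft_contr {n n₁ : ℤ} (h : n₁ = n - 1) (h' : n = n₁ + 1) (v : P) (φ : Module.Dual R P)
    (x : ExtPow R P n) :
    wedgeLeft h' v (contr h φ x) = wedgeVec h' v (contrR h φ x) := by
  apply Subtype.ext
  have h1 : (wedgeLeft h' v (contr h φ x) : ExteriorAlgebra R P) =
      ExteriorAlgebra.ι R v * (contr h φ x).1 := rfl
  rw [h1, ι_mul_extPiece v (contr h φ x).2, contrR, LinearMap.smul_apply, LinearMap.smul_apply,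
    map_zsmul, coe_zsmul_submodule, wedgeVec_coe]

lemma sum_neg_add_cancel {A I : Type*} [AddCommGroup A] [Fintype I] (f : I → A) (a b : A) :
    (∑ i, -f i + a) + (∑ i, f i + b) = a + b := by
  rw [Finset.sum_neg_distrib]
  abel

lemma sum_add_neg_cancel {A I : Type*} [AddCommGroup A] [Fintype I] (f : I → A) (a b : A) :
    (∑ i, f i + a) + (∑ i, -f i + b) = a + b := by
  rw [Finset.sum_neg_distrib]
  abel

/-- `H = (e ∧ -) ⊗ (division by e)` is a homotopy from the identity of the Koszul complex of `P` to
the projection to the Koszul complex of `M`. -/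
lemma kappa_homotopy (hs : LineSplit ic π e ε) {p p' p₁ q q' q₁ : ℤ} (hp : p' = p - 1)
    (hp' : p = p' + 1) (hq : q' = q + 1) (hp₁ : p₁ = p + 1) (hq₁ : q = q₁ + 1) (hp₁' : p = p₁ - 1)
    (x : ExtPow R P p ⊗[R] SymPow R P q) :
    kappa hp₁' hq₁ (TensorProduct.map (wedgeLeft hp₁ e) (symDiv hs hq₁) x) +
      TensorProduct.map (wedgeLeft hp' e) (symDiv hs hq) (kappa hp hq x) =
    x - TensorProduct.map (extMap ic rfl) (symMap ic rfl)
      (TensorProduct.map (extMap π rfl) (symMap π rfl) x) := by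
  classical
  induction x using TensorProduct.induction_on with
  | zero => simp
  | add x y hx hy =>
    simp only [map_add]
    rw [add_add_add_comm, hx, hy]
    abel
  | tmul x y =>
    simp only [kappa, TensorProduct.map_tmul]
    rw [hs.evMap_split, hs.evMap_split, evMap_tmul _ _ (Module.Free.chooseBasis R M),
      evMap_tmul _ _ (Module.Free.chooseBasis R M), map_add, map_sum]
    simp only [TensorProduct.map_tmul, LinearMap.comp_apply]
    simp_rw [symDiv_symMul_incl hs hq₁ hq hq hq₁, contr_wedgeLeft hp₁ hp₁' hp hp']
    have h0 : ∀ i, π.dualMap ((Module.Free.chooseBasis R M).coord i) e = 0 := fun i => by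
      simp [hs.proj_e]
    simp only [h0, zero_smul, zero_sub, hs.coeff_e, one_smul, neg_tmul]
    refine (sum_neg_add_cancel (A := ExtPow R P p ⊗[R] SymPow R P q)
      (I := Module.Free.ChooseBasisIndex R M) _ _ _).trans ?_
    rw [symMul_symDiv hs hq₁ rfl, symDiv_symMul_self hs hq hq, symMap_id, wedgeLeft_contr,
      hs.extMap_incl_proj rfl hp' hp]
    simp only [sub_tmul, tmul_sub]
    abel

/-- The contraction by `e` and the multiplication dual to the division by `e` form a homotopy from
the identity of the complex `⋀ (P*) ⊗ D (P*)` to the projection to `⋀ (M*) ⊗ D (M*)`. -/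
lemma eta_homotopy (hs : LineSplit ic π e ε) {p p' p₁ q q' q₁ : ℤ} (hp : p' = p + 1)
    (hp' : p = p' - 1) (hq : q' = q - 1) (hq' : q = q' + 1) (hp₁ : p₁ = p - 1) (hq₁ : q₁ = q + 1)
    (hp₁' : p = p₁ + 1) (hq₁' : q = q₁ - 1)
    (x : ExtPow R (Module.Dual R P) p ⊗[R] DivPow R P q) :
    eta hp₁' hq₁' (TensorProduct.map (contrR hp₁ (Module.Dual.eval R P e)) (divMul hs hq₁) x) +
      TensorProduct.map (contrR hp' (Module.Dual.eval R P e)) (divMul hs hq') (eta hp hq x) =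
    x - TensorProduct.map (extMap π.dualMap rfl) (divMap π rfl)
      (TensorProduct.map (extMap ic.dualMap rfl) (divMap ic rfl) x) := by
  classical
  induction x using TensorProduct.induction_on with
  | zero => simp
  | add x y hx hy =>
    simp only [map_add]
    rw [add_add_add_comm, hx, hy]
    abel
  | tmul x y =>
    simp only [eta, TensorProduct.map_tmul]
    rw [hs.evMap_split, hs.evMap_split, evMap_tmul _ _ (Module.Free.chooseBasis R M),
      evMap_tmul _ _ (Module.Free.chooseBasis R M), map_add, map_sum]
    simp only [TensorProduct.map_tmul, LinearMap.comp_apply]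
    simp_rw [divMul_divAct_incl hs hq₁ hq hq' hq₁', contrR_wedgeVec hp hp' hp₁ hp₁' rfl, extMap_id]
    have h0 : ∀ i, Module.Dual.eval R P e (π.dualMap ((Module.Free.chooseBasis R M).coord i)) = 0 :=
      fun i => by simp [hs.proj_e]
    have h1 : Module.Dual.eval R P e ε = 1 := hs.coeff_e
    simp only [h0, h1, zero_smul, zero_sub, one_smul, neg_tmul]
    refine (sum_add_neg_cancel (A := ExtPow R (Module.Dual R P) p ⊗[R] DivPow R P q)
      (I := Module.Free.ChooseBasisIndex R M) _ _ _).trans ?_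
    rw [divAct_divMul_self hs, divMul_divAct_self hs, hs.dual.extMap_incl_proj rfl hp₁' hp₁]
    have h2 : divMap LinearMap.id (show q = q from rfl) y = y := by
      ext z
      simp only [divMap, LinearMap.dualMap_apply]
      rw [symMap_id]
    rw [h2]
    simp only [sub_tmul, tmul_sub]
    abel

end Koszul

section Exactness
variable {R : Type u} [CommRing R] [Nontrivial R]

/-- A basis vector splits off. -/
lemma exists_lineSplit {P : Type v} [AddCommGroup P] [Module R P] {n : ℕ}
    (b : Module.Basis (Fin (n + 1)) R P) :
    ∃ (ic : (Fin n → R) →ₗ[R] P) (π : P →ₗ[R] (Fin n → R)) (e : P) (ε : Module.Dual R P),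
      LineSplit ic π e ε := by
  refine ⟨Fintype.linearCombination R (fun i => b i.succ), LinearMap.pi fun i => b.coord i.succ,
    b 0, b.coord 0, ?_, ?_, ?_, ?_, ?_⟩
  · intro m
    ext i
    simp [Fintype.linearCombination_apply, Finsupp.single_apply]
  · ext i
    simp [Fin.succ_ne_zero]
  · intro m
    simp [Fintype.linearCombination_apply, Fin.succ_ne_zero]
  · simp
  · intro p
    conv_rhs => rw [← b.sum_repr p, Fin.sum_univ_succ]
    simp [Fintype.linearCombination_apply, add_comm]

lemma subsingleton_tensor_left {A B : Type*} [AddCommGroup A] [Module R A] [AddCommGroup B]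
    [Module R B] [Subsingleton A] : Subsingleton (A ⊗[R] B) :=
  ⟨fun x y => by
    have hx : ∀ z : A ⊗[R] B, z = 0 := fun z => by
      induction z using TensorProduct.induction_on with
      | zero => rfl
      | add x y hx hy => rw [hx, hy, add_zero]
      | tmul x y => rw [Subsingleton.elim x 0, zero_tmul]
    rw [hx x, hx y]⟩

lemma subsingleton_tensor_right {A B : Type*} [AddCommGroup A] [Module R A] [AddCommGroup B]
    [Module R B] [Subsingleton B] : Subsingleton (A ⊗[R] B) :=
  ⟨fun x y => by
    have hx : ∀ z : A ⊗[R] B, z = 0 := fun z => by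
      induction z using TensorProduct.induction_on with
      | zero => rfl
      | add x y hx hy => rw [hx, hy, add_zero]
      | tmul x y => rw [Subsingleton.elim y 0, tmul_zero]
    rw [hx x, hx y]⟩

lemma extPow_subsingleton_of_subsingleton {P : Type v} [AddCommGroup P] [Module R P]
    [Subsingleton P] {n : ℤ} (h : n ≠ 0) : Subsingleton (ExtPow R P n) := by
  refine extPow_subsingleton ?_
  rw [Module.finrank_zero_of_subsingleton]
  push_cast
  omega

lemma symPow_subsingleton_neg {P : Type v} [AddCommGroup P] [Module R P]
    {n : ℤ} (h : n < 0) : Subsingleton (SymPow R P n) := by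
  change Subsingleton (symPiece R P n)
  rw [symPiece_neg h]; infer_instance

lemma symPow_subsingleton_of_subsingleton {P : Type v} [AddCommGroup P] [Module R P]
    [Subsingleton P] {n : ℤ} (h : n ≠ 0) : Subsingleton (SymPow R P n) := by
  rcases lt_or_ge n 0 with hn | hn
  · exact symPow_subsingleton_neg hn
  · lift n to ℕ using hn
    change Subsingleton (symPiece R P n)
    have h0 : LinearMap.range (SymmetricAlgebra.ι R P) = ⊥ := by
      rw [LinearMap.range_eq_bot]
      exact LinearMap.ext fun x => by rw [Subsingleton.elim x 0]; simp
    rw [symPiece_coe, h0, ← Submodule.zero_eq_bot, zero_pow (by exact_mod_cast h),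
      Submodule.zero_eq_bot]
    infer_instance

/-- The Koszul complex `⋀ P ⊗ Sym P` is exact in positive total degrees. -/
theorem kappa_exact {P : Type u} [AddCommGroup P] [Module R P] [Module.Free R P]
    [Module.Finite R P] {p p' p₁ q q' q₁ : ℤ} (hp : p' = p - 1) (hq : q' = q + 1) (hp₁ : p = p₁ - 1)
    (hq₁ : q = q₁ + 1) (hpq : 1 ≤ p + q) (x : ExtPow R P p ⊗[R] SymPow R P q)
    (hx : kappa hp hq x = 0) : ∃ w, kappa hp₁ hq₁ w = x := by
  obtain ⟨n, b⟩ : Σ n, Module.Basis (Fin n) R P := ⟨_, Module.finBasis R P⟩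
  induction n generalizing P with
  | zero =>
    refine ⟨0, ?_⟩
    rw [map_zero]
    have := b.equivFun.injective.subsingleton
    rcases eq_or_ne p 0 with h | h
    · have := symPow_subsingleton_of_subsingleton (R := R) (P := P) (show q ≠ 0 by omega)
      have := subsingleton_tensor_right (R := R) (A := ExtPow R P p) (B := SymPow R P q)
      exact Subsingleton.elim _ _
    · have := extPow_subsingleton_of_subsingleton (R := R) (P := P) h
      have := subsingleton_tensor_left (R := R) (A := ExtPow R P p) (B := SymPow R P q)
      exact Subsingleton.elim _ _
  | succ n ih =>
    obtain ⟨ic, π, e, ε, hs⟩ := exists_lineSplit b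
    have h := kappa_homotopy hs hp (by omega) hq (by omega) hq₁ hp₁ x
    rw [hx, map_zero, add_zero] at h
    obtain ⟨w, hw⟩ := ih (TensorProduct.map (extMap π rfl) (symMap π rfl) x) (by
      rw [kappa_map π hp hq hp hq rfl rfl, hx, map_zero]) (Pi.basisFun R (Fin n))
    rw [← hw, ← kappa_map ic hp₁ hq₁ hp₁ hq₁ rfl rfl] at h
    exact ⟨_, (map_add _ _ _).trans (add_eq_of_eq_sub h)⟩

/-- The complex `⋀ (P*) ⊗ D (P*)` is exact in positive total degrees. -/
theorem eta_exact {P : Type u} [AddCommGroup P] [Module R P] [Module.Free R P]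
    [Module.Finite R P] {p p' p₁ q q' q₁ : ℤ} (hp : p' = p + 1) (hq : q' = q - 1) (hp₁ : p = p₁ + 1)
    (hq₁ : q = q₁ - 1) (hpq : 1 ≤ p + q) (x : ExtPow R (Module.Dual R P) p ⊗[R] DivPow R P q)
    (hx : eta hp hq x = 0) : ∃ w, eta hp₁ hq₁ w = x := by
  obtain ⟨n, b⟩ : Σ n, Module.Basis (Fin n) R P := ⟨_, Module.finBasis R P⟩
  induction n generalizing P with
  | zero =>
    refine ⟨0, ?_⟩
    rw [map_zero]
    have := b.equivFun.injective.subsingleton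
    have : Subsingleton (Module.Dual R P) := ⟨fun f g => LinearMap.ext fun x => by
      rw [Subsingleton.elim x 0, map_zero, map_zero]⟩
    rcases eq_or_ne p 0 with h | h
    · have := symPow_subsingleton_of_subsingleton (R := R) (P := P) (show q ≠ 0 by omega)
      have : Subsingleton (DivPow R P q) := ⟨fun f g => LinearMap.ext fun x => by
        rw [Subsingleton.elim x 0, map_zero, map_zero]⟩
      have := subsingleton_tensor_right (R := R) (A := ExtPow R (Module.Dual R P) p)
        (B := DivPow R P q)
      exact Subsingleton.elim _ _
    · have := extPow_subsingleton_of_subsingleton (R := R) (P := Module.Dual R P) h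
      have := subsingleton_tensor_left (R := R) (A := ExtPow R (Module.Dual R P) p)
        (B := DivPow R P q)
      exact Subsingleton.elim _ _
  | succ n ih =>
    obtain ⟨ic, π, e, ε, hs⟩ := exists_lineSplit b
    have h := eta_homotopy hs hp (by omega) hq (by omega) (by omega) (by omega) hp₁ hq₁ x
    rw [hx, map_zero, add_zero] at h
    obtain ⟨w, hw⟩ := ih (TensorProduct.map (extMap ic.dualMap rfl) (divMap ic rfl) x) (by
      rw [eta_map ic hp hq hp hq rfl rfl, hx, map_zero]) (Pi.basisFun R (Fin n))
    rw [← hw, ← eta_map π hp₁ hq₁ hp₁ hq₁ rfl rfl] at h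
    exact ⟨_, (map_add _ _ _).trans (add_eq_of_eq_sub h)⟩

end Exactness

/-! ### Schur modules of a direct sum with a line -/

section Schur
variable {R : Type u} [CommRing R] {M : Type u} [AddCommGroup M] [Module R M]
  {P : Type u} [AddCommGroup P] [Module R P]
  [Module.Free R M] [Module.Finite R M] [Module.Free R P] [Module.Finite R P]
  {ic : M →ₗ[R] P} {π : P →ₗ[R] M} {e : P} {ε : Module.Dual R P}

lemma negOnePow_pred_coe (n : ℤ) : ((n - 1).negOnePow : ℤ) = -(n.negOnePow : ℤ) := by
  conv_rhs => rw [show n = (n - 1) + 1 by omega, Int.negOnePow_succ]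
  simp

lemma contr_contrR {n k l k' : ℤ} (hk : k = n - 1) (hl : l = k - 1) (hk' : k' = n - 1)
    (hl' : l = k' - 1) (φ ψ : Module.Dual R P) (x : ExtPow R P n) :
    contr hl φ (contrR hk ψ x) = contrR hl' ψ (contr hk' φ x) := by
  obtain rfl : k = k' := by omega
  have h := contr_contr_add hk hl φ ψ x
  subst hl
  simp only [contrR, LinearMap.smul_apply, map_zsmul, negOnePow_pred_coe, neg_smul]
  rw [eq_neg_of_add_eq_zero_left h, smul_neg]

/-- The projection `L^p_q P → L^{p-1}_q M` which picks the coefficient of `e` in the exterior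
factor. -/
def schurCo (π : P →ₗ[R] M) (ε : Module.Dual R P) {p p₁ q q₁ : ℤ} (hp : p₁ = p - 1)
    (hq : q₁ = q) : schurLPos R P p q →ₗ[R] schurLPos R M p₁ q₁ :=
  schurMap π rfl hq ∘ₗ schurContr hp rfl ε

lemma schurCo_coe (π : P →ₗ[R] M) (ε : Module.Dual R P) {p p₁ q q₁ : ℤ} (hp : p₁ = p - 1)
    (hq : q₁ = q) (x : schurLPos R P p q) :
    (schurCo π ε hp hq x).1 = TensorProduct.map (extCo π ε hp) (symMap π hq) x.1 := by
  change TensorProduct.map _ _ (TensorProduct.map _ _ x.1) = _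
  rw [← LinearMap.comp_apply, ← TensorProduct.map_comp]
  congr 2
  exact LinearMap.ext fun y => symMap_symMap π LinearMap.id rfl hq y

lemma schurMap_coe (π : P →ₗ[R] M) {p p₁ q q₁ : ℤ} (hp : p₁ = p)
    (hq : q₁ = q) (x : schurLPos R P p q) :
    (schurMap π hp hq x).1 = TensorProduct.map (extMap π hp) (symMap π hq) x.1 := rfl

lemma schurAct_coe {p q l : ℤ} (hl : l = q + 1) (v : P) (x : schurLPos R P p q) :
    (schurAct hl v x).1 = LinearMap.lTensor _ (symMul hl v) x.1 := rfl

lemma kappa_extCo (π : P →ₗ[R] M) (ε : Module.Dual R P) {p p' q q' p₁ p₁' : ℤ} (hp : p' = p - 1)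
    (hq : q' = q + 1) (hp₁ : p₁' = p₁ - 1) (h : p₁ = p - 1) (h' : p₁' = p' - 1)
    (x : ExtPow R P p ⊗[R] SymPow R P q) :
    kappa hp₁ hq (TensorProduct.map (extCo π ε h) (symMap π rfl) x) =
      TensorProduct.map (extCo π ε h') (symMap π rfl) (kappa hp hq x) := by
  refine evMap_push π _ _ _ _ _ _ _ _ ?_ ?_ x
  · intro φ x
    have h1 : contr hp₁ φ (extCo π ε h x) =
        extMap π rfl (contr hp₁ (π.dualMap φ) (contrR h ε x)) :=
      Subtype.ext (contractLeft_extMap _ _ _)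
    rw [h1, contr_contrR h hp₁ hp h']
    rfl
  · intro v y
    exact Subtype.ext (by simp [symAlgMap_ι])

lemma schurMap_schurAct_eq_zero {f : P →ₗ[R] M} {p p₁ q q₁ q₂ : ℤ} (h : q = q₁ + 1)
    (h' : q₂ = q) (hp : p₁ = p) {v : P} (hv : f v = 0) (x : schurLPos R P p q₁) :
    schurMap f hp h' (schurAct h v x) = 0 := by
  apply Subtype.ext
  rw [schurMap_coe, schurAct_coe, LinearMap.lTensor, ← LinearMap.comp_apply,
    ← TensorProduct.map_comp]
  have : symMap f h' ∘ₗ symMul h v = 0 := LinearMap.ext fun y => symMap_symMul_eq_zero f h h' hv y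
  rw [this]
  simp

lemma schurCo_schurAct_eq_zero {f : P →ₗ[R] M} {p p₁ q q₁ q₂ : ℤ} (h : q = q₁ + 1)
    (h' : q₂ = q) (hp : p₁ = p - 1) {v : P} (hv : f v = 0) (x : schurLPos R P p q₁) :
    schurCo f ε hp h' (schurAct h v x) = 0 := by
  apply Subtype.ext
  rw [schurCo_coe, schurAct_coe, LinearMap.lTensor, ← LinearMap.comp_apply,
    ← TensorProduct.map_comp]
  have : symMap f h' ∘ₗ symMul h v = 0 := LinearMap.ext fun y => symMap_symMul_eq_zero f h h' hv y
  rw [this]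
  simp

lemma LineSplit.schurAct_injective (hs : LineSplit ic π e ε) {p q q₁ : ℤ} (h : q = q₁ + 1) :
    Function.Injective (schurAct (R := R) (p := p) h e) := by
  have hinj : Function.Injective (LinearMap.lTensor (ExtPow R P p) (symMul (R := R) h e)) :=
    Module.Flat.lTensor_preserves_injective_linearMap _ (hs.symMul_injective h)
  exact fun x y hxy => Subtype.ext (hinj (congrArg Subtype.val hxy))

lemma eq_zero_of_mem_schurLPos {p q : ℤ} (hq : q ≤ 0) (x : schurLPos R P p q) : x = 0 := by
  have := x.2
  rw [mem_schurLPos (p' := p - 1) (q' := q + 1) rfl rfl, if_neg (by omega)] at this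
  exact Subtype.ext this

lemma map_map_apply {A B C A' B' C' : Type*} [AddCommMonoid A] [Module R A] [AddCommMonoid B]
    [Module R B] [AddCommMonoid C] [Module R C] [AddCommMonoid A'] [Module R A'] [AddCommMonoid B']
    [Module R B'] [AddCommMonoid C'] [Module R C'] (f : A →ₗ[R] B) (g : B →ₗ[R] C)
    (f' : A' →ₗ[R] B') (g' : B' →ₗ[R] C') (x : A ⊗[R] A') :
    TensorProduct.map g g' (TensorProduct.map f f' x) =
      TensorProduct.map (g ∘ₗ f) (g' ∘ₗ f') x := by
  rw [TensorProduct.map_comp]; rfl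

/-- An element of `⋀ P ⊗ Y` vanishes if its components in `⋀ M ⊗ Y` do. -/
lemma LineSplit.tensor_eq_zero (hs : LineSplit ic π e ε) {n n₁ : ℤ} (h : n₁ = n - 1) {Y : Type*}
    [AddCommGroup Y] [Module R Y] (z : ExtPow R P n ⊗[R] Y)
    (h1 : LinearMap.rTensor Y (extMap π rfl) z = 0)
    (h2 : LinearMap.rTensor Y (extCo π ε h) z = 0) : z = 0 := by
  have h3 : extMap ic rfl ∘ₗ extMap π rfl +
      wedgeVec (show n = n₁ + 1 by omega) e ∘ₗ extMap ic rfl ∘ₗ extCo π ε h = LinearMap.id :=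
    LinearMap.ext fun x => hs.ext_decomp rfl (show n = n₁ + 1 by omega) x
  rw [← LinearMap.rTensor_id_apply Y _ z, ← h3, LinearMap.rTensor_add, LinearMap.add_apply,
    LinearMap.rTensor_comp_apply, LinearMap.rTensor_comp_apply, LinearMap.rTensor_comp_apply, h1,
    h2]
  simp

variable [Nontrivial R]

lemma LineSplit.lTensor_symMul_injective (hs : LineSplit ic π e ε) (p : ℤ) {q q₁ : ℤ}
    (h : q = q₁ + 1) :
    Function.Injective (LinearMap.lTensor (ExtPow R P p) (symMul (R := R) h e)) :=
  Module.Flat.lTensor_preserves_injective_linearMap _ (hs.symMul_injective h)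

/-- The kernel of the projections to `L^p_q M` and `L^{p-1}_q M` is `e L^p_{q-1} P`. For `q = 1`
this uses that `κ` is injective on `⋀ᵖ P ⊗ Sym₀ P`. -/
lemma LineSplit.exists_schurAct (hs : LineSplit ic π e ε) {p p₁ q q₁ q₂ : ℤ} (hp : 1 ≤ p)
    (h : q = q₁ + 1) (h' : q₂ = q) (hp₁ : p₁ = p - 1) (x : schurLPos R P p q)
    (h1 : schurMap π rfl h' x = 0) (h2 : schurCo π ε hp₁ h' x = 0) :
    ∃ y, schurAct h e y = x := by
  subst h'
  rcases le_or_gt q₂ 0 with hq | hq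
  · exact ⟨0, by rw [map_zero, eq_zero_of_mem_schurLPos hq x]⟩
  have h3 : LinearMap.lTensor (ExtPow R P p) (symMap π rfl) x.1 = 0 := by
    apply hs.tensor_eq_zero hp₁
    · rw [LinearMap.rTensor, LinearMap.lTensor, map_map_apply]
      exact congrArg Subtype.val h1
    · have := congrArg Subtype.val h2
      rw [schurCo_coe] at this
      rw [LinearMap.rTensor, LinearMap.lTensor, map_map_apply]
      exact this
  have h4 : LinearMap.lTensor (ExtPow R P p) (symMul h e)
      (LinearMap.lTensor _ (symDiv hs h) x.1) = x.1 := by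
    have h5 : symMul h e ∘ₗ symDiv hs h + symMap ic rfl ∘ₗ symMap π rfl = LinearMap.id :=
      LinearMap.ext fun y => add_eq_of_eq_sub (symMul_symDiv hs h rfl y)
    have h6 := LinearMap.lTensor_id_apply (ExtPow R P p) _ x.1
    rw [← h5, LinearMap.lTensor_add, LinearMap.add_apply, LinearMap.lTensor_comp_apply,
      LinearMap.lTensor_comp_apply, h3, map_zero, add_zero] at h6
    exact h6
  have hx := x.2
  rw [mem_schurLPos (p' := p - 1) (q' := q₂ + 1) rfl rfl, if_pos (by omega)] at hx
  have h6 : kappa (p' := p - 1) (q' := q₁ + 1) rfl rfl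
      (LinearMap.lTensor (ExtPow R P p) (symDiv hs h) x.1) = 0 := by
    apply hs.lTensor_symMul_injective (p - 1) (show q₁ + 1 + 1 = q₁ + 1 + 1 from rfl)
    rw [← kappa_symMul rfl rfl h (show q₁ + 1 + 1 = q₂ + 1 by omega), h4, map_zero]
    obtain rfl : q₂ = q₁ + 1 := h
    exact hx
  refine ⟨⟨LinearMap.lTensor _ (symDiv hs h) x.1, ?_⟩, Subtype.ext h4⟩
  rw [mem_schurLPos (p' := p - 1) (q' := q₁ + 1) rfl rfl]
  split_ifs with hq₁
  · exact h6
  · obtain ⟨w, hw⟩ := kappa_exact (p₁ := p + 1) (q₁ := q₁ - 1) rfl rfl (by omega) (by omega)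
      (by omega) _ h6
    have := symPow_subsingleton_neg (R := R) (P := P) (show q₁ - 1 < 0 by omega)
    have := subsingleton_tensor_right (R := R) (A := ExtPow R P (p + 1))
      (B := SymPow R P (q₁ - 1))
    rw [← hw, Subsingleton.elim w 0, map_zero]

lemma LineSplit.schurMap_incl (hs : LineSplit ic π e ε) {p p₁ q q₁ : ℤ} (hp : p₁ = p) (hq : q₁ = q)
    (x : schurLPos R M p q) :
    schurMap π hp.symm hq.symm (schurMap ic hp hq x) = x := by
  subst hp hq
  apply Subtype.ext
  rw [schurMap_coe, schurMap_coe, map_map_apply]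
  have h1 : extMap (R := R) π (show p₁ = p₁ from rfl) ∘ₗ extMap ic rfl = LinearMap.id :=
    LinearMap.ext fun y => by
      rw [LinearMap.comp_apply, hs.extMap_proj_incl, extMap_id]; rfl
  have h2 : symMap (R := R) π (show q₁ = q₁ from rfl) ∘ₗ symMap ic rfl = LinearMap.id :=
    LinearMap.ext fun y => by
      rw [LinearMap.comp_apply, hs.symMap_proj_incl, symMap_id]; rfl
  rw [h1, h2, TensorProduct.map_id]
  rfl

lemma LineSplit.schurCo_incl (hs : LineSplit ic π e ε) {p p₁ q q₁ p₂ q₂ : ℤ} (hp : p₁ = p)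
    (hq : q₁ = q) (hp₂ : p₂ = p₁ - 1) (hq₂ : q₂ = q₁) (x : schurLPos R M p q) :
    schurCo π ε hp₂ hq₂ (schurMap ic hp hq x) = 0 := by
  apply Subtype.ext
  rw [schurCo_coe, schurMap_coe, map_map_apply]
  have h1 : extCo (R := R) π ε hp₂ ∘ₗ extMap ic hp = 0 :=
    LinearMap.ext fun y => hs.extCo_extMap_incl hp hp₂ y
  rw [h1, TensorProduct.map_zero_left]
  rfl

/-- The projections of `L^p_q P` to `L^p_q M` and to `L^{p-1}_q M` are jointly surjective if
`1 ≤ p`. -/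
lemma LineSplit.exists_schur_proj (hs : LineSplit ic π e ε) {p p₁ q q₂ : ℤ} (hp : 1 ≤ p)
    (h' : q₂ = q) (hp₁ : p₁ = p - 1) (a : schurLPos R M p q₂) (b : schurLPos R M p₁ q₂) :
    ∃ x : schurLPos R P p q, schurMap π rfl h' x = a ∧ schurCo π ε hp₁ h' x = b := by
  subst h'
  rcases le_or_gt q₂ 0 with hq | hq
  · exact ⟨0, by rw [map_zero, eq_zero_of_mem_schurLPos hq a],
      by rw [map_zero, eq_zero_of_mem_schurLPos hq b]⟩
  have hb := b.2
  rw [mem_schurLPos (p' := p₁ - 1) (q' := q₂ + 1) rfl rfl, if_pos (by omega)] at hb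
  obtain ⟨z, hz⟩ := kappa_exact (p₁ := p) (q₁ := q₂ - 1) rfl rfl hp₁ (by omega) (by omega) _ hb
  have hk : p = p + 1 - 1 := by omega
  have hq1 : q₂ = q₂ - 1 + 1 := by omega
  -- The cycle `κ (z ∧ e)` has the component `κ z = b` along `e`.
  set w : ExtPow R P (p + 1) ⊗[R] SymPow R P (q₂ - 1) :=
    TensorProduct.map (wedgeVec rfl e ∘ₗ extMap ic rfl) (symMap ic rfl) z with hw
  have h1 : TensorProduct.map (extMap π rfl) (symMap π rfl) w = 0 := by
    rw [hw, map_map_apply]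
    have : extMap (R := R) π (show p + 1 = p + 1 from rfl) ∘ₗ wedgeVec rfl e ∘ₗ
        extMap (n := p) ic rfl = 0 :=
      LinearMap.ext fun y => extMap_wedgeVec_eq_zero π rfl rfl hs.proj_e _
    rw [this, TensorProduct.map_zero_left]
    rfl
  have h2 : TensorProduct.map (extCo π ε hk) (symMap π rfl) w = z := by
    rw [hw, map_map_apply]
    have h3 : extCo (R := R) π ε hk ∘ₗ wedgeVec rfl e ∘ₗ extMap ic rfl = LinearMap.id :=
      LinearMap.ext fun y => by
        have := hs.extCo_extSplit (show p + 1 = p + 1 from rfl) rfl hk (0, y)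
        simp only [extSplit, LinearMap.coprod_apply, map_zero, zero_add] at this
        rw [extMap_id] at this
        exact this
    have h4 : symMap (R := R) π (show q₂ - 1 = q₂ - 1 from rfl) ∘ₗ symMap ic rfl = LinearMap.id :=
      LinearMap.ext fun y => by
        rw [LinearMap.comp_apply, hs.symMap_proj_incl, symMap_id]; rfl
    rw [h3, h4, TensorProduct.map_id]
    rfl
  have hmem : kappa hk hq1 w ∈ schurLPos R P p q₂ := by
    rw [mem_schurLPos (p' := p - 1) (q' := q₂ + 1) rfl rfl, if_pos (by omega)]
    exact kappa_kappa _ _ _ _ _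
  refine ⟨schurMap ic rfl rfl a + ⟨kappa hk hq1 w, hmem⟩, ?_, ?_⟩
  · rw [map_add, hs.schurMap_incl rfl rfl]
    have : schurMap π rfl rfl ⟨kappa hk hq1 w, hmem⟩ = 0 := by
      apply Subtype.ext
      rw [schurMap_coe]
      change TensorProduct.map _ _ (kappa hk hq1 w) = 0
      rw [← kappa_map π hk hq1 hk hq1 rfl rfl, h1, map_zero]
    rw [this, add_zero]
  · rw [map_add, hs.schurCo_incl rfl rfl, zero_add]
    apply Subtype.ext
    rw [schurCo_coe]
    change TensorProduct.map _ _ (kappa hk hq1 w) = _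
    rw [← hz, ← h2]
    exact (kappa_extCo π ε hk hq1 hp₁ hk hp₁ w).symm

end Schur

/-! ### Weyl modules of a direct sum with a line -/

section Weyl
variable {R : Type u} [CommRing R] {M : Type u} [AddCommGroup M] [Module R M]
  {P : Type u} [AddCommGroup P] [Module R P]
  [Module.Free R M] [Module.Finite R M] [Module.Free R P] [Module.Finite R P]
  {ic : M →ₗ[R] P} {π : P →ₗ[R] M} {e : P} {ε : Module.Dual R P}

lemma sum_neg_add {A I : Type*} [AddCommGroup A] [Fintype I] (f : I → A) (a : A) :
    ∑ i, -f i + a = a - ∑ i, f i := by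
  rw [Finset.sum_neg_distrib]
  abel

lemma eq_zero_of_zero_eq_zero_sub {A : Type*} [AddCommGroup A] {a : A} (h : 0 = 0 - a) :
    a = 0 := by
  rw [zero_sub] at h
  exact neg_eq_zero.mp h.symm

lemma eta_eta {p p' p'' q q' q'' : ℤ} (hp : p' = p + 1) (hq : q' = q - 1) (hp' : p'' = p' + 1)
    (hq' : q'' = q' - 1) (x : ExtPow R (Module.Dual R P) p ⊗[R] DivPow R P q) :
    eta hp' hq' (eta hp hq x) = 0 := by
  unfold eta
  refine evMap_evMap (R := R) (V := P) (P := ExtPow R (Module.Dual R P) p)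
    (P' := ExtPow R (Module.Dual R P) p') (P'' := ExtPow R (Module.Dual R P) p'')
    (Q := DivPow R P q) (Q' := DivPow R P q') (Q'' := DivPow R P q'')
    (wedgeVec hp) (divAct hq) (wedgeVec hp') (divAct hq') ?_ ?_ ?_ x
  · intro φ y
    exact wedgeVec_wedgeVec_self hp hp' φ y
  · intro φ ψ y
    exact wedgeVec_wedgeVec_add hp hp' φ ψ y
  · intro v w y
    exact divAct_comm hq hq' v w y

lemma divMap_id {q : ℤ} (h : q = q) (x : DivPow R P q) : divMap LinearMap.id h x = x := by
  ext z
  simp only [divMap, LinearMap.dualMap_apply]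
  rw [symMap_id]

lemma divMap_divMap {Q : Type*} [AddCommGroup Q] [Module R Q] (f : M →ₗ[R] P) (g : P →ₗ[R] Q)
    {q q₁ q₂ : ℤ} (h : q₁ = q) (h' : q₂ = q₁) (x : DivPow R Q q) :
    divMap f h' (divMap g h x) = divMap (g ∘ₗ f) (h'.trans h) x := by
  ext z
  simp only [divMap, LinearMap.dualMap_apply]
  rw [symMap_symMap]

lemma weylMap_coe (f : M →ₗ[R] P) {p p₁ q q₁ : ℤ} (hp : p = p₁) (hq : q = q₁)
    (x : weylK R P p₁ q₁) :
    (weylMap f hp hq x).1 = TensorProduct.map (extMap f.dualMap hp) (divMap f hq) x.1 := rfl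

lemma weylAct_coe {p q l : ℤ} (hl : l = q - 1) (v : P) (x : weylK R P p q) :
    (weylAct hl v x).1 = LinearMap.lTensor _ (divAct hl v) x.1 := rfl

lemma weylWedge_coe {p p₁ q q₁ : ℤ} (hp : p₁ = p + 1) (hq : q₁ = q) (δ : Module.Dual R P)
    (x : weylK R P p q) :
    (weylWedge hp hq δ x).1 =
      TensorProduct.map (wedgeVec hp δ) (divMap LinearMap.id hq) x.1 := rfl

/-- The map `K^p_q (M*) ⊕ K^{p-1}_q (M*) → K^p_q (P*)`, `(x, y) ↦ x + y ∧ ε`. -/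
def weylSum (π : P →ₗ[R] M) (ε : Module.Dual R P) {p p₁ p₂ q q₁ q₂ : ℤ} (h : p = p₁) (hq : q = q₁)
    (h₂ : p = p₂ + 1) (hq₂ : q = q₂) :
    weylK R M p₁ q₁ × weylK R M p₂ q₂ →ₗ[R] weylK R P p q :=
  LinearMap.coprod (weylMap π h hq) (weylWedge h₂ hq₂ ε ∘ₗ weylMap π rfl rfl)

lemma weylSum_coe (π : P →ₗ[R] M) (ε : Module.Dual R P) {p p₂ q : ℤ}
    (h₂ : p = p₂ + 1) (x : weylK R M p q × weylK R M p₂ q) :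
    (weylSum π ε rfl rfl h₂ rfl x).1 =
      TensorProduct.map (extMap π.dualMap rfl) (divMap π rfl) x.1.1 +
      TensorProduct.map (wedgeVec h₂ ε ∘ₗ extMap π.dualMap rfl) (divMap π rfl) x.2.1 := by
  change TensorProduct.map _ _ x.1.1 + TensorProduct.map _ _ (TensorProduct.map _ _ x.2.1) = _
  rw [map_map_apply]
  congr 3
  exact LinearMap.ext fun y => divMap_id rfl _

lemma LineSplit.divMap_incl_proj (hs : LineSplit ic π e ε) {q q₁ q₂ : ℤ} (h : q₁ = q)
    (h' : q₂ = q₁) (x : DivPow R M q) :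
    divMap ic h' (divMap π h x) = divMap LinearMap.id (h'.trans h) x := by
  rw [divMap_divMap, hs.proj_comp_incl]

lemma LineSplit.weylSum_injective (hs : LineSplit ic π e ε) {p p₁ p₂ q q₁ q₂ : ℤ} (h : p = p₁)
    (hq : q = q₁) (h₂ : p = p₂ + 1) (hq₂ : q = q₂) :
    Function.Injective (weylSum π ε h hq h₂ hq₂) := by
  subst h hq hq₂
  intro x y hxy
  have hx := congrArg Subtype.val hxy
  rw [weylSum_coe, weylSum_coe] at hx
  have hd : divMap (R := R) ic (show q = q from rfl) ∘ₗ divMap π rfl = LinearMap.id :=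
    LinearMap.ext fun y => by rw [LinearMap.comp_apply, hs.divMap_incl_proj, divMap_id]; rfl
  have h₂' : p₂ = p - 1 := by omega
  have e1 : extMap (R := R) ic.dualMap (show p = p from rfl) ∘ₗ extMap π.dualMap rfl =
      LinearMap.id :=
    LinearMap.ext fun y => by
      rw [LinearMap.comp_apply, hs.dual.extMap_proj_incl, extMap_id]; rfl
  have e2 : extMap (R := R) ic.dualMap (show p = p from rfl) ∘ₗ wedgeVec h₂ ε ∘ₗ
      extMap π.dualMap rfl = 0 :=
    LinearMap.ext fun y => extMap_wedgeVec_eq_zero _ h₂ rfl hs.dual.proj_e _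
  have e3 : extCo (R := R) ic.dualMap (Module.Dual.eval R P e) h₂' ∘ₗ extMap π.dualMap rfl = 0 :=
    LinearMap.ext fun y => hs.dual.extCo_extMap_incl rfl h₂' y
  have e4 : extCo (R := R) ic.dualMap (Module.Dual.eval R P e) h₂' ∘ₗ wedgeVec h₂ ε ∘ₗ
      extMap π.dualMap rfl = LinearMap.id :=
    LinearMap.ext fun y => by
      have := hs.dual.extCo_extSplit (show p = p from rfl) h₂ h₂' (0, y)
      simp only [extSplit, LinearMap.coprod_apply, map_zero, zero_add] at this
      rw [extMap_id] at this
      exact this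
  refine Prod.ext (Subtype.ext ?_) (Subtype.ext ?_)
  · have h := congrArg (TensorProduct.map (extMap ic.dualMap rfl) (divMap ic rfl)) hx
    simp only [map_add, map_map_apply, hd, e1, e2, TensorProduct.map_zero_left,
      TensorProduct.map_id, LinearMap.zero_apply, LinearMap.id_apply, add_zero] at h
    exact h
  · have h := congrArg (TensorProduct.map (extCo ic.dualMap (Module.Dual.eval R P e) h₂')
      (divMap ic rfl)) hx
    simp only [map_add, map_map_apply, hd, e3, e4, TensorProduct.map_zero_left,
      TensorProduct.map_id, LinearMap.zero_apply, LinearMap.id_apply, zero_add] at h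
    exact h

lemma LineSplit.divAct_divMap_self (hs : LineSplit ic π e ε) {q q₁ q' : ℤ} (h : q₁ = q)
    (h' : q' = q₁ - 1) (y : DivPow R M q) : divAct h' e (divMap π h y) = 0 := by
  rw [divAct_divMap π (q' := q') (by omega) h' h rfl, hs.proj_e]
  simp

lemma LineSplit.weylAct_weylSum (hs : LineSplit ic π e ε) {p p₁ p₂ q q₁ q₂ q' : ℤ} (h : p = p₁)
    (hq : q = q₁) (h₂ : p = p₂ + 1) (hq₂ : q = q₂) (hq' : q' = q - 1)
    (x : weylK R M p₁ q₁ × weylK R M p₂ q₂) :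
    weylAct hq' e (weylSum π ε h hq h₂ hq₂ x) = 0 := by
  subst h hq hq₂
  apply Subtype.ext
  have hd : divAct hq' e ∘ₗ divMap π rfl = 0 :=
    LinearMap.ext fun y => hs.divAct_divMap_self rfl hq' y
  rw [weylAct_coe, weylSum_coe, map_add, LinearMap.lTensor, map_map_apply, map_map_apply, hd,
    TensorProduct.map_zero_right, TensorProduct.map_zero_right]
  simp

/-- The component along `ε` of the differential of `⋀ (P*) ⊗ D (P*)`. It receives a contribution of
the action of `e`, from the summand `ε ⊗ e` of the canonical element. -/
lemma LineSplit.eta_extCo (hs : LineSplit ic π e ε) {p p' q q' p₁ : ℤ} (hp : p' = p + 1)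
    (hq : q' = q - 1) (hp₁ : p₁ = p - 1) (hp₁' : p = p₁ + 1) (hp' : p = p' - 1)
    (x : ExtPow R (Module.Dual R P) p ⊗[R] DivPow R P q) :
    TensorProduct.map (extCo ic.dualMap (Module.Dual.eval R P e) hp') (divMap ic rfl)
        (eta hp hq x) =
      TensorProduct.map (extMap ic.dualMap rfl) (divMap ic rfl)
        (LinearMap.lTensor _ (divAct hq e) x) -
      eta hp₁' hq (TensorProduct.map (extCo ic.dualMap (Module.Dual.eval R P e) hp₁)
        (divMap ic rfl) x) := by
  classical
  induction x using TensorProduct.induction_on with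
  | zero => simp
  | add x y hx hy =>
    simp only [map_add]
    rw [hx, hy]
    abel
  | tmul x y =>
    simp only [eta, TensorProduct.map_tmul, LinearMap.lTensor_tmul]
    rw [hs.evMap_split, evMap_tmul _ _ (Module.Free.chooseBasis R M),
      evMap_tmul _ _ (Module.Free.chooseBasis R M), map_add, map_sum]
    simp only [TensorProduct.map_tmul, LinearMap.comp_apply]
    simp_rw [extCo_wedgeVec _ _ hp hp' hp₁ hp₁' rfl, hs.dual.proj_incl, hs.dual.proj_e,
      hs.dual.coeff_incl, hs.dual.coeff_e, divAct_divMap ic hq hq rfl rfl]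
    simp only [zero_smul, zero_sub, one_smul, neg_tmul, map_zero, LinearMap.zero_apply, sub_zero]
    exact sum_neg_add (A := ExtPow R (Module.Dual R M) p ⊗[R] DivPow R M q')
      (I := Module.Free.ChooseBasisIndex R M) _ _

/-- The kernel of the action of `e` on `K^p_q (P*)` is `K^p_q (M*) ⊕ K^{p-1}_q (M*)`. -/
lemma LineSplit.exists_weylSum (hs : LineSplit ic π e ε) {p p₁ p₂ q q₁ q₂ q' : ℤ} (h : p = p₁)
    (hq : q = q₁) (h₂ : p = p₂ + 1) (hq₂ : q = q₂) (hq' : q' = q - 1) (x : weylK R P p q)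
    (hx : weylAct hq' e x = 0) : ∃ y, weylSum π ε h hq h₂ hq₂ y = x := by
  subst h hq hq₂
  have hx := congrArg Subtype.val hx
  rw [weylAct_coe] at hx
  rw [ZeroMemClass.coe_zero] at hx
  have h₂' : p₂ = p - 1 := by omega
  have hmem := x.2
  rw [mem_weylK (p' := p + 1) rfl hq'] at hmem
  have h1 : LinearMap.lTensor _ (divMap π rfl ∘ₗ divMap ic rfl) x.1 = x.1 := by
    have h5 : divMul hs (show q = q' + 1 by omega) ∘ₗ divAct hq' e +
        divMap π rfl ∘ₗ divMap ic rfl = LinearMap.id :=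
      LinearMap.ext fun y => add_eq_of_eq_sub (divMul_divAct_self hs _ hq' y)
    have h6 := LinearMap.lTensor_id_apply (ExtPow R (Module.Dual R P) p) _ x.1
    rw [← h5, LinearMap.lTensor_add, LinearMap.add_apply, LinearMap.lTensor_comp_apply, hx,
      map_zero, zero_add] at h6
    exact h6
  refine ⟨(⟨TensorProduct.map (extMap ic.dualMap rfl) (divMap ic rfl) x.1, ?_⟩,
    ⟨TensorProduct.map (extCo ic.dualMap (Module.Dual.eval R P e) h₂') (divMap ic rfl) x.1, ?_⟩),
    ?_⟩
  · rw [mem_weylK (p' := p + 1) rfl hq', eta_map ic rfl hq' rfl hq' rfl rfl, hmem, map_zero]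
  · have h3 := hs.eta_extCo rfl hq' h₂' h₂ (by omega) x.1
    rw [hx, hmem, map_zero, map_zero] at h3
    rw [mem_weylK (p' := p) h₂ hq']
    exact eq_zero_of_zero_eq_zero_sub (A := ExtPow R (Module.Dual R M) p ⊗[R] DivPow R M q') h3
  · apply Subtype.ext
    rw [weylSum_coe]
    simp only
    rw [map_map_apply, map_map_apply, ← LinearMap.add_apply, ← TensorProduct.map_add_left]
    have h7 : extMap π.dualMap rfl ∘ₗ extMap ic.dualMap rfl +
        (wedgeVec h₂ ε ∘ₗ extMap π.dualMap rfl) ∘ₗ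
          extCo ic.dualMap (Module.Dual.eval R P e) h₂' = LinearMap.id :=
      LinearMap.ext fun y => hs.dual.ext_decomp rfl h₂ y
    rw [h7]
    exact h1

lemma divPow_subsingleton_neg [Nontrivial R] {q : ℤ} (h : q < 0) : Subsingleton (DivPow R P q) :=
  ⟨fun f g => LinearMap.ext fun x => by
    have := symPow_subsingleton_neg (R := R) (P := P) h
    rw [Subsingleton.elim x 0, map_zero, map_zero]⟩

lemma weylK_subsingleton_neg [Nontrivial R] {p q : ℤ} (h : q < 0) :
    Subsingleton (weylK R P p q) := by
  have := divPow_subsingleton_neg (R := R) (P := P) h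
  have := subsingleton_tensor_right (R := R) (A := ExtPow R (Module.Dual R P) p)
    (B := DivPow R P q)
  infer_instance

/-- The action of `e` maps `K^p_q (P*)` onto `K^p_{q-1} (P*)` if `1 ≤ p`. -/
lemma LineSplit.weylAct_surjective [Nontrivial R] (hs : LineSplit ic π e ε) {p q q' : ℤ}
    (hp : 1 ≤ p) (hq' : q' = q - 1) :
    Function.Surjective (weylAct (R := R) (G := P) (p := p) hq' e) := by
  intro y
  rcases lt_or_ge q' 0 with hq | hq
  · have := weylK_subsingleton_neg (R := R) (P := P) (p := p) hq
    exact ⟨0, Subsingleton.elim _ _⟩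
  have hy := y.2
  rw [mem_weylK (p' := p + 1) (q' := q' - 1) rfl rfl] at hy
  obtain ⟨w, hw⟩ := eta_exact (p₁ := p - 1) (q₁ := q) rfl rfl (by omega) hq' (by omega) _ hy
  have hp' : p = p - 1 + 1 := by omega
  have hq'' : q = q + 1 - 1 := by omega
  -- The cycle `y` is `η w`, and `w = e z`, so `y = e (η z)`.
  set z := LinearMap.lTensor (ExtPow R (Module.Dual R P) (p - 1))
    (divMul hs (show q + 1 = q + 1 from rfl)) w with hz
  have hmem : eta hp' hq'' z ∈ weylK R P p q := by
    rw [mem_weylK (p' := p + 1) (q' := q - 1) rfl rfl]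
    exact eta_eta hp' hq'' rfl rfl z
  refine ⟨⟨eta hp' hq'' z, hmem⟩, Subtype.ext ?_⟩
  have h1 : divAct hq'' e ∘ₗ divMul hs rfl = LinearMap.id :=
    LinearMap.ext fun z => by rw [LinearMap.comp_apply, divAct_divMul_self, divMap_id]; rfl
  have h2 : LinearMap.lTensor _ (divAct hq'' e) z = w := by
    rw [hz, ← LinearMap.lTensor_comp_apply, h1, LinearMap.lTensor_id_apply]
  have h3 := eta_divAct hp' hq'' hq'' hq' hq' e z
  rw [h2] at h3
  exact h3.symm.trans hw

end Weyl

/-! ### Freeness -/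

section Free
variable {R : Type u} [CommRing R]

/-- An extension of free modules is free. The modules are additive monoids because the submodules of
tensor products to which it is applied carry no visible structure of additive group. -/
lemma free_of_exact {A B C : Type u} [AddCommMonoid A] [Module R A] [AddCommMonoid B]
    [Module R B] [AddCommMonoid C] [Module R C] [Module.Free R A] [Module.Free R C] (f : A →ₗ[R] B)
    (g : B →ₗ[R] C) (hf : Function.Injective f) (h : Function.Exact f g)
    (hg : Function.Surjective g) : Module.Free R B := by
  let _ := Module.addCommMonoidToAddCommGroup R (M := A)
  let _ := Module.addCommMonoidToAddCommGroup R (M := B)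
  let _ := Module.addCommMonoidToAddCommGroup R (M := C)
  obtain ⟨s, hs⟩ := g.exists_rightInverse_of_surjective (LinearMap.range_eq_top.2 hg)
  exact Module.Free.of_equiv (h.splitSurjectiveEquiv hf ⟨s, hs⟩).1.symm

instance symPow_finite {P : Type u} [AddCommGroup P] [Module R P] [Module.Finite R P] (q : ℤ) :
    Module.Finite R (SymPow R P q) := by
  change Module.Finite R (symPiece R P q)
  rcases lt_or_ge q 0 with hn | hn
  · rw [symPiece_neg hn]; infer_instance
  · lift q to ℕ using hn
    rw [symPiece_coe, Module.Finite.iff_fg, LinearMap.range_eq_map]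
    exact Submodule.FG.pow (Submodule.FG.map _ Module.Finite.fg_top) q

/-- The identification `R = Sym₀ P`. -/
def symZero (P : Type u) [AddCommGroup P] [Module R P] : R →ₗ[R] SymPow R P 0 :=
  LinearMap.toSpanSingleton R _ ⟨1, one_mem_symPiece⟩

lemma symZero_bijective (P : Type u) [AddCommGroup P] [Module R P] :
    Function.Bijective (symZero (R := R) P) := by
  have h' : ∀ z, (symZero (R := R) P z).1 = algebraMap R (SymmetricAlgebra R P) z := fun z => by
    rw [Algebra.algebraMap_eq_smul_one]; rfl
  constructor
  · intro x y hxy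
    have h := congrArg Subtype.val hxy
    rw [h', h'] at h
    exact (SymmetricAlgebra.algebraMap_inj P x y).1 h
  · rintro ⟨x, hx⟩
    have hx' := hx
    rw [show (0 : ℤ) = ((0 : ℕ) : ℤ) from rfl, symPiece_coe, pow_zero,
      Submodule.mem_one] at hx'
    obtain ⟨y, rfl⟩ := hx'
    exact ⟨y, Subtype.ext (h' y)⟩

lemma symPow_zero_free (P : Type u) [AddCommGroup P] [Module R P] :
    Module.Free R (SymPow R P 0) :=
  Module.Free.of_equiv (LinearEquiv.ofBijective _ (symZero_bijective P))

variable [Nontrivial R]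

/-- By induction on the rank, with the decomposition `Sym_q P = e Sym_{q-1} P ⊕ Sym_q M`. -/
instance symPow_free {P : Type u} [AddCommGroup P] [Module R P] [Module.Free R P]
    [Module.Finite R P] (q : ℤ) : Module.Free R (SymPow R P q) := by
  obtain ⟨n, b⟩ : Σ n, Module.Basis (Fin n) R P := ⟨_, Module.finBasis R P⟩
  induction n generalizing P q with
  | zero =>
    have := b.equivFun.injective.subsingleton
    rcases eq_or_ne q 0 with rfl | h
    · exact symPow_zero_free P
    · have := symPow_subsingleton_of_subsingleton (R := R) (P := P) h
      infer_instance
  | succ n ih =>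
    obtain ⟨ic, π, e, ε, hs⟩ := exists_lineSplit b
    rcases lt_or_ge q 0 with hq | hq
    · have := symPow_subsingleton_neg (R := R) (P := P) hq
      infer_instance
    lift q to ℕ using hq
    induction q with
    | zero => exact symPow_zero_free P
    | succ q ihq =>
      have h1 := ih (P := Fin n → R) ((q : ℤ) + 1) (Pi.basisFun R (Fin n))
      exact Module.Free.of_equiv (LinearEquiv.ofBijective _
        (hs.symSplit_bijective (q := ((q + 1 : ℕ) : ℤ)) (q₁ := q) (q₂ := (q : ℤ) + 1)
          (by push_cast; rfl) (by push_cast; rfl)))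

/-- By induction on the rank and on `q`, with the exact sequence
`0 → L^p_{q-1} P → L^p_q P → L^p_q M ⊕ L^{p-1}_q M → 0`, in which the modules are zero for
`q ≤ 0`. -/
lemma schurLPos_free {P : Type u} [AddCommGroup P] [Module R P] [Module.Free R P]
    [Module.Finite R P] {p : ℤ} (hp : 0 ≤ p) (q : ℤ) : Module.Free R (schurLPos R P p q) := by
  obtain ⟨n, b⟩ : Σ n, Module.Basis (Fin n) R P := ⟨_, Module.finBasis R P⟩
  induction n generalizing P p q with
  | zero =>
    have := b.equivFun.injective.subsingleton
    rcases le_or_gt q 0 with hq | hq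
    · have : Subsingleton (schurLPos R P p q) :=
        ⟨fun x y => by rw [eq_zero_of_mem_schurLPos hq x, eq_zero_of_mem_schurLPos hq y]⟩
      infer_instance
    · have := symPow_subsingleton_of_subsingleton (R := R) (P := P) (show q ≠ 0 by omega)
      have := subsingleton_tensor_right (R := R) (A := ExtPow R P p) (B := SymPow R P q)
      infer_instance
  | succ n ih =>
    obtain ⟨ic, π, e, ε, hs⟩ := exists_lineSplit b
    rcases le_or_gt q 0 with hq | hq
    · have : Subsingleton (schurLPos R P p q) :=
        ⟨fun x y => by rw [eq_zero_of_mem_schurLPos hq x, eq_zero_of_mem_schurLPos hq y]⟩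
      infer_instance
    rcases hp.eq_or_lt with rfl | hp
    · have h : schurLPos R P 0 q = ⊤ := by
        refine eq_top_iff.2 fun x _ => ?_
        have hsub : Subsingleton (ExtPow R P (0 - 1)) := extPow_subsingleton (Or.inl (by omega))
        have := subsingleton_tensor_left (R := R) (A := ExtPow R P (0 - 1))
          (B := SymPow R P (q + 1))
        rw [mem_schurLPos rfl rfl, if_pos (by omega)]
        exact Subsingleton.elim _ _
      rw [h]
      exact Module.Free.of_equiv (LinearEquiv.ofTop ⊤ rfl).symm
    · obtain ⟨k, rfl⟩ : ∃ k : ℕ, q = k := ⟨q.toNat, by omega⟩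
      clear hq
      induction k with
      | zero =>
        have : Subsingleton (schurLPos R P p (0 : ℕ)) :=
          ⟨fun x y => by rw [eq_zero_of_mem_schurLPos le_rfl x, eq_zero_of_mem_schurLPos le_rfl y]⟩
        infer_instance
      | succ k ihk =>
        have h1 := ih (P := Fin n → R) hp.le ((k + 1 : ℕ) : ℤ) (Pi.basisFun R (Fin n))
        have h2 := ih (P := Fin n → R) (p := p - 1) (by omega) ((k + 1 : ℕ) : ℤ)
          (Pi.basisFun R (Fin n))
        have hk1 : ((k + 1 : ℕ) : ℤ) = k + 1 := by push_cast; rfl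
        let f : schurLPos R P p k →ₗ[R] schurLPos R P p ((k + 1 : ℕ) : ℤ) := schurAct hk1 e
        let g : schurLPos R P p ((k + 1 : ℕ) : ℤ) →ₗ[R]
            schurLPos R (Fin n → R) p ((k + 1 : ℕ) : ℤ) ×
              schurLPos R (Fin n → R) (p - 1) ((k + 1 : ℕ) : ℤ) :=
          LinearMap.prod (schurMap π rfl rfl) (schurCo π ε rfl rfl)
        refine free_of_exact f g (hs.schurAct_injective hk1) ?_ ?_
        · intro x
          constructor
          · intro hx
            exact hs.exists_schurAct (by omega) _ rfl rfl x (congrArg Prod.fst hx)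
              (congrArg Prod.snd hx)
          · rintro ⟨y, rfl⟩
            exact Prod.ext (schurMap_schurAct_eq_zero _ _ _ hs.proj_e _)
              (schurCo_schurAct_eq_zero _ _ _ hs.proj_e _)
        · rintro ⟨a, b⟩
          obtain ⟨x, hx, hx'⟩ := hs.exists_schur_proj (show 1 ≤ p by omega) rfl rfl a b
          exact ⟨x, Prod.ext hx hx'⟩

lemma weylK_zero_free (P : Type u) [AddCommGroup P] [Module R P] [Module.Free R P]
    [Module.Finite R P] (p : ℤ) : Module.Free R (weylK R P p 0) := by
  have h : weylK R P p 0 = ⊤ := by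
    refine eq_top_iff.2 fun x _ => ?_
    have hsub := divPow_subsingleton_neg (R := R) (P := P) (show (0 : ℤ) - 1 < 0 by omega)
    have := subsingleton_tensor_right (R := R) (A := ExtPow R (Module.Dual R P) (p + 1))
      (B := DivPow R P (0 - 1))
    rw [mem_weylK rfl rfl]
    exact Subsingleton.elim _ _
  rw [h]
  exact Module.Free.of_equiv (LinearEquiv.ofTop ⊤ rfl).symm

/-- By induction on the rank and on `q`, with the exact sequence
`0 → K^p_q (M*) ⊕ K^{p-1}_q (M*) → K^p_q (P*) → K^p_{q-1} (P*) → 0` for `1 ≤ p`. The remaining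
modules are `K^p_0 (P*) = ⋀ᵖ (P*)` and, for `1 ≤ q`, `K^0_q (P*) = 0`. -/
lemma weylK_free {P : Type u} [AddCommGroup P] [Module R P] [Module.Free R P]
    [Module.Finite R P] {p : ℤ} (hp : 0 ≤ p) (q : ℤ) : Module.Free R (weylK R P p q) := by
  obtain ⟨n, b⟩ : Σ n, Module.Basis (Fin n) R P := ⟨_, Module.finBasis R P⟩
  induction n generalizing P p q with
  | zero =>
    have := b.equivFun.injective.subsingleton
    rcases eq_or_ne q 0 with rfl | hq
    · exact weylK_zero_free P p
    · have := symPow_subsingleton_of_subsingleton (R := R) (P := P) hq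
      have : Subsingleton (DivPow R P q) := ⟨fun f g => LinearMap.ext fun x => by
        rw [Subsingleton.elim x 0, map_zero, map_zero]⟩
      have := subsingleton_tensor_right (R := R) (A := ExtPow R (Module.Dual R P) p)
        (B := DivPow R P q)
      infer_instance
  | succ n ih =>
    obtain ⟨ic, π, e, ε, hs⟩ := exists_lineSplit b
    rcases lt_or_ge q 0 with hq | hq
    · have := weylK_subsingleton_neg (R := R) (P := P) (p := p) hq
      infer_instance
    obtain ⟨k, rfl⟩ : ∃ k : ℕ, q = k := ⟨q.toNat, by omega⟩
    clear hq
    induction k with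
    | zero => exact weylK_zero_free P p
    | succ k ihk =>
      rcases hp.eq_or_lt with rfl | hp
      · have : Subsingleton (weylK R P 0 ((k + 1 : ℕ) : ℤ)) := by
          have hz : ∀ x : weylK R P 0 ((k + 1 : ℕ) : ℤ), x = 0 := fun x => by
            have hx := x.2
            rw [mem_weylK rfl rfl] at hx
            obtain ⟨w, hw⟩ := eta_exact (p₁ := -1) (q₁ := ((k + 1 : ℕ) : ℤ) + 1) rfl rfl
              (by omega) (by omega) (by push_cast; omega) _ hx
            have hsub : Subsingleton (ExtPow R (Module.Dual R P) (-1)) :=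
              extPow_subsingleton (Or.inl (by omega))
            have := subsingleton_tensor_left (R := R) (A := ExtPow R (Module.Dual R P) (-1))
              (B := DivPow R P (((k + 1 : ℕ) : ℤ) + 1))
            exact Subtype.ext (by rw [← hw, Subsingleton.elim w 0, map_zero]; rfl)
          exact ⟨fun x y => by rw [hz x, hz y]⟩
        infer_instance
      · have h1 := ih (P := Fin n → R) hp.le ((k + 1 : ℕ) : ℤ) (Pi.basisFun R (Fin n))
        have h2 := ih (P := Fin n → R) (p := p - 1) (by omega) ((k + 1 : ℕ) : ℤ)
          (Pi.basisFun R (Fin n))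
        have hp1 : p = p - 1 + 1 := by omega
        have hk1 : (k : ℤ) = ((k + 1 : ℕ) : ℤ) - 1 := by push_cast; omega
        let f : weylK R (Fin n → R) p ((k + 1 : ℕ) : ℤ) ×
            weylK R (Fin n → R) (p - 1) ((k + 1 : ℕ) : ℤ) →ₗ[R]
              weylK R P p ((k + 1 : ℕ) : ℤ) := weylSum π ε rfl rfl hp1 rfl
        let g : weylK R P p ((k + 1 : ℕ) : ℤ) →ₗ[R] weylK R P p k := weylAct hk1 e
        have hf : Function.Injective f := hs.weylSum_injective rfl rfl hp1 rfl
        have hg : Function.Surjective g := hs.weylAct_surjective (by omega) hk1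
        refine free_of_exact f g hf ?_ hg
        intro x
        constructor
        · exact hs.exists_weylSum rfl rfl hp1 rfl hk1 x
        · rintro ⟨y, rfl⟩
          exact hs.weylAct_weylSum rfl rfl hp1 rfl hk1 y

end Free

/-! ### The canonical element of the exterior powers -/

section EvExt
variable {R : Type u} [CommRing R] {M : Type u} [AddCommGroup M] [Module R M]
  {P : Type u} [AddCommGroup P] [Module R P]

lemma evExtList_zero (l : List (Module.Dual R M × M)) :
    evExtList 0 l = extProd R 0 [] ⊗ₜ[R] extProd R 0 [] := by
  simp [evExtList]

lemma extMap_extProd_nil (f : M →ₗ[R] P) :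
    extMap f rfl (extProd R 0 ([] : List M)) = extProd R 0 [] := by
  apply Subtype.ext
  rw [extMap_coe, extProd_coe (by simp), extProd_coe (by simp)]
  simp

lemma extMap_wedgeLeft (f : M →ₗ[R] P) {n k : ℤ} (h : k = n + 1) (v : M) (x : ExtPow R M n) :
    extMap f rfl (wedgeLeft h v x) = wedgeLeft h (f v) (extMap f rfl x) :=
  Subtype.ext (by
    change ExteriorAlgebra.map f (ExteriorAlgebra.ι R v * x.1) =
      ExteriorAlgebra.ι R (f v) * ExteriorAlgebra.map f x.1
    rw [map_mul, ExteriorAlgebra.map_apply_ι])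

lemma evExtList_map (f : Module.Dual R M →ₗ[R] Module.Dual R P) (g : M →ₗ[R] P)
    (l : List (Module.Dual R M × M)) : ∀ {k : ℤ}, 0 ≤ k →
      evExtList k (l.map (Prod.map f g)) =
        TensorProduct.map (extMap f rfl) (extMap g rfl) (evExtList k l) := by
  induction l with
  | nil =>
    intro k hk
    rcases hk.eq_or_lt with rfl | hk
    · rw [evExtList_zero, evExtList_zero, TensorProduct.map_tmul, extMap_extProd_nil,
        extMap_extProd_nil]
    · rw [List.map_nil, evExtList_nil hk, evExtList_nil hk, map_zero]
  | cons a l ih =>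
    intro k hk
    rcases hk.eq_or_lt with rfl | hk
    · rw [evExtList_zero, evExtList_zero, TensorProduct.map_tmul, extMap_extProd_nil,
        extMap_extProd_nil]
    · have h1 : k = k - 1 + 1 := by omega
      rw [List.map_cons, evExtList_cons (by omega) h1, evExtList_cons (by omega) h1,
        ih (by omega), ih (by omega), map_add, map_map_apply, map_map_apply]
      congr 3
      · exact LinearMap.ext fun x => (extMap_wedgeVec f h1 rfl rfl h1 a.1 x).symm
      · exact LinearMap.ext fun x => (extMap_wedgeLeft g h1 a.2 x).symm

/-- The operator `tOp` depends only on the tensor `∑ φ ⊗ v`. -/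
lemma tOp_eq_lift {k k' : ℤ} (h : k' = k + 1) (l : List (Module.Dual R M × M)) :
    tOp h l = TensorProduct.lift
      ((TensorProduct.mapBilinear (RingHom.id R) _ _ _ _).compl₁₂ (wedgeVec h)
        ((TensorProduct.mk R (ExtPow R M k) (SymPow R M 1)).flip ∘ₗ symOne R M))
      (l.map fun a => a.1 ⊗ₜ[R] a.2).sum := by
  rw [tOp, map_list_sum, List.map_map]
  rfl

variable [Nontrivial R] [Module.Free R M] [Module.Finite R M] [Module.Free R P] [Module.Finite R P]

/-- The map `x ↦ κ (x ⊗ 1)` is injective on `⋀ᵏ M` for `1 ≤ k`, as `⋀ᵏ⁺¹ M ⊗ Sym_{-1} M = 0`. -/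
lemma kappaAux_injective {k k' : ℤ} (hk : 1 ≤ k) (h : k' = k - 1) :
    Function.Injective (kappaAux (R := R) (G := M) h) := by
  have h1 : Function.Injective (kappa (R := R) (G := M) h (show (1 : ℤ) = 0 + 1 by omega)) := by
    rw [injective_iff_map_eq_zero]
    intro x hx
    obtain ⟨w, hw⟩ := kappa_exact (p₁ := k + 1) (q₁ := -1) h (by omega) (by omega) (by omega)
      (by omega) x hx
    have := symPow_subsingleton_neg (R := R) (P := M) (show (-1 : ℤ) < 0 by omega)
    have := subsingleton_tensor_right (R := R) (A := ExtPow R M (k + 1)) (B := SymPow R M (-1))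
    rw [← hw, Subsingleton.elim w 0, map_zero]
  have h2 : Function.Injective (LinearMap.lTensor (ExtPow R M k) (symZero (R := R) M)) :=
    Module.Flat.lTensor_preserves_injective_linearMap _ (symZero_bijective M).1
  have h3 : kappaAux (R := R) (G := M) h = kappa h (show (1 : ℤ) = 0 + 1 by omega) ∘ₗ
      LinearMap.lTensor _ (symZero M) ∘ₗ (TensorProduct.rid R _).symm.toLinearMap := by
    refine LinearMap.ext fun x => ?_
    simp only [kappaAux, LinearMap.comp_apply, LinearEquiv.coe_coe, TensorProduct.rid_symm_apply,
      LinearMap.lTensor_tmul, symZero, LinearMap.toSpanSingleton_apply, one_smul]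
    rfl
  rw [h3, LinearMap.coe_comp, LinearMap.coe_comp]
  exact h1.comp (h2.comp (LinearEquiv.injective (TensorProduct.rid R (ExtPow R M k)).symm))

/-- The element of `⋀ᵏ (M*) ⊗ ⋀ᵏ M` formed from a list of pairs depends only on the tensor
`∑ φ ⊗ v`: it is determined inductively, as `κ` is injective on `⋀ᵏ M ⊗ Sym₀ M` for `1 ≤ k`. -/
lemma evExtList_congr (l l' : List (Module.Dual R M × M))
    (h : (l.map fun a => a.1 ⊗ₜ[R] a.2).sum = (l'.map fun a => a.1 ⊗ₜ[R] a.2).sum) (k : ℕ) :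
    evExtList (k : ℤ) l = evExtList (k : ℤ) l' := by
  induction k with
  | zero => rw [Nat.cast_zero, evExtList_zero, evExtList_zero]
  | succ k ih =>
    have hk : (k : ℤ) = ((k + 1 : ℕ) : ℤ) - 1 := by push_cast; omega
    have hk' : ((k + 1 : ℕ) : ℤ) = k + 1 := by push_cast; rfl
    have hinj : Function.Injective (LinearMap.lTensor
        (ExtPow R (Module.Dual R M) ((k + 1 : ℕ) : ℤ)) (kappaAux (R := R) (G := M) hk)) :=
      Module.Flat.lTensor_preserves_injective_linearMap _ (kappaAux_injective (by omega) hk)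
    apply hinj
    rw [kappaAux_evExtList _ (by omega) hk hk', kappaAux_evExtList _ (by omega) hk hk', ih,
      tOp_eq_lift, tOp_eq_lift, h]

/-- The canonical element of `⋀ᵏ (M*) ⊗ ⋀ᵏ M` can be computed with any list of pairs that represents
the canonical element of `M* ⊗ M`. -/
lemma evExt_eq {k : ℤ} (hk : 0 ≤ k) (l : List (Module.Dual R M × M))
    (h : (l.map fun a => a.1 ⊗ₜ[R] a.2).sum = evStar R M) : evExt R M k = evExtList k l := by
  lift k to ℕ using hk
  refine evExtList_congr _ _ ?_ k
  rw [h, List.map_ofFn, List.sum_ofFn, evStar_eq_sum (Module.finBasis R M)]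
  rfl

variable {ic : M →ₗ[R] P} {π : P →ₗ[R] M} {e : P} {ε : Module.Dual R P}

/-- The canonical element of `⋀ᵏ⁺¹ (P*) ⊗ ⋀ᵏ⁺¹ P` for `P = M ⊕ R e`. -/
lemma LineSplit.evExt_split (hs : LineSplit ic π e ε) {k k' : ℤ} (hk : 0 ≤ k) (h : k' = k + 1) :
    evExt R P k' =
      TensorProduct.map (extMap π.dualMap rfl) (extMap ic rfl) (evExt R M k') +
      TensorProduct.map (wedgeVec h ε ∘ₗ extMap π.dualMap rfl) (wedgeLeft h e ∘ₗ extMap ic rfl)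
        (evExt R M k) := by
  set l := List.ofFn fun i => ((Module.finBasis R M).coord i, Module.finBasis R M i) with hl
  have hsum : (l.map fun a => a.1 ⊗ₜ[R] a.2).sum = evStar R M := by
    rw [hl, List.map_ofFn, List.sum_ofFn, evStar_eq_sum (Module.finBasis R M)]
    rfl
  have hev : evStar R P = TensorProduct.map π.dualMap ic (evStar R M) + ε ⊗ₜ e := by
    have h1 := hs.evSum_split (TensorProduct.mk R (Module.Dual R P) P)
    have h2 : ∀ x, TensorProduct.lift (TensorProduct.mk R (Module.Dual R P) P) x = x := fun x => by
      rw [TensorProduct.lift_mk]; rfl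
    rw [evSum, h2] at h1
    rw [h1]
    rfl
  rw [evExt_eq (by omega) ((ε, e) :: l.map (Prod.map π.dualMap ic)), evExtList_cons hk h,
    evExtList_map _ _ _ (by omega), evExtList_map _ _ _ hk, map_map_apply]
  · rfl
  · rw [List.map_cons, List.sum_cons, hev, add_comm, ← hsum, map_list_sum, List.map_map,
      List.map_map]
    rfl

end EvExt

/-! ### Koszul maps of a block sum with an isomorphism of lines -/

section Block
variable {R : Type u} [CommRing R] {M P N Q : Type u} [AddCommGroup M] [Module R M]
  [AddCommGroup P] [Module R P] [AddCommGroup N] [Module R N] [AddCommGroup Q] [Module R Q]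
  {ic : M →ₗ[R] P} {π : P →ₗ[R] M} {e : P} {ε : Module.Dual R P}
  {jc : N →ₗ[R] Q} {ρ : Q →ₗ[R] N} {f : Q} {φ : Module.Dual R Q}
  {Φ : Module.Dual R P →ₗ[R] Q} {Φ' : Module.Dual R M →ₗ[R] N}

/-- The map `Φ` is the direct sum of `Φ' : M* → N` and of the isomorphism of lines `ε ↦ f`, with
respect to decompositions `P = M ⊕ R e` and `Q = N ⊕ R f`. -/
structure BlockSplit (ic : M →ₗ[R] P) (π : P →ₗ[R] M) (e : P) (ε : Module.Dual R P)
    (jc : N →ₗ[R] Q) (ρ : Q →ₗ[R] N) (f : Q) (φ : Module.Dual R Q)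
    (Φ : Module.Dual R P →ₗ[R] Q) (Φ' : Module.Dual R M →ₗ[R] N) : Prop where
  source : LineSplit ic π e ε
  target : LineSplit jc ρ f φ
  map_dual : ∀ δ, Φ (π.dualMap δ) = jc (Φ' δ)
  map_coeff : Φ ε = f

lemma LineSplit.extCo_wedgeVec_incl (hs : LineSplit ic π e ε) {n k n₁ k' : ℤ} (h : k = n + 1)
    (h' : k' = k - 1) (hn : n₁ = n - 1) (hk' : k' = n₁ + 1) (m : M) (x : ExtPow R P n) :
    extCo π ε h' (wedgeVec h (ic m) x) = (-1 : R) • wedgeVec hk' m (extCo π ε hn x) := by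
  rw [extCo_wedgeVec π ε h h' hn hk' (by omega), hs.coeff_incl, hs.proj_incl, zero_smul, zero_sub]
  exact (neg_one_smul R _).symm

lemma LineSplit.extCo_wedgeVec_self (hs : LineSplit ic π e ε) {n k k' : ℤ} (h : k = n + 1)
    (h' : k' = k - 1) (hk : k' = n) (x : ExtPow R P n) :
    extCo π ε h' (wedgeVec h e x) = extMap π hk x := by
  rw [extCo_wedgeVec π ε h h' rfl (by omega) hk, hs.coeff_e, hs.proj_e, one_smul, map_zero]
  simp

lemma LineSplit.extMap_wedgeVec_incl (hs : LineSplit ic π e ε) {n k n' k' : ℤ} (h : k = n + 1)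
    (hk : k' = k) (hn : n' = n) (h' : k' = n' + 1) (m : M) (x : ExtPow R P n) :
    extMap π hk (wedgeVec h (ic m) x) = wedgeVec h' m (extMap π hn x) := by
  rw [extMap_wedgeVec π h hk hn h', hs.proj_incl]

lemma wedgeVec_swap {n k k' l : ℤ} (h : k = n + 1) (h' : l = k + 1) (hk : k' = n + 1)
    (hk' : l = k' + 1) (v w : P) (x : ExtPow R P n) :
    wedgeVec h' v (wedgeVec h w x) = (-1 : R) • wedgeVec hk' w (wedgeVec hk v x) := by
  obtain rfl : k = k' := by omega
  exact (eq_neg_of_add_eq_zero_left (wedgeVec_wedgeVec_add h h' v w x)).trans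
    (neg_one_smul R _).symm

variable [Module.Free R M] [Module.Finite R M] [Module.Free R P] [Module.Finite R P]
  {Y Y' Z Z' : Type*} [AddCommMonoid Y] [Module R Y] [AddCommMonoid Y'] [Module R Y']
  [AddCommMonoid Z] [Module R Z] [AddCommMonoid Z'] [Module R Z']

namespace BlockSplit

lemma evMap_eq (hb : BlockSplit ic π e ε jc ρ f φ Φ Φ') {r r' : ℤ} (hr : r' = r + 1)
    (B : P →ₗ[R] Y →ₗ[R] Y') (z : ExtPow R Q r ⊗[R] Y) :
    evMap (wedgeVec hr ∘ₗ Φ) B z = evMap (wedgeVec hr ∘ₗ jc ∘ₗ Φ') (B ∘ₗ ic) z +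
      TensorProduct.map (wedgeVec hr f) (B e) z := by
  have h1 : (wedgeVec hr ∘ₗ Φ) ∘ₗ π.dualMap = wedgeVec hr ∘ₗ jc ∘ₗ Φ' :=
    LinearMap.ext fun δ => congrArg (wedgeVec hr) (hb.map_dual δ)
  rw [hb.source.evMap_split, h1, LinearMap.comp_apply, hb.map_coeff]

lemma evMap_proj_eq (hb : BlockSplit ic π e ε jc ρ f φ Φ Φ') {r r' : ℤ} (hr : r' = r + 1)
    (B : P →ₗ[R] Y →ₗ[R] Y') (z : ExtPow R N r ⊗[R] Y) :
    evMap (wedgeVec hr ∘ₗ ρ ∘ₗ Φ) B z = evMap (wedgeVec hr ∘ₗ Φ') (B ∘ₗ ic) z := by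
  have h1 : (wedgeVec hr ∘ₗ ρ ∘ₗ Φ) ∘ₗ π.dualMap = wedgeVec hr ∘ₗ Φ' :=
    LinearMap.ext fun δ => congrArg (wedgeVec hr) (by
      rw [LinearMap.comp_apply, hb.map_dual, hb.target.proj_incl])
  rw [hb.source.evMap_split, h1, LinearMap.comp_apply, LinearMap.comp_apply, hb.map_coeff,
    hb.target.proj_e, map_zero, TensorProduct.map_zero_left, LinearMap.zero_apply, add_zero]

lemma map_extCo_evMap (hb : BlockSplit ic π e ε jc ρ f φ Φ Φ') {r r' r₁ r₁' : ℤ} (hr : r' = r + 1)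
    (h : r₁ = r - 1) (h' : r₁' = r' - 1) (hr₁ : r₁' = r₁ + 1) (hrr : r₁' = r)
    (B : P →ₗ[R] Y →ₗ[R] Y') (B' : M →ₗ[R] Z →ₗ[R] Z') (g : Y →ₗ[R] Z) (g' : Y' →ₗ[R] Z')
    (hg : ∀ m y, g' (B (ic m) y) = B' m (g y)) (z : ExtPow R Q r ⊗[R] Y) :
    TensorProduct.map (extCo ρ φ h') g' (evMap (wedgeVec hr ∘ₗ Φ) B z) =
      (-1 : R) • evMap (wedgeVec hr₁ ∘ₗ Φ') B' (TensorProduct.map (extCo ρ φ h) g z) +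
      TensorProduct.map (extMap ρ hrr) (g' ∘ₗ B e) z := by
  classical
  rw [hb.evMap_eq hr, map_add, map_map_apply]
  congr 1
  · induction z using TensorProduct.induction_on with
    | zero => simp
    | add x y hx hy => simp only [map_add, smul_add, hx, hy]
    | tmul x y =>
      rw [TensorProduct.map_tmul, evMap_tmul _ _ (Module.Free.chooseBasis R M),
        evMap_tmul _ _ (Module.Free.chooseBasis R M), map_sum, Finset.smul_sum]
      refine Finset.sum_congr rfl fun i _ => ?_
      rw [TensorProduct.map_tmul, LinearMap.comp_apply, LinearMap.comp_apply, LinearMap.comp_apply,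
        LinearMap.comp_apply, hb.target.extCo_wedgeVec_incl hr h' h hr₁, hg]
      rfl
  · congr 2
    exact LinearMap.ext fun x => hb.target.extCo_wedgeVec_self hr h' hrr x

lemma map_proj_evMap (hb : BlockSplit ic π e ε jc ρ f φ Φ Φ') {r r' r₁ r₁' : ℤ} (hr : r' = r + 1)
    (h : r₁ = r) (h' : r₁' = r') (hr₁ : r₁' = r₁ + 1)
    (B : P →ₗ[R] Y →ₗ[R] Y') (B' : M →ₗ[R] Z →ₗ[R] Z') (g : Y →ₗ[R] Z) (g' : Y' →ₗ[R] Z')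
    (hg : ∀ m y, g' (B (ic m) y) = B' m (g y)) (z : ExtPow R Q r ⊗[R] Y) :
    TensorProduct.map (extMap ρ h') g' (evMap (wedgeVec hr ∘ₗ Φ) B z) =
      evMap (wedgeVec hr₁ ∘ₗ Φ') B' (TensorProduct.map (extMap ρ h) g z) := by
  classical
  have h0 : extMap ρ h' ∘ₗ wedgeVec hr f = 0 :=
    LinearMap.ext fun x => extMap_wedgeVec_eq_zero ρ hr h' hb.target.proj_e x
  rw [hb.evMap_eq hr, map_add, map_map_apply, h0, TensorProduct.map_zero_left,
    LinearMap.zero_apply, add_zero]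
  induction z using TensorProduct.induction_on with
  | zero => simp
  | add x y hx hy => simp only [map_add, hx, hy]
  | tmul x y =>
    rw [TensorProduct.map_tmul, evMap_tmul _ _ (Module.Free.chooseBasis R M),
      evMap_tmul _ _ (Module.Free.chooseBasis R M), map_sum]
    refine Finset.sum_congr rfl fun i _ => ?_
    rw [TensorProduct.map_tmul, LinearMap.comp_apply, LinearMap.comp_apply, LinearMap.comp_apply,
      LinearMap.comp_apply, hb.target.extMap_wedgeVec_incl hr h' h hr₁, hg]

lemma evMap_map_incl (hb : BlockSplit ic π e ε jc ρ f φ Φ Φ') {r r' r₁ r₁' : ℤ} (hr : r' = r + 1)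
    (h : r = r₁) (h' : r' = r₁') (hr₁ : r₁' = r₁ + 1)
    (B : P →ₗ[R] Y →ₗ[R] Y') (B' : M →ₗ[R] Z →ₗ[R] Z') (g : Z →ₗ[R] Y) (g' : Z' →ₗ[R] Y')
    (hg : ∀ m y, B (ic m) (g y) = g' (B' m y)) (z : ExtPow R N r₁ ⊗[R] Z) :
    evMap (wedgeVec hr ∘ₗ Φ) B (TensorProduct.map (extMap jc h) g z) =
      TensorProduct.map (extMap jc h') g' (evMap (wedgeVec hr₁ ∘ₗ Φ') B' z) +
      TensorProduct.map (wedgeVec hr f ∘ₗ extMap jc h) (B e ∘ₗ g) z := by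
  classical
  rw [hb.evMap_eq hr, map_map_apply]
  congr 1
  induction z using TensorProduct.induction_on with
  | zero => simp
  | add x y hx hy => simp only [map_add, hx, hy]
  | tmul x y =>
    rw [TensorProduct.map_tmul, evMap_tmul _ _ (Module.Free.chooseBasis R M),
      evMap_tmul _ _ (Module.Free.chooseBasis R M), map_sum]
    refine Finset.sum_congr rfl fun i _ => ?_
    rw [TensorProduct.map_tmul, LinearMap.comp_apply, LinearMap.comp_apply, LinearMap.comp_apply,
      LinearMap.comp_apply, extMap_wedgeVec jc hr₁ h' h hr, hg]

lemma evMap_map_wedge (hb : BlockSplit ic π e ε jc ρ f φ Φ Φ') {s r r' r₁ r₁' : ℤ}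
    (hr : r' = r + 1) (hs : r = s + 1) (h : s = r₁) (h' : r = r₁') (hr₁ : r₁' = r₁ + 1)
    (B : P →ₗ[R] Y →ₗ[R] Y') (B' : M →ₗ[R] Z →ₗ[R] Z') (g : Z →ₗ[R] Y) (g' : Z' →ₗ[R] Y')
    (hg : ∀ m y, B (ic m) (g y) = g' (B' m y)) (z : ExtPow R N r₁ ⊗[R] Z) :
    evMap (wedgeVec hr ∘ₗ Φ) B (TensorProduct.map (wedgeVec hs f ∘ₗ extMap jc h) g z) =
      (-1 : R) • TensorProduct.map (wedgeVec hr f ∘ₗ extMap jc h') g'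
        (evMap (wedgeVec hr₁ ∘ₗ Φ') B' z) := by
  classical
  have h0 : wedgeVec hr f ∘ₗ wedgeVec hs f ∘ₗ extMap jc h = 0 :=
    LinearMap.ext fun x => wedgeVec_wedgeVec_self hs hr f _
  rw [hb.evMap_eq hr, map_map_apply, h0, TensorProduct.map_zero_left, LinearMap.zero_apply,
    add_zero]
  induction z using TensorProduct.induction_on with
  | zero => simp
  | add x y hx hy => simp only [map_add, smul_add, hx, hy]
  | tmul x y =>
    rw [TensorProduct.map_tmul, evMap_tmul _ _ (Module.Free.chooseBasis R M),
      evMap_tmul _ _ (Module.Free.chooseBasis R M), map_sum, Finset.smul_sum]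
    refine Finset.sum_congr rfl fun i _ => ?_
    rw [TensorProduct.map_tmul, LinearMap.comp_apply, LinearMap.comp_apply, LinearMap.comp_apply,
      LinearMap.comp_apply, LinearMap.comp_apply, LinearMap.comp_apply, hg,
      extMap_wedgeVec jc hr₁ h' h hs, wedgeVec_swap hs hr hs hr, TensorProduct.smul_tmul']

end BlockSplit

/-- The sign `(-1)ⁿ` in `R`. -/
def sgn (R : Type u) [CommRing R] (n : ℤ) : R := ((n.negOnePow : ℤ) : R)

lemma sgn_succ (n : ℤ) : sgn R (n + 1) = -sgn R n := by
  simp [sgn, Int.negOnePow_succ]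

lemma sgn_mul_self (n : ℤ) : sgn R n * sgn R n = 1 := by
  rw [sgn, ← Int.cast_mul, ← Units.val_mul, Int.units_mul_self]
  simp

lemma negOnePow_smul_eq {A : Type*} [AddCommMonoid A] [Module R A] [Module ℤ A] (n : ℤ) (x : A) :
    (n.negOnePow : ℤ) • x = sgn R n • x := by
  unfold sgn
  rcases Int.units_eq_one_or n.negOnePow with h | h
  · rw [h]; simp
  · rw [h]
    have h1 : ((-1 : ℤˣ) : ℤ) • x + x = 0 := by
      conv_lhs => rw [← one_smul ℤ x, smul_smul, ← add_smul]
      simp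
    have h2 : (((-1 : ℤˣ) : ℤ) : R) • x + x = 0 := by
      conv_lhs => rw [← one_smul R x, smul_smul, ← add_smul]
      simp
    calc _ = ((-1 : ℤˣ) : ℤ) • x + ((((-1 : ℤˣ) : ℤ) : R) • x + x) := by rw [h2, add_zero]
      _ = (((-1 : ℤˣ) : ℤ) : R) • x + (((-1 : ℤˣ) : ℤ) • x + x) := by abel
      _ = _ := by rw [h1, add_zero]

/-! ### The map from the exterior power to the Schur modules -/

lemma wedgeLeft_eq {n k : ℤ} (h : k = n + 1) (v : P) (x : ExtPow R P n) :
    wedgeLeft h v x = sgn R n • wedgeVec h v x := by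
  apply Subtype.ext
  change ExteriorAlgebra.ι R v * x.1 = sgn R n • (x.1 * ExteriorAlgebra.ι R v)
  rw [ι_mul_extPiece v x.2, negOnePow_smul_eq (R := R)]

lemma schurMap_kappaOne {k k₁ p p₁ q q₁ : ℤ} (hp : p = k - 1) (hq : q = 1) (hp₁ : p₁ = p)
    (hq₁ : q₁ = q) (hk : k₁ = k) (hp' : p₁ = k₁ - 1) (hq' : q₁ = 1) (x : ExtPow R P k) :
    schurMap π hp₁ hq₁ (kappaOne hp hq x) = kappaOne hp' hq' (extMap π hk x) := by
  subst hq hq₁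
  apply Subtype.ext
  rw [schurMap_coe]
  refine (kappa_map π hp (show (1 : ℤ) = 0 + 1 by omega) hp' (by omega) hk rfl _).symm.trans ?_
  change kappa _ _ (TensorProduct.map _ _ (x ⊗ₜ _)) = kappa _ _ (_ ⊗ₜ _)
  rw [TensorProduct.map_tmul]
  congr 2
  exact Subtype.ext (map_one (symAlgMap π))

lemma schurCo_kappaOne {k k₁ p p₁ q q₁ : ℤ} (hp : p = k - 1) (hq : q = 1) (hp₁ : p₁ = p - 1)
    (hq₁ : q₁ = q) (hk : k₁ = k - 1) (hp' : p₁ = k₁ - 1) (hq' : q₁ = 1) (x : ExtPow R P k) :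
    schurCo π ε hp₁ hq₁ (kappaOne hp hq x) = kappaOne hp' hq' (extCo π ε hk x) := by
  subst hq hq₁
  apply Subtype.ext
  rw [schurCo_coe]
  refine (kappa_extCo π ε hp (show (1 : ℤ) = 0 + 1 by omega) hp' hk hp₁ _).symm.trans ?_
  change kappa _ _ (TensorProduct.map _ _ (x ⊗ₜ _)) = kappa _ _ (_ ⊗ₜ _)
  rw [TensorProduct.map_tmul]
  congr 2
  exact Subtype.ext (map_one (symAlgMap π))

lemma LineSplit.extCo_wedgeLeft_incl (hs : LineSplit ic π e ε) {n k n₁ : ℤ} (h : k = n + 1)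
    (hn : n₁ = k - 1) (hnn : n₁ = n) (x : ExtPow R M n) :
    extCo π ε hn (wedgeLeft h e (extMap ic rfl x)) = sgn R n • extMap LinearMap.id hnn x := by
  rw [wedgeLeft_eq, map_smul, hs.extCo_wedgeVec_self h hn hnn, hs.extMap_proj_incl]

namespace BlockSplit
variable [Nontrivial R] [Module.Free R Q]

lemma extMap_block (hb : BlockSplit ic π e ε jc ρ f φ Φ Φ') {n : ℤ}
    (x : ExtPow R (Module.Dual R M) n) :
    extMap Φ rfl (extMap π.dualMap rfl x) = extMap jc rfl (extMap Φ' rfl x) := by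
  rw [extMap_extMap, extMap_extMap]
  congr 2
  exact LinearMap.ext hb.map_dual

/-- The component along `f ⊗ 1` of the value at `v` of the map `⋀ Q → ⋀ Q ⊗ L P`. -/
lemma map_schurMap_epsOf (hb : BlockSplit ic π e ε jc ρ f φ Φ Φ') {n k r p q r₁ p₁ q₁ : ℤ}
    (hr : r = n + k) (hp : p = k - 1) (hq : q = 1) (hr₁ : r₁ = r - 1) (hp₁ : p₁ = p)
    (hq₁ : q₁ = q) (hk : 1 ≤ k) (hp' : p₁ = k - 1) (hq' : q₁ = 1) (v : ExtPow R Q n) :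
    TensorProduct.map (extCo ρ φ hr₁) (schurMap π hp₁ hq₁)
        (epsOf Φ hr hp hq (evExt R P k) v) =
      TensorProduct.map (extCo ρ φ hr₁ ∘ₗ wedge hr v ∘ₗ extMap jc rfl ∘ₗ extMap Φ' rfl)
        (kappaOne hp' hq') (evExt R M k) := by
  have hk1 : k = (k - 1) + 1 := by omega
  rw [epsOf_apply, map_map_apply, hb.source.evExt_split (by omega) hk1, map_add, map_map_apply,
    map_map_apply]
  have h1 : (schurMap π hp₁ hq₁ ∘ₗ kappaOne hp hq) ∘ₗ wedgeLeft hk1 e ∘ₗ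
      extMap ic rfl = 0 := by
    refine LinearMap.ext fun x => ?_
    simp only [LinearMap.comp_apply]
    rw [schurMap_kappaOne hp hq hp₁ hq₁ rfl hp' hq', wedgeLeft_eq, map_smul,
      extMap_wedgeVec_eq_zero π hk1 rfl hb.source.proj_e]
    simp
  have h2 : (schurMap π hp₁ hq₁ ∘ₗ kappaOne hp hq) ∘ₗ extMap ic rfl = kappaOne hp' hq' := by
    refine LinearMap.ext fun x => ?_
    simp only [LinearMap.comp_apply]
    rw [schurMap_kappaOne hp hq hp₁ hq₁ rfl hp' hq', hb.source.extMap_proj_incl, extMap_id]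
  rw [h1, h2, TensorProduct.map_zero_right, LinearMap.zero_apply, add_zero]
  congr 2
  refine LinearMap.ext fun x => ?_
  simp only [LinearMap.comp_apply]
  rw [hb.extMap_block]

/-- The component along `f ⊗ e` of the value at `v` of the map `⋀ Q → ⋀ Q ⊗ L P`. -/
lemma map_schurCo_epsOf (hb : BlockSplit ic π e ε jc ρ f φ Φ Φ') {n k k₁ r r₀ p q r₁ p₁ q₁ : ℤ}
    (hr : r = n + k) (hp : p = k - 1) (hq : q = 1) (hr₁ : r₁ = r - 1) (hp₁ : p₁ = p - 1)
    (hq₁ : q₁ = q) (hk : 0 ≤ k₁) (hk₁ : k = k₁ + 1) (hp' : p₁ = k₁ - 1) (hq' : q₁ = 1)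
    (hr₀ : r₀ = n + k₁) (hrr : r = r₀ + 1) (v : ExtPow R Q n) :
    TensorProduct.map (extCo ρ φ hr₁) (schurCo π ε hp₁ hq₁)
        (epsOf Φ hr hp hq (evExt R P k) v) =
      sgn R k₁ • TensorProduct.map (extMap ρ (by omega) ∘ₗ wedge hr₀ v ∘ₗ extMap jc rfl ∘ₗ
        extMap Φ' rfl) (kappaOne hp' hq') (evExt R M k₁) := by
  have hk₁' : k₁ = k - 1 := by omega
  rw [epsOf_apply, map_map_apply, hb.source.evExt_split hk hk₁, map_add, map_map_apply,
    map_map_apply]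
  have h1 : (schurCo π ε hp₁ hq₁ ∘ₗ kappaOne hp hq) ∘ₗ wedgeLeft hk₁ e ∘ₗ
      extMap ic rfl = sgn R k₁ • (kappaOne hp' hq' : ExtPow R M k₁ →ₗ[R] schurLPos R M p₁ q₁) := by
    refine LinearMap.ext fun x => ?_
    simp only [LinearMap.comp_apply]
    rw [schurCo_kappaOne hp hq hp₁ hq₁ hk₁' hp' hq',
      hb.source.extCo_wedgeLeft_incl hk₁ hk₁' rfl, extMap_id, (kappaOne hp' hq').map_smul]
    rfl
  have h2 : (schurCo π ε hp₁ hq₁ ∘ₗ kappaOne hp hq) ∘ₗ extMap ic rfl = 0 := by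
    refine LinearMap.ext fun x => ?_
    simp only [LinearMap.comp_apply]
    rw [schurCo_kappaOne hp hq hp₁ hq₁ hk₁' hp' hq', hb.source.extCo_extMap_incl]
    simp
  rw [h1, h2, TensorProduct.map_zero_right, LinearMap.zero_apply, zero_add,
    TensorProduct.map_smul_right, LinearMap.smul_apply]
  congr 3
  refine LinearMap.ext fun x => ?_
  simp only [LinearMap.comp_apply]
  rw [wedge_extMap_wedgeVec Φ hk₁ hr hr₀ hrr, hb.map_coeff, hb.extMap_block,
    hb.target.extCo_wedgeVec_self hrr hr₁ (by omega)]

/-- On `⋀ N` the component along `f ⊗ 1` vanishes. -/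
lemma map_schurMap_epsOf_incl (hb : BlockSplit ic π e ε jc ρ f φ Φ Φ') {n n₀ k r p q r₁ p₁ q₁ : ℤ}
    (hr : r = n + k) (hp : p = k - 1) (hq : q = 1) (hr₁ : r₁ = r - 1) (hp₁ : p₁ = p)
    (hq₁ : q₁ = q) (hk : 1 ≤ k) (hn : n = n₀) (u : ExtPow R N n₀) :
    TensorProduct.map (extCo ρ φ hr₁) (schurMap π hp₁ hq₁)
        (epsOf Φ hr hp hq (evExt R P k) (extMap jc hn u)) = 0 := by
  rw [hb.map_schurMap_epsOf hr hp hq hr₁ hp₁ hq₁ hk (by omega) (by omega)]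
  have h1 : extCo ρ φ hr₁ ∘ₗ wedge hr (extMap jc hn u) ∘ₗ extMap jc rfl ∘ₗ
      extMap (n := k) Φ' rfl = 0 := by
    refine LinearMap.ext fun x => ?_
    simp only [LinearMap.comp_apply]
    have : wedge hr (extMap jc hn u) (extMap jc rfl (extMap Φ' rfl x)) =
        extMap jc rfl (wedge (show r = n₀ + k by omega) u (extMap Φ' rfl x)) :=
      Subtype.ext (map_mul (ExteriorAlgebra.map jc) _ _).symm
    rw [this, hb.target.extCo_extMap_incl]
    rfl
  rw [h1, TensorProduct.map_zero_left, LinearMap.zero_apply]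

lemma map_schurMap_epsOf_wedge (hb : BlockSplit ic π e ε jc ρ f φ Φ Φ')
    {n n₀ n₁ k r p q r₁ p₁ q₁ : ℤ}
    (hr : r = n + k) (hp : p = k - 1) (hq : q = 1) (hr₁ : r₁ = r - 1) (hp₁ : p₁ = p)
    (hq₁ : q₁ = q) (hk : 1 ≤ k) (hn : n₁ = n₀) (hn₁ : n = n₁ + 1) (hr₀ : r₁ = n₀ + k)
    (hp' : p₁ = k - 1) (hq' : q₁ = 1) (u : ExtPow R N n₀) :
    TensorProduct.map (extCo ρ φ hr₁) (schurMap π hp₁ hq₁)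
        (epsOf Φ hr hp hq (evExt R P k) (wedgeVec hn₁ f (extMap jc hn u))) =
      sgn R k • epsOf Φ' hr₀ hp' hq' (evExt R M k) u := by
  subst hn
  rw [hb.map_schurMap_epsOf hr hp hq hr₁ hp₁ hq₁ hk hp' hq', epsOf_apply, ← LinearMap.smul_apply,
    ← TensorProduct.map_smul_left]
  congr 2
  refine LinearMap.ext fun x => ?_
  simp only [LinearMap.comp_apply, LinearMap.smul_apply]
  have h1 : wedge hr (wedgeVec hn₁ f (extMap jc rfl u)) (extMap jc rfl (extMap Φ' rfl x)) =
      sgn R k • wedgeVec (show r = r₁ + 1 by omega) f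
        (extMap jc rfl (wedge hr₀ u (extMap Φ' rfl x))) := by
    apply Subtype.ext
    change ExteriorAlgebra.map jc u.1 * ExteriorAlgebra.ι R f *
        ExteriorAlgebra.map jc (ExteriorAlgebra.map Φ' x.1) =
      sgn R k • (ExteriorAlgebra.map jc (u.1 * ExteriorAlgebra.map Φ' x.1) *
        ExteriorAlgebra.ι R f)
    rw [mul_assoc, ι_mul_extPiece f (map_mem_extPiece jc (map_mem_extPiece Φ' x.2)),
      negOnePow_smul_eq (R := R), mul_smul_comm, map_mul, mul_assoc]
  rw [h1, map_smul, hb.target.extCo_wedgeVec_self _ hr₁ rfl, hb.target.extMap_proj_incl, extMap_id]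

lemma map_schurCo_epsOf_incl (hb : BlockSplit ic π e ε jc ρ f φ Φ Φ')
    {n n₀ k k₁ r p q r₁ p₁ q₁ : ℤ}
    (hr : r = n + k) (hp : p = k - 1) (hq : q = 1) (hr₁ : r₁ = r - 1) (hp₁ : p₁ = p - 1)
    (hq₁ : q₁ = q) (hk : 0 ≤ k₁) (hk₁ : k = k₁ + 1) (hn : n = n₀) (hp' : p₁ = k₁ - 1)
    (hq' : q₁ = 1) (hr₀ : r₁ = n₀ + k₁) (u : ExtPow R N n₀) :
    TensorProduct.map (extCo ρ φ hr₁) (schurCo π ε hp₁ hq₁)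
        (epsOf Φ hr hp hq (evExt R P k) (extMap jc hn u)) =
      sgn R k₁ • epsOf Φ' hr₀ hp' hq' (evExt R M k₁) u := by
  subst hn
  rw [hb.map_schurCo_epsOf hr hp hq hr₁ hp₁ hq₁ hk hk₁ hp' hq' hr₀ (by omega), epsOf_apply]
  congr 3
  refine LinearMap.ext fun x => ?_
  simp only [LinearMap.comp_apply]
  have : wedge hr₀ (extMap jc rfl u) (extMap jc rfl (extMap Φ' rfl x)) =
      extMap jc rfl (wedge hr₀ u (extMap Φ' rfl x)) :=
    Subtype.ext (map_mul (ExteriorAlgebra.map jc) _ _).symm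
  rw [this, hb.target.extMap_proj_incl, extMap_id]

lemma map_schurCo_epsOf_wedge (hb : BlockSplit ic π e ε jc ρ f φ Φ Φ')
    {n n₀ n₁ k k₁ r p q r₁ p₁ q₁ : ℤ}
    (hr : r = n + k) (hp : p = k - 1) (hq : q = 1) (hr₁ : r₁ = r - 1) (hp₁ : p₁ = p - 1)
    (hq₁ : q₁ = q) (hk : 0 ≤ k₁) (hk₁ : k = k₁ + 1) (hn : n₁ = n₀) (hn₁ : n = n₁ + 1)
    (u : ExtPow R N n₀) :
    TensorProduct.map (extCo ρ φ hr₁) (schurCo π ε hp₁ hq₁)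
        (epsOf Φ hr hp hq (evExt R P k) (wedgeVec hn₁ f (extMap jc hn u))) = 0 := by
  rw [hb.map_schurCo_epsOf hr hp hq hr₁ hp₁ hq₁ hk hk₁ (by omega) (by omega) rfl (by omega)]
  have h1 : extMap ρ (show r₁ = n + k₁ by omega) ∘ₗ wedge rfl (wedgeVec hn₁ f (extMap jc hn u)) ∘ₗ
      extMap jc rfl ∘ₗ extMap (n := k₁) Φ' rfl = 0 := by
    refine LinearMap.ext fun x => Subtype.ext ?_
    change ExteriorAlgebra.map ρ (ExteriorAlgebra.map jc u.1 * ExteriorAlgebra.ι R f * _) = 0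
    rw [map_mul, map_mul, ExteriorAlgebra.map_apply_ι, hb.target.proj_e]
    simp
  rw [h1, TensorProduct.map_zero_left, LinearMap.zero_apply, smul_zero]

end BlockSplit
end Block

/-! ### The map from the Weyl modules to the exterior power -/

section Mu
variable {R : Type u} [CommRing R] {M P N Q : Type u} [AddCommGroup M] [Module R M]
  [AddCommGroup P] [Module R P] [AddCommGroup N] [Module R N] [AddCommGroup Q] [Module R Q]
  {ic : M →ₗ[R] P} {π : P →ₗ[R] M} {e : P} {ε : Module.Dual R P}
  {jc : N →ₗ[R] Q} {ρ : Q →ₗ[R] N} {f : Q} {φ : Module.Dual R Q}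
  {Φ : Module.Dual R P →ₗ[R] Q} {Φ' : Module.Dual R M →ₗ[R] N}

lemma divEval_divMap (g : P →ₗ[R] M) {q q₁ : ℤ} (h : q₁ = q) (y : DivPow R M q) :
    divEval (divMap g h y) = divEval y := by
  subst h
  unfold divEval
  split_ifs with h
  · subst h
    exact congrArg y (Subtype.ext (map_one (symAlgMap g)))
  · rfl

variable [Module.Free R M] [Module.Finite R M] [Module.Free R P] [Module.Finite R P]

lemma BlockSplit.extPhi_incl (hb : BlockSplit ic π e ε jc ρ f φ Φ Φ') {a q : ℤ}
    (x : ExtPow R (Module.Dual R M) a ⊗[R] DivPow R M q) :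
    extPhi Φ (TensorProduct.map (extMap π.dualMap rfl) (divMap π rfl) x) =
      extMap jc rfl (extPhi Φ' x) := by
  induction x using TensorProduct.induction_on with
  | zero => simp
  | add x y hx hy => simp only [map_add, hx, hy]
  | tmul x y =>
    rw [TensorProduct.map_tmul, extPhi_tmul, extPhi_tmul, divEval_divMap, map_smul, extMap_extMap,
      extMap_extMap]
    congr 3
    exact LinearMap.ext hb.map_dual

lemma BlockSplit.extPhi_wedge (hb : BlockSplit ic π e ε jc ρ f φ Φ Φ') {a a₁ q : ℤ}
    (ha : a = a₁ + 1) (x : ExtPow R (Module.Dual R M) a₁ ⊗[R] DivPow R M q) :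
    extPhi Φ (TensorProduct.map (wedgeVec ha ε ∘ₗ extMap π.dualMap rfl) (divMap π rfl) x) =
      wedgeVec ha f (extMap jc rfl (extPhi Φ' x)) := by
  induction x using TensorProduct.induction_on with
  | zero => simp
  | add x y hx hy => simp only [map_add, hx, hy]
  | tmul x y =>
    rw [TensorProduct.map_tmul, extPhi_tmul, extPhi_tmul, divEval_divMap, map_smul, map_smul,
      LinearMap.comp_apply, extMap_wedgeVec Φ ha rfl rfl ha, hb.map_coeff, extMap_extMap,
      extMap_extMap]
    congr 4
    exact LinearMap.ext hb.map_dual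

lemma BlockSplit.muAmb_incl (hb : BlockSplit ic π e ε jc ρ f φ Φ Φ') {r r₁ a q : ℤ}
    (hr : r = r₁) (x : ExtPow R N r₁ ⊗[R] weylK R M a q) :
    (muAmb Φ (TensorProduct.map (extMap jc hr) (weylMap π rfl rfl) x)).1 =
      ExteriorAlgebra.map jc (muAmb Φ' x).1 := by
  subst hr
  induction x using TensorProduct.induction_on with
  | zero => simp
  | add x y hx hy => simp only [map_add, Submodule.coe_add, hx, hy]
  | tmul x y =>
    change (ExteriorAlgebra.map jc x.1) * (extPhi Φ (TensorProduct.map _ _ y.1)).1 =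
      ExteriorAlgebra.map jc (x.1 * (extPhi Φ' y.1).1)
    rw [hb.extPhi_incl, map_mul]
    rfl

lemma BlockSplit.muAmb_wedge (hb : BlockSplit ic π e ε jc ρ f φ Φ Φ') {r r₁ a a₁ q q₁ : ℤ}
    (hr : r = r₁) (ha : a = a₁ + 1) (hq : q = q₁) (x : ExtPow R N r₁ ⊗[R] weylK R M a₁ q₁) :
    (muAmb Φ (TensorProduct.map (extMap jc hr) (weylWedge ha hq ε ∘ₗ weylMap π rfl rfl) x)).1 =
      ExteriorAlgebra.map jc (muAmb Φ' x).1 * ExteriorAlgebra.ι R f := by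
  subst hr hq
  induction x using TensorProduct.induction_on with
  | zero => simp
  | add x y hx hy => simp only [map_add, Submodule.coe_add, hx, hy, add_mul]
  | tmul x y =>
    have h1 : (weylWedge ha rfl ε (weylMap π rfl rfl y)).1 = TensorProduct.map
        (wedgeVec ha ε ∘ₗ extMap π.dualMap rfl) (divMap π rfl) y.1 := by
      rw [weylWedge_coe, weylMap_coe, map_map_apply]
      congr 2
      exact LinearMap.ext fun y => divMap_id rfl _
    change (ExteriorAlgebra.map jc x.1) *
        (extPhi Φ (weylWedge ha rfl ε (weylMap π rfl rfl y)).1).1 =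
      ExteriorAlgebra.map jc (x.1 * (extPhi Φ' y.1).1) * ExteriorAlgebra.ι R f
    rw [h1, hb.extPhi_wedge, map_mul, mul_assoc]
    rfl

end Mu

/-! ### Exact sequences of tensor products -/

section Tensor
variable {R : Type u} [CommRing R]

/-- Right exactness of the tensor product, for modules that are not given as additive groups. -/
lemma lTensor_exact_addCommMonoid {A B C : Type*} [AddCommMonoid A] [Module R A] [AddCommMonoid B]
    [Module R B] [AddCommMonoid C] [Module R C] (X : Type*) [AddCommMonoid X] [Module R X]
    {f : A →ₗ[R] B} {g : B →ₗ[R] C} (h : Function.Exact f g) (hg : Function.Surjective g) :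
    Function.Exact (LinearMap.lTensor X f) (LinearMap.lTensor X g) := by
  let _ := Module.addCommMonoidToAddCommGroup R (M := A)
  let _ := Module.addCommMonoidToAddCommGroup R (M := B)
  let _ := Module.addCommMonoidToAddCommGroup R (M := C)
  let _ := Module.addCommMonoidToAddCommGroup R (M := X)
  exact lTensor_exact X h hg

variable {A B C₁ C₂ : Type*} [AddCommMonoid A] [Module R A] [AddCommMonoid B]
    [Module R B] [AddCommMonoid C₁] [Module R C₁] [AddCommMonoid C₂] [Module R C₂]
    (X : Type*) [AddCommMonoid X] [Module R X]

/-- Right exactness of the tensor product for an exact sequence `A → B → C₁ ⊕ C₂ → 0`. -/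
lemma exists_lTensor_of_prod {f : A →ₗ[R] B} {g₁ : B →ₗ[R] C₁} {g₂ : B →ₗ[R] C₂}
    (h₁ : ∀ x, g₁ (f x) = 0) (h₂ : ∀ x, g₂ (f x) = 0)
    (h : ∀ y, g₁ y = 0 → g₂ y = 0 → ∃ x, f x = y) (hg : ∀ a b, ∃ y, g₁ y = a ∧ g₂ y = b)
    (z : X ⊗[R] B) (hz₁ : LinearMap.lTensor X g₁ z = 0) (hz₂ : LinearMap.lTensor X g₂ z = 0) :
    ∃ w, LinearMap.lTensor X f w = z := by
  have hex : Function.Exact f (LinearMap.prod g₁ g₂) := fun y =>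
    ⟨fun hy => h y (congrArg Prod.fst hy) (congrArg Prod.snd hy), by
      rintro ⟨x, rfl⟩
      exact Prod.ext (h₁ x) (h₂ x)⟩
  have hsurj : Function.Surjective (LinearMap.prod g₁ g₂) := fun ⟨a, b⟩ => by
    obtain ⟨y, h1, h2⟩ := hg a b
    exact ⟨y, Prod.ext h1 h2⟩
  refine (lTensor_exact_addCommMonoid X hex hsurj z).1 ?_
  apply (TensorProduct.prodRight R R X C₁ C₂).injective
  have h3 : ∀ z,
      TensorProduct.prodRight R R X C₁ C₂ (LinearMap.lTensor X (LinearMap.prod g₁ g₂) z) =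
      (LinearMap.lTensor X g₁ z, LinearMap.lTensor X g₂ z) := fun z => by
    induction z using TensorProduct.induction_on with
    | zero => simp only [map_zero]; rfl
    | add x y hx hy => simp only [map_add, hx, hy, Prod.mk_add_mk]
    | tmul x y => simp
  rw [h3, hz₁, hz₂, map_zero]
  rfl

lemma exists_lTensor_eq_of_prod {g₁ : B →ₗ[R] C₁} {g₂ : B →ₗ[R] C₂}
    (hg : ∀ a b, ∃ y, g₁ y = a ∧ g₂ y = b) (a : X ⊗[R] C₁) (b : X ⊗[R] C₂) :
    ∃ z, LinearMap.lTensor X g₁ z = a ∧ LinearMap.lTensor X g₂ z = b := by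
  have h1 : ∀ a : X ⊗[R] C₁, ∃ z, LinearMap.lTensor X g₁ z = a ∧ LinearMap.lTensor X g₂ z = 0 := by
    intro a
    induction a using TensorProduct.induction_on with
    | zero => exact ⟨0, map_zero _, map_zero _⟩
    | add x y hx hy =>
      obtain ⟨z, rfl, h⟩ := hx
      obtain ⟨w, rfl, h'⟩ := hy
      exact ⟨z + w, map_add _ _ _, by rw [map_add, h, h', add_zero]⟩
    | tmul x y =>
      obtain ⟨w, h, h'⟩ := hg y 0
      exact ⟨x ⊗ₜ w, by rw [LinearMap.lTensor_tmul, h],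
        by rw [LinearMap.lTensor_tmul, h', tmul_zero]⟩
  have h2 : ∀ b : X ⊗[R] C₂, ∃ z, LinearMap.lTensor X g₁ z = 0 ∧ LinearMap.lTensor X g₂ z = b := by
    intro b
    induction b using TensorProduct.induction_on with
    | zero => exact ⟨0, map_zero _, map_zero _⟩
    | add x y hx hy =>
      obtain ⟨z, h, rfl⟩ := hx
      obtain ⟨w, h', rfl⟩ := hy
      exact ⟨z + w, by rw [map_add, h, h', add_zero], map_add _ _ _⟩
    | tmul x y =>
      obtain ⟨w, h, h'⟩ := hg 0 y
      exact ⟨x ⊗ₜ w, by rw [LinearMap.lTensor_tmul, h, tmul_zero],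
        by rw [LinearMap.lTensor_tmul, h']⟩
  obtain ⟨z, h, h'⟩ := h1 a
  obtain ⟨w, k, k'⟩ := h2 b
  exact ⟨z + w, by rw [map_add, h, k, add_zero], by rw [map_add, h', k', zero_add]⟩

end Tensor

/-! ### Schur and Weyl modules tensored with exterior powers -/

section Exact
variable {R : Type u} [CommRing R] {M P N Q : Type u} [AddCommGroup M] [Module R M]
  [AddCommGroup P] [Module R P] [AddCommGroup N] [Module R N] [AddCommGroup Q] [Module R Q]
  {ic : M →ₗ[R] P} {π : P →ₗ[R] M} {e : P} {ε : Module.Dual R P}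
  {jc : N →ₗ[R] Q} {ρ : Q →ₗ[R] N} {f : Q} {φ : Module.Dual R Q}

section Split
variable {Y Z W : Type*} [AddCommMonoid Y] [Module R Y] [AddCommMonoid Z] [Module R Z]
  [AddCommMonoid W] [Module R W]

lemma LineSplit.map_proj_map_incl (hs : LineSplit jc ρ f φ) {r r₁ : ℤ} (h : r = r₁)
    (g : Y →ₗ[R] Z) (g' : Z →ₗ[R] W) (z : ExtPow R N r₁ ⊗[R] Y) :
    TensorProduct.map (extMap ρ h.symm) g' (TensorProduct.map (extMap jc h) g z) =
      LinearMap.lTensor _ (g' ∘ₗ g) z := by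
  rw [map_map_apply, LinearMap.lTensor]
  congr 2
  exact LinearMap.ext fun x => by
    rw [LinearMap.comp_apply, hs.extMap_proj_incl, extMap_id]; rfl

lemma LineSplit.map_proj_map_wedge (hs : LineSplit jc ρ f φ) {r r₀ r₁ r₂ : ℤ} (h : r = r₁ + 1)
    (h₁ : r₁ = r₂) (h₀ : r₀ = r) (g : Y →ₗ[R] Z) (g' : Z →ₗ[R] W) (z : ExtPow R N r₂ ⊗[R] Y) :
    TensorProduct.map (extMap ρ h₀) g'
      (TensorProduct.map (wedgeVec h f ∘ₗ extMap jc h₁) g z) = 0 := by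
  have h0 : extMap ρ h₀ ∘ₗ wedgeVec h f ∘ₗ extMap jc h₁ = 0 :=
    LinearMap.ext fun x => extMap_wedgeVec_eq_zero ρ h h₀ hs.proj_e _
  rw [map_map_apply, h0, TensorProduct.map_zero_left, LinearMap.zero_apply]

lemma LineSplit.map_extCo_map_incl (hs : LineSplit jc ρ f φ) {r r₁ r₂ : ℤ} (h : r = r₁)
    (h' : r₂ = r - 1) (g : Y →ₗ[R] Z) (g' : Z →ₗ[R] W) (z : ExtPow R N r₁ ⊗[R] Y) :
    TensorProduct.map (extCo ρ φ h') g' (TensorProduct.map (extMap jc h) g z) = 0 := by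
  have h0 : extCo ρ φ h' ∘ₗ extMap jc h = 0 :=
    LinearMap.ext fun x => hs.extCo_extMap_incl h h' x
  rw [map_map_apply, h0, TensorProduct.map_zero_left, LinearMap.zero_apply]

lemma LineSplit.map_extCo_map_wedge (hs : LineSplit jc ρ f φ) {r r₁ r₂ : ℤ} (h : r = r₁ + 1)
    (h₁ : r₁ = r₂) (h' : r₂ = r - 1) (g : Y →ₗ[R] Z) (g' : Z →ₗ[R] W)
    (z : ExtPow R N r₂ ⊗[R] Y) :
    TensorProduct.map (extCo ρ φ h') g'
      (TensorProduct.map (wedgeVec h f ∘ₗ extMap jc h₁) g z) = LinearMap.lTensor _ (g' ∘ₗ g) z := by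
  subst h₁
  rw [map_map_apply, LinearMap.lTensor]
  congr 2
  exact LinearMap.ext fun x => by
    rw [LinearMap.comp_apply, LinearMap.comp_apply, hs.extCo_wedgeVec_self h h' rfl,
      hs.extMap_proj_incl, extMap_id]; rfl

lemma LineSplit.tensor_decomp (hs : LineSplit jc ρ f φ) {r r₀ r₁ r₂ : ℤ} (h : r = r₁ + 1)
    (h₁ : r₁ = r₂) (h' : r₂ = r - 1) (h₀ : r = r₀) (z : ExtPow R Q r ⊗[R] Y) :
    TensorProduct.map (extMap jc h₀) LinearMap.id
        (TensorProduct.map (extMap ρ h₀.symm) LinearMap.id z) +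
      TensorProduct.map (wedgeVec h f ∘ₗ extMap jc h₁) LinearMap.id
        (TensorProduct.map (extCo ρ φ h') LinearMap.id z) = z := by
  subst h₁ h₀
  rw [map_map_apply, map_map_apply, ← LinearMap.add_apply, ← TensorProduct.map_add_left]
  have h7 : extMap jc rfl ∘ₗ extMap ρ rfl +
      (wedgeVec h f ∘ₗ extMap jc rfl) ∘ₗ extCo ρ φ h' = LinearMap.id :=
    LinearMap.ext fun y => hs.ext_decomp rfl h y
  rw [h7]
  exact LinearMap.congr_fun TensorProduct.map_id z

end Split

variable [Nontrivial R] [Module.Free R M] [Module.Finite R M] [Module.Free R P] [Module.Finite R P]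
  [Module.Free R N] [Module.Free R Q]

/-- The map `⋀ʳ N ⊗ L^p_q P ⊕ ⋀ʳ⁻¹ N ⊗ L^p_{q-1} P → ⋀ʳ Q ⊗ L^p_q P`. -/
def schurIncl (jc : N →ₗ[R] Q) (f : Q) (e : P) {p r r₁ r₂ q q₁ : ℤ} (h : r = r₁)
    (h₂ : r = r₂ + 1) (hq : q = q₁ + 1) :
    (ExtPow R N r₁ ⊗[R] schurLPos R P p q) × (ExtPow R N r₂ ⊗[R] schurLPos R P p q₁) →ₗ[R]
      ExtPow R Q r ⊗[R] schurLPos R P p q :=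
  LinearMap.coprod (TensorProduct.map (extMap jc h) LinearMap.id)
    (TensorProduct.map (wedgeVec h₂ f ∘ₗ extMap jc rfl) (schurAct hq e))

lemma schurIncl_injective (hG : LineSplit ic π e ε) (hF : LineSplit jc ρ f φ)
    {p r r₁ r₂ q q₁ : ℤ} (h : r = r₁) (h₂ : r = r₂ + 1) (hq : q = q₁ + 1) :
    Function.Injective (schurIncl (p := p) jc f e h h₂ hq) := by
  subst h
  rintro ⟨x, y⟩ ⟨x', y'⟩ hxy
  simp only [schurIncl, LinearMap.coprod_apply] at hxy
  refine Prod.ext ?_ ?_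
  · have h1 := congrArg (TensorProduct.map (extMap ρ rfl) LinearMap.id) hxy
    rw [map_add, map_add, hF.map_proj_map_incl rfl, hF.map_proj_map_incl rfl,
      hF.map_proj_map_wedge, hF.map_proj_map_wedge, add_zero, add_zero, LinearMap.id_comp,
      LinearMap.lTensor_id_apply, LinearMap.lTensor_id_apply] at h1
    exact h1
  · have h1 := congrArg (TensorProduct.map (extCo ρ φ (show r₂ = r - 1 by omega)) LinearMap.id) hxy
    rw [map_add, map_add, hF.map_extCo_map_incl, hF.map_extCo_map_incl,
      hF.map_extCo_map_wedge, hF.map_extCo_map_wedge, zero_add, zero_add, LinearMap.id_comp] at h1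
    have hinj : Function.Injective (LinearMap.lTensor (ExtPow R N r₂)
        (schurAct (R := R) (G := P) (p := p) hq e)) :=
      Module.Flat.lTensor_preserves_injective_linearMap _ (hG.schurAct_injective hq)
    exact hinj h1

/-- The common kernel of the two projections of `⋀ʳ Q ⊗ L^p_q P` to `⋀ʳ⁻¹ N ⊗ L^p_q M` and to
`⋀ʳ⁻¹ N ⊗ L^{p-1}_q M` is the image of `schurIncl`: the part in `⋀ʳ N` is
unconstrained, and the coefficient of `f` lies in `e L^p_{q-1} P`. -/
lemma exists_schurIncl (hG : LineSplit ic π e ε) (hF : LineSplit jc ρ f φ)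
    {p p₁ p₂ r r₁ r₂ q q₁ q₂ : ℤ} (hp : 1 ≤ p) (h : r = r₁) (h₂ : r = r₂ + 1) (hq : q = q₁ + 1)
    (h₂' : r₂ = r - 1) (hp₁ : p₁ = p) (hp₂ : p₂ = p - 1) (hq₂ : q₂ = q)
    (z : ExtPow R Q r ⊗[R] schurLPos R P p q)
    (h1 : TensorProduct.map (extCo ρ φ h₂') (schurMap π hp₁ hq₂) z = 0)
    (h2 : TensorProduct.map (extCo ρ φ h₂') (schurCo π ε hp₂ hq₂) z = 0) :
    ∃ w, schurIncl jc f e h h₂ hq w = z := by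
  subst hp₁ hq₂
  obtain ⟨y, hy⟩ := exists_lTensor_of_prod (ExtPow R N r₂)
    (fun x => schurMap_schurAct_eq_zero hq rfl rfl hG.proj_e x)
    (fun x => schurCo_schurAct_eq_zero (ε := ε) hq rfl hp₂ hG.proj_e x)
    (fun x hx hx' => hG.exists_schurAct hp hq rfl hp₂ x hx hx')
    (fun a b => hG.exists_schur_proj hp rfl hp₂ a b)
    (TensorProduct.map (extCo ρ φ h₂') LinearMap.id z)
    (by rw [LinearMap.lTensor, map_map_apply]; exact h1)
    (by rw [LinearMap.lTensor, map_map_apply]; exact h2)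
  refine ⟨(TensorProduct.map (extMap ρ h.symm) LinearMap.id z, y), ?_⟩
  rw [schurIncl, LinearMap.coprod_apply]
  refine Eq.trans ?_ (hF.tensor_decomp h₂ rfl h₂' h z)
  congr 1
  rw [← hy, LinearMap.lTensor, map_map_apply]
  rfl

lemma schurIncl_proj (hG : LineSplit ic π e ε) (hF : LineSplit jc ρ f φ)
    {p p₁ r r₁ r₂ q q₁ q₂ : ℤ} (h : r = r₁) (h₂ : r = r₂ + 1) (hq : q = q₁ + 1)
    (h₂' : r₂ = r - 1) (hp₁ : p₁ = p) (hq₂ : q₂ = q)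
    (w : (ExtPow R N r₁ ⊗[R] schurLPos R P p q) × (ExtPow R N r₂ ⊗[R] schurLPos R P p q₁)) :
    TensorProduct.map (extCo ρ φ h₂') (schurMap π hp₁ hq₂) (schurIncl jc f e h h₂ hq w) = 0 := by
  have h0 : schurMap π hp₁ hq₂ ∘ₗ schurAct hq e = 0 :=
    LinearMap.ext fun x => schurMap_schurAct_eq_zero hq hq₂ hp₁ hG.proj_e x
  rw [schurIncl, LinearMap.coprod_apply, map_add, hF.map_extCo_map_incl,
    hF.map_extCo_map_wedge, h0, LinearMap.lTensor_zero, zero_add]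
  rfl

lemma schurIncl_coeff (hG : LineSplit ic π e ε) (hF : LineSplit jc ρ f φ)
    {p p₁ r r₁ r₂ q q₁ q₂ : ℤ} (h : r = r₁) (h₂ : r = r₂ + 1) (hq : q = q₁ + 1)
    (h₂' : r₂ = r - 1) (hp₁ : p₁ = p - 1) (hq₂ : q₂ = q)
    (w : (ExtPow R N r₁ ⊗[R] schurLPos R P p q) × (ExtPow R N r₂ ⊗[R] schurLPos R P p q₁)) :
    TensorProduct.map (extCo ρ φ h₂') (schurCo π ε hp₁ hq₂) (schurIncl jc f e h h₂ hq w) = 0 := by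
  have h0 : schurCo π ε hp₁ hq₂ ∘ₗ schurAct hq e = 0 :=
    LinearMap.ext fun x => schurCo_schurAct_eq_zero hq hq₂ hp₁ hG.proj_e x
  rw [schurIncl, LinearMap.coprod_apply, map_add, hF.map_extCo_map_incl,
    hF.map_extCo_map_wedge, h0, LinearMap.lTensor_zero, zero_add]
  rfl

lemma exists_schur_quot (hG : LineSplit ic π e ε) (hF : LineSplit jc ρ f φ)
    {p p₁ p₂ r r₂ q q₂ : ℤ} (hp : 1 ≤ p) (h₂' : r₂ = r - 1) (hp₁ : p₁ = p) (hp₂ : p₂ = p - 1)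
    (hq₂ : q₂ = q) (a : ExtPow R N r₂ ⊗[R] schurLPos R M p₁ q₂)
    (b : ExtPow R N r₂ ⊗[R] schurLPos R M p₂ q₂) :
    ∃ z : ExtPow R Q r ⊗[R] schurLPos R P p q,
      TensorProduct.map (extCo ρ φ h₂') (schurMap π hp₁ hq₂) z = a ∧
      TensorProduct.map (extCo ρ φ h₂') (schurCo π ε hp₂ hq₂) z = b := by
  subst hp₁ hq₂
  obtain ⟨y, rfl, rfl⟩ := exists_lTensor_eq_of_prod (ExtPow R N r₂)
    (fun a b => hG.exists_schur_proj hp rfl hp₂ a b) a b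
  have h : r = r₂ + 1 := by omega
  refine ⟨TensorProduct.map (wedgeVec h f ∘ₗ extMap jc rfl) LinearMap.id y, ?_, ?_⟩
  · rw [hF.map_extCo_map_wedge, LinearMap.comp_id]
  · rw [hF.map_extCo_map_wedge, LinearMap.comp_id]

section Incl
variable {K K₁ K₂ L : Type*} [AddCommMonoid K] [Module R K] [AddCommMonoid K₁] [Module R K₁]
  [AddCommMonoid K₂] [Module R K₂] [AddCommMonoid L] [Module R L]

/-- The map `⋀ʳ N ⊗ K₁ ⊕ ⋀ʳ N ⊗ K₂ → ⋀ʳ Q ⊗ K` given by maps `K₁ → K` and `K₂ → K`. -/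
def tensorIncl (jc : N →ₗ[R] Q) (f₁ : K₁ →ₗ[R] K) (f₂ : K₂ →ₗ[R] K) {r r₁ r₂ : ℤ}
    (h₁ : r = r₁) (h₂ : r = r₂) :
    (ExtPow R N r₁ ⊗[R] K₁) × (ExtPow R N r₂ ⊗[R] K₂) →ₗ[R] ExtPow R Q r ⊗[R] K :=
  LinearMap.coprod (TensorProduct.map (extMap jc h₁) f₁) (TensorProduct.map (extMap jc h₂) f₂)

variable {f₁ : K₁ →ₗ[R] K} {f₂ : K₂ →ₗ[R] K} {g : K →ₗ[R] L}

lemma tensorIncl_eq {r r₁ : ℤ} (h₁ : r = r₁)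
    (x : (ExtPow R N r₁ ⊗[R] K₁) × (ExtPow R N r₁ ⊗[R] K₂)) :
    tensorIncl jc f₁ f₂ h₁ h₁ x = TensorProduct.map (extMap jc h₁) (LinearMap.coprod f₁ f₂)
        ((TensorProduct.prodRight R R _ _ _).symm x) := by
  obtain ⟨w, rfl⟩ := (TensorProduct.prodRight R R _ _ _).surjective x
  rw [LinearEquiv.symm_apply_apply]
  induction w using TensorProduct.induction_on with
  | zero => simp only [map_zero]
  | add x y hx hy => simp only [map_add, hx, hy]
  | tmul x y =>
    obtain ⟨y, y'⟩ := y
    rw [TensorProduct.prodRight_tmul, tensorIncl, LinearMap.coprod_apply,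
      TensorProduct.map_tmul, TensorProduct.map_tmul, TensorProduct.map_tmul,
      LinearMap.coprod_apply, tmul_add]

lemma tensorIncl_injective (hF : LineSplit jc ρ f φ) {r r₁ r₂ : ℤ} (h₁ : r = r₁) (h₂ : r = r₂)
    (hf : Function.Injective (LinearMap.coprod f₁ f₂)) :
    Function.Injective (tensorIncl jc f₁ f₂ h₁ h₂) := by
  obtain rfl : r₁ = r₂ := by omega
  intro x y hxy
  rw [tensorIncl_eq, tensorIncl_eq] at hxy
  have h1 := congrArg (TensorProduct.map (extMap ρ h₁.symm) LinearMap.id) hxy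
  rw [hF.map_proj_map_incl, hF.map_proj_map_incl, LinearMap.id_comp] at h1
  have hinj : Function.Injective (LinearMap.lTensor (ExtPow R N r₁) (LinearMap.coprod f₁ f₂)) :=
    Module.Flat.lTensor_preserves_injective_linearMap _ hf
  exact (TensorProduct.prodRight R R _ _ _).symm.injective (hinj h1)

lemma map_tensorIncl {r r₁ r₂ r₃ : ℤ} (h₁ : r = r₁) (h₂ : r = r₂) (h₃ : r₃ = r)
    (hg : ∀ x, g (LinearMap.coprod f₁ f₂ x) = 0)
    (x : (ExtPow R N r₁ ⊗[R] K₁) × (ExtPow R N r₂ ⊗[R] K₂)) :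
    TensorProduct.map (extMap ρ h₃) g (tensorIncl jc f₁ f₂ h₁ h₂ x) = 0 := by
  obtain rfl : r₁ = r₂ := by omega
  have h0 : g ∘ₗ LinearMap.coprod f₁ f₂ = 0 := LinearMap.ext hg
  rw [tensorIncl_eq, map_map_apply, h0, TensorProduct.map_zero_right, LinearMap.zero_apply]

lemma map_extCo_tensorIncl (hF : LineSplit jc ρ f φ) {r r₁ r₂ r₃ : ℤ}
    (h₁ : r = r₁) (h₂ : r = r₂) (h₃ : r₃ = r - 1)
    (x : (ExtPow R N r₁ ⊗[R] K₁) × (ExtPow R N r₂ ⊗[R] K₂)) :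
    TensorProduct.map (extCo ρ φ h₃) g (tensorIncl jc f₁ f₂ h₁ h₂ x) = 0 := by
  obtain rfl : r₁ = r₂ := by omega
  rw [tensorIncl_eq, hF.map_extCo_map_incl]

/-- If `K₁ ⊕ K₂ → K → L → 0` is exact, then the image of `tensorIncl` consists of the elements of
`⋀ʳ Q ⊗ K` whose coefficient at `f` and whose image in `⋀ʳ N ⊗ L` vanish. -/
lemma exists_tensorIncl (hF : LineSplit jc ρ f φ) {r r₁ r₂ r₃ r₄ : ℤ}
    (h₁ : r = r₁) (h₂ : r = r₂) (h₃ : r₃ = r - 1) (h₄ : r₄ = r)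
    (hex : Function.Exact (LinearMap.coprod f₁ f₂) g) (hg : Function.Surjective g)
    (z : ExtPow R Q r ⊗[R] K) (hz₁ : TensorProduct.map (extMap ρ h₄) g z = 0)
    (hz₂ : TensorProduct.map (extCo ρ φ h₃) LinearMap.id z = 0) :
    ∃ x, tensorIncl jc f₁ f₂ h₁ h₂ x = z := by
  obtain rfl : r₁ = r₂ := by omega
  obtain rfl : r₁ = r₄ := by omega
  obtain ⟨w, hw⟩ := (lTensor_exact_addCommMonoid (ExtPow R N r₁) hex hg
    (TensorProduct.map (extMap ρ h₄) LinearMap.id z)).1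
    (by rw [LinearMap.lTensor, map_map_apply]; exact hz₁)
  refine ⟨TensorProduct.prodRight R R _ _ _ w, ?_⟩
  rw [tensorIncl_eq, LinearEquiv.symm_apply_apply]
  have h5 := hF.tensor_decomp (show r = r₃ + 1 by omega) rfl h₃ h₁ z
  rw [hz₂, map_zero, add_zero, ← hw, LinearMap.lTensor, map_map_apply] at h5
  exact h5

lemma exists_tensor_quot (hF : LineSplit jc ρ f φ) {r r₃ r₄ : ℤ} (h₃ : r₃ = r - 1) (h₄ : r₄ = r)
    (hg : Function.Surjective g) (s : ExtPow R N r₄ ⊗[R] L) (t : ExtPow R N r₃ ⊗[R] K) :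
    ∃ z : ExtPow R Q r ⊗[R] K,
      TensorProduct.map (extMap ρ h₄) g z = s ∧
      TensorProduct.map (extCo ρ φ h₃) LinearMap.id z = t := by
  obtain ⟨w, rfl⟩ := LinearMap.lTensor_surjective (ExtPow R N r₄) hg s
  refine ⟨TensorProduct.map (extMap jc h₄.symm) LinearMap.id w +
    TensorProduct.map (wedgeVec (show r = r₃ + 1 by omega) f ∘ₗ extMap jc rfl) LinearMap.id t,
    ?_, ?_⟩
  · rw [map_add, hF.map_proj_map_incl h₄.symm, hF.map_proj_map_wedge, add_zero, LinearMap.comp_id]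
  · rw [map_add, hF.map_extCo_map_incl, hF.map_extCo_map_wedge, zero_add, LinearMap.comp_id,
      LinearMap.lTensor_id_apply]

end Incl

end Exact

/-! ### Complexes of modules -/

section Homology
variable {R : Type u} [CommRing R]

lemma homologyMap_smul {A B : ChainComplex (ModuleCat.{u} R) ℤ} (r : R) (f : A ⟶ B) (j : ℤ) :
    HomologicalComplex.homologyMap (r • f) j = r • HomologicalComplex.homologyMap f j :=
  ShortComplex.homologyMap_smul (C := ModuleCat.{u} R)
    (φ := (HomologicalComplex.shortComplexFunctor (ModuleCat.{u} R) (ComplexShape.down ℤ) j).map f)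
    (a := r)

/-- If the kernel of an epimorphism of complexes is acyclic, then the epimorphism is bijective on
homology. -/
lemma bijective_homologyMap_g {S : ShortComplex (ChainComplex (ModuleCat.{u} R) ℤ)}
    (hS : S.ShortExact) (h : S.X₁.Acyclic) (j : ℤ) :
    Function.Bijective (HomologicalComplex.homologyMap S.g j).hom := by
  have hz : ∀ i, Limits.IsZero (S.X₁.homology i) := fun i => (h i).isZero_homology
  have h1 : Mono (HomologicalComplex.homologyMap S.g j) :=
    (hS.homology_exact₂ j).mono_g ((hz j).eq_of_src _ _)
  have h2 : Epi (HomologicalComplex.homologyMap S.g j) :=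
    (hS.homology_exact₃ j (j - 1) (by simp)).epi_f ((hz _).eq_of_tgt _ _)
  exact ⟨(ModuleCat.mono_iff_injective _).1 h1, (ModuleCat.epi_iff_surjective _).1 h2⟩

/-- If the cokernel of a monomorphism of complexes is acyclic, then the monomorphism is bijective on
homology. -/
lemma bijective_homologyMap_f {S : ShortComplex (ChainComplex (ModuleCat.{u} R) ℤ)}
    (hS : S.ShortExact) (h : S.X₃.Acyclic) (j : ℤ) :
    Function.Bijective (HomologicalComplex.homologyMap S.f j).hom := by
  have hz : ∀ i, Limits.IsZero (S.X₃.homology i) := fun i => (h i).isZero_homology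
  have h1 : Epi (HomologicalComplex.homologyMap S.f j) :=
    (hS.homology_exact₂ j).epi_f ((hz j).eq_of_tgt _ _)
  have h2 : Mono (HomologicalComplex.homologyMap S.f j) :=
    (hS.homology_exact₁ (j + 1) j (by simp)).mono_g ((hz _).eq_of_src _ _)
  exact ⟨(ModuleCat.mono_iff_injective _).1 h2, (ModuleCat.epi_iff_surjective _).1 h1⟩

lemma mkComplex_d {X : ℤ → Type u} [∀ j, AddCommGroup (X j)] [∀ j, Module R (X j)]
    {d : ∀ i j : ℤ, j + 1 = i → (X i →ₗ[R] X j)}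
    (hd : ∀ (i j k : ℤ) (hij : j + 1 = i) (hjk : k + 1 = j) (x : X i),
      d j k hjk (d i j hij x) = 0) {i j : ℤ} (h : j + 1 = i) :
    (mkComplex X d hd).d i j = ModuleCat.ofHom (d i j h) :=
  dif_pos h

lemma tensorC_d (A : ChainComplex (ModuleCat.{u} R) ℤ) (P : Type u) [AddCommGroup P] [Module R P]
    {i j : ℤ} (h : j + 1 = i) :
    ((tensorC A P).d i j).hom = LinearMap.rTensor P (A.d i j).hom :=
  congrArg ModuleCat.Hom.hom (mkComplex_d _ h)

lemma prodC_d (A B : ChainComplex (ModuleCat.{u} R) ℤ) {i j : ℤ} (h : j + 1 = i) :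
    ((prodC A B).d i j).hom = (A.d i j).hom.prodMap (B.d i j).hom :=
  congrArg ModuleCat.Hom.hom (mkComplex_d _ h)

lemma shiftC_d (A : ChainComplex (ModuleCat.{u} R) ℤ) (n : ℤ) {i j : ℤ} (h : j + 1 = i) :
    ((shiftC A n).d i j).hom = (A.d (n + i) (n + j)).hom :=
  congrArg ModuleCat.Hom.hom (mkComplex_d _ h)

lemma Tot_d {A B : ChainComplex (ModuleCat.{u} R) ℤ} (θ : A ⟶ B) {i j : ℤ} (h : j + 1 = i)
    (x : A.X (i - 1)) (y : B.X i) :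
    ((Tot θ).d i j).hom (x, y) = ((A.d (i - 1) (j - 1)).hom x,
      (θ.f j).hom ((A.XIsoOfEq (show i - 1 = j by omega)).hom.hom x) - (B.d i j).hom y) := by
  have h1 : ((Tot θ).d i j).hom = _ := congrArg ModuleCat.Hom.hom (mkComplex_d _ h)
  rw [h1]
  rfl

/-- The total complex of a map of complexes which is bijective in each degree is acyclic. -/
lemma Tot_acyclic {A B : ChainComplex (ModuleCat.{u} R) ℤ} (θ : A ⟶ B)
    (hθ : ∀ j, Function.Bijective (θ.f j).hom) : (Tot θ).Acyclic := by
  intro j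
  rw [HomologicalComplex.exactAt_iff' _ (j + 1) j (j - 1) (by simp) (by simp),
    ShortComplex.moduleCat_exact_iff]
  rintro ⟨x, y⟩ hx
  change ((Tot θ).d j (j - 1)).hom (x, y) = 0 at hx
  rw [Tot_d θ (by omega)] at hx
  have hx2 := congrArg Prod.snd hx
  simp only at hx2
  obtain ⟨z, hz⟩ := (hθ j).2 y
  have e : (j + 1) - 1 = j := by omega
  refine ⟨((A.XIsoOfEq e).inv.hom z, 0), ?_⟩
  change ((Tot θ).d (j + 1) j).hom (_, 0) = _
  have hinv : (A.XIsoOfEq e).hom.hom ((A.XIsoOfEq e).inv.hom z) = z := by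
    rw [← ModuleCat.comp_apply, Iso.inv_hom_id]; rfl
  rw [Tot_d θ rfl, hinv, hz, map_zero, sub_zero]
  refine Prod.ext ?_ rfl
  -- `θ` maps both `x` and the differential of `z` to the differential of `y`.
  have hinj : Function.Injective fun t => (θ.f (j - 1)).hom
      ((A.XIsoOfEq (show j - 1 = j - 1 from rfl)).hom.hom t) := by
    intro s t hst
    have := (hθ (j - 1)).1 hst
    simpa using this
  apply hinj
  simp only
  rw [sub_eq_zero.1 hx2, ← hz]
  have e1 : (A.XIsoOfEq e).inv ≫ A.d (j + 1 - 1) (j - 1) ≫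
      (A.XIsoOfEq (show j - 1 = j - 1 from rfl)).hom ≫ θ.f (j - 1) = θ.f j ≫ B.d j (j - 1) := by
    rw [HomologicalComplex.XIsoOfEq_rfl, Iso.refl_hom, Category.id_comp,
      HomologicalComplex.XIsoOfEq_inv_comp_d_assoc, θ.comm]
  exact congrArg (fun t => t.hom z) e1

/-- A short exact sequence of complexes from exactness in each degree. -/
lemma shortExact_mk {A B C : ChainComplex (ModuleCat.{u} R) ℤ} (f : A ⟶ B) (g : B ⟶ C)
    (z : f ≫ g = 0) (hf : ∀ j, Function.Injective (f.f j).hom)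
    (hfg : ∀ j x, (g.f j).hom x = 0 → ∃ y, (f.f j).hom y = x)
    (hg : ∀ j, Function.Surjective (g.f j).hom) : (ShortComplex.mk f g z).ShortExact := by
  apply HomologicalComplex.shortExact_of_degreewise_shortExact
  intro j
  have hm : Mono ((ShortComplex.mk f g z).map (HomologicalComplex.eval _ _ j)).f :=
    (ModuleCat.mono_iff_injective _).2 (hf j)
  have he : Epi ((ShortComplex.mk f g z).map (HomologicalComplex.eval _ _ j)).g :=
    (ModuleCat.epi_iff_surjective _).2 (hg j)
  exact { exact := (ShortComplex.moduleCat_exact_iff _).2 (hfg j) }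

/-- The projection to the first summand. -/
def prodFst (A B : ChainComplex (ModuleCat.{u} R) ℤ) : prodC A B ⟶ A where
  f j := ModuleCat.ofHom (LinearMap.fst R (A.X j) (B.X j))
  comm' i j h := by
    have h' : j + 1 = i := h
    refine ModuleCat.hom_ext (LinearMap.ext fun x => ?_)
    change (A.d i j).hom (Prod.fst x) = Prod.fst (((prodC A B).d i j).hom x)
    rw [prodC_d _ _ h']
    rfl

/-- The projection to the second summand. -/
def prodSnd (A B : ChainComplex (ModuleCat.{u} R) ℤ) : prodC A B ⟶ B where
  f j := ModuleCat.ofHom (LinearMap.snd R (A.X j) (B.X j))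
  comm' i j h := by
    have h' : j + 1 = i := h
    refine ModuleCat.hom_ext (LinearMap.ext fun x => ?_)
    change (B.d i j).hom (Prod.snd x) = Prod.snd (((prodC A B).d i j).hom x)
    rw [prodC_d _ _ h']
    rfl

lemma prodInl_prodFst (A B : ChainComplex (ModuleCat.{u} R) ℤ) :
    prodInl A B ≫ prodFst A B = 𝟙 A := rfl

lemma prodInr_prodSnd (A B : ChainComplex (ModuleCat.{u} R) ℤ) :
    prodInr A B ≫ prodSnd A B = 𝟙 B := rfl

lemma prodInl_prodSnd (A B : ChainComplex (ModuleCat.{u} R) ℤ) :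
    prodInl A B ≫ prodSnd A B = 0 := rfl

lemma prodInr_prodFst (A B : ChainComplex (ModuleCat.{u} R) ℤ) :
    prodInr A B ≫ prodFst A B = 0 := rfl

lemma prodFst_prodInl_add (A B : ChainComplex (ModuleCat.{u} R) ℤ) :
    prodFst A B ≫ prodInl A B + prodSnd A B ≫ prodInr A B = 𝟙 (prodC A B) := by
  ext j : 1
  refine ModuleCat.hom_ext (LinearMap.ext fun x => ?_)
  obtain ⟨x, y⟩ := x
  change ((x, 0) : A.X j × B.X j) + (0, y) = (x, y)
  simp

/-- The map `A ⊗ P → A`, `x ⊗ p ↦ c(p) x`, for `c ∈ P*`. -/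
def tensorEval (A : ChainComplex (ModuleCat.{u} R) ℤ) {P : Type u} [AddCommGroup P] [Module R P]
    (c : Module.Dual R P) : tensorC A P ⟶ A where
  f j := ModuleCat.ofHom (TensorProduct.lift ((LinearMap.lsmul R (A.X j)).flip.compl₂ c))
  comm' i j h := by
    have h' : j + 1 = i := h
    refine ModuleCat.hom_ext (TensorProduct.ext' fun x p => ?_)
    change (A.d i j).hom (c p • x) = TensorProduct.lift
      ((LinearMap.lsmul R (A.X j)).flip.compl₂ c) (((tensorC A P).d i j).hom (x ⊗ₜ p))
    rw [tensorC_d _ _ h']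
    exact map_smul (A.d i j).hom (c p) x

variable {P : Type u} [AddCommGroup P] [Module R P] {p : P} {c : Module.Dual R P}

lemma tensorBy_tensorEval (A : ChainComplex (ModuleCat.{u} R) ℤ) (h : c p = 1) :
    tensorBy A p ≫ tensorEval A c = 𝟙 A := by
  ext j : 1
  refine ModuleCat.hom_ext (LinearMap.ext fun x => ?_)
  change c p • x = x
  rw [h, one_smul]

lemma tensorEval_tensorBy (A : ChainComplex (ModuleCat.{u} R) ℤ) (h : ∀ q, c q • p = q) :
    tensorEval A c ≫ tensorBy A p = 𝟙 (tensorC A P) := by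
  ext j : 1
  refine ModuleCat.hom_ext (TensorProduct.ext' fun x q => ?_)
  change (c q • x) ⊗ₜ[R] p = x ⊗ₜ q
  rw [TensorProduct.smul_tmul, h]

lemma tensorBy_eq_smul (A : ChainComplex (ModuleCat.{u} R) ℤ) (h : ∀ q, c q • p = q) (q : P) :
    tensorBy A q = c q • tensorBy A p := by
  ext j : 1
  refine ModuleCat.hom_ext (LinearMap.ext fun x => ?_)
  change x ⊗ₜ[R] q = c q • (x ⊗ₜ[R] p)
  rw [← TensorProduct.tmul_smul, h]

/-- The comparison of homology: if `C → D` and `A ⊕ (B ⊗ P) → D` are bijective on homology, and `P`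
is free of rank one, then `H(A) ⊕ (H(B) ⊗ P)` is isomorphic to `H(C)`. -/
theorem exists_homology_equiv {A B C D : ChainComplex (ModuleCat.{u} R) ℤ} (h1 : c p = 1)
    (h2 : ∀ q, c q • p = q) (g : C ⟶ D) (f : prodC A (tensorC B P) ⟶ D) (j : ℤ)
    (hg : Function.Bijective (HomologicalComplex.homologyMap g j).hom)
    (hf : Function.Bijective (HomologicalComplex.homologyMap f j).hom) :
    ∃ e : ((A.homology j) × ((B.homology j) ⊗[R] P)) ≃ₗ[R] C.homology j,
      ∀ (x : A.homology j) (y : B.homology j) (γ : P),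
        (HomologicalComplex.homologyMap g j).hom (e (x, y ⊗ₜ[R] γ)) =
          (HomologicalComplex.homologyMap (prodInl A (tensorC B P) ≫ f) j).hom x +
          (HomologicalComplex.homologyMap
            (tensorBy B γ ≫ prodInr A (tensorC B P) ≫ f) j).hom y := by
  let H {X Y : ChainComplex (ModuleCat.{u} R) ℤ} (t : X ⟶ Y) : X.homology j →ₗ[R] Y.homology j :=
    (HomologicalComplex.homologyMap t j).hom
  have Hc : ∀ {X Y Z : ChainComplex (ModuleCat.{u} R) ℤ} (s : X ⟶ Y) (t : Y ⟶ Z) x,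
      H (s ≫ t) x = H t (H s x) := fun s t x => by
    simp only [H, HomologicalComplex.homologyMap_comp]; rfl
  have Hid : ∀ (X : ChainComplex (ModuleCat.{u} R) ℤ) x, H (𝟙 X) x = x := fun X x => by
    simp only [H, HomologicalComplex.homologyMap_id]; rfl
  have Hz : ∀ (X Y : ChainComplex (ModuleCat.{u} R) ℤ) x, H (0 : X ⟶ Y) x = 0 := fun X Y x => by
    simp only [H, HomologicalComplex.homologyMap_zero]; rfl
  have Ha : ∀ {X Y : ChainComplex (ModuleCat.{u} R) ℤ} (s t : X ⟶ Y) x,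
      H (s + t) x = H s x + H t x := fun s t x => by
    simp only [H, HomologicalComplex.homologyMap_add]; rfl
  have Hs : ∀ {X Y : ChainComplex (ModuleCat.{u} R) ℤ} (r : R) (s : X ⟶ Y) x,
      H (r • s) x = r • H s x := fun r s x => by
    simp only [H, homologyMap_smul]; rfl
  let ev : (B.homology j) ⊗[R] P ≃ₗ[R] B.homology j :=
    LinearEquiv.ofLinearMap (TensorProduct.lift ((LinearMap.lsmul R (B.homology j)).flip.compl₂ c))
      ((TensorProduct.mk R (B.homology j) P).flip p)
      (LinearMap.ext fun y => by
        change c p • y = y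
        rw [h1, one_smul])
      (TensorProduct.ext' fun y q => by
        change (c q • y) ⊗ₜ[R] p = y ⊗ₜ q
        rw [TensorProduct.smul_tmul, h2])
  let Ψ : (A.homology j) × (B.homology j) →ₗ[R] D.homology j :=
    LinearMap.coprod (H (prodInl A (tensorC B P) ≫ f))
      (H (tensorBy B p ≫ prodInr A (tensorC B P) ≫ f))
  have hΨ : Function.Bijective Ψ := by
    constructor
    · rintro ⟨x, y⟩ ⟨x', y'⟩ hxy
      simp only [Ψ, LinearMap.coprod_apply, Hc, ← map_add] at hxy
      have h3 := hf.1 hxy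
      have h4 := congrArg (H (prodFst A (tensorC B P))) h3
      have h5 := congrArg (H (prodSnd A (tensorC B P))) h3
      simp only [map_add, ← Hc, Category.assoc, prodInl_prodFst, prodInr_prodFst,
        prodInl_prodSnd, prodInr_prodSnd, Limits.comp_zero, Hz, Hid, add_zero, zero_add,
        Category.comp_id] at h4 h5
      have h6 := congrArg (H (tensorEval B c)) h5
      rw [← Hc, ← Hc, tensorBy_tensorEval B h1, Hid, Hid] at h6
      exact Prod.ext h4 h6
    · intro z
      obtain ⟨w, rfl⟩ := hf.2 z
      refine ⟨(H (prodFst A (tensorC B P)) w,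
        H (tensorEval B c) (H (prodSnd A (tensorC B P)) w)), ?_⟩
      simp only [Ψ, LinearMap.coprod_apply, Hc]
      rw [← Hc (tensorEval B c), tensorEval_tensorBy B h2, Hid, ← map_add, ← Hc, ← Hc, ← Ha,
        prodFst_prodInl_add, Hid]
  refine ⟨((LinearEquiv.refl R (A.homology j)).prodCongr ev).trans
    ((LinearEquiv.ofBijective Ψ hΨ).trans (LinearEquiv.ofBijective (H g) hg).symm), ?_⟩
  intro x y γ
  have h3 : H g ((LinearEquiv.ofBijective (H g) hg).symm (Ψ (x, c γ • y))) = Ψ (x, c γ • y) :=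
    (LinearEquiv.ofBijective (H g) hg).apply_symm_apply _
  refine h3.trans ?_
  simp only [Ψ, LinearMap.coprod_apply]
  rw [tensorBy_eq_smul B h2 γ]
  congr 1
  change _ = H ((c γ • tensorBy B p) ≫ prodInr A (tensorC B P) ≫ f) y
  rw [Hc (c γ • tensorBy B p), Hs, map_smul, map_smul, ← Hc]

end Homology

/-! ### Splitting off summands of rank one -/

section LineBasis
variable {R : Type u} [CommRing R] {M N : Type u} [AddCommGroup M] [Module R M]
  [AddCommGroup N] [Module R N]

/-- The element `e` is a basis of `N`, with dual basis `ε`. -/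
structure LineBasis (e : N) (ε : Module.Dual R N) : Prop where
  coeff_self : ε e = 1
  decomp : ∀ n, ε n • e = n

lemma exists_lineBasis [Nontrivial R] [Module.Free R N] [Module.Finite R N]
    (h : Module.finrank R N = 1) : ∃ (e : N) (ε : Module.Dual R N), LineBasis e ε := by
  let b := Module.finBasisOfFinrankEq R N h
  refine ⟨b 0, b.coord 0, by simp, fun n => ?_⟩
  have := b.sum_repr n
  simpa using this

lemma LineBasis.dual {e : N} {ε : Module.Dual R N} (h : LineBasis e ε) :
    LineBasis ε (Module.Dual.eval R N e) where
  coeff_self := h.coeff_self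
  decomp δ := LinearMap.ext fun n => by
    change δ e * ε n = δ n
    rw [mul_comm, ← smul_eq_mul, ← map_smul, h.decomp]

lemma LineBasis.map {N₁ : Type u} [AddCommGroup N₁] [Module R N₁] {e : N} {ε : Module.Dual R N}
    (h : LineBasis e ε) (Ψ : N ≃ₗ[R] N₁) : LineBasis (Ψ e) (ε ∘ₗ Ψ.symm.toLinearMap) where
  coeff_self := by simpa using h.coeff_self
  decomp n := by
    have := congrArg Ψ (h.decomp (Ψ.symm n))
    simpa using this

lemma LineBasis.lineSplit {e : N} {ε : Module.Dual R N} (h : LineBasis e ε) :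
    LineSplit (LinearMap.inl R M N) (LinearMap.fst R M N) (LinearMap.inr R M N e)
      ((LinearMap.snd R M N).dualMap ε) where
  proj_incl _ := rfl
  proj_e := rfl
  coeff_incl _ := map_zero ε
  coeff_e := h.coeff_self
  decomp p := by
    refine Prod.ext ?_ ?_
    · simp
    · simpa using h.decomp p.2

/-- Every element of `A ⊗ N` is of the form `a ⊗ e`. -/
lemma LineBasis.exists_tmul {e : N} {ε : Module.Dual R N} (h : LineBasis e ε) {A : Type*}
    [AddCommMonoid A] [Module R A] (z : A ⊗[R] N) : ∃ a : A, z = a ⊗ₜ e := by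
  induction z using TensorProduct.induction_on with
  | zero => exact ⟨0, (zero_tmul _ _).symm⟩
  | add x y hx hy =>
    obtain ⟨a, rfl⟩ := hx
    obtain ⟨b, rfl⟩ := hy
    exact ⟨a + b, (add_tmul _ _ _).symm⟩
  | tmul a n => exact ⟨ε n • a, by rw [smul_tmul, h.decomp]⟩

lemma LineBasis.tmul_injective {e : N} {ε : Module.Dual R N} (h : LineBasis e ε) {A : Type*}
    [AddCommMonoid A] [Module R A] : Function.Injective fun a : A => a ⊗ₜ[R] e := by
  intro a b hab
  have := congrArg (TensorProduct.lift ((LinearMap.lsmul R A).flip.compl₂ ε)) hab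
  change ε e • a = ε e • b at this
  rwa [h.coeff_self, one_smul, one_smul] at this

lemma LineBasis.tensor {N₁ : Type u} [AddCommGroup N₁] [Module R N₁] {e : N} {ε : Module.Dual R N}
    (h : LineBasis e ε) {e₁ : N₁} {ε₁ : Module.Dual R N₁} (h₁ : LineBasis e₁ ε₁) :
    LineBasis (e ⊗ₜ[R] e₁) (LinearMap.mul' R R ∘ₗ TensorProduct.map ε ε₁) where
  coeff_self := by
    change ε e * ε₁ e₁ = 1
    rw [h.coeff_self, h₁.coeff_self, one_mul]
  decomp z := by
    obtain ⟨a, rfl⟩ := h₁.exists_tmul z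
    change (ε a * ε₁ e₁) • _ = _
    rw [h₁.coeff_self, mul_one, smul_tmul', h.decomp]

lemma LineBasis.evMap_eq [Module.Free R N] [Module.Finite R N] {e : N} {ε : Module.Dual R N}
    (h : LineBasis e ε) {X X' Y Y' : Type*} [AddCommMonoid X]
    [Module R X] [AddCommMonoid X'] [Module R X'] [AddCommMonoid Y] [Module R Y]
    [AddCommMonoid Y'] [Module R Y'] (A : Module.Dual R N →ₗ[R] X →ₗ[R] X')
    (B : N →ₗ[R] Y →ₗ[R] Y') : evMap A B = TensorProduct.map (A ε) (B e) :=
  evSum_line h.coeff_self h.decomp _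

end LineBasis

section Formulas
variable {R : Type u} [CommRing R] [Nontrivial R]
  {F' F'' G' G'' : Type u} [AddCommGroup F'] [Module R F'] [Module.Free R F'] [Module.Finite R F']
  [AddCommGroup F''] [Module R F''] [Module.Free R F''] [Module.Finite R F'']
  [AddCommGroup G'] [Module R G'] [Module.Free R G'] [Module.Finite R G']
  [AddCommGroup G''] [Module R G''] [Module.Free R G''] [Module.Finite R G'']
  {e : G''} {ε : Module.Dual R G''} {f : F''} {φ : Module.Dual R F''}

lemma LineBasis.extProj_apply (hf : LineBasis f φ) {n k : ℤ} (h : k = n - 1)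
    (u : ExtPow R (F' × F'') n) :
    extProj h u = extCo (LinearMap.fst R F' F'') ((LinearMap.snd R F' F'').dualMap φ) h u ⊗ₜ f := by
  simp only [extProj, LinearMap.comp_apply, hf.evMap_eq]
  change _ ⊗ₜ ((1 : R) • f) = _
  rw [one_smul]
  rfl

lemma LineBasis.schurProj_coe (he : LineBasis e ε) {p p₁ q q₁ : ℤ} (hp : p₁ = p - 1) (hq : q₁ = q)
    (x : schurLPos R (G' × G'') p q) :
    schurProj hp hq x =
      schurCo (LinearMap.fst R G' G'') ((LinearMap.snd R G' G'').dualMap ε) hp hq x ⊗ₜ e := by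
  simp only [schurProj, LinearMap.comp_apply, he.evMap_eq]
  change _ ⊗ₜ ((1 : R) • e) = _
  rw [one_smul]
  rfl

lemma LineBasis.weylSplit_apply (he : LineBasis e ε) {p q q₁ : ℤ} (hq : q₁ = q - 1)
    (x : weylK R (G' × G'') p q) :
    weylSplit hq x = weylAct hq (LinearMap.inr R G' G'' e) x ⊗ₜ ε := by
  simp only [weylSplit, LinearMap.comp_apply, he.evMap_eq]
  change _ ⊗ₜ ((1 : R) • ε) = _
  rw [one_smul]

lemma LineBasis.kosTwist_one (he : LineBasis e ε) (Φ'' : Module.Dual R G'' →ₗ[R] F'') (r : R) :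
    kosTwist Φ'' r = r • (Φ'' ε ⊗ₜ[R] e) := by
  rw [kosTwist, LinearMap.toSpanSingleton_apply, evSum_line he.coeff_self he.decomp]
  rfl

lemma blockSplit_blockSum (he : LineBasis e ε) (hf : LineBasis f φ)
    (Φ' : Module.Dual R G' →ₗ[R] F') (Φ'' : Module.Dual R G'' →ₗ[R] F'') (h : Φ'' ε = f) :
    BlockSplit (LinearMap.inl R G' G'') (LinearMap.fst R G' G'') (LinearMap.inr R G' G'' e)
      ((LinearMap.snd R G' G'').dualMap ε) (LinearMap.inl R F' F'') (LinearMap.fst R F' F'')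
      (LinearMap.inr R F' F'' f) ((LinearMap.snd R F' F'').dualMap φ) (blockSum Φ' Φ'') Φ' where
  source := he.lineSplit
  target := hf.lineSplit
  map_dual δ := by
    refine Prod.ext ?_ ?_
    · exact congrArg Φ' (LinearMap.ext fun _ => rfl)
    · exact (congrArg Φ'' (LinearMap.ext fun _ => map_zero δ)).trans (map_zero Φ'')
  map_coeff := by
    refine Prod.ext ?_ ?_
    · exact (congrArg Φ' (LinearMap.ext fun _ => map_zero ε)).trans (map_zero Φ')
    · exact (congrArg Φ'' (LinearMap.ext fun _ => rfl)).trans h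

end Formulas

/-! ### Compatibility of the Koszul maps with a block decomposition -/

section BlockMaps
variable {R : Type u} [CommRing R] {M P N Q : Type u} [AddCommGroup M] [Module R M]
  [AddCommGroup P] [Module R P] [AddCommGroup N] [Module R N] [AddCommGroup Q] [Module R Q]
  [Module.Free R M] [Module.Finite R M] [Module.Free R P] [Module.Finite R P]
  {ic : M →ₗ[R] P} {π : P →ₗ[R] M} {e : P} {ε : Module.Dual R P}
  {jc : N →ₗ[R] Q} {ρ : Q →ₗ[R] N} {f : Q} {φ : Module.Dual R Q}
  {Φ : Module.Dual R P →ₗ[R] Q} {Φ' : Module.Dual R M →ₗ[R] N}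

lemma map_eq_zero_of_right {A A' B B' : Type*} [AddCommMonoid A] [Module R A] [AddCommMonoid A']
    [Module R A'] [AddCommMonoid B] [Module R B] [AddCommMonoid B'] [Module R B'] (u : A →ₗ[R] A')
    {g : B →ₗ[R] B'} (hg : ∀ y, g y = 0) (z : A ⊗[R] B) : TensorProduct.map u g z = 0 := by
  rw [show g = 0 from LinearMap.ext hg, TensorProduct.map_zero_right, LinearMap.zero_apply]

lemma schurMap_schurAct (g : P →ₗ[R] M) {p p₁ q q' q₁ q₁' : ℤ} (hq : q' = q + 1)
    (hq₁ : q₁' = q₁ + 1) (hp : p₁ = p) (h : q₁ = q) (h' : q₁' = q') (v : P)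
    (x : schurLPos R P p q) :
    schurMap g hp h' (schurAct hq v x) = schurAct hq₁ (g v) (schurMap g hp h x) := by
  apply Subtype.ext
  rw [schurMap_coe, schurAct_coe, schurAct_coe, schurMap_coe, LinearMap.lTensor, LinearMap.lTensor,
    map_map_apply, map_map_apply]
  congr 2
  exact LinearMap.ext fun y => symMap_symMul g hq h' h hq₁ v y

lemma schurCo_schurAct (g : P →ₗ[R] M) (δ : Module.Dual R P) {p p₁ q q' q₁ q₁' : ℤ}
    (hq : q' = q + 1) (hq₁ : q₁' = q₁ + 1) (hp : p₁ = p - 1) (h : q₁ = q) (h' : q₁' = q') (v : P)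
    (x : schurLPos R P p q) :
    schurCo g δ hp h' (schurAct hq v x) = schurAct hq₁ (g v) (schurCo g δ hp h x) := by
  apply Subtype.ext
  rw [schurCo_coe, schurAct_coe, schurAct_coe, schurCo_coe, LinearMap.lTensor, LinearMap.lTensor,
    map_map_apply, map_map_apply]
  congr 2
  exact LinearMap.ext fun y => symMap_symMul g hq h' h hq₁ v y

lemma weylAct_weylMap (g : P →ₗ[R] M) {p p₁ q q' q₁ q₁' : ℤ} (hq : q' = q - 1)
    (hq₁ : q₁' = q₁ - 1) (hp : p = p₁) (h : q = q₁) (h' : q' = q₁') (v : P)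
    (x : weylK R M p₁ q₁) :
    weylAct hq v (weylMap g hp h x) = weylMap g hp h' (weylAct hq₁ (g v) x) := by
  apply Subtype.ext
  rw [weylMap_coe, weylAct_coe, weylAct_coe, weylMap_coe, LinearMap.lTensor, LinearMap.lTensor,
    map_map_apply, map_map_apply]
  congr 2
  exact LinearMap.ext fun y => divAct_divMap g hq₁ hq h h' v y

lemma weylAct_weylMap_eq_zero {g : P →ₗ[R] M} {p p₁ q q' q₁ : ℤ} (hq : q' = q - 1)
    (hp : p = p₁) (h : q = q₁) {v : P} (hv : g v = 0) (x : weylK R M p₁ q₁) :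
    weylAct hq v (weylMap g hp h x) = 0 := by
  apply Subtype.ext
  rw [weylAct_coe, weylMap_coe, LinearMap.lTensor, map_map_apply]
  have h0 : divAct hq v ∘ₗ divMap g h = 0 := LinearMap.ext fun y => by
    subst h
    rw [LinearMap.comp_apply, divAct_divMap g hq hq rfl rfl, hv, map_zero]
    rfl
  rw [h0, TensorProduct.map_zero_right]
  rfl

lemma weylAct_weylWedge {p p₁ q q' q₁ q₁' : ℤ} (hq : q' = q - 1)
    (hq₁ : q₁' = q₁ - 1) (hp : p = p₁ + 1) (h : q = q₁) (h' : q' = q₁') (v : P)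
    (δ : Module.Dual R P) (x : weylK R P p₁ q₁) :
    weylAct hq v (weylWedge hp h δ x) = weylWedge hp h' δ (weylAct hq₁ v x) := by
  apply Subtype.ext
  rw [weylWedge_coe, weylAct_coe, weylAct_coe, weylWedge_coe, LinearMap.lTensor, LinearMap.lTensor,
    map_map_apply, map_map_apply]
  congr 2
  exact LinearMap.ext fun y => divAct_divMap LinearMap.id hq₁ hq h h' v y

lemma weylAct_weylWedge_weylMap_eq_zero {g : P →ₗ[R] M} {p p₁ q q' : ℤ} (hq : q' = q - 1)
    (hp : p = p₁ + 1) {v : P} (hv : g v = 0) (δ : Module.Dual R P) (x : weylK R M p₁ q) :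
    weylAct hq v (weylWedge hp rfl δ (weylMap g rfl rfl x)) = 0 := by
  have h1 := congrArg Subtype.val (weylAct_weylMap_eq_zero hq (rfl : p₁ = p₁) rfl hv x)
  apply Subtype.ext
  rw [weylAct_weylWedge hq hq hp rfl rfl, weylWedge_coe, h1]
  exact map_zero (TensorProduct.map (wedgeVec hp δ) (divMap LinearMap.id rfl))

lemma weylMap_id {p q : ℤ} (x : weylK R P p q) : weylMap LinearMap.id rfl rfl x = x := by
  apply Subtype.ext
  rw [weylMap_coe, LinearMap.dualMap_id]
  have h1 : extMap (LinearMap.id (R := R) (M := Module.Dual R P)) (rfl : p = p) = LinearMap.id :=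
    LinearMap.ext fun y => extMap_id rfl y
  have h2 : divMap (LinearMap.id (R := R) (M := P)) (rfl : q = q) = LinearMap.id :=
    LinearMap.ext fun y => divMap_id rfl y
  rw [h1, h2, TensorProduct.map_id, LinearMap.id_apply]

lemma schurMap_id {p q : ℤ} (x : schurLPos R P p q) : schurMap LinearMap.id rfl rfl x = x := by
  apply Subtype.ext
  rw [schurMap_coe]
  have h1 : extMap (LinearMap.id (R := R) (M := P)) (rfl : p = p) = LinearMap.id :=
    LinearMap.ext fun y => extMap_id rfl y
  have h2 : symMap (LinearMap.id (R := R) (M := P)) (rfl : q = q) = LinearMap.id :=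
    LinearMap.ext fun y => symMap_id rfl y
  rw [h1, h2, TensorProduct.map_id, LinearMap.id_apply]

namespace BlockSplit

lemma map_schurMap_kosPhi (hb : BlockSplit ic π e ε jc ρ f φ Φ Φ')
    {p p₁ q q' q₁ q₁' r r' r₁ r₁' : ℤ}
    (hr : r' = r + 1) (hq : q' = q + 1) (hr₁ : r₁' = r₁ + 1) (hq₁ : q₁' = q₁ + 1)
    (hp : p₁ = p) (h : r₁ = r - 1) (h' : r₁' = r' - 1) (k : q₁ = q) (k' : q₁' = q')
    (z : ExtPow R Q r ⊗[R] schurLPos R P p q) :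
    TensorProduct.map (extCo ρ φ h') (schurMap π hp k') (kosPhi Φ hr hq z) =
      (-1 : R) • kosPhi Φ' hr₁ hq₁ (TensorProduct.map (extCo ρ φ h) (schurMap π hp k) z) := by
  unfold kosPhi
  rw [hb.map_extCo_evMap hr h h' hr₁ (by omega) (schurAct hq) (schurAct hq₁) (schurMap π hp k)
    (schurMap π hp k') (fun m y => by
      rw [schurMap_schurAct π hq hq₁ hp k k', hb.source.proj_incl])]
  have h0 : schurMap π hp k' ∘ₗ schurAct hq e = 0 :=
    LinearMap.ext fun y => schurMap_schurAct_eq_zero hq k' hp hb.source.proj_e y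
  rw [h0, TensorProduct.map_zero_right, LinearMap.zero_apply, add_zero]

lemma map_schurCo_kosPhi (hb : BlockSplit ic π e ε jc ρ f φ Φ Φ') {p p₁ q q' q₁ q₁' r r' r₁ r₁' : ℤ}
    (hr : r' = r + 1) (hq : q' = q + 1) (hr₁ : r₁' = r₁ + 1) (hq₁ : q₁' = q₁ + 1)
    (hp : p₁ = p - 1) (h : r₁ = r - 1) (h' : r₁' = r' - 1) (k : q₁ = q) (k' : q₁' = q')
    (z : ExtPow R Q r ⊗[R] schurLPos R P p q) :
    TensorProduct.map (extCo ρ φ h') (schurCo π ε hp k') (kosPhi Φ hr hq z) =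
      (-1 : R) • kosPhi Φ' hr₁ hq₁ (TensorProduct.map (extCo ρ φ h) (schurCo π ε hp k) z) := by
  unfold kosPhi
  rw [hb.map_extCo_evMap hr h h' hr₁ (by omega) (schurAct hq) (schurAct hq₁) (schurCo π ε hp k)
    (schurCo π ε hp k') (fun m y => by
      rw [schurCo_schurAct π ε hq hq₁ hp k k', hb.source.proj_incl])]
  have h0 : schurCo π ε hp k' ∘ₗ schurAct hq e = 0 :=
    LinearMap.ext fun y => schurCo_schurAct_eq_zero hq k' hp hb.source.proj_e y
  rw [h0, TensorProduct.map_zero_right, LinearMap.zero_apply, add_zero]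

lemma kosPhi_map_incl (hb : BlockSplit ic π e ε jc ρ f φ Φ Φ') {p q q' q₁ q₁' r r' r₁ r₁' : ℤ}
    (hr : r' = r + 1) (hq : q' = q + 1) (hr₁ : r₁' = r₁ + 1) (hq₁ : q₁' = q₁ + 1)
    (h : r = r₁) (h' : r' = r₁') (k : q = q₁) (k' : q' = q₁') (l : q' = q₁ + 1)
    (z : ExtPow R N r₁ ⊗[R] schurLPos R P p q₁) :
    kosPhi Φ hr hq (TensorProduct.map (extMap jc h) (schurMap LinearMap.id rfl k) z) =
      TensorProduct.map (extMap jc h') (schurMap LinearMap.id rfl k') (kosPhi (ρ ∘ₗ Φ) hr₁ hq₁ z) +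
      TensorProduct.map (wedgeVec hr f ∘ₗ extMap jc h) (schurAct l e) z := by
  subst k k' h h'
  unfold kosPhi
  rw [hb.evMap_map_incl hr rfl rfl hr₁ (schurAct hq) (schurAct hq₁ ∘ₗ ic)
    (schurMap LinearMap.id rfl rfl) (schurMap LinearMap.id rfl rfl) (fun m y => by
      rw [schurMap_id, schurMap_id]; rfl), hb.evMap_proj_eq]
  congr 2
  congr 1
  exact LinearMap.ext fun y => congrArg (schurAct hq e) (schurMap_id y)

lemma kosPhi_map_wedge (hb : BlockSplit ic π e ε jc ρ f φ Φ Φ')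
    {p q q' q₁ q₁' s r r' r₁ r₁' : ℤ}
    (hr : r' = r + 1) (hq : q' = q + 1) (hr₁ : r₁' = r₁ + 1) (hq₁ : q₁' = q₁ + 1)
    (hs : r = s + 1) (h : s = r₁) (hs' : r' = r + 1) (h' : r = r₁') (l : q = q₁ + 1)
    (l' : q' = q₁' + 1) (z : ExtPow R N r₁ ⊗[R] schurLPos R P p q₁) :
    kosPhi Φ hr hq (TensorProduct.map (wedgeVec hs f ∘ₗ extMap jc h) (schurAct l e) z) =
      (-1 : R) • TensorProduct.map (wedgeVec hs' f ∘ₗ extMap jc h') (schurAct l' e)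
        (kosPhi (ρ ∘ₗ Φ) hr₁ hq₁ z) := by
  unfold kosPhi
  rw [hb.evMap_map_wedge hr hs h h' hr₁ (schurAct hq) (schurAct hq₁ ∘ₗ ic)
    (schurAct l e) (schurAct l' e) (fun m y => by
      obtain rfl : q₁' = q := by omega
      exact schurAct_comm _ _ _ _ _), hb.evMap_proj_eq]

lemma etaPhi_map_incl (hb : BlockSplit ic π e ε jc ρ f φ Φ Φ') {p q q' q₁ q₁' r r' r₁ r₁' : ℤ}
    (hr : r' = r + 1) (hq : q' = q - 1) (hr₁ : r₁' = r₁ + 1) (hq₁ : q₁' = q₁ - 1)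
    (h : r = r₁) (h' : r' = r₁') (k : q = q₁) (k' : q' = q₁')
    (z : ExtPow R N r₁ ⊗[R] weylK R M p q₁) :
    etaPhi Φ hr hq (TensorProduct.map (extMap jc h) (weylMap π rfl k) z) =
      TensorProduct.map (extMap jc h') (weylMap π rfl k') (etaPhi Φ' hr₁ hq₁ z) := by
  have hg (m : M) (y : weylK R M p q₁) : weylAct hq (ic m) (weylMap (p := p) π rfl k y) =
      weylMap π rfl k' (weylAct hq₁ m y) :=
    (weylAct_weylMap π hq hq₁ rfl k k' (ic m) y).trans
      (congrArg (fun t => weylMap π rfl k' (weylAct hq₁ t y)) (hb.source.proj_incl m))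
  refine (hb.evMap_map_incl hr h h' hr₁ (weylAct hq) (weylAct hq₁)
    (weylMap π rfl k) (weylMap π rfl k') hg z).trans ?_
  exact (congrArg (_ + ·) (map_eq_zero_of_right _ (fun y =>
    weylAct_weylMap_eq_zero hq rfl k hb.source.proj_e y) z)).trans (add_zero _)

lemma etaPhi_map_wedge (hb : BlockSplit ic π e ε jc ρ f φ Φ Φ') {p p₁ q q' r r' r₁ r₁' : ℤ}
    (hr : r' = r + 1) (hq : q' = q - 1) (hr₁ : r₁' = r₁ + 1)
    (h : r = r₁) (h' : r' = r₁') (hp : p = p₁ + 1)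
    (z : ExtPow R N r₁ ⊗[R] weylK R M p₁ q) :
    etaPhi Φ hr hq (TensorProduct.map (extMap jc h)
        (weylWedge hp rfl ε ∘ₗ weylMap π rfl rfl) z) =
      TensorProduct.map (extMap jc h') (weylWedge hp rfl ε ∘ₗ weylMap π rfl rfl)
        (etaPhi Φ' hr₁ hq z) := by
  let g (s : ℤ) : weylK R M p₁ s →ₗ[R] weylK R P p s :=
    weylWedge hp rfl ε ∘ₗ weylMap π rfl rfl
  have hg (m : M) (y : weylK R M p₁ q) :
      weylAct hq (ic m) (g q y) = g q' (weylAct hq m y) := by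
    refine (weylAct_weylWedge hq hq hp rfl rfl (ic m) ε _).trans
      (congrArg (weylWedge hp rfl ε) ?_)
    have h1 := weylAct_weylMap π hq hq rfl rfl rfl (ic m) y
    rwa [hb.source.proj_incl] at h1
  have h0 (y : weylK R M p₁ q) : (weylAct hq e ∘ₗ g q) y = 0 :=
    weylAct_weylWedge_weylMap_eq_zero hq hp hb.source.proj_e ε y
  refine (hb.evMap_map_incl hr h h' hr₁ (weylAct hq) (weylAct hq) (g q) (g q') hg z).trans ?_
  exact (congrArg (_ + ·) (map_eq_zero_of_right _ h0 z)).trans (add_zero _)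

lemma map_proj_etaPhi (hb : BlockSplit ic π e ε jc ρ f φ Φ Φ') {p q q' q₁ q₁' r r' r₁ r₁' : ℤ}
    (hr : r' = r + 1) (hq : q' = q - 1) (hr₁ : r₁' = r₁ + 1) (hq₁ : q₁' = q₁ - 1)
    (h : r₁ = r) (h' : r₁' = r') (k : q₁ = q - 1) (k' : q₁' = q' - 1)
    (z : ExtPow R Q r ⊗[R] weylK R P p q) :
    TensorProduct.map (extMap ρ h') (weylAct k' e) (etaPhi Φ hr hq z) =
      etaPhi (ρ ∘ₗ Φ) hr₁ hq₁ (TensorProduct.map (extMap ρ h) (weylAct k e) z) := by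
  obtain rfl : q₁ = q' := by omega
  exact (hb.map_proj_evMap hr h h' hr₁ (weylAct hq) (weylAct hq₁ ∘ₗ ic) (weylAct k e)
    (weylAct k' e) (fun m y => weylAct_comm hq k' e (ic m) y) z).trans
    (hb.evMap_proj_eq hr₁ (weylAct hq₁) _).symm

lemma map_extCo_etaPhi (hb : BlockSplit ic π e ε jc ρ f φ Φ Φ') {p q q' r r' r₁ r₁' : ℤ}
    (hr : r' = r + 1) (hq : q' = q - 1) (hr₁ : r₁' = r₁ + 1)
    (h : r₁ = r - 1) (h' : r₁' = r' - 1) (hrr : r₁' = r)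
    (z : ExtPow R Q r ⊗[R] weylK R P p q) :
    TensorProduct.map (extCo ρ φ h') LinearMap.id (etaPhi Φ hr hq z) =
      (-1 : R) • etaPhi (ρ ∘ₗ Φ) hr₁ hq (TensorProduct.map (extCo ρ φ h) LinearMap.id z) +
      TensorProduct.map (extMap ρ hrr) (weylAct hq e) z := by
  refine (hb.map_extCo_evMap hr h h' hr₁ hrr (weylAct hq) (weylAct hq ∘ₗ ic) LinearMap.id
    LinearMap.id (fun m y => rfl) z).trans ?_
  exact congrArg (fun t => (-1 : R) • t + _) (hb.evMap_proj_eq hr₁ (weylAct hq) _).symm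

end BlockSplit
end BlockMaps

/-! ### The quotient complex -/

section Quot
variable {R : Type u} [CommRing R] [Nontrivial R]
  {F' F'' G' G'' : Type u} [AddCommGroup F'] [Module R F'] [Module.Free R F'] [Module.Finite R F']
  [AddCommGroup F''] [Module R F''] [Module.Free R F''] [Module.Finite R F'']
  [AddCommGroup G'] [Module R G'] [Module.Free R G'] [Module.Finite R G']
  [AddCommGroup G''] [Module R G''] [Module.Free R G''] [Module.Finite R G'']
  {e : G''} {ε : Module.Dual R G''} {f : F''} {φ : Module.Dual R F''}

/-- The component `⋀ʳ F ⊗ L^p_q G → ⋀ʳ⁻¹ F' ⊗ L^p_q G' ⊗ F''` of `quot†`. -/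
def quotMap (hF : Module.finrank R F'' = 1) (hG : Module.finrank R G'' = 1) (i a j : ℤ) :
    LMod R (G' × G'') (F' × F'') (Module.finrank R (F' × F'') - i - 1)
      (Module.finrank R (G' × G'') - a) j →ₗ[R]
    LMod R G' F' (Module.finrank R F' - i - 1) (Module.finrank R G' - (a - 1)) j ⊗[R] F'' :=
  (TensorProduct.rightComm R _ F'' _).toLinearMap ∘ₗ
      TensorProduct.map (extProj (by have := finrank_prod_one (F' := F') hF; omega))
        (schurMap (LinearMap.fst R G' G'') (by have := finrank_prod_one (F' := G') hG; omega)
          (by have := finrank_prod_one (F' := F') hF; omega))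

/-- The component `⋀ʳ F ⊗ L^p_q G → ⋀ʳ⁻¹ F' ⊗ L^{p-1}_q G' ⊗ F'' ⊗ G''` of `quot†`. -/
def quotCo (hF : Module.finrank R F'' = 1) (hG : Module.finrank R G'' = 1) (i a j : ℤ) :
    LMod R (G' × G'') (F' × F'') (Module.finrank R (F' × F'') - i - 1)
      (Module.finrank R (G' × G'') - a) j →ₗ[R]
    LMod R G' F' (Module.finrank R F' - i - 1) (Module.finrank R G' - a) j ⊗[R] (F'' ⊗[R] G'') :=
  (TensorProduct.tensorTensorTensorComm R _ F'' _ G'').toLinearMap ∘ₗ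
      TensorProduct.map (extProj (by have := finrank_prod_one (F' := F') hF; omega))
        (schurProj (by have := finrank_prod_one (F' := G') hG; omega)
          (by have := finrank_prod_one (F' := F') hF; omega))

lemma quotDagger_apply (hF : Module.finrank R F'' = 1) (hG : Module.finrank R G'' = 1) (i a j : ℤ)
    (x : CMod R (G' × G'') (F' × F'') i a j) :
    quotDagger hF hG i a j x =
      (x.1, x.2.1, quotMap hF hG i a j x.2.2, quotCo hF hG i a j x.2.2) := rfl

/-- The map `quotMap` after identifying `F''` with `R`. -/
def quotMapOne (φ : Module.Dual R F'') (hF : Module.finrank R F'' = 1)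
    (hG : Module.finrank R G'' = 1) (i a j : ℤ) :
    LMod R (G' × G'') (F' × F'') (Module.finrank R (F' × F'') - i - 1)
      (Module.finrank R (G' × G'') - a) j →ₗ[R]
    LMod R G' F' (Module.finrank R F' - i - 1) (Module.finrank R G' - (a - 1)) j :=
  TensorProduct.map (extCo (LinearMap.fst R F' F'') ((LinearMap.snd R F' F'').dualMap φ)
      (by have := finrank_prod_one (F' := F') hF; omega))
    (schurMap (LinearMap.fst R G' G'') (by have := finrank_prod_one (F' := G') hG; omega)
      (by have := finrank_prod_one (F' := F') hF; omega))

/-- The map `quotCo` after identifying `F''` and `G''` with `R`. -/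
def quotCoOne (φ : Module.Dual R F'') (ε : Module.Dual R G'') (hF : Module.finrank R F'' = 1)
    (hG : Module.finrank R G'' = 1) (i a j : ℤ) :
    LMod R (G' × G'') (F' × F'') (Module.finrank R (F' × F'') - i - 1)
      (Module.finrank R (G' × G'') - a) j →ₗ[R]
    LMod R G' F' (Module.finrank R F' - i - 1) (Module.finrank R G' - a) j :=
  TensorProduct.map (extCo (LinearMap.fst R F' F'') ((LinearMap.snd R F' F'').dualMap φ)
      (by have := finrank_prod_one (F' := F') hF; omega))
    (schurCo (LinearMap.fst R G' G'') ((LinearMap.snd R G' G'').dualMap ε)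
      (by have := finrank_prod_one (F' := G') hG; omega)
      (by have := finrank_prod_one (F' := F') hF; omega))

lemma quotMap_apply (hf : LineBasis f φ) (hF : Module.finrank R F'' = 1)
    (hG : Module.finrank R G'' = 1) (i a j : ℤ)
    (z : LMod R (G' × G'') (F' × F'') (Module.finrank R (F' × F'') - i - 1)
      (Module.finrank R (G' × G'') - a) j) :
    quotMap hF hG i a j z = quotMapOne φ hF hG i a j z ⊗ₜ f := by
  induction z using TensorProduct.induction_on with
  | zero => rw [map_zero, map_zero, zero_tmul]
  | add x y hx hy => rw [map_add, map_add, hx, hy, add_tmul]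
  | tmul u x =>
    simp only [quotMap, LinearMap.comp_apply, TensorProduct.map_tmul, hf.extProj_apply]
    rfl

lemma quotCo_apply (he : LineBasis e ε) (hf : LineBasis f φ) (hF : Module.finrank R F'' = 1)
    (hG : Module.finrank R G'' = 1) (i a j : ℤ)
    (z : LMod R (G' × G'') (F' × F'') (Module.finrank R (F' × F'') - i - 1)
      (Module.finrank R (G' × G'') - a) j) :
    quotCo hF hG i a j z = quotCoOne φ ε hF hG i a j z ⊗ₜ (f ⊗ₜ e) := by
  induction z using TensorProduct.induction_on with
  | zero => rw [map_zero, map_zero, zero_tmul]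
  | add x y hx hy => rw [map_add, map_add, hx, hy, add_tmul]
  | tmul u x =>
    simp only [quotCo, LinearMap.comp_apply, TensorProduct.map_tmul, hf.extProj_apply,
      he.schurProj_coe]
    rfl

/-- The first component of `quot†` anticommutes with the differentials of `𝕃`. -/
lemma quotMapOne_kosPhi (he : LineBasis e ε) (hf : LineBasis f φ) (hF : Module.finrank R F'' = 1)
    (hG : Module.finrank R G'' = 1) (Φ' : Module.Dual R G' →ₗ[R] F')
    (Φ'' : Module.Dual R G'' →ₗ[R] F'') (h : Φ'' ε = f) (i a : ℤ) {j j' : ℤ} (hj : j + 1 = j')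
    (z : LMod R (G' × G'') (F' × F'') (Module.finrank R (F' × F'') - i - 1)
      (Module.finrank R (G' × G'') - a) j') :
    quotMapOne φ hF hG i a j (kosPhi (blockSum Φ' Φ'') (by omega) (by omega) z) =
      (-1 : R) • kosPhi Φ' (by omega) (by omega) (quotMapOne φ hF hG i a j' z) :=
  (blockSplit_blockSum he hf Φ' Φ'' h).map_schurMap_kosPhi _ _ _ _ _ _ _ _ _ z

/-- The second component of `quot†` anticommutes with the differentials of `𝕃`. -/
lemma quotCoOne_kosPhi (he : LineBasis e ε) (hf : LineBasis f φ) (hF : Module.finrank R F'' = 1)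
    (hG : Module.finrank R G'' = 1) (Φ' : Module.Dual R G' →ₗ[R] F')
    (Φ'' : Module.Dual R G'' →ₗ[R] F'') (h : Φ'' ε = f) (i a : ℤ) {j j' : ℤ} (hj : j + 1 = j')
    (z : LMod R (G' × G'') (F' × F'') (Module.finrank R (F' × F'') - i - 1)
      (Module.finrank R (G' × G'') - a) j') :
    quotCoOne φ ε hF hG i a j (kosPhi (blockSum Φ' Φ'') (by omega) (by omega) z) =
      (-1 : R) • kosPhi Φ' (by omega) (by omega) (quotCoOne φ ε hF hG i a j' z) :=
  (blockSplit_blockSum he hf Φ' Φ'' h).map_schurCo_kosPhi _ _ _ _ _ _ _ _ _ z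

/-- The differential of the complex `D`. On the pieces of `𝕂` and of `⋀ F` it is the one of
`C^{i,a}_Φ`, followed by the two components of `quot†`; on the pieces of `𝕃` it is `-Kos_{Φ'}`. -/
def dDiff (Φ' : Module.Dual R G' →ₗ[R] F') (Φ'' : Module.Dual R G'' →ₗ[R] F'')
    (hF : Module.finrank R F'' = 1) (hG : Module.finrank R G'' = 1) (i a j' j : ℤ)
    (h : j + 1 = j') : DMod R F' F'' G' G'' i a j' →ₗ[R] DMod R F' F'' G' G'' i a j :=
  LinearMap.prod (etaPhi (blockSum Φ' Φ'') (by omega) (by omega) ∘ₗ LinearMap.fst R _ _)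
    (LinearMap.prod (mu (blockSum Φ' Φ'') (by omega) (by omega) ∘ₗ LinearMap.fst R _ _)
      (LinearMap.prod
        (quotMap hF hG i a j ∘ₗ
            eps (blockSum Φ' Φ'') (k := Module.finrank R (G' × G'') + 1 - a) (by omega) (by omega)
              (by omega) ∘ₗ LinearMap.fst R _ _ ∘ₗ LinearMap.snd R _ _ +
          (-1 : R) • (LinearMap.rTensor F'' (kosPhi Φ' (by omega) (by omega)) ∘ₗ
            LinearMap.fst R _ _ ∘ₗ LinearMap.snd R _ _ ∘ₗ LinearMap.snd R _ _))
        (quotCo hF hG i a j ∘ₗ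
            eps (blockSum Φ' Φ'') (k := Module.finrank R (G' × G'') + 1 - a) (by omega) (by omega)
              (by omega) ∘ₗ LinearMap.fst R _ _ ∘ₗ LinearMap.snd R _ _ +
          (-1 : R) • (LinearMap.rTensor (F'' ⊗[R] G'') (kosPhi Φ' (by omega) (by omega)) ∘ₗ
            LinearMap.snd R _ _ ∘ₗ LinearMap.snd R _ _ ∘ₗ LinearMap.snd R _ _))))

/-- The map `quot†` commutes with the differentials. -/
lemma quotDagger_cDiff (he : LineBasis e ε) (hf : LineBasis f φ) (hF : Module.finrank R F'' = 1)
    (hG : Module.finrank R G'' = 1) (Φ' : Module.Dual R G' →ₗ[R] F')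
    (Φ'' : Module.Dual R G'' →ₗ[R] F'') (h : Φ'' ε = f) (i a : ℤ) {j j' : ℤ} (hj : j + 1 = j')
    (x : CMod R (G' × G'') (F' × F'') i a j') :
    quotDagger hF hG i a j (cDiff (blockSum Φ' Φ'') i a j' j hj x) =
      dDiff Φ' Φ'' hF hG i a j' j hj (quotDagger hF hG i a j' x) := by
  obtain ⟨x, y, z⟩ := x
  refine Prod.ext rfl (Prod.ext rfl (Prod.ext ?_ ?_))
  · refine (map_add (quotMap hF hG i a j) _ _).trans (congrArg (_ + ·) ?_)
    change quotMap hF hG i a j (kosPhi _ _ _ z) =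
      (-1 : R) • LinearMap.rTensor F'' (kosPhi Φ' _ _) (quotMap hF hG i a j' z)
    rw [quotMap_apply hf, quotMap_apply hf, quotMapOne_kosPhi he hf hF hG Φ' Φ'' h i a hj]
    rfl
  · refine (map_add (quotCo hF hG i a j) _ _).trans (congrArg (_ + ·) ?_)
    change quotCo hF hG i a j (kosPhi _ _ _ z) =
      (-1 : R) • LinearMap.rTensor (F'' ⊗[R] G'') (kosPhi Φ' _ _) (quotCo hF hG i a j' z)
    rw [quotCo_apply he hf, quotCo_apply he hf, quotCoOne_kosPhi he hf hF hG Φ' Φ'' h i a hj]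
    rfl

lemma quotDagger_surjective (he : LineBasis e ε) (hf : LineBasis f φ)
    (hF : Module.finrank R F'' = 1) (hG : Module.finrank R G'' = 1) (i a j : ℤ)
    (hag : a ≤ Module.finrank R (G' × G'') - 1) :
    Function.Surjective (quotDagger (F' := F') (G' := G') hF hG i a j) := by
  rintro ⟨x, y, z, w⟩
  have hs : LineBasis (f ⊗ₜ[R] e) _ := hf.tensor he
  obtain ⟨z, rfl⟩ := hf.exists_tmul z
  obtain ⟨w, rfl⟩ := hs.exists_tmul w
  obtain ⟨t, ht, ht'⟩ := exists_schur_quot (he.lineSplit (M := G')) (hf.lineSplit (M := F'))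
    (p := Module.finrank R (G' × G'') - a)
    (p₁ := Module.finrank R G' - (a - 1)) (p₂ := Module.finrank R G' - a)
    (q := Module.finrank R (F' × F'') - (Module.finrank R (F' × F'') - i - 1) - j)
    (q₂ := Module.finrank R F' - (Module.finrank R F' - i - 1) - j)
    (r := Module.finrank R (F' × F'') - j) (r₂ := Module.finrank R F' - j) (by omega)
    (by have := finrank_prod_one (F' := F') hF; omega)
    (by have := finrank_prod_one (F' := G') hG; omega)
    (by have := finrank_prod_one (F' := G') hG; omega) (by omega) z w
  refine ⟨(x, y, t), Prod.ext rfl (Prod.ext rfl (Prod.ext ?_ ?_))⟩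
  · exact (quotMap_apply hf hF hG i a j t).trans (congrArg (· ⊗ₜ f) ht)
  · exact (quotCo_apply he hf hF hG i a j t).trans (congrArg (· ⊗ₜ (f ⊗ₜ e)) ht')

lemma cDiff_cDiff {G F : Type u} [AddCommGroup G] [Module R G] [Module.Free R G]
    [Module.Finite R G] [AddCommGroup F] [Module R F] [Module.Free R F]
    (Φ : Module.Dual R G →ₗ[R] F) (i a : ℤ) {j j' j'' : ℤ} (hj : j + 1 = j') (hj' : j' + 1 = j'')
    (x : CMod R G F i a j'') : cDiff Φ i a j' j hj (cDiff Φ i a j'' j' hj' x) = 0 := by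
  have h1 := congrArg (fun t => ModuleCat.Hom.hom t x) ((CComplex Φ i a).d_comp_d j'' j' j)
  have h2 : (CComplex Φ i a).d j'' j' = _ := mkComplex_d _ hj'
  have h3 : (CComplex Φ i a).d j' j = _ := mkComplex_d _ hj
  rw [h2, h3] at h1
  exact h1

/-- As `quot†` is surjective, this is inherited from `C^{i,a}_Φ`. -/
lemma dDiff_dDiff (he : LineBasis e ε) (hf : LineBasis f φ) (hF : Module.finrank R F'' = 1)
    (hG : Module.finrank R G'' = 1) (Φ' : Module.Dual R G' →ₗ[R] F')
    (Φ'' : Module.Dual R G'' →ₗ[R] F'') (h : Φ'' ε = f) (i a : ℤ)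
    (hag : a ≤ Module.finrank R (G' × G'') - 1) {j j' j'' : ℤ} (hj : j + 1 = j')
    (hj' : j' + 1 = j'') (x : DMod R F' F'' G' G'' i a j'') :
    dDiff Φ' Φ'' hF hG i a j' j hj (dDiff Φ' Φ'' hF hG i a j'' j' hj' x) = 0 := by
  obtain ⟨x, rfl⟩ := quotDagger_surjective he hf hF hG i a j'' hag x
  refine (congrArg (dDiff Φ' Φ'' hF hG i a j' j hj)
    (quotDagger_cDiff he hf hF hG Φ' Φ'' h i a hj' x)).symm.trans ?_
  refine (quotDagger_cDiff he hf hF hG Φ' Φ'' h i a hj _).symm.trans ?_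
  refine (congrArg (quotDagger hF hG i a j) (cDiff_cDiff (blockSum Φ' Φ'') i a hj hj' x)).trans ?_
  exact map_zero (quotDagger hF hG i a j)

/-- The negation of `DMod` is the multiplication by `-1`. -/
instance dMod_addCommGroup (i a j : ℤ) : AddCommGroup (DMod R F' F'' G' G'' i a j) :=
  Module.addCommMonoidToAddCommGroup R

/-- The complex `D`, with the modules `DMod` and the differentials `dDiff`. -/
def DComplex (he : LineBasis e ε) (hf : LineBasis f φ) (hF : Module.finrank R F'' = 1)
    (hG : Module.finrank R G'' = 1) (Φ' : Module.Dual R G' →ₗ[R] F')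
    (Φ'' : Module.Dual R G'' →ₗ[R] F'') (h : Φ'' ε = f) (i a : ℤ)
    (hag : a ≤ Module.finrank R (G' × G'') - 1) : ChainComplex (ModuleCat.{u} R) ℤ :=
  mkComplex (DMod R F' F'' G' G'' i a) (dDiff Φ' Φ'' hF hG i a)
    (fun _ _ _ hj hj' x => dDiff_dDiff he hf hF hG Φ' Φ'' h i a hag hj' hj x)

end Quot

/-! ### The first short exact sequence -/

section Dagger
variable {R : Type u} [CommRing R]

lemma XIsoOfEq_tensorC (A : ChainComplex (ModuleCat.{u} R) ℤ) {P : Type u} [AddCommGroup P]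
    [Module R P] {k j : ℤ} (h : k = j) (x : A.X k) (p : P) :
    ((tensorC A P).XIsoOfEq h).hom.hom (x ⊗ₜ[R] p) = ((A.XIsoOfEq h).hom.hom x) ⊗ₜ[R] p := by
  subst h
  simp only [HomologicalComplex.XIsoOfEq_rfl, Iso.refl_hom]
  rfl

lemma Tot_tensorMapC_d (A : ChainComplex (ModuleCat.{u} R) ℤ) {P Q : Type u} [AddCommGroup P]
    [Module R P] [AddCommGroup Q] [Module R Q] (t : P →ₗ[R] Q) {j j' : ℤ} (h : j + 1 = j')
    (x : A.X (j' - 1)) (p : P) (y : A.X j') :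
    ((Tot (tensorMapC A t)).d j' j).hom (x ⊗ₜ[R] p, y ⊗ₜ[R] t p) =
      ((A.d (j' - 1) (j - 1)).hom x ⊗ₜ[R] p,
        ((A.XIsoOfEq (show j' - 1 = j by omega)).hom.hom x - (A.d j' j).hom y) ⊗ₜ[R] t p) := by
  refine (Tot_d (tensorMapC A t) h (x ⊗ₜ[R] p) (y ⊗ₜ[R] t p)).trans (Prod.ext ?_ ?_)
  · exact congrArg (fun m => m (x ⊗ₜ[R] p)) (tensorC_d A P (show (j - 1) + 1 = j' - 1 by omega))
  · refine (congrArg₂ (fun a b : A.X j ⊗[R] Q => a - b) ?_ ?_).trans (sub_tmul _ _ _).symm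
    · exact congrArg ((tensorMapC A t).f j).hom (XIsoOfEq_tensorC A _ x p)
    · exact congrArg (fun m => m (y ⊗ₜ[R] t p)) (tensorC_d A Q h)

lemma add_congr {A : Type*} [Add A] {a b c d : A} (h : a = b) (h' : c = d) : a + c = b + d := by
  rw [h, h']

variable [Nontrivial R]
  {F' F'' G' G'' : Type u} [AddCommGroup F'] [Module R F'] [Module.Free R F'] [Module.Finite R F']
  [AddCommGroup F''] [Module R F''] [Module.Free R F''] [Module.Finite R F'']
  [AddCommGroup G'] [Module R G'] [Module.Free R G'] [Module.Finite R G']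
  [AddCommGroup G''] [Module R G''] [Module.Free R G''] [Module.Finite R G'']
  {e : G''} {ε : Module.Dual R G''} {f : F''} {φ : Module.Dual R F''}

lemma map_tensorTensorTensorComm {A A' B B' P Q : Type*} [AddCommMonoid A] [Module R A]
    [AddCommMonoid A'] [Module R A'] [AddCommMonoid B] [Module R B] [AddCommMonoid B']
    [Module R B'] [AddCommMonoid P] [Module R P] [AddCommMonoid Q] [Module R Q]
    (α : A →ₗ[R] P →ₗ[R] A') (β : B →ₗ[R] Q →ₗ[R] B') {α₁ : A →ₗ[R] A'} {β₁ : B →ₗ[R] B'}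
    {p : P} {q : Q} (hα : ∀ x, α x p = α₁ x) (hβ : ∀ x, β x q = β₁ x) (y : A ⊗[R] B) :
    TensorProduct.map (TensorProduct.lift α) (TensorProduct.lift β)
      (TensorProduct.tensorTensorTensorComm R A B P Q (y ⊗ₜ (p ⊗ₜ q))) =
      TensorProduct.map α₁ β₁ y := by
  induction y using TensorProduct.induction_on with
  | zero => rw [zero_tmul, map_zero, map_zero, map_zero]
  | add x y hx hy => rw [add_tmul, map_add, map_add, map_add, hx, hy]
  | tmul u x =>
    rw [TensorProduct.tensorTensorTensorComm_tmul, TensorProduct.map_tmul, TensorProduct.map_tmul,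
      TensorProduct.lift.tmul, TensorProduct.lift.tmul, hα, hβ]

section LComplex
variable {G F P Q : Type u} [AddCommGroup G] [Module R G] [Module.Free R G]
    [Module.Finite R G] [AddCommGroup F] [Module R F] [AddCommGroup P]
    [Module R P] [AddCommGroup Q] [Module R Q]

/-- The differential of `𝕃^{N,p}_Φ`. -/
def lDiff (Φ : Module.Dual R G →ₗ[R] F) (N p : ℤ) {j j' : ℤ} (h : j + 1 = j') :
    LMod R G F N p j' →ₗ[R] LMod R G F N p j :=
  kosPhi Φ (by omega) (by omega)

lemma LComplex_d (Φ : Module.Dual R G →ₗ[R] F) (N p : ℤ) {j j' : ℤ} (h : j + 1 = j')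
    (x : LMod R G F N p j') : ((LComplex Φ N p).d j' j).hom x = lDiff Φ N p h x :=
  congrArg (fun m : (LComplex Φ N p).X j' ⟶ (LComplex Φ N p).X j => m.hom x) (mkComplex_d _ h)

variable (R G F) in
/-- The identification of two components of `𝕃^{N,p}_Φ` whose degrees are equal. -/
def lCast (N p : ℤ) {k j : ℤ} (h : k = j) : LMod R G F N p k →ₗ[R] LMod R G F N p j :=
  TensorProduct.map (extMap LinearMap.id (by omega)) (schurMap LinearMap.id rfl (by omega))

lemma lCast_rfl (N p : ℤ) {j : ℤ} (x : LMod R G F N p j) : lCast R G F N p rfl x = x := by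
  have h1 : extMap LinearMap.id rfl =
    (LinearMap.id : ExtPow R F (Module.finrank R F - j) →ₗ[R] _) :=
    LinearMap.ext fun y => extMap_id rfl y
  have h2 : schurMap LinearMap.id rfl rfl =
    (LinearMap.id : schurLPos R G p (Module.finrank R F - N - j) →ₗ[R] _) :=
    LinearMap.ext fun y => schurMap_id y
  rw [lCast, h1, h2, TensorProduct.map_id, LinearMap.id_apply]

lemma XIsoOfEq_LComplex (Φ : Module.Dual R G →ₗ[R] F) (N p : ℤ) {k j : ℤ} (h : k = j)
    (x : LMod R G F N p k) :
    ((LComplex Φ N p).XIsoOfEq h).hom.hom x = lCast R G F N p h x := by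
  subst h
  rw [lCast_rfl, HomologicalComplex.XIsoOfEq_rfl]
  rfl

lemma Tot_LComplex_d (Φ : Module.Dual R G →ₗ[R] F) (N p : ℤ) (t : P →ₗ[R] Q) {j j' : ℤ}
    (hj : j + 1 = j') (x : LMod R G F N p (j' - 1)) (v : P) (y : LMod R G F N p j') :
    ((Tot (tensorMapC (LComplex Φ N p) t)).d j' j).hom (x ⊗ₜ[R] v, y ⊗ₜ[R] t v) =
      (lDiff Φ N p (show (j - 1) + 1 = j' - 1 by omega) x ⊗ₜ[R] v,
        (lCast R G F N p (show j' - 1 = j by omega) x - lDiff Φ N p hj y) ⊗ₜ[R] t v) := by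
  refine (Tot_tensorMapC_d (LComplex Φ N p) t hj x v y).trans (Prod.ext ?_ ?_)
  · exact congrArg (· ⊗ₜ[R] v) (LComplex_d Φ N p _ x)
  · exact congrArg (· ⊗ₜ[R] t v) (congrArg₂ (fun a b : LMod R G F N p j => a - b)
      (XIsoOfEq_LComplex Φ N p _ x) (LComplex_d Φ N p hj y))

end LComplex

/-- The first component of `incl†`, after identifying `F''` and `G''` with `R`. -/
def inclFst (hF : Module.finrank R F'' = 1) (i a j : ℤ) :
    LMod R (G' × G'') F' (Module.finrank R (F' × F'') - i - 1)
      (Module.finrank R (G' × G'') - a) (j - 1) →ₗ[R]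
    LMod R (G' × G'') (F' × F'') (Module.finrank R (F' × F'') - i - 1)
      (Module.finrank R (G' × G'') - a) j :=
  TensorProduct.map
    (extMap (LinearMap.inl R F' F'') (by have := finrank_prod_one (F' := F') hF; omega))
    (schurMap LinearMap.id rfl (by have := finrank_prod_one (F' := F') hF; omega))

/-- The second component of `incl†`, after identifying `F''` and `G''` with `R`. -/
def inclSnd (e : G'') (f : F'') (hF : Module.finrank R F'' = 1) (i a j : ℤ) :
    LMod R (G' × G'') F' (Module.finrank R (F' × F'') - i - 1)
      (Module.finrank R (G' × G'') - a) j →ₗ[R]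
    LMod R (G' × G'') (F' × F'') (Module.finrank R (F' × F'') - i - 1)
      (Module.finrank R (G' × G'') - a) j :=
  TensorProduct.map
    (wedgeVec (by have := finrank_prod_one (F' := F') hF; omega) (LinearMap.inr R F' F'' f) ∘ₗ
      extMap (LinearMap.inl R F' F'') rfl)
    (schurAct (by have := finrank_prod_one (F' := F') hF; omega) (LinearMap.inr R G' G'' e))

lemma inclDagger_apply (e : G'') (f : F'') (hF : Module.finrank R F'' = 1) (i a j : ℤ)
    (x : LMod R (G' × G'') F' (Module.finrank R (F' × F'') - i - 1)
      (Module.finrank R (G' × G'') - a) (j - 1))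
    (y : LMod R (G' × G'') F' (Module.finrank R (F' × F'') - i - 1)
      (Module.finrank R (G' × G'') - a) j) :
    inclDagger hF i a j (x ⊗ₜ[R] (1 : R), y ⊗ₜ[R] (f ⊗ₜ[R] e)) =
      (0, 0, inclFst hF i a j x + inclSnd e f hF i a j y) := by
  refine Prod.ext rfl (Prod.ext rfl ?_)
  refine add_congr ?_ ?_
  · change inclFst hF i a j ((1 : R) • x) = _
    rw [one_smul]
  · exact map_tensorTensorTensorComm _ _ (fun _ => rfl) (fun _ => rfl) y

lemma inclSnd_lCast (e : G'') (f : F'') (hF : Module.finrank R F'' = 1) (i a : ℤ) {k j : ℤ}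
    (h : k = j) (x : LMod R (G' × G'') F' (Module.finrank R (F' × F'') - i - 1)
      (Module.finrank R (G' × G'') - a) k) :
    inclSnd e f hF i a j (lCast R (G' × G'') F' _ _ h x) =
    TensorProduct.map
      (wedgeVec (by have := finrank_prod_one (F' := F') hF; omega) (LinearMap.inr R F' F'' f) ∘ₗ
        extMap (LinearMap.inl R F' F'') (show (Module.finrank R F' : ℤ) - j = _ by rw [h]))
      (schurAct (by have := finrank_prod_one (F' := F') hF; omega) (LinearMap.inr R G' G'' e))
      x := by
  subst h
  rw [lCast_rfl]
  rfl

lemma lDiff_inclFst (he : LineBasis e ε) (hf : LineBasis f φ) (hF : Module.finrank R F'' = 1)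
    (Φ' : Module.Dual R G' →ₗ[R] F')
    (Φ'' : Module.Dual R G'' →ₗ[R] F'') (h : Φ'' ε = f) (i a : ℤ) {j j' : ℤ} (hj : j + 1 = j')
    (x : LMod R (G' × G'') F' (Module.finrank R (F' × F'') - i - 1)
      (Module.finrank R (G' × G'') - a) (j' - 1)) :
    lDiff (blockSum Φ' Φ'') _ _ hj (inclFst hF i a j' x) =
      inclFst hF i a j (lDiff (LinearMap.fst R F' F'' ∘ₗ blockSum Φ' Φ'') _ _
        (show (j - 1) + 1 = j' - 1 by omega) x) +
      inclSnd e f hF i a j (lCast R (G' × G'') F' _ _ (show j' - 1 = j by omega) x) := by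
  rw [inclSnd_lCast]
  exact (blockSplit_blockSum he hf Φ' Φ'' h).kosPhi_map_incl _ _ _ _ _ _ _ _ _ x

lemma lDiff_inclSnd (he : LineBasis e ε) (hf : LineBasis f φ) (hF : Module.finrank R F'' = 1)
    (Φ' : Module.Dual R G' →ₗ[R] F')
    (Φ'' : Module.Dual R G'' →ₗ[R] F'') (h : Φ'' ε = f) (i a : ℤ) {j j' : ℤ} (hj : j + 1 = j')
    (x : LMod R (G' × G'') F' (Module.finrank R (F' × F'') - i - 1)
      (Module.finrank R (G' × G'') - a) j') :
    lDiff (blockSum Φ' Φ'') _ _ hj (inclSnd e f hF i a j' x) =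
      (-1 : R) • inclSnd e f hF i a j
        (lDiff (LinearMap.fst R F' F'' ∘ₗ blockSum Φ' Φ'') _ _ hj x) :=
  (blockSplit_blockSum he hf Φ' Φ'' h).kosPhi_map_wedge _ _ _ _ _ _
    (by omega) (by have := finrank_prod_one (F' := F') hF; omega) _ _ x

/-- Every element of `A ⊗ R` is of the form `a ⊗ 1`. -/
lemma exists_tmul_one {A : Type*} [AddCommMonoid A] [Module R A] (z : A ⊗[R] R) :
    ∃ a : A, z = a ⊗ₜ 1 :=
  LineBasis.exists_tmul (e := (1 : R)) (ε := LinearMap.id) ⟨rfl, fun _ => mul_one _⟩ z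

lemma cDiff_of_LMod {G F : Type u} [AddCommGroup G] [Module R G] [Module.Free R G]
    [Module.Finite R G] [AddCommGroup F] [Module R F] [Module.Free R F]
    (Φ : Module.Dual R G →ₗ[R] F) (i a : ℤ) {j j' : ℤ} (hj : j + 1 = j')
    (z : LMod R G F (Module.finrank R F - i - 1) (Module.finrank R G - a) j') :
    cDiff Φ i a j' j hj (0, 0, z) = (0, 0, lDiff Φ _ _ hj z) := by
  refine Prod.ext ?_ (Prod.ext ?_ ?_)
  · change etaPhi Φ _ _ 0 = 0
    exact map_zero _
  · change mu Φ (by omega) (by omega) 0 = 0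
    exact map_zero _
  · change eps Φ _ _ _ 0 + kosPhi Φ _ _ z = kosPhi Φ _ _ z
    rw [map_zero, zero_add]

lemma add_add_neg_one_smul {A : Type*} [AddCommGroup A] [Module R A] (u v w : A) :
    u + v + (-1 : R) • w = u + (v - w) := by
  rw [neg_one_smul, add_assoc, sub_eq_add_neg]

/-- The map `(x, y) ↦ x + y ∧ f e` commutes with the differentials, where the source carries the
differential of a total complex. -/
lemma lDiff_incl (he : LineBasis e ε) (hf : LineBasis f φ) (hF : Module.finrank R F'' = 1)
    (Φ' : Module.Dual R G' →ₗ[R] F') (Φ'' : Module.Dual R G'' →ₗ[R] F'') (h : Φ'' ε = f)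
    (i a : ℤ) {j j' : ℤ} (hj : j + 1 = j')
    (x : LMod R (G' × G'') F' (Module.finrank R (F' × F'') - i - 1)
      (Module.finrank R (G' × G'') - a) (j' - 1))
    (y : LMod R (G' × G'') F' (Module.finrank R (F' × F'') - i - 1)
      (Module.finrank R (G' × G'') - a) j') :
    lDiff (blockSum Φ' Φ'') _ _ hj (inclFst hF i a j' x + inclSnd e f hF i a j' y) =
      inclFst hF i a j (lDiff (LinearMap.fst R F' F'' ∘ₗ blockSum Φ' Φ'') _ _
        (show (j - 1) + 1 = j' - 1 by omega) x) +
      inclSnd e f hF i a j (lCast R (G' × G'') F' _ _ (show j' - 1 = j by omega) x -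
        lDiff (LinearMap.fst R F' F'' ∘ₗ blockSum Φ' Φ'') _ _ hj y) := by
  rw [map_add, lDiff_inclFst he hf hF Φ' Φ'' h i a hj, lDiff_inclSnd he hf hF Φ' Φ'' h i a hj,
    map_sub]
  exact add_add_neg_one_smul (R := R) (A := LMod R (G' × G'') (F' × F'')
    (Module.finrank R (F' × F'') - i - 1) (Module.finrank R (G' × G'') - a) j) _ _ _

lemma inclDagger_d_tmul (he : LineBasis e ε) (hf : LineBasis f φ) (hF : Module.finrank R F'' = 1)
    (Φ' : Module.Dual R G' →ₗ[R] F') (Φ'' : Module.Dual R G'' →ₗ[R] F'') (h : Φ'' ε = f)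
    (i a : ℤ) {j j' : ℤ} (hj : j + 1 = j')
    (x : LMod R (G' × G'') F' (Module.finrank R (F' × F'') - i - 1)
        (Module.finrank R (G' × G'') - a) (j' - 1))
    (y : LMod R (G' × G'') F' (Module.finrank R (F' × F'') - i - 1)
        (Module.finrank R (G' × G'') - a) j') :
    cDiff (blockSum Φ' Φ'') i a j' j hj
        (inclDagger hF i a j' (x ⊗ₜ[R] (1 : R), y ⊗ₜ[R] (f ⊗ₜ[R] e))) =
      inclDagger hF i a j (((Tot (tensorMapC
        (LComplex (LinearMap.fst R F' F'' ∘ₗ blockSum Φ' Φ'')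
          (Module.finrank R (F' × F'') - i - 1) (Module.finrank R (G' × G'') - a))
        (kosTwist Φ''))).d j' j).hom (x ⊗ₜ[R] (1 : R), y ⊗ₜ[R] (f ⊗ₜ[R] e))) := by
  have hk : kosTwist Φ'' 1 = f ⊗ₜ[R] e := by rw [he.kosTwist_one, one_smul, h]
  have hd := Tot_LComplex_d
    (LinearMap.fst R F' F'' ∘ₗ blockSum Φ' Φ'') (Module.finrank R (F' × F'') - i - 1)
    (Module.finrank R (G' × G'') - a) (kosTwist Φ'') hj x 1 y
  rw [hk] at hd
  refine Eq.trans ?_ (congrArg (inclDagger hF i a j) hd).symm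
  refine (congrArg (cDiff (blockSum Φ' Φ'') i a j' j hj)
    (inclDagger_apply e f hF i a j' x y)).trans ?_
  refine (cDiff_of_LMod (blockSum Φ' Φ'') i a hj _).trans ?_
  refine Eq.trans ?_ (inclDagger_apply e f hF i a j _ _).symm
  exact congrArg (fun t => (0, 0, t)) (lDiff_incl he hf hF Φ' Φ'' h i a hj x y)

/-- Every element of `(A ⊗ R) ⊕ (B ⊗ F'' ⊗ G'')` is of the form `(x ⊗ 1, y ⊗ f ⊗ e)`. -/
lemma exists_pair_tmul (hf : LineBasis f φ) (he : LineBasis e ε) {A B : Type*} [AddCommMonoid A]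
    [Module R A] [AddCommMonoid B] [Module R B] (x : (A ⊗[R] R) × (B ⊗[R] (F'' ⊗[R] G''))) :
    ∃ (x₁ : A) (y₁ : B), x = (x₁ ⊗ₜ[R] (1 : R), y₁ ⊗ₜ[R] (f ⊗ₜ[R] e)) := by
  obtain ⟨x₁, hx₁⟩ := exists_tmul_one x.1
  obtain ⟨y₁, hy₁⟩ := (hf.tensor he).exists_tmul x.2
  exact ⟨x₁, y₁, Prod.ext hx₁ hy₁⟩

lemma inclDagger_d (he : LineBasis e ε) (hf : LineBasis f φ) (hF : Module.finrank R F'' = 1)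
    (Φ' : Module.Dual R G' →ₗ[R] F') (Φ'' : Module.Dual R G'' →ₗ[R] F'') (h : Φ'' ε = f)
    (i a : ℤ) {j j' : ℤ} (hj : j + 1 = j')
    (x : (LMod R (G' × G'') F' (Module.finrank R (F' × F'') - i - 1)
        (Module.finrank R (G' × G'') - a) (j' - 1) ⊗[R] R) ×
      (LMod R (G' × G'') F' (Module.finrank R (F' × F'') - i - 1)
        (Module.finrank R (G' × G'') - a) j' ⊗[R] (F'' ⊗[R] G''))) :
    cDiff (blockSum Φ' Φ'') i a j' j hj (inclDagger hF i a j' x) =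
      inclDagger hF i a j (((Tot (tensorMapC
        (LComplex (LinearMap.fst R F' F'' ∘ₗ blockSum Φ' Φ'')
          (Module.finrank R (F' × F'') - i - 1) (Module.finrank R (G' × G'') - a))
        (kosTwist Φ''))).d j' j).hom x) := by
  obtain ⟨x₁, y₁, hx⟩ := exists_pair_tmul hf he x
  refine (congrArg (fun t => cDiff (blockSum Φ' Φ'') i a j' j hj (inclDagger hF i a j' t))
    hx).trans ((inclDagger_d_tmul he hf hF Φ' Φ'' h i a hj x₁ y₁).trans ?_)
  exact congrArg (fun t => inclDagger hF i a j (((Tot (tensorMapC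
        (LComplex (LinearMap.fst R F' F'' ∘ₗ blockSum Φ' Φ'')
          (Module.finrank R (F' × F'') - i - 1) (Module.finrank R (G' × G'') - a))
        (kosTwist Φ''))).d j' j).hom t)) hx.symm

lemma map_id_lTensor {A A' B B' : Type*} [AddCommMonoid A] [Module R A] [AddCommMonoid A']
    [Module R A'] [AddCommMonoid B] [Module R B] [AddCommMonoid B'] [Module R B']
    (α : A →ₗ[R] A') (m : B →ₗ[R] B') (x : A ⊗[R] B) :
    TensorProduct.map α LinearMap.id (m.lTensor A x) = TensorProduct.map α m x := by
  rw [LinearMap.lTensor, map_map_apply, LinearMap.comp_id, LinearMap.id_comp]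

lemma schurIncl_eq (e : G'') (f : F'') (hF : Module.finrank R F'' = 1) (i a j : ℤ)
    (x : LMod R (G' × G'') F' (Module.finrank R (F' × F'') - i - 1)
      (Module.finrank R (G' × G'') - a) (j - 1))
    (y : LMod R (G' × G'') F' (Module.finrank R (F' × F'') - i - 1)
      (Module.finrank R (G' × G'') - a) j) :
    inclFst hF i a j x + inclSnd e f hF i a j y =
      schurIncl (LinearMap.inl R F' F'') (LinearMap.inr R F' F'' f) (LinearMap.inr R G' G'' e)
        (by have := finrank_prod_one (F' := F') hF; omega)
        (by have := finrank_prod_one (F' := F') hF; omega)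
        (by have := finrank_prod_one (F' := F') hF; omega)
        (LinearMap.lTensor _ (schurMap LinearMap.id rfl
          (by have := finrank_prod_one (F' := F') hF; omega)) x, y) := by
  exact add_congr (map_id_lTensor _ _ x).symm rfl

lemma schurMap_id_bijective {G : Type u} [AddCommGroup G] [Module R G] [Module.Free R G]
    [Module.Finite R G] {p q q' : ℤ} (h : q' = q) :
    Function.Bijective (schurMap (LinearMap.id : G →ₗ[R] G) (rfl : p = p) h) := by
  subst h
  have : schurMap (LinearMap.id : G →ₗ[R] G) (rfl : p = p) (rfl : q' = q') = LinearMap.id :=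
    LinearMap.ext schurMap_id
  rw [this]
  exact Function.bijective_id

lemma prod_lTensor_injective {A B C D : Type*} [AddCommMonoid A] [Module R A]
    [AddCommMonoid B] [Module R B] [AddCommMonoid C] [Module R C] {m : A →ₗ[R] B}
    (hm : Function.Bijective m) {x x' : C ⊗[R] A} {y y' : D}
    (h : (m.lTensor C x, y) = (m.lTensor C x', y')) : x = x' ∧ y = y' :=
  ⟨(LinearEquiv.lTensor C (LinearEquiv.ofBijective m hm)).injective (congrArg Prod.fst h),
    congrArg Prod.snd h⟩

lemma incl_injective (he : LineBasis e ε) (hf : LineBasis f φ) (hF : Module.finrank R F'' = 1)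
    (i a j : ℤ)
    {x x' : LMod R (G' × G'') F' (Module.finrank R (F' × F'') - i - 1)
      (Module.finrank R (G' × G'') - a) (j - 1)}
    {y y' : LMod R (G' × G'') F' (Module.finrank R (F' × F'') - i - 1)
      (Module.finrank R (G' × G'') - a) j}
    (h : inclFst hF i a j x + inclSnd e f hF i a j y =
      inclFst hF i a j x' + inclSnd e f hF i a j y') : x = x' ∧ y = y' := by
  rw [schurIncl_eq, schurIncl_eq] at h
  exact prod_lTensor_injective (schurMap_id_bijective _)
    (schurIncl_injective (he.lineSplit (M := G')) (hf.lineSplit (M := F')) _ _ _ h)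

/-- The kernel of `quot†` on the pieces of `𝕃` is the image of `incl†`. -/
lemma exists_incl (he : LineBasis e ε) (hf : LineBasis f φ) (hF : Module.finrank R F'' = 1)
    (hG : Module.finrank R G'' = 1) (i a j : ℤ) (hag : a ≤ Module.finrank R (G' × G'') - 1)
    (z : LMod R (G' × G'') (F' × F'') (Module.finrank R (F' × F'') - i - 1)
      (Module.finrank R (G' × G'') - a) j)
    (h₁ : quotMapOne φ hF hG i a j z = 0) (h₂ : quotCoOne φ ε hF hG i a j z = 0) :
    ∃ x y, inclFst hF i a j x + inclSnd e f hF i a j y = z := by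
  obtain ⟨⟨x, y⟩, hw⟩ := exists_schurIncl (he.lineSplit (M := G')) (hf.lineSplit (M := F'))
    (p := Module.finrank R (G' × G'') - a) (r₁ := Module.finrank R F' - (j - 1))
    (r₂ := Module.finrank R F' - j)
    (q₁ := Module.finrank R F' - (Module.finrank R (F' × F'') - i - 1) - j) (by omega)
    (by have := finrank_prod_one (F' := F') hF; omega)
    (by have := finrank_prod_one (F' := F') hF; omega)
    (by have := finrank_prod_one (F' := F') hF; omega) _ _ _ _ z h₁ h₂
  obtain ⟨x, rfl⟩ := LinearMap.lTensor_surjective _ (schurMap_id_bijective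
    (p := Module.finrank R (G' × G'') - a)
    (q := Module.finrank R F' - (Module.finrank R (F' × F'') - i - 1) - (j - 1))
    (by have := finrank_prod_one (F' := F') hF; omega)).2 x
  exact ⟨x, y, (schurIncl_eq e f hF i a j x y).trans hw⟩

lemma quotMapOne_incl (he : LineBasis e ε) (hf : LineBasis f φ) (hF : Module.finrank R F'' = 1)
    (hG : Module.finrank R G'' = 1) (i a j : ℤ)
    (x : LMod R (G' × G'') F' (Module.finrank R (F' × F'') - i - 1)
      (Module.finrank R (G' × G'') - a) (j - 1))
    (y : LMod R (G' × G'') F' (Module.finrank R (F' × F'') - i - 1)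
      (Module.finrank R (G' × G'') - a) j) :
    quotMapOne φ hF hG i a j (inclFst hF i a j x + inclSnd e f hF i a j y) = 0 := by
  rw [schurIncl_eq]
  exact schurIncl_proj he.lineSplit hf.lineSplit _ _ _ _ _ _ _

lemma quotCoOne_incl (he : LineBasis e ε) (hf : LineBasis f φ) (hF : Module.finrank R F'' = 1)
    (hG : Module.finrank R G'' = 1) (i a j : ℤ)
    (x : LMod R (G' × G'') F' (Module.finrank R (F' × F'') - i - 1)
      (Module.finrank R (G' × G'') - a) (j - 1))
    (y : LMod R (G' × G'') F' (Module.finrank R (F' × F'') - i - 1)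
      (Module.finrank R (G' × G'') - a) j) :
    quotCoOne φ ε hF hG i a j (inclFst hF i a j x + inclSnd e f hF i a j y) = 0 := by
  rw [schurIncl_eq]
  exact schurIncl_coeff he.lineSplit hf.lineSplit _ _ _ _ _ _ _

end Dagger

/-! ### The inclusion of the second short exact sequence -/

section Ddagger
variable {R : Type u} [CommRing R] [Nontrivial R]
  {F' F'' G' G'' : Type u} [AddCommGroup F'] [Module R F'] [Module.Free R F'] [Module.Finite R F']
  [AddCommGroup F''] [Module R F''] [Module.Free R F''] [Module.Finite R F'']
  [AddCommGroup G'] [Module R G'] [Module.Free R G'] [Module.Finite R G']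
  [AddCommGroup G''] [Module R G''] [Module.Free R G''] [Module.Finite R G'']
  {e : G''} {ε : Module.Dual R G''} {f : F''} {φ : Module.Dual R F''}

lemma eps_of_eq {G F : Type u} [AddCommGroup G] [Module R G] [Module.Free R G]
    [Module.Finite R G] [AddCommGroup F] [Module R F]
    (Φ : Module.Dual R G →ₗ[R] F) {i n j' k r p q : ℤ} (hr : j' = i + 1 → r = n + k)
    (hp : p = k - 1) (hq : j' = i + 1 → q = 1) (h : j' = i + 1) (m : midPiece R F i n j')
    (u : ExtPow R F n) (hu : (m : ExteriorAlgebra R F) = u) :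
    eps Φ hr hp hq m = epsOf Φ (hr h) hp (hq h) (evExt R G k) u := by
  rw [eps, dif_pos h]
  exact congrArg (epsOf Φ (hr h) hp (hq h) (evExt R G k)) (Subtype.ext hu)

lemma eps_of_ne {G F : Type u} [AddCommGroup G] [Module R G] [Module.Free R G]
    [Module.Finite R G] [AddCommGroup F] [Module R F]
    (Φ : Module.Dual R G →ₗ[R] F) {i n j' k r p q : ℤ} (hr : j' = i + 1 → r = n + k)
    (hp : p = k - 1) (hq : j' = i + 1 → q = 1) (h : j' ≠ i + 1) (m : midPiece R F i n j') :
    eps Φ hr hp hq m = 0 := by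
  rw [eps, dif_neg h, LinearMap.zero_apply]

/-- In position `i + 1` the elements of `midPiece` are those of the exterior power. -/
lemma exists_extPow_of_midPiece {F : Type u} [AddCommGroup F] [Module R F] {i n j : ℤ}
    (h : j = i + 1) (m : midPiece R F i n j) :
    ∃ u : ExtPow R F n, (m : ExteriorAlgebra R F) = u :=
  ⟨⟨m.1, by have := mem_midPiece.1 m.2; rwa [if_pos h] at this⟩, rfl⟩

lemma map_schurMap_eps_midIncl (he : LineBasis e ε) (hf : LineBasis f φ)
    (Φ' : Module.Dual R G' →ₗ[R] F') (Φ'' : Module.Dual R G'' →ₗ[R] F'') (h : Φ'' ε = f)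
    {i n n₀ j k r p q r₁ p₁ q₁ : ℤ} (hr : j = i + 1 → r = n + k) (hp : p = k - 1)
    (hq : j = i + 1 → q = 1) (hr₁ : r₁ = r - 1) (hp₁ : p₁ = p) (hq₁ : q₁ = q) (hk : 1 ≤ k)
    (hn : n = n₀) (m : midPiece R F' i n₀ j) :
    TensorProduct.map (extCo (LinearMap.fst R F' F'') ((LinearMap.snd R F' F'').dualMap φ) hr₁)
      (schurMap (LinearMap.fst R G' G'') hp₁ hq₁)
      (eps (blockSum Φ' Φ'') hr hp hq (midIncl hn m)) = 0 := by
  by_cases hj : j = i + 1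
  · obtain ⟨u, hu⟩ := exists_extPow_of_midPiece hj m
    rw [eps_of_eq (blockSum Φ' Φ'') hr hp hq hj _ (extMap (LinearMap.inl R F' F'') hn u)
      (congrArg (ExteriorAlgebra.map (LinearMap.inl R F' F'')) hu)]
    exact (blockSplit_blockSum he hf Φ' Φ'' h).map_schurMap_epsOf_incl _ _ _ _ _ _ hk _ u
  · rw [eps_of_ne _ _ _ _ hj, map_zero]

lemma map_schurMap_eps_midWedge (he : LineBasis e ε) (hf : LineBasis f φ)
    (Φ' : Module.Dual R G' →ₗ[R] F') (Φ'' : Module.Dual R G'' →ₗ[R] F'') (h : Φ'' ε = f)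
    {i n n₀ j k k₀ r p q r₁ p₁ q₁ : ℤ} (hr : j = i + 1 → r = n + k) (hp : p = k - 1)
    (hq : j = i + 1 → q = 1) (hr₁ : r₁ = r - 1) (hp₁ : p₁ = p) (hq₁ : q₁ = q) (hk : 1 ≤ k)
    (hk₀ : k = k₀) (hn : n = n₀ + 1) (hr₀ : j = i + 1 → r₁ = n₀ + k₀) (hp' : p₁ = k₀ - 1)
    (hq' : j = i + 1 → q₁ = 1) (m : midPiece R F' i n₀ j) :
    TensorProduct.map (extCo (LinearMap.fst R F' F'') ((LinearMap.snd R F' F'').dualMap φ) hr₁)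
      (schurMap (LinearMap.fst R G' G'') hp₁ hq₁)
      (eps (blockSum Φ' Φ'') hr hp hq (midWedge hn f m)) =
    sgn R k • eps Φ' hr₀ hp' hq' m := by
  subst hk₀
  by_cases hj : j = i + 1
  · obtain ⟨u, hu⟩ := exists_extPow_of_midPiece hj m
    rw [eps_of_eq (blockSum Φ' Φ'') hr hp hq hj _
      (wedgeVec hn (LinearMap.inr R F' F'' f) (extMap (LinearMap.inl R F' F'') rfl u))
      (congrArg (fun t => ExteriorAlgebra.map (LinearMap.inl R F' F'') t *
        ExteriorAlgebra.ι R (LinearMap.inr R F' F'' f)) hu), eps_of_eq Φ' hr₀ hp' hq' hj m u hu]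
    exact (blockSplit_blockSum he hf Φ' Φ'' h).map_schurMap_epsOf_wedge _ _ _ _ _ _ hk rfl hn
      _ _ _ u
  · rw [eps_of_ne _ _ _ _ hj, eps_of_ne _ _ _ _ hj, map_zero, smul_zero]

lemma map_schurCo_eps_midIncl (he : LineBasis e ε) (hf : LineBasis f φ)
    (Φ' : Module.Dual R G' →ₗ[R] F') (Φ'' : Module.Dual R G'' →ₗ[R] F'') (h : Φ'' ε = f)
    {i n n₀ j k k₁ r p q r₁ p₁ q₁ : ℤ} (hr : j = i + 1 → r = n + k) (hp : p = k - 1)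
    (hq : j = i + 1 → q = 1) (hr₁ : r₁ = r - 1) (hp₁ : p₁ = p - 1) (hq₁ : q₁ = q) (hk : 0 ≤ k₁)
    (hk₁ : k = k₁ + 1) (hn : n = n₀) (hr₀ : j = i + 1 → r₁ = n₀ + k₁) (hp' : p₁ = k₁ - 1)
    (hq' : j = i + 1 → q₁ = 1) (m : midPiece R F' i n₀ j) :
    TensorProduct.map (extCo (LinearMap.fst R F' F'') ((LinearMap.snd R F' F'').dualMap φ) hr₁)
      (schurCo (LinearMap.fst R G' G'') ((LinearMap.snd R G' G'').dualMap ε) hp₁ hq₁)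
      (eps (blockSum Φ' Φ'') hr hp hq (midIncl hn m)) =
    sgn R k₁ • eps Φ' hr₀ hp' hq' m := by
  by_cases hj : j = i + 1
  · obtain ⟨u, hu⟩ := exists_extPow_of_midPiece hj m
    rw [eps_of_eq (blockSum Φ' Φ'') hr hp hq hj _ (extMap (LinearMap.inl R F' F'') hn u)
      (congrArg (ExteriorAlgebra.map (LinearMap.inl R F' F'')) hu),
      eps_of_eq Φ' hr₀ hp' hq' hj m u hu]
    exact (blockSplit_blockSum he hf Φ' Φ'' h).map_schurCo_epsOf_incl _ _ _ _ _ _ hk hk₁ hn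
      _ _ _ u
  · rw [eps_of_ne _ _ _ _ hj, eps_of_ne _ _ _ _ hj, map_zero, smul_zero]

lemma map_schurCo_eps_midWedge (he : LineBasis e ε) (hf : LineBasis f φ)
    (Φ' : Module.Dual R G' →ₗ[R] F') (Φ'' : Module.Dual R G'' →ₗ[R] F'') (h : Φ'' ε = f)
    {i n n₀ j k k₁ r p q r₁ p₁ q₁ : ℤ} (hr : j = i + 1 → r = n + k) (hp : p = k - 1)
    (hq : j = i + 1 → q = 1) (hr₁ : r₁ = r - 1) (hp₁ : p₁ = p - 1) (hq₁ : q₁ = q) (hk : 0 ≤ k₁)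
    (hk₁ : k = k₁ + 1) (hn : n = n₀ + 1) (m : midPiece R F' i n₀ j) :
    TensorProduct.map (extCo (LinearMap.fst R F' F'') ((LinearMap.snd R F' F'').dualMap φ) hr₁)
      (schurCo (LinearMap.fst R G' G'') ((LinearMap.snd R G' G'').dualMap ε) hp₁ hq₁)
      (eps (blockSum Φ' Φ'') hr hp hq (midWedge hn f m)) = 0 := by
  by_cases hj : j = i + 1
  · obtain ⟨u, hu⟩ := exists_extPow_of_midPiece hj m
    rw [eps_of_eq (blockSum Φ' Φ'') hr hp hq hj _
      (wedgeVec hn (LinearMap.inr R F' F'' f) (extMap (LinearMap.inl R F' F'') rfl u))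
      (congrArg (fun t => ExteriorAlgebra.map (LinearMap.inl R F' F'') t *
        ExteriorAlgebra.ι R (LinearMap.inr R F' F'' f)) hu)]
    exact (blockSplit_blockSum he hf Φ' Φ'' h).map_schurCo_epsOf_wedge _ _ _ _ _ _ hk hk₁ rfl hn u
  · rw [eps_of_ne _ _ _ _ hj, map_zero]

lemma mu_map_incl (he : LineBasis e ε) (hf : LineBasis f φ)
    (Φ' : Module.Dual R G' →ₗ[R] F') (Φ'' : Module.Dual R G'' →ₗ[R] F'') (h : Φ'' ε = f)
    {r r₁ a q i n n₁ j : ℤ} (hr : r = r₁) (hn : q = 0 → n = r + a) (hn₁ : q = 0 → n₁ = r₁ + a)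
    (hj : q = 0 → j = i + 1) (hnn : n = n₁) (x : ExtPow R F' r₁ ⊗[R] weylK R G' a q) :
    mu (blockSum Φ' Φ'') hn hj (TensorProduct.map (extMap (LinearMap.inl R F' F'') hr)
      (weylMap (LinearMap.fst R G' G'') rfl rfl) x) = midIncl hnn (mu Φ' hn₁ hj x) :=
  Subtype.ext ((blockSplit_blockSum he hf Φ' Φ'' h).muAmb_incl hr x)

lemma mu_map_wedge (he : LineBasis e ε) (hf : LineBasis f φ)
    (Φ' : Module.Dual R G' →ₗ[R] F') (Φ'' : Module.Dual R G'' →ₗ[R] F'') (h : Φ'' ε = f)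
    {r r₁ a a₁ q i n n₁ j : ℤ} (hr : r = r₁) (ha : a = a₁ + 1) (hn : q = 0 → n = r + a)
    (hn₁ : q = 0 → n₁ = r₁ + a₁) (hj : q = 0 → j = i + 1) (hnn : n = n₁ + 1)
    (x : ExtPow R F' r₁ ⊗[R] weylK R G' a₁ q) :
    mu (blockSum Φ' Φ'') hn hj (TensorProduct.map (extMap (LinearMap.inl R F' F'') hr)
      (weylWedge ha rfl ((LinearMap.snd R G' G'').dualMap ε) ∘ₗ
        weylMap (LinearMap.fst R G' G'') rfl rfl) x) = midWedge hnn f (mu Φ' hn₁ hj x) :=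
  Subtype.ext ((blockSplit_blockSum he hf Φ' Φ'' h).muAmb_wedge hr ha rfl x)

/-- The first component of `incl‡` on the pieces of `𝕂`. -/
def kInclFst (hF : Module.finrank R F'' = 1) (hG : Module.finrank R G'' = 1) (i a j : ℤ) :
    KMod R G' F' (Module.finrank R F' - Module.finrank R G' - i - 1) a (-i - 2 + j) →ₗ[R]
    KMod R (G' × G'') (F' × F'')
      (Module.finrank R (F' × F'') - Module.finrank R (G' × G'') - i - 1) a (-i - 2 + j) :=
  TensorProduct.map
    (extMap (LinearMap.inl R F' F'') (by
      have := finrank_prod_one (F' := F') hF; have := finrank_prod_one (F' := G') hG; omega))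
    (weylMap (LinearMap.fst R G' G'') rfl rfl)

/-- The second component of `incl‡` on the pieces of `𝕂`, after identifying `G''*` with `R`. -/
def kInclSnd (ε : Module.Dual R G'') (hF : Module.finrank R F'' = 1)
    (hG : Module.finrank R G'' = 1) (i a j : ℤ) :
    KMod R G' F' (Module.finrank R F' - Module.finrank R G' - i - 1) (a - 1) (-i - 2 + j) →ₗ[R]
    KMod R (G' × G'') (F' × F'')
      (Module.finrank R (F' × F'') - Module.finrank R (G' × G'') - i - 1) a (-i - 2 + j) :=
  TensorProduct.map
    (extMap (LinearMap.inl R F' F'') (by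
      have := finrank_prod_one (F' := F') hF; have := finrank_prod_one (F' := G') hG; omega))
    (weylWedge (by omega) rfl ((LinearMap.snd R G' G'').dualMap ε) ∘ₗ
      weylMap (LinearMap.fst R G' G'') rfl rfl)

lemma inclDdagger₁_apply (he : LineBasis e ε) (Φ'' : Module.Dual R G'' →ₗ[R] F'')
    (h : Φ'' ε = f) (hF : Module.finrank R F'' = 1) (hG : Module.finrank R G'' = 1) (i a j : ℤ)
    (x : CMod R G' F' i a j) :
    inclDdagger₁ Φ'' hF hG i a j x =
      (kInclFst hF hG i a j x.1,
        midIncl (by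
          have := finrank_prod_one (F' := F') hF; have := finrank_prod_one (F' := G') hG; omega)
          x.2.1, 0,
        sgn R (Module.finrank R (G' × G'') - a + i - j) • (x.2.2 ⊗ₜ[R] (f ⊗ₜ[R] e))) := by
  refine Prod.ext rfl (Prod.ext rfl (Prod.ext rfl ?_))
  refine Eq.trans ?_ (congrArg (fun t =>
    sgn R (Module.finrank R (G' × G'') - a + i - j) • (x.2.2 ⊗ₜ[R] t))
    (show kosTwist Φ'' 1 = f ⊗ₜ[R] e by rw [he.kosTwist_one, one_smul, h]))
  change (((Module.finrank R (G' × G'') - a + i - j).negOnePow : ℤ) •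
    ((TensorProduct.mk R (LMod R G' F' (Module.finrank R F' - i - 1) (Module.finrank R G' - a) j)
      (F'' ⊗[R] G'')).flip (kosTwist Φ'' 1))) x.2.2 = _
  rw [LinearMap.smul_apply, negOnePow_smul_eq (R := R)]
  rfl

lemma map_assoc_tmul {A A' B B' P : Type*} [AddCommMonoid A] [Module R A] [AddCommMonoid A']
    [Module R A'] [AddCommMonoid B] [Module R B] [AddCommMonoid B'] [Module R B']
    [AddCommMonoid P] [Module R P] (α : A →ₗ[R] A') (β : B →ₗ[R] P →ₗ[R] B') {β₁ : B →ₗ[R] B'}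
    {p : P} (hβ : ∀ x, β x p = β₁ x) (z : A ⊗[R] B) :
    TensorProduct.map α (TensorProduct.lift β) (TensorProduct.assoc R A B P (z ⊗ₜ p)) =
      TensorProduct.map α β₁ z := by
  induction z using TensorProduct.induction_on with
  | zero => rw [zero_tmul, map_zero, map_zero, map_zero]
  | add x y hx hy => rw [add_tmul, map_add, map_add, map_add, hx, hy]
  | tmul u x =>
    rw [TensorProduct.assoc_tmul, TensorProduct.map_tmul, TensorProduct.map_tmul,
      TensorProduct.lift.tmul, hβ]

lemma inclDdagger₂_apply (Φ'' : Module.Dual R G'' →ₗ[R] F'')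
    (h : Φ'' ε = f) (hF : Module.finrank R F'' = 1) (hG : Module.finrank R G'' = 1) (i a j : ℤ)
    (x : CMod R G' F' i (a - 1) j) :
    inclDdagger₂ Φ'' hF hG i a j (x ⊗ₜ[R] ε) =
      (kInclSnd ε hF hG i a j x.1,
        midWedge (by
          have := finrank_prod_one (F' := F') hF; have := finrank_prod_one (F' := G') hG; omega)
          f x.2.1,
        sgn R (Module.finrank R (G' × G'') - a + 1 + i - j) • (x.2.2 ⊗ₜ[R] f), 0) := by
  refine Prod.ext ?_ (Prod.ext ?_ (Prod.ext ?_ rfl))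
  · exact map_assoc_tmul _ _ (fun _ => rfl) x.1
  · exact congrArg (fun t => midWedge _ t x.2.1) h
  · refine Eq.trans ?_ (congrArg (fun t =>
      sgn R (Module.finrank R (G' × G'') - a + 1 + i - j) • (x.2.2 ⊗ₜ[R] t)) h)
    change (((Module.finrank R (G' × G'') - a + 1 + i - j).negOnePow : ℤ) •
      (LinearMap.lTensor (LMod R G' F' (Module.finrank R F' - i - 1)
        (Module.finrank R G' - (a - 1)) j) Φ'' ∘ₗ
        LinearMap.rTensor _ (LinearMap.snd R _ _ ∘ₗ LinearMap.snd R _ _))) (x ⊗ₜ[R] ε) = _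
    rw [LinearMap.smul_apply, negOnePow_smul_eq (R := R)]
    rfl

end Ddagger

/-! ### Compatibility of the second inclusion with the differentials -/

section DdaggerChain
variable {R : Type u} [CommRing R] [Nontrivial R]
  {F' F'' G' G'' : Type u} [AddCommGroup F'] [Module R F'] [Module.Free R F'] [Module.Finite R F']
  [AddCommGroup F''] [Module R F''] [Module.Free R F''] [Module.Finite R F'']
  [AddCommGroup G'] [Module R G'] [Module.Free R G'] [Module.Finite R G']
  [AddCommGroup G''] [Module R G''] [Module.Free R G''] [Module.Finite R G'']
  {e : G''} {ε : Module.Dual R G''} {f : F''} {φ : Module.Dual R F''}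

lemma sgn_sub_one_neg {A : Type*} [AddCommMonoid A] [Module R A] {n n' : ℤ} (h : n = n' + 1)
    (x : A) : (-1 : R) • sgn R n' • x = sgn R n • x := by
  rw [h, sgn_succ, smul_smul, neg_one_mul]

/-- The two signs in `incl‡` are such that it commutes with the differentials, of which the one on
the pieces of `𝕃` in `D` carries a sign. -/
lemma sgn_add_tmul {A B P : Type*} [AddCommMonoid A] [Module R A] [AddCommMonoid B] [Module R B]
    [AddCommMonoid P] [Module R P] (d : A →ₗ[R] B) {n n' k : ℤ} (h : n = n' + 1) (u v : B) (x : A)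
    (p : P) (hu : u = sgn R k • v) (hk : n ≠ k → v = 0) :
    u ⊗ₜ[R] p + (-1 : R) • d.rTensor P (sgn R n' • (x ⊗ₜ[R] p)) =
      sgn R n • ((v + d x) ⊗ₜ[R] p) := by
  rw [map_smul, LinearMap.rTensor_tmul, sgn_sub_one_neg h, add_tmul, smul_add, hu]
  by_cases hnk : n = k
  · rw [hnk]; rfl
  · rw [hk hnk, smul_zero, zero_tmul, smul_zero]

/-- The differential of `C^{i,a}_Φ` on the piece of `⋀ F`. -/
def epsDiff {G F : Type u} [AddCommGroup G] [Module R G] [Module.Free R G]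
    [Module.Finite R G] [AddCommGroup F] [Module R F] [Module.Free R F]
    (Φ : Module.Dual R G →ₗ[R] F) (i a : ℤ) {j j' : ℤ} (hj : j + 1 = j') :
    midPiece R F i (Module.finrank R F - Module.finrank R G + a - i - 1) j' →ₗ[R]
      LMod R G F (Module.finrank R F - i - 1) (Module.finrank R G - a) j :=
  eps Φ (k := Module.finrank R G + 1 - a) (by omega) (by omega) (by omega)

/-- The inclusion of `incl‡` on the piece of `⋀ F'`. -/
def mInclFst (hF : Module.finrank R F'' = 1) (hG : Module.finrank R G'' = 1) (i a j : ℤ) :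
    midPiece R F' i (Module.finrank R F' - Module.finrank R G' + a - i - 1) j →ₗ[R]
    midPiece R (F' × F'') i
      (Module.finrank R (F' × F'') - Module.finrank R (G' × G'') + a - i - 1) j :=
  midIncl (by have := finrank_prod_one (F' := F') hF; have := finrank_prod_one (F' := G') hG; omega)

/-- The map `y ↦ y ∧ f` of `incl‡` on the piece of `⋀ F'`. -/
def mInclSnd (f : F'') (hF : Module.finrank R F'' = 1) (hG : Module.finrank R G'' = 1)
    (i a j : ℤ) :
    midPiece R F' i (Module.finrank R F' - Module.finrank R G' + (a - 1) - i - 1) j →ₗ[R]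
    midPiece R (F' × F'') i
      (Module.finrank R (F' × F'') - Module.finrank R (G' × G'') + a - i - 1) j :=
  midWedge
    (by have := finrank_prod_one (F' := F') hF; have := finrank_prod_one (F' := G') hG; omega) f

lemma quotMapOne_epsDiff_mInclFst (he : LineBasis e ε) (hf : LineBasis f φ)
    (hF : Module.finrank R F'' = 1) (hG : Module.finrank R G'' = 1)
    (Φ' : Module.Dual R G' →ₗ[R] F') (Φ'' : Module.Dual R G'' →ₗ[R] F'') (h : Φ'' ε = f)
    (i a : ℤ) (hag : a ≤ Module.finrank R (G' × G'') - 1) {j j' : ℤ} (hj : j + 1 = j')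
    (m : midPiece R F' i (Module.finrank R F' - Module.finrank R G' + a - i - 1) j') :
    quotMapOne φ hF hG i a j (epsDiff (blockSum Φ' Φ'') i a hj (mInclFst hF hG i a j' m)) = 0 :=
  map_schurMap_eps_midIncl he hf Φ' Φ'' h _ _ _ _ _ _ (by omega) _ m

lemma quotMapOne_epsDiff_mInclSnd (he : LineBasis e ε) (hf : LineBasis f φ)
    (hF : Module.finrank R F'' = 1) (hG : Module.finrank R G'' = 1)
    (Φ' : Module.Dual R G' →ₗ[R] F') (Φ'' : Module.Dual R G'' →ₗ[R] F'') (h : Φ'' ε = f)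
    (i a : ℤ) (hag : a ≤ Module.finrank R (G' × G'') - 1) {j j' : ℤ} (hj : j + 1 = j')
    (m : midPiece R F' i (Module.finrank R F' - Module.finrank R G' + (a - 1) - i - 1) j') :
    quotMapOne φ hF hG i a j (epsDiff (blockSum Φ' Φ'') i a hj (mInclSnd f hF hG i a j' m)) =
      sgn R (Module.finrank R (G' × G'') + 1 - a) • epsDiff Φ' i (a - 1) hj m :=
  map_schurMap_eps_midWedge he hf Φ' Φ'' h _ _ _ _ _ _ (by omega)
    (by have := finrank_prod_one (F' := G') hG; omega) _ _ _ _ m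

lemma quotCoOne_epsDiff_mInclFst (he : LineBasis e ε) (hf : LineBasis f φ)
    (hF : Module.finrank R F'' = 1) (hG : Module.finrank R G'' = 1)
    (Φ' : Module.Dual R G' →ₗ[R] F') (Φ'' : Module.Dual R G'' →ₗ[R] F'') (h : Φ'' ε = f)
    (i a : ℤ) (hag : a ≤ Module.finrank R (G' × G'') - 1) {j j' : ℤ} (hj : j + 1 = j')
    (m : midPiece R F' i (Module.finrank R F' - Module.finrank R G' + a - i - 1) j') :
    quotCoOne φ ε hF hG i a j (epsDiff (blockSum Φ' Φ'') i a hj (mInclFst hF hG i a j' m)) =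
      sgn R (Module.finrank R G' + 1 - a) • epsDiff Φ' i a hj m :=
  map_schurCo_eps_midIncl he hf Φ' Φ'' h _ _ _ _ _ _
    (by have := finrank_prod_one (F' := G') hG; omega)
    (by have := finrank_prod_one (F' := G') hG; omega) _ _ _ _ m

lemma quotCoOne_epsDiff_mInclSnd (he : LineBasis e ε) (hf : LineBasis f φ)
    (hF : Module.finrank R F'' = 1) (hG : Module.finrank R G'' = 1)
    (Φ' : Module.Dual R G' →ₗ[R] F') (Φ'' : Module.Dual R G'' →ₗ[R] F'') (h : Φ'' ε = f)
    (i a : ℤ) (hag : a ≤ Module.finrank R (G' × G'') - 1) {j j' : ℤ} (hj : j + 1 = j')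
    (m : midPiece R F' i (Module.finrank R F' - Module.finrank R G' + (a - 1) - i - 1) j') :
    quotCoOne φ ε hF hG i a j (epsDiff (blockSum Φ' Φ'') i a hj (mInclSnd f hF hG i a j' m)) = 0 :=
  map_schurCo_eps_midWedge he hf Φ' Φ'' h (k₁ := (Module.finrank R (G' × G'') : ℤ) - a) _ _ _ _ _ _
    (by omega) (by omega) _ m

lemma epsDiff_of_ne {G F : Type u} [AddCommGroup G] [Module R G] [Module.Free R G]
    [Module.Finite R G] [AddCommGroup F] [Module R F] [Module.Free R F]
    (Φ : Module.Dual R G →ₗ[R] F) (i a : ℤ) {j j' : ℤ} (hj : j + 1 = j') (h : j ≠ i)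
    (m : midPiece R F i (Module.finrank R F - Module.finrank R G + a - i - 1) j') :
    epsDiff Φ i a hj m = 0 :=
  eps_of_ne Φ _ _ _ (by omega) m

lemma dDiff_apply (Φ' : Module.Dual R G' →ₗ[R] F') (Φ'' : Module.Dual R G'' →ₗ[R] F'')
    (hF : Module.finrank R F'' = 1) (hG : Module.finrank R G'' = 1) (i a : ℤ) {j j' : ℤ}
    (hj : j + 1 = j') (x : DMod R F' F'' G' G'' i a j') :
    dDiff Φ' Φ'' hF hG i a j' j hj x =
      (etaPhi (blockSum Φ' Φ'') (by omega) (by omega) x.1,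
        mu (blockSum Φ' Φ'') (by omega) (by omega) x.1,
        quotMap hF hG i a j (epsDiff (blockSum Φ' Φ'') i a hj x.2.1) +
          (-1 : R) • LinearMap.rTensor F'' (lDiff Φ' _ _ hj) x.2.2.1,
        quotCo hF hG i a j (epsDiff (blockSum Φ' Φ'') i a hj x.2.1) +
          (-1 : R) • LinearMap.rTensor (F'' ⊗[R] G'') (lDiff Φ' _ _ hj) x.2.2.2) := rfl

lemma smul_rTensor_zero {A B P : Type*} [AddCommMonoid A] [Module R A] [AddCommMonoid B]
    [Module R B] [AddCommMonoid P] [Module R P] (d : A →ₗ[R] B) {u : B} (hu : u = 0) (p : P) :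
    u ⊗ₜ[R] p + (-1 : R) • d.rTensor P 0 = 0 := by
  rw [hu, map_zero, zero_tmul, smul_zero, add_zero]

/-- The map `incl‡` on `C^{i,a}_{Φ'}` commutes with the differentials. -/
lemma dDiff_inclDdagger₁ (he : LineBasis e ε) (hf : LineBasis f φ)
    (hF : Module.finrank R F'' = 1) (hG : Module.finrank R G'' = 1)
    (Φ' : Module.Dual R G' →ₗ[R] F') (Φ'' : Module.Dual R G'' →ₗ[R] F'') (h : Φ'' ε = f)
    (i a : ℤ) (hag : a ≤ Module.finrank R (G' × G'') - 1) {j j' : ℤ} (hj : j + 1 = j')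
    (x : CMod R G' F' i a j') :
    dDiff Φ' Φ'' hF hG i a j' j hj (inclDdagger₁ Φ'' hF hG i a j' x) =
      inclDdagger₁ Φ'' hF hG i a j (cDiff Φ' i a j' j hj x) := by
  have hg' := finrank_prod_one (F' := G') hG
  refine (congrArg (dDiff Φ' Φ'' hF hG i a j' j hj)
    (inclDdagger₁_apply he Φ'' h hF hG i a j' x)).trans
    (Eq.trans ?_ (inclDdagger₁_apply he Φ'' h hF hG i a j _).symm)
  refine (dDiff_apply Φ' Φ'' hF hG i a hj _).trans ?_
  refine Prod.ext ?_ (Prod.ext ?_ (Prod.ext ?_ ?_))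
  · exact (blockSplit_blockSum he hf Φ' Φ'' h).etaPhi_map_incl _ _ _ _ _ _ _ _ x.1
  · exact mu_map_incl he hf Φ' Φ'' h _ (by omega) (by omega) (by omega) _ x.1
  · refine (add_congr (quotMap_apply hf hF hG i a j _) rfl).trans ?_
    exact smul_rTensor_zero _
      (quotMapOne_epsDiff_mInclFst he hf hF hG Φ' Φ'' h i a hag hj x.2.1) f
  · refine (add_congr (quotCo_apply he hf hF hG i a j _) rfl).trans ?_
    exact sgn_add_tmul (lDiff Φ' _ _ hj) (by omega) _ _ x.2.2 _
      (quotCoOne_epsDiff_mInclFst he hf hF hG Φ' Φ'' h i a hag hj x.2.1)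
      (fun hne => epsDiff_of_ne Φ' i a hj (by omega) x.2.1)

/-- The map `incl‡` on `C^{i,a-1}_{Φ'} ⊗ G''*` commutes with the differentials. -/
lemma dDiff_inclDdagger₂ (he : LineBasis e ε) (hf : LineBasis f φ)
    (hF : Module.finrank R F'' = 1) (hG : Module.finrank R G'' = 1)
    (Φ' : Module.Dual R G' →ₗ[R] F') (Φ'' : Module.Dual R G'' →ₗ[R] F'') (h : Φ'' ε = f)
    (i a : ℤ) (hag : a ≤ Module.finrank R (G' × G'') - 1) {j j' : ℤ} (hj : j + 1 = j')
    (x : CMod R G' F' i (a - 1) j') :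
    dDiff Φ' Φ'' hF hG i a j' j hj (inclDdagger₂ Φ'' hF hG i a j' (x ⊗ₜ[R] ε)) =
      inclDdagger₂ Φ'' hF hG i a j (cDiff Φ' i (a - 1) j' j hj x ⊗ₜ[R] ε) := by
  have hf' := finrank_prod_one (F' := F') hF
  have hg' := finrank_prod_one (F' := G') hG
  refine (congrArg (dDiff Φ' Φ'' hF hG i a j' j hj)
    (inclDdagger₂_apply Φ'' h hF hG i a j' x)).trans
    (Eq.trans ?_ (inclDdagger₂_apply Φ'' h hF hG i a j _).symm)
  refine (dDiff_apply Φ' Φ'' hF hG i a hj _).trans ?_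
  refine Prod.ext ?_ (Prod.ext ?_ (Prod.ext ?_ ?_))
  · exact (blockSplit_blockSum he hf Φ' Φ'' h).etaPhi_map_wedge _ _ _ _ _ _ x.1
  · exact mu_map_wedge he hf Φ' Φ'' h _ _ (by omega) (by omega) (by omega) _ x.1
  · refine (add_congr (quotMap_apply hf hF hG i a j _) rfl).trans ?_
    exact sgn_add_tmul (lDiff Φ' _ _ hj) (by omega) _ _ x.2.2 _
      (quotMapOne_epsDiff_mInclSnd he hf hF hG Φ' Φ'' h i a hag hj x.2.1)
      (fun hne => epsDiff_of_ne Φ' i (a - 1) hj (by omega) x.2.1)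
  · refine (add_congr (quotCo_apply he hf hF hG i a j _) rfl).trans ?_
    exact smul_rTensor_zero _
      (quotCoOne_epsDiff_mInclSnd he hf hF hG Φ' Φ'' h i a hag hj x.2.1) (f ⊗ₜ[R] e)

end DdaggerChain

/-! ### The projection of the second short exact sequence -/

section KComplex
variable {R : Type u} [CommRing R] {G F P Q : Type u} [AddCommGroup G] [Module R G]
  [Module.Free R G] [Module.Finite R G] [AddCommGroup F] [Module R F] [AddCommGroup P]
  [Module R P] [AddCommGroup Q] [Module R Q]

/-- The differential of `𝕂^{N,p}_Φ[n]`. -/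
def kDiff (Φ : Module.Dual R G →ₗ[R] F) (N p n : ℤ) {j j' : ℤ} (h : j + 1 = j') :
    KMod R G F N p (n + j') →ₗ[R] KMod R G F N p (n + j) :=
  etaPhi Φ (by omega) (by omega)

lemma shiftC_KComplex_d (Φ : Module.Dual R G →ₗ[R] F) (N p n : ℤ) {j j' : ℤ} (h : j + 1 = j')
    (x : KMod R G F N p (n + j')) :
    ((shiftC (KComplex Φ N p) n).d j' j).hom x = kDiff Φ N p n h x :=
  (congrArg (fun m : KMod R G F N p (n + j') →ₗ[R] KMod R G F N p (n + j) => m x)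
    (shiftC_d (KComplex Φ N p) n h)).trans
  (congrArg (fun m : (KComplex Φ N p).X (n + j') ⟶ (KComplex Φ N p).X (n + j) => m.hom x)
    (mkComplex_d _ (show (n + j) + 1 = n + j' by omega)))

variable (R G F) in
/-- The identification of two components of `𝕂^{N,p}_Φ[n]` whose degrees are equal. -/
def kCast (N p n : ℤ) {k j : ℤ} (h : k = j) : KMod R G F N p (n + k) →ₗ[R] KMod R G F N p (n + j) :=
  TensorProduct.map (extMap LinearMap.id (by omega)) (weylMap LinearMap.id rfl (by omega))

lemma kCast_rfl (N p n : ℤ) {j : ℤ} (x : KMod R G F N p (n + j)) :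
    kCast R G F N p n rfl x = x := by
  have h1 : extMap LinearMap.id rfl = (LinearMap.id : ExtPow R F (N - (n + j)) →ₗ[R] _) :=
    LinearMap.ext fun y => extMap_id rfl y
  have h2 : weylMap LinearMap.id rfl rfl = (LinearMap.id : weylK R G p (n + j) →ₗ[R] _) :=
    LinearMap.ext fun y => weylMap_id y
  rw [kCast, h1, h2, TensorProduct.map_id, LinearMap.id_apply]

lemma XIsoOfEq_KComplex (Φ : Module.Dual R G →ₗ[R] F) (N p n : ℤ) {k j : ℤ} (h : k = j)
    (x : KMod R G F N p (n + k)) :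
    ((shiftC (KComplex Φ N p) n).XIsoOfEq h).hom.hom x = kCast R G F N p n h x := by
  subst h
  rw [kCast_rfl, HomologicalComplex.XIsoOfEq_rfl]
  rfl

lemma Tot_KComplex_d (Φ : Module.Dual R G →ₗ[R] F) (N p n : ℤ) (t : P →ₗ[R] Q) {j j' : ℤ}
    (hj : j + 1 = j') (x : KMod R G F N p (n + (j' - 1))) (v : P) (y : KMod R G F N p (n + j')) :
    ((Tot (tensorMapC (shiftC (KComplex Φ N p) n) t)).d j' j).hom (x ⊗ₜ[R] v, y ⊗ₜ[R] t v) =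
      (kDiff Φ N p n (show (j - 1) + 1 = j' - 1 by omega) x ⊗ₜ[R] v,
        (kCast R G F N p n (show j' - 1 = j by omega) x - kDiff Φ N p n hj y) ⊗ₜ[R] t v) := by
  refine (Tot_tensorMapC_d (shiftC (KComplex Φ N p) n) t hj x v y).trans (Prod.ext ?_ ?_)
  · exact congrArg (· ⊗ₜ[R] v) (shiftC_KComplex_d Φ N p n _ x)
  · exact congrArg (· ⊗ₜ[R] t v) (congrArg₂ (fun a b : KMod R G F N p (n + j) => a - b)
      (XIsoOfEq_KComplex Φ N p n _ x) (shiftC_KComplex_d Φ N p n hj y))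

end KComplex

section QuotDdagger
variable {R : Type u} [CommRing R] [Nontrivial R]
  {F' F'' G' G'' : Type u} [AddCommGroup F'] [Module R F'] [Module.Free R F'] [Module.Finite R F']
  [AddCommGroup F''] [Module R F''] [Module.Free R F''] [Module.Finite R F'']
  [AddCommGroup G'] [Module R G'] [Module.Free R G'] [Module.Finite R G']
  [AddCommGroup G''] [Module R G''] [Module.Free R G''] [Module.Finite R G'']
  {e : G''} {ε : Module.Dual R G''} {f : F''} {φ : Module.Dual R F''}

/-- The first component of `quot‡`, after identifying `G''*` with `R`. -/
def kQuotFst (e : G'') (i a j : ℤ) :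
    KMod R (G' × G'') (F' × F'')
      (Module.finrank R (F' × F'') - Module.finrank R (G' × G'') - i - 1) a (-i - 2 + j) →ₗ[R]
    KMod R (G' × G'') F' (Module.finrank R (F' × F'') - Module.finrank R (G' × G'') - i - 2) a
      (-i - 2 + (j - 1)) :=
  TensorProduct.map (extMap (LinearMap.fst R F' F'') (by omega))
    (weylAct (by omega) (LinearMap.inr R G' G'' e))

/-- The second component of `quot‡`, after identifying `F''` with `R`. -/
def kQuotSnd (φ : Module.Dual R F'') (i a j : ℤ) :
    KMod R (G' × G'') (F' × F'')
      (Module.finrank R (F' × F'') - Module.finrank R (G' × G'') - i - 1) a (-i - 2 + j) →ₗ[R]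
    KMod R (G' × G'') F' (Module.finrank R (F' × F'') - Module.finrank R (G' × G'') - i - 2) a
      (-i - 2 + j) :=
  TensorProduct.map (extCo (LinearMap.fst R F' F'') ((LinearMap.snd R F' F'').dualMap φ) (by omega))
    LinearMap.id

lemma assoc_symm_map {A A' B B' P : Type*} [AddCommMonoid A] [Module R A] [AddCommMonoid A']
    [Module R A'] [AddCommMonoid B] [Module R B] [AddCommMonoid B'] [Module R B']
    [AddCommMonoid P] [Module R P] (α : A →ₗ[R] A') {β : B →ₗ[R] B' ⊗[R] P} {β₁ : B →ₗ[R] B'}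
    {p : P} (hβ : ∀ x, β x = β₁ x ⊗ₜ p) (z : A ⊗[R] B) :
    (TensorProduct.assoc R A' B' P).symm (TensorProduct.map α β z) =
      TensorProduct.map α β₁ z ⊗ₜ p := by
  induction z using TensorProduct.induction_on with
  | zero => rw [map_zero, map_zero, map_zero, zero_tmul]
  | add x y hx hy => rw [map_add, map_add, map_add, hx, hy, add_tmul]
  | tmul u x =>
    rw [TensorProduct.map_tmul, TensorProduct.map_tmul, hβ, TensorProduct.assoc_symm_tmul]

lemma rightComm_map {A A' B P : Type*} [AddCommMonoid A] [Module R A] [AddCommMonoid A']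
    [Module R A'] [AddCommMonoid B] [Module R B]
    [AddCommMonoid P] [Module R P] {α : A →ₗ[R] A' ⊗[R] P} {α₁ : A →ₗ[R] A'}
    {p : P} (hα : ∀ x, α x = α₁ x ⊗ₜ p) (z : A ⊗[R] B) :
    TensorProduct.rightComm R A' P B (TensorProduct.map α LinearMap.id z) =
      TensorProduct.map α₁ LinearMap.id z ⊗ₜ p := by
  induction z using TensorProduct.induction_on with
  | zero => rw [map_zero, map_zero, map_zero, zero_tmul]
  | add x y hx hy => rw [map_add, map_add, map_add, hx, hy, add_tmul]
  | tmul u x =>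
    rw [TensorProduct.map_tmul, TensorProduct.map_tmul, hα, TensorProduct.rightComm_tmul]

lemma quotDdagger_apply (he : LineBasis e ε) (hf : LineBasis f φ) (i a j : ℤ)
    (x : DMod R F' F'' G' G'' i a j) :
    quotDdagger (R := R) (F' := F') (F'' := F'') (G' := G') (G'' := G'') i a j x =
      (kQuotFst e i a j x.1 ⊗ₜ[R] ε, kQuotSnd φ i a j x.1 ⊗ₜ[R] f) :=
  Prod.ext (assoc_symm_map _ (fun y => he.weylSplit_apply _ y) x.1)
    (rightComm_map (fun y => hf.extProj_apply _ y) x.1)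

lemma kQuotFst_etaPhi (he : LineBasis e ε) (hf : LineBasis f φ)
    (Φ' : Module.Dual R G' →ₗ[R] F') (Φ'' : Module.Dual R G'' →ₗ[R] F'') (h : Φ'' ε = f)
    (i a : ℤ) {j j' : ℤ} (hj : j + 1 = j')
    (x : KMod R (G' × G'') (F' × F'')
      (Module.finrank R (F' × F'') - Module.finrank R (G' × G'') - i - 1) a (-i - 2 + j')) :
    kQuotFst e i a j (etaPhi (blockSum Φ' Φ'') (by omega) (by omega) x) =
      kDiff (LinearMap.fst R F' F'' ∘ₗ blockSum Φ' Φ'') _ a (-i - 2)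
        (show (j - 1) + 1 = j' - 1 by omega) (kQuotFst e i a j' x) :=
  (blockSplit_blockSum he hf Φ' Φ'' h).map_proj_etaPhi _ _ _ _ _ _ _ _ x

lemma neg_one_smul_add_eq {A : Type*} [AddCommGroup A] [Module R A] (u : A) {v w : A}
    (h : v = w) : (-1 : R) • u + v = w - u := by
  rw [neg_one_smul, h, neg_add_eq_sub]

/-- A change of degree after a map between pieces of the complexes `𝕂` is a map of the same kind. -/
lemma kCast_kQuotFst (e : G'') (i a : ℤ) {j j' : ℤ} (hj : j + 1 = j')
    (x : KMod R (G' × G'') (F' × F'')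
      (Module.finrank R (F' × F'') - Module.finrank R (G' × G'') - i - 1) a (-i - 2 + j')) :
    kCast R (G' × G'') F' _ a (-i - 2) (show j' - 1 = j by omega) (kQuotFst e i a j' x) =
      TensorProduct.map (extMap (LinearMap.fst R F' F'') (by omega))
        (weylAct (by omega) (LinearMap.inr R G' G'' e)) x := by
  obtain rfl : j' - 1 = j := by omega
  exact kCast_rfl _ _ _ _

/-- The summand `e* ⊗ e` of the canonical element maps to `f ⊗ e`, and contributes the component of
`quot‡` along `G''*` to the one along `F''`: this is the map `1 ⊗ Φ''` of the total complex. -/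
lemma kQuotSnd_etaPhi (he : LineBasis e ε) (hf : LineBasis f φ)
    (Φ' : Module.Dual R G' →ₗ[R] F') (Φ'' : Module.Dual R G'' →ₗ[R] F'') (h : Φ'' ε = f)
    (i a : ℤ) {j j' : ℤ} (hj : j + 1 = j')
    (x : KMod R (G' × G'') (F' × F'')
      (Module.finrank R (F' × F'') - Module.finrank R (G' × G'') - i - 1) a (-i - 2 + j')) :
    kQuotSnd φ i a j (etaPhi (blockSum Φ' Φ'') (by omega) (by omega) x) =
      kCast R (G' × G'') F' _ a (-i - 2) (show j' - 1 = j by omega) (kQuotFst e i a j' x) -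
      kDiff (LinearMap.fst R F' F'' ∘ₗ blockSum Φ' Φ'') _ a (-i - 2) hj (kQuotSnd φ i a j' x) := by
  rw [kCast_kQuotFst e i a hj]
  refine ((blockSplit_blockSum he hf Φ' Φ'' h).map_extCo_etaPhi
    (r₁ := Module.finrank R (F' × F'') - Module.finrank R (G' × G'') - i - 2 - (-i - 2 + j'))
    (r₁' := Module.finrank R (F' × F'') - Module.finrank R (G' × G'') - i - 2 - (-i - 2 + j))
    _ _ (by omega) (by omega) _ (by omega) x).trans ?_
  exact neg_one_smul_add_eq (R := R) (A := KMod R (G' × G'') F'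
    (Module.finrank R (F' × F'') - Module.finrank R (G' × G'') - i - 2) a (-i - 2 + j)) _ rfl

/-- The map `quot‡` commutes with the differentials. -/
lemma quotDdagger_dDiff (he : LineBasis e ε) (hf : LineBasis f φ)
    (hF : Module.finrank R F'' = 1) (hG : Module.finrank R G'' = 1)
    (Φ' : Module.Dual R G' →ₗ[R] F') (Φ'' : Module.Dual R G'' →ₗ[R] F'') (h : Φ'' ε = f)
    (i a : ℤ) {j j' : ℤ} (hj : j + 1 = j') (x : DMod R F' F'' G' G'' i a j') :
    quotDdagger (R := R) (F' := F') (F'' := F'') (G' := G') (G'' := G'') i a j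
        (dDiff Φ' Φ'' hF hG i a j' j hj x) =
      ((Tot (tensorMapC (shiftC (KComplex (LinearMap.fst R F' F'' ∘ₗ blockSum Φ' Φ'')
        (Module.finrank R (F' × F'') - Module.finrank R (G' × G'') - i - 2) a) (-i - 2)) Φ'')).d
          j' j).hom
        (quotDdagger (R := R) (F' := F') (F'' := F'') (G' := G') (G'' := G'') i a j' x) := by
  have h1 := Tot_KComplex_d (LinearMap.fst R F' F'' ∘ₗ blockSum Φ' Φ'')
    (Module.finrank R (F' × F'') - Module.finrank R (G' × G'') - i - 2) a (-i - 2) Φ'' hj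
    (kQuotFst e i a j' x.1) ε (kQuotSnd φ i a j' x.1)
  rw [h] at h1
  refine (quotDdagger_apply he hf i a j _).trans (Eq.trans ?_ (congrArg (fun t =>
    ((Tot (tensorMapC (shiftC (KComplex (LinearMap.fst R F' F'' ∘ₗ blockSum Φ' Φ'')
        (Module.finrank R (F' × F'') - Module.finrank R (G' × G'') - i - 2) a) (-i - 2)) Φ'')).d
          j' j).hom t) (quotDdagger_apply he hf i a j' x)).symm)
  refine Eq.trans ?_ h1.symm
  exact Prod.ext (congrArg (· ⊗ₜ[R] ε) (kQuotFst_etaPhi he hf Φ' Φ'' h i a hj x.1))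
    (congrArg (· ⊗ₜ[R] f) (kQuotSnd_etaPhi he hf Φ' Φ'' h i a hj x.1))

end QuotDdagger

/-! ### Exactness of the second sequence in each position -/

section DdaggerExact
variable {R : Type u} [CommRing R] [Nontrivial R]
  {F' F'' G' G'' : Type u} [AddCommGroup F'] [Module R F'] [Module.Free R F'] [Module.Finite R F']
  [AddCommGroup F''] [Module R F''] [Module.Free R F''] [Module.Finite R F'']
  [AddCommGroup G'] [Module R G'] [Module.Free R G'] [Module.Finite R G']
  [AddCommGroup G''] [Module R G''] [Module.Free R G''] [Module.Finite R G'']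
  {e : G''} {ε : Module.Dual R G''} {f : F''} {φ : Module.Dual R F''}

lemma LineSplit.weylSum_exact {M P : Type u} [AddCommGroup M] [Module R M] [Module.Free R M]
    [Module.Finite R M] [AddCommGroup P] [Module R P] [Module.Free R P] [Module.Finite R P]
    {ic : M →ₗ[R] P} {π : P →ₗ[R] M} {e : P} {ε : Module.Dual R P} (hs : LineSplit ic π e ε)
    {p p₁ p₂ q q₁ q₂ q' : ℤ} (h : p = p₁) (hq : q = q₁) (h₂ : p = p₂ + 1) (hq₂ : q = q₂)
    (hq' : q' = q - 1) : Function.Exact (weylSum π ε h hq h₂ hq₂) (weylAct hq' e) := by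
  intro x
  constructor
  · exact fun hx => hs.exists_weylSum h hq h₂ hq₂ hq' x hx
  · rintro ⟨y, rfl⟩
    exact hs.weylAct_weylSum h hq h₂ hq₂ hq' y

lemma kIncl_eq (ε : Module.Dual R G'') (hF : Module.finrank R F'' = 1)
    (hG : Module.finrank R G'' = 1) (i a j : ℤ)
    (x : KMod R G' F' (Module.finrank R F' - Module.finrank R G' - i - 1) a (-i - 2 + j))
    (y : KMod R G' F' (Module.finrank R F' - Module.finrank R G' - i - 1) (a - 1) (-i - 2 + j)) :
    kInclFst hF hG i a j x + kInclSnd ε hF hG i a j y =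
      tensorIncl (LinearMap.inl R F' F'') (weylMap (LinearMap.fst R G' G'') rfl rfl)
        (weylWedge (by omega) rfl ((LinearMap.snd R G' G'').dualMap ε) ∘ₗ
          weylMap (LinearMap.fst R G' G'') rfl rfl)
        (by have := finrank_prod_one (F' := F') hF
            have := finrank_prod_one (F' := G') hG
            omega)
        (by have := finrank_prod_one (F' := F') hF
            have := finrank_prod_one (F' := G') hG
            omega) (x, y) := rfl

lemma kIncl_injective (he : LineBasis e ε) (hf : LineBasis f φ) (hF : Module.finrank R F'' = 1)
    (hG : Module.finrank R G'' = 1) (i a j : ℤ)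
    {x x' : KMod R G' F' (Module.finrank R F' - Module.finrank R G' - i - 1) a (-i - 2 + j)}
    {y y' : KMod R G' F' (Module.finrank R F' - Module.finrank R G' - i - 1) (a - 1) (-i - 2 + j)}
    (h : kInclFst hF hG i a j x + kInclSnd ε hF hG i a j y =
      kInclFst hF hG i a j x' + kInclSnd ε hF hG i a j y') : x = x' ∧ y = y' := by
  have h₁ := (kIncl_eq ε hF hG i a j x y).symm.trans (h.trans (kIncl_eq ε hF hG i a j x' y'))
  exact Prod.ext_iff.1 (tensorIncl_injective (hf.lineSplit (M := F')) _ _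
    ((he.lineSplit (M := G')).weylSum_injective rfl rfl (by omega) rfl) h₁)

lemma kQuot_kIncl (he : LineBasis e ε) (hf : LineBasis f φ) (hF : Module.finrank R F'' = 1)
    (hG : Module.finrank R G'' = 1) (i a j : ℤ)
    (x : KMod R G' F' (Module.finrank R F' - Module.finrank R G' - i - 1) a (-i - 2 + j))
    (y : KMod R G' F' (Module.finrank R F' - Module.finrank R G' - i - 1) (a - 1) (-i - 2 + j)) :
    kQuotFst e i a j (kInclFst hF hG i a j x + kInclSnd ε hF hG i a j y) = 0 ∧
      kQuotSnd φ i a j (kInclFst hF hG i a j x + kInclSnd ε hF hG i a j y) = 0 := by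
  rw [kIncl_eq]
  exact ⟨map_tensorIncl _ _ _ ((he.lineSplit (M := G')).weylAct_weylSum rfl rfl _ rfl _) (x, y),
    map_extCo_tensorIncl (hf.lineSplit (M := F')) _ _ _ (x, y)⟩

/-- The kernel of `quot‡` on the pieces of `𝕂` is the image of `incl‡`. -/
lemma exists_kIncl (he : LineBasis e ε) (hf : LineBasis f φ) (hF : Module.finrank R F'' = 1)
    (hG : Module.finrank R G'' = 1) (i a j : ℤ) (ha : 1 ≤ a)
    (z : KMod R (G' × G'') (F' × F'')
      (Module.finrank R (F' × F'') - Module.finrank R (G' × G'') - i - 1) a (-i - 2 + j))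
    (h₁ : kQuotFst e i a j z = 0) (h₂ : kQuotSnd φ i a j z = 0) :
    ∃ x y, kInclFst hF hG i a j x + kInclSnd ε hF hG i a j y = z := by
  have hf' := finrank_prod_one (F' := F') hF
  have hg' := finrank_prod_one (F' := G') hG
  obtain ⟨⟨x, y⟩, hw⟩ := exists_tensorIncl (hf.lineSplit (M := F'))
    (r₁ := Module.finrank R F' - Module.finrank R G' - i - 1 - (-i - 2 + j))
    (r₂ := Module.finrank R F' - Module.finrank R G' - i - 1 - (-i - 2 + j))
    (by omega) (by omega) _ _
    ((he.lineSplit (M := G')).weylSum_exact rfl rfl (show a = (a - 1) + 1 by omega) rfl _)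
    ((he.lineSplit (M := G')).weylAct_surjective ha _) z h₁ h₂
  exact ⟨x, y, (kIncl_eq ε hF hG i a j x y).trans hw⟩

lemma exists_kQuot (he : LineBasis e ε) (hf : LineBasis f φ) (i a j : ℤ) (ha : 1 ≤ a)
    (s : KMod R (G' × G'') F' (Module.finrank R (F' × F'') - Module.finrank R (G' × G'') - i - 2) a
      (-i - 2 + (j - 1)))
    (t : KMod R (G' × G'') F' (Module.finrank R (F' × F'') - Module.finrank R (G' × G'') - i - 2) a
      (-i - 2 + j)) :
    ∃ z, kQuotFst e i a j z = s ∧ kQuotSnd φ i a j z = t :=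
  exists_tensor_quot (hf.lineSplit (M := F')) _ _
    ((he.lineSplit (M := G')).weylAct_surjective ha _) s t

/-- In position `i + 1` the map `(x, y) ↦ x + y ∧ f` is the decomposition `extSplit` of the exterior
power. The statement compares elements of the exterior algebras, as the degrees on the two sides are
equal by a computation with ranks only. -/
lemma mIncl_coe (f : F'') (hF : Module.finrank R F'' = 1) (hG : Module.finrank R G'' = 1)
    (i a j : ℤ)
    (x : midPiece R F' i (Module.finrank R F' - Module.finrank R G' + a - i - 1) j)
    (y : midPiece R F' i (Module.finrank R F' - Module.finrank R G' + (a - 1) - i - 1) j)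
    (u : ExtPow R F' (Module.finrank R F' - Module.finrank R G' + a - i - 1))
    (v : ExtPow R F' (Module.finrank R F' - Module.finrank R G' + (a - 1) - i - 1))
    (hu : (x : ExteriorAlgebra R F') = u) (hv : (y : ExteriorAlgebra R F') = v) :
    ((mInclFst hF hG i a j x + mInclSnd f hF hG i a j y : midPiece R (F' × F'') i _ j) :
      ExteriorAlgebra R (F' × F'')) =
    (extSplit (LinearMap.inl R F' F'') (LinearMap.inr R F' F'' f) rfl (by omega) (u, v) :
      ExtPow R (F' × F'') (Module.finrank R F' - Module.finrank R G' + a - i - 1)) :=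
  congrArg₂ (fun s t => ExteriorAlgebra.map (LinearMap.inl R F' F'') s +
    ExteriorAlgebra.map (LinearMap.inl R F' F'') t *
      ExteriorAlgebra.ι R (LinearMap.inr R F' F'' f)) hu hv

lemma midPiece_eq_zero {F : Type u} [AddCommGroup F] [Module R F] {i n j : ℤ}
    (h : j ≠ i + 1) (m : midPiece R F i n j) : m = 0 :=
  Subtype.ext (by have := mem_midPiece.1 m.2; rwa [if_neg h] at this)

lemma mIncl_injective (hf : LineBasis f φ) (hF : Module.finrank R F'' = 1)
    (hG : Module.finrank R G'' = 1) (i a j : ℤ)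
    {x x' : midPiece R F' i (Module.finrank R F' - Module.finrank R G' + a - i - 1) j}
    {y y' : midPiece R F' i (Module.finrank R F' - Module.finrank R G' + (a - 1) - i - 1) j}
    (h : mInclFst hF hG i a j x + mInclSnd f hF hG i a j y =
      mInclFst hF hG i a j x' + mInclSnd f hF hG i a j y') : x = x' ∧ y = y' := by
  by_cases hj : j = i + 1
  · obtain ⟨u, hu⟩ := exists_extPow_of_midPiece hj x
    obtain ⟨u', hu'⟩ := exists_extPow_of_midPiece hj x'
    obtain ⟨v, hv⟩ := exists_extPow_of_midPiece hj y
    obtain ⟨v', hv'⟩ := exists_extPow_of_midPiece hj y'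
    have h1 := congrArg Subtype.val h
    rw [mIncl_coe f hF hG i a j x y u v hu hv, mIncl_coe f hF hG i a j x' y' u' v' hu' hv'] at h1
    have h2 := ((hf.lineSplit (M := F')).extSplit_bijective _ _).1 (Subtype.ext h1)
    obtain ⟨rfl, rfl⟩ := Prod.ext_iff.1 h2
    exact ⟨Subtype.ext (hu.trans hu'.symm), Subtype.ext (hv.trans hv'.symm)⟩
  · exact ⟨(midPiece_eq_zero hj x).trans (midPiece_eq_zero hj x').symm,
      (midPiece_eq_zero hj y).trans (midPiece_eq_zero hj y').symm⟩

/-- In position `i + 1` the map `incl‡` is surjective on the pieces of `⋀ F`. -/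
lemma exists_mIncl (hf : LineBasis f φ) (hF : Module.finrank R F'' = 1)
    (hG : Module.finrank R G'' = 1) (i a j : ℤ)
    (z : midPiece R (F' × F'') i
      (Module.finrank R (F' × F'') - Module.finrank R (G' × G'') + a - i - 1) j) :
    ∃ x y, mInclFst hF hG i a j x + mInclSnd f hF hG i a j y = z := by
  have hf' := finrank_prod_one (F' := F') hF
  have hg' := finrank_prod_one (F' := G') hG
  by_cases hj : j = i + 1
  · have hz : (z : ExteriorAlgebra R (F' × F'')) ∈ extPiece R (F' × F'')
        (Module.finrank R F' - Module.finrank R G' + a - i - 1) := by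
      have := mem_midPiece.1 z.2
      rw [if_pos hj] at this
      convert this using 2
      omega
    obtain ⟨⟨u, v⟩, huv⟩ := ((hf.lineSplit (M := F')).extSplit_bijective
      (n := Module.finrank R F' - Module.finrank R G' + a - i - 1) rfl
      (n₂ := Module.finrank R F' - Module.finrank R G' + (a - 1) - i - 1) (by omega)).2 ⟨z, hz⟩
    refine ⟨⟨u, mem_midPiece.2 (by rw [if_pos hj]; exact u.2)⟩,
      ⟨v, mem_midPiece.2 (by rw [if_pos hj]; exact v.2)⟩, Subtype.ext ?_⟩
    exact (mIncl_coe f hF hG i a j _ _ u v rfl rfl).trans (congrArg Subtype.val huv)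
  · exact ⟨0, 0, (midPiece_eq_zero hj _).trans (midPiece_eq_zero hj z).symm⟩

lemma sgn_smul_sgn_smul {A : Type*} [AddCommMonoid A] [Module R A] (n : ℤ) (x : A) :
    sgn R n • sgn R n • x = x := by
  rw [smul_smul, sgn_mul_self, one_smul]

lemma LineBasis.sgn_smul_tmul_injective {N : Type u} [AddCommGroup N] [Module R N] {e : N}
    {ε : Module.Dual R N} (he : LineBasis e ε) {A : Type*} [AddCommMonoid A] [Module R A] {n : ℤ}
    {x x' : A} (h : sgn R n • (x ⊗ₜ[R] e) = sgn R n • (x' ⊗ₜ[R] e)) : x = x' := by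
  have h1 := congrArg (sgn R n • ·) h
  simp only [sgn_smul_sgn_smul] at h1
  exact he.tmul_injective h1

lemma LineBasis.exists_sgn_smul_tmul {N : Type u} [AddCommGroup N] [Module R N] {e : N}
    {ε : Module.Dual R N} (he : LineBasis e ε) {A : Type*} [AddCommMonoid A] [Module R A] (n : ℤ)
    (z : A ⊗[R] N) : ∃ x : A, sgn R n • (x ⊗ₜ[R] e) = z := by
  obtain ⟨x, rfl⟩ := he.exists_tmul z
  exact ⟨sgn R n • x, by rw [smul_tmul', smul_smul, sgn_mul_self, one_smul]⟩

end DdaggerExact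

/-! ### The maps of the two sequences on elements -/

section Assembly
variable {R : Type u} [CommRing R] [Nontrivial R]
  {F' F'' G' G'' : Type u} [AddCommGroup F'] [Module R F'] [Module.Free R F'] [Module.Finite R F']
  [AddCommGroup F''] [Module R F''] [Module.Free R F''] [Module.Finite R F'']
  [AddCommGroup G'] [Module R G'] [Module.Free R G'] [Module.Finite R G']
  [AddCommGroup G''] [Module R G''] [Module.Free R G''] [Module.Finite R G'']
  {e : G''} {ε : Module.Dual R G''} {f : F''} {φ : Module.Dual R F''}

lemma inclDdagger_apply (he : LineBasis e ε) (Φ'' : Module.Dual R G'' →ₗ[R] F'')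
    (h : Φ'' ε = f) (hF : Module.finrank R F'' = 1) (hG : Module.finrank R G'' = 1) (i a j : ℤ)
    (x : CMod R G' F' i a j) (y : CMod R G' F' i (a - 1) j) :
    inclDdagger₁ Φ'' hF hG i a j x + inclDdagger₂ Φ'' hF hG i a j (y ⊗ₜ[R] ε) =
      (kInclFst hF hG i a j x.1 + kInclSnd ε hF hG i a j y.1,
        mInclFst hF hG i a j x.2.1 + mInclSnd f hF hG i a j y.2.1,
        sgn R (Module.finrank R (G' × G'') - a + 1 + i - j) • (y.2.2 ⊗ₜ[R] f),
        sgn R (Module.finrank R (G' × G'') - a + i - j) • (x.2.2 ⊗ₜ[R] (f ⊗ₜ[R] e))) := by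
  refine (add_congr (inclDdagger₁_apply he Φ'' h hF hG i a j x)
    (inclDdagger₂_apply Φ'' h hF hG i a j y)).trans ?_
  exact Prod.ext rfl (Prod.ext rfl (Prod.ext (zero_add _) (add_zero _)))

lemma inclDdagger_pair_injective (he : LineBasis e ε) (hf : LineBasis f φ)
    (Φ'' : Module.Dual R G'' →ₗ[R] F'') (h : Φ'' ε = f) (hF : Module.finrank R F'' = 1)
    (hG : Module.finrank R G'' = 1) (i a j : ℤ) {x x' : CMod R G' F' i a j}
    {y y' : CMod R G' F' i (a - 1) j}
    (hxy : inclDdagger₁ Φ'' hF hG i a j x + inclDdagger₂ Φ'' hF hG i a j (y ⊗ₜ[R] ε) =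
      inclDdagger₁ Φ'' hF hG i a j x' + inclDdagger₂ Φ'' hF hG i a j (y' ⊗ₜ[R] ε)) :
    x = x' ∧ y = y' := by
  have h1 := (inclDdagger_apply he Φ'' h hF hG i a j x y).symm.trans
    (hxy.trans (inclDdagger_apply he Φ'' h hF hG i a j x' y'))
  obtain ⟨hk, hm, hl, hl'⟩ : _ ∧ _ ∧ _ ∧ _ := by
    simpa only [Prod.mk.injEq] using h1
  obtain ⟨hk₁, hk₂⟩ := kIncl_injective he hf hF hG i a j hk
  obtain ⟨hm₁, hm₂⟩ := mIncl_injective hf hF hG i a j hm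
  exact ⟨Prod.ext hk₁ (Prod.ext hm₁ ((hf.tensor he).sgn_smul_tmul_injective hl')),
    Prod.ext hk₂ (Prod.ext hm₂ (hf.sgn_smul_tmul_injective hl))⟩

section Pairs
variable {N N₁ : Type u} [AddCommGroup N] [Module R N] [AddCommGroup N₁] [Module R N₁]
  {p : N} {π : Module.Dual R N} {p₁ : N₁} {π₁ : Module.Dual R N₁} {A B : Type*} [AddCommMonoid A]
  [Module R A] [AddCommMonoid B] [Module R B]

lemma pair_tmul_eq_zero_iff (hp : LineBasis p π) (hp₁ : LineBasis p₁ π₁) {x : A} {y : B} :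
    ((x ⊗ₜ[R] p, y ⊗ₜ[R] p₁) : (A ⊗[R] N) × (B ⊗[R] N₁)) = 0 ↔ x = 0 ∧ y = 0 := by
  constructor
  · intro h
    exact ⟨hp.tmul_injective ((congrArg Prod.fst h).trans (zero_tmul A p).symm),
      hp₁.tmul_injective ((congrArg Prod.snd h).trans (zero_tmul B p₁).symm)⟩
  · rintro ⟨rfl, rfl⟩
    rw [zero_tmul, zero_tmul]
    rfl

lemma exists_pair_eq_tmul (hp : LineBasis p π) (hp₁ : LineBasis p₁ π₁)
    (z : (A ⊗[R] N) × (B ⊗[R] N₁)) : ∃ (x : A) (y : B), z = (x ⊗ₜ[R] p, y ⊗ₜ[R] p₁) := by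
  obtain ⟨x, hx⟩ := hp.exists_tmul z.1
  obtain ⟨y, hy⟩ := hp₁.exists_tmul z.2
  exact ⟨x, y, Prod.ext hx hy⟩

end Pairs

lemma quotDdagger_eq_zero_iff (he : LineBasis e ε) (hf : LineBasis f φ) (i a j : ℤ)
    (x : DMod R F' F'' G' G'' i a j) :
    quotDdagger (R := R) (F' := F') (F'' := F'') (G' := G') (G'' := G'') i a j x = 0 ↔
      kQuotFst e i a j x.1 = 0 ∧ kQuotSnd φ i a j x.1 = 0 := by
  rw [quotDdagger_apply he hf]
  exact pair_tmul_eq_zero_iff he.dual hf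

lemma quotDdagger_inclDdagger (he : LineBasis e ε) (hf : LineBasis f φ)
    (Φ'' : Module.Dual R G'' →ₗ[R] F'') (h : Φ'' ε = f) (hF : Module.finrank R F'' = 1)
    (hG : Module.finrank R G'' = 1) (i a j : ℤ) (x : CMod R G' F' i a j)
    (y : CMod R G' F' i (a - 1) j) :
    quotDdagger (R := R) (F' := F') (F'' := F'') (G' := G') (G'' := G'') i a j
      (inclDdagger₁ Φ'' hF hG i a j x + inclDdagger₂ Φ'' hF hG i a j (y ⊗ₜ[R] ε)) = 0 := by
  refine (congrArg (fun z => quotDdagger (R := R) (F' := F') (F'' := F'') (G' := G') (G'' := G'')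
    i a j z) (inclDdagger_apply he Φ'' h hF hG i a j x y)).trans ?_
  exact (quotDdagger_eq_zero_iff he hf i a j _).2 (kQuot_kIncl he hf hF hG i a j x.1 y.1)

/-- A preimage under a map of direct sums, assembled from preimages of the components. -/
lemma exists_of_components {K₁ K₂ K M₁ M₂ M L₁ L₂ T₁ T₂ : Type*} {k : K₁ → K₂ → K}
    {m : M₁ → M₂ → M} {l₁ : L₁ → T₁} {l₂ : L₂ → T₂} {z : K × M × T₂ × T₁}
    (hk : ∃ x y, k x y = z.1) (hm : ∃ x y, m x y = z.2.1) (hl₂ : ∃ y, l₂ y = z.2.2.1)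
    (hl₁ : ∃ x, l₁ x = z.2.2.2) :
    ∃ (x : K₁ × M₁ × L₁) (y : K₂ × M₂ × L₂),
      (k x.1 y.1, m x.2.1 y.2.1, l₂ y.2.2, l₁ x.2.2) = z := by
  obtain ⟨k₁, k₂, hk⟩ := hk
  obtain ⟨m₁, m₂, hm⟩ := hm
  obtain ⟨y, hl₂⟩ := hl₂
  obtain ⟨x, hl₁⟩ := hl₁
  exact ⟨(k₁, m₁, x), (k₂, m₂, y), Prod.ext hk (Prod.ext hm (Prod.ext hl₂ hl₁))⟩

lemma exists_inclDdagger_pair (he : LineBasis e ε) (hf : LineBasis f φ)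
    (Φ'' : Module.Dual R G'' →ₗ[R] F'') (h : Φ'' ε = f) (hF : Module.finrank R F'' = 1)
    (hG : Module.finrank R G'' = 1) (i a j : ℤ) (ha : 1 ≤ a) (z : DMod R F' F'' G' G'' i a j)
    (hz : quotDdagger (R := R) (F' := F') (F'' := F'') (G' := G') (G'' := G'') i a j z = 0) :
    ∃ (x : CMod R G' F' i a j) (y : CMod R G' F' i (a - 1) j),
      inclDdagger₁ Φ'' hF hG i a j x + inclDdagger₂ Φ'' hF hG i a j (y ⊗ₜ[R] ε) = z := by
  have h1 := (quotDdagger_eq_zero_iff he hf i a j z).1 hz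
  obtain ⟨x, y, hxy⟩ := exists_of_components
    (exists_kIncl he hf hF hG i a j ha z.1 h1.1 h1.2) (exists_mIncl hf hF hG i a j z.2.1)
    (hf.exists_sgn_smul_tmul (Module.finrank R (G' × G'') - a + 1 + i - j) z.2.2.1)
    ((hf.tensor he).exists_sgn_smul_tmul (Module.finrank R (G' × G'') - a + i - j) z.2.2.2)
  exact ⟨x, y, (inclDdagger_apply he Φ'' h hF hG i a j x y).trans hxy⟩

/-- The map `incl‡` in position `j`. -/
def inclDdagger (Φ'' : Module.Dual R G'' →ₗ[R] F'') (hF : Module.finrank R F'' = 1)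
    (hG : Module.finrank R G'' = 1) (i a j : ℤ) :
    CMod R G' F' i a j × (CMod R G' F' i (a - 1) j ⊗[R] Module.Dual R G'') →ₗ[R]
      DMod R F' F'' G' G'' i a j :=
  LinearMap.coprod (inclDdagger₁ Φ'' hF hG i a j) (inclDdagger₂ Φ'' hF hG i a j)

/-- Every element of `A ⊕ (B ⊗ N)` is of the form `(a, b ⊗ p)` if `p` is a basis of `N`. -/
lemma LineBasis.exists_prod_tmul {N : Type u} [AddCommGroup N] [Module R N] {p : N}
    {π : Module.Dual R N} (hp : LineBasis p π) {A B : Type*} [AddCommMonoid A] [Module R A]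
    [AddCommMonoid B] [Module R B] (z : A × (B ⊗[R] N)) :
    ∃ (x : A) (y : B), z = (x, y ⊗ₜ[R] p) := by
  obtain ⟨y, hy⟩ := hp.exists_tmul z.2
  exact ⟨z.1, y, Prod.ext rfl hy⟩

lemma LineBasis.prod_tmul_induction {N : Type u} [AddCommGroup N] [Module R N] {p : N}
    {π : Module.Dual R N} (hp : LineBasis p π) {A B : Type*} [AddCommMonoid A] [Module R A]
    [AddCommMonoid B] [Module R B] {C : A × (B ⊗[R] N) → Prop} (h : ∀ x y, C (x, y ⊗ₜ[R] p))
    (z : A × (B ⊗[R] N)) : C z := by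
  obtain ⟨x, y, rfl⟩ := hp.exists_prod_tmul z
  exact h x y

lemma inclDdagger_injective (he : LineBasis e ε) (hf : LineBasis f φ)
    (Φ'' : Module.Dual R G'' →ₗ[R] F'') (h : Φ'' ε = f) (hF : Module.finrank R F'' = 1)
    (hG : Module.finrank R G'' = 1) (i a j : ℤ) :
    Function.Injective (inclDdagger (F' := F') (G' := G') Φ'' hF hG i a j) := by
  intro z z' hz
  obtain ⟨x, y, hxy⟩ := he.dual.exists_prod_tmul z
  obtain ⟨x', y', hxy'⟩ := he.dual.exists_prod_tmul z'
  have h1 := (congrArg (inclDdagger Φ'' hF hG i a j) hxy).symm.trans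
    (hz.trans (congrArg (inclDdagger Φ'' hF hG i a j) hxy'))
  have h2 := inclDdagger_pair_injective he hf Φ'' h hF hG i a j h1
  exact hxy.trans ((Prod.ext h2.1 (congrArg (· ⊗ₜ[R] ε) h2.2)).trans hxy'.symm)

lemma quotDdagger_comp_inclDdagger (he : LineBasis e ε) (hf : LineBasis f φ)
    (Φ'' : Module.Dual R G'' →ₗ[R] F'') (h : Φ'' ε = f) (hF : Module.finrank R F'' = 1)
    (hG : Module.finrank R G'' = 1) (i a j : ℤ)
    (z : CMod R G' F' i a j × (CMod R G' F' i (a - 1) j ⊗[R] Module.Dual R G'')) :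
    quotDdagger (R := R) (F' := F') (F'' := F'') (G' := G') (G'' := G'') i a j
      (inclDdagger Φ'' hF hG i a j z) = 0 := by
  exact he.dual.prod_tmul_induction (C := fun z => quotDdagger (R := R) (F' := F') (F'' := F'')
      (G' := G') (G'' := G'') i a j (inclDdagger Φ'' hF hG i a j z) = 0)
    (fun x y => quotDdagger_inclDdagger he hf Φ'' h hF hG i a j x y) z

lemma exists_inclDdagger (he : LineBasis e ε) (hf : LineBasis f φ)
    (Φ'' : Module.Dual R G'' →ₗ[R] F'') (h : Φ'' ε = f) (hF : Module.finrank R F'' = 1)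
    (hG : Module.finrank R G'' = 1) (i a j : ℤ) (ha : 1 ≤ a) (z : DMod R F' F'' G' G'' i a j)
    (hz : quotDdagger (R := R) (F' := F') (F'' := F'') (G' := G') (G'' := G'') i a j z = 0) :
    ∃ w, inclDdagger Φ'' hF hG i a j w = z := by
  obtain ⟨x, y, hxy⟩ := exists_inclDdagger_pair he hf Φ'' h hF hG i a j ha z hz
  exact ⟨(x, y ⊗ₜ[R] ε), hxy⟩

lemma dDiff_inclDdagger (he : LineBasis e ε) (hf : LineBasis f φ) (hF : Module.finrank R F'' = 1)
    (hG : Module.finrank R G'' = 1) (Φ' : Module.Dual R G' →ₗ[R] F')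
    (Φ'' : Module.Dual R G'' →ₗ[R] F'') (h : Φ'' ε = f) (i a : ℤ)
    (hag : a ≤ Module.finrank R (G' × G'') - 1) {j j' : ℤ} (hj : j + 1 = j')
    (z : CMod R G' F' i a j' × (CMod R G' F' i (a - 1) j' ⊗[R] Module.Dual R G'')) :
    dDiff Φ' Φ'' hF hG i a j' j hj (inclDdagger Φ'' hF hG i a j' z) =
      inclDdagger Φ'' hF hG i a j ((cDiff Φ' i a j' j hj).prodMap
        ((cDiff Φ' i (a - 1) j' j hj).rTensor (Module.Dual R G'')) z) := by
  exact he.dual.prod_tmul_induction (C := fun z =>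
      dDiff Φ' Φ'' hF hG i a j' j hj (inclDdagger Φ'' hF hG i a j' z) =
        inclDdagger Φ'' hF hG i a j ((cDiff Φ' i a j' j hj).prodMap
          ((cDiff Φ' i (a - 1) j' j hj).rTensor (Module.Dual R G'')) z))
    (fun x y => (map_add (dDiff Φ' Φ'' hF hG i a j' j hj) _ _).trans
      (add_congr (dDiff_inclDdagger₁ he hf hF hG Φ' Φ'' h i a hag hj x)
        (dDiff_inclDdagger₂ he hf hF hG Φ' Φ'' h i a hag hj y))) z

lemma prodC_CComplex_d {G F P : Type u} [AddCommGroup G] [Module R G] [Module.Free R G]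
    [Module.Finite R G] [AddCommGroup F] [Module R F] [Module.Free R F] [AddCommGroup P]
    [Module R P] (Φ : Module.Dual R G →ₗ[R] F) (i a : ℤ) {j j' : ℤ} (hj : j + 1 = j')
    (z : CMod R G F i a j' × (CMod R G F i (a - 1) j' ⊗[R] P)) :
    ((prodC (CComplex Φ i a) (tensorC (CComplex Φ i (a - 1)) P)).d j' j).hom z =
      (cDiff Φ i a j' j hj).prodMap ((cDiff Φ i (a - 1) j' j hj).rTensor P) z := by
  have h1 : ((CComplex Φ i a).d j' j).hom = cDiff Φ i a j' j hj :=
    congrArg ModuleCat.Hom.hom (mkComplex_d _ hj)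
  have h2 : ((CComplex Φ i (a - 1)).d j' j).hom = cDiff Φ i (a - 1) j' j hj :=
    congrArg ModuleCat.Hom.hom (mkComplex_d _ hj)
  refine (congrArg (fun m => m z)
    (prodC_d (CComplex Φ i a) (tensorC (CComplex Φ i (a - 1)) P) hj)).trans (Prod.ext ?_ ?_)
  · exact congrArg (fun m => m z.1) h1
  · exact (congrArg (fun m => m z.2) (tensorC_d (CComplex Φ i (a - 1)) P hj)).trans
      (congrArg (fun m => LinearMap.rTensor P m z.2) h2)

lemma quotDdagger_surjective (he : LineBasis e ε) (hf : LineBasis f φ) (i a j : ℤ) (ha : 1 ≤ a) :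
    Function.Surjective
      (quotDdagger (R := R) (F' := F') (F'' := F'') (G' := G') (G'' := G'') i a j) := by
  intro w
  obtain ⟨s, t, hw⟩ := exists_pair_eq_tmul he.dual hf w
  obtain ⟨z, hs, ht⟩ := exists_kQuot he hf i a j ha s t
  refine ⟨(z, 0), (quotDdagger_apply he hf i a j (z, 0)).trans (Eq.trans ?_ hw.symm)⟩
  exact Prod.ext (congrArg (· ⊗ₜ[R] ε) hs) (congrArg (· ⊗ₜ[R] f) ht)

lemma midPiece_free {F : Type u} [AddCommGroup F] [Module R F] [Module.Free R F] (i n j : ℤ) :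
    Module.Free R (midPiece R F i n j) := by
  by_cases h : j = i + 1
  · rw [midPiece, if_pos h]
    exact extPow_free n
  · rw [midPiece, if_neg h]
    infer_instance

lemma dMod_free (hG : Module.finrank R G'' = 1) (i a j : ℤ) (ha : 1 ≤ a)
    (hag : a ≤ Module.finrank R (G' × G'') - 1) : Module.Free R (DMod R F' F'' G' G'' i a j) := by
  have hg' := finrank_prod_one (F' := G') hG
  have := weylK_free (R := R) (P := G' × G'') (p := a) (by omega) (-i - 2 + j)
  have := midPiece_free (R := R) (F := F' × F'') i
    (Module.finrank R (F' × F'') - Module.finrank R (G' × G'') + a - i - 1) j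
  have := schurLPos_free (R := R) (P := G') (p := Module.finrank R G' - (a - 1)) (by omega)
    (Module.finrank R F' - (Module.finrank R F' - i - 1) - j)
  have := schurLPos_free (R := R) (P := G') (p := Module.finrank R G' - a) (by omega)
    (Module.finrank R F' - (Module.finrank R F' - i - 1) - j)
  infer_instance

lemma kosTwist_bijective (he : LineBasis e ε) (hf : LineBasis f φ)
    (Φ'' : Module.Dual R G'' →ₗ[R] F'') (h : Φ'' ε = f) : Function.Bijective (kosTwist Φ'') := by
  have hk : ∀ r, kosTwist Φ'' r = r • (f ⊗ₜ[R] e) := fun r => by rw [he.kosTwist_one, h]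
  have hs := hf.tensor he
  constructor
  · intro r s hrs
    rw [hk, hk] at hrs
    have := congrArg (LinearMap.mul' R R ∘ₗ TensorProduct.map φ ε) hrs
    rw [map_smul, map_smul, hs.coeff_self] at this
    simpa using this
  · intro z
    exact ⟨_, (hk _).trans (hs.decomp z)⟩

/-- A morphism of chain complexes is determined by degreewise maps that commute with the
differentials. -/
def mkHom {A B : ChainComplex (ModuleCat.{u} R) ℤ} (m : ∀ j, A.X j →ₗ[R] B.X j)
    (hm : ∀ (j j' : ℤ), j + 1 = j' → ∀ x,
      (B.d j' j).hom (m j' x) = m j ((A.d j' j).hom x)) : A ⟶ B where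
  f j := ModuleCat.ofHom (m j)
  comm' j' j h := ModuleCat.hom_ext (LinearMap.ext fun x => hm j j' h x)

lemma tensorMapC_bijective (A : ChainComplex (ModuleCat.{u} R) ℤ) {P Q : Type u} [AddCommGroup P]
    [Module R P] [AddCommGroup Q] [Module R Q] {t : P →ₗ[R] Q} (ht : Function.Bijective t) (j : ℤ) :
    Function.Bijective ((tensorMapC A t).f j).hom :=
  (LinearEquiv.lTensor (A.X j) (LinearEquiv.ofBijective t ht)).bijective

end Assembly

/-! ### The two short exact sequences of complexes -/

section Complexes
variable {R : Type u} [CommRing R] [Nontrivial R]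
  {F' F'' G' G'' : Type u} [AddCommGroup F'] [Module R F'] [Module.Free R F'] [Module.Finite R F']
  [AddCommGroup F''] [Module R F''] [Module.Free R F''] [Module.Finite R F'']
  [AddCommGroup G'] [Module R G'] [Module.Free R G'] [Module.Finite R G']
  [AddCommGroup G''] [Module R G''] [Module.Free R G''] [Module.Finite R G'']
  {e : G''} {ε : Module.Dual R G''} {f : F''} {φ : Module.Dual R F''}

lemma CComplex_d {G F : Type u} [AddCommGroup G] [Module R G] [Module.Free R G]
    [Module.Finite R G] [AddCommGroup F] [Module R F] [Module.Free R F]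
    (Φ : Module.Dual R G →ₗ[R] F) (i a : ℤ) {j j' : ℤ} (hj : j + 1 = j') (x : CMod R G F i a j') :
    ((CComplex Φ i a).d j' j).hom x = cDiff Φ i a j' j hj x :=
  congrArg (fun m : (CComplex Φ i a).X j' ⟶ (CComplex Φ i a).X j => m.hom x) (mkComplex_d _ hj)

lemma DComplex_d (he : LineBasis e ε) (hf : LineBasis f φ) (hF : Module.finrank R F'' = 1)
    (hG : Module.finrank R G'' = 1) (Φ' : Module.Dual R G' →ₗ[R] F')
    (Φ'' : Module.Dual R G'' →ₗ[R] F'') (h : Φ'' ε = f) (i a : ℤ)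
    (hag : a ≤ Module.finrank R (G' × G'') - 1) {j j' : ℤ} (hj : j + 1 = j')
    (x : DMod R F' F'' G' G'' i a j') :
    ((DComplex he hf hF hG Φ' Φ'' h i a hag).d j' j).hom x = dDiff Φ' Φ'' hF hG i a j' j hj x :=
  congrArg (fun m : (DComplex he hf hF hG Φ' Φ'' h i a hag).X j' ⟶
    (DComplex he hf hF hG Φ' Φ'' h i a hag).X j => m.hom x) (mkComplex_d _ hj)

/-- The map of complexes `incl†`. -/
def inclDaggerC (he : LineBasis e ε) (hf : LineBasis f φ) (hF : Module.finrank R F'' = 1)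
    (Φ' : Module.Dual R G' →ₗ[R] F') (Φ'' : Module.Dual R G'' →ₗ[R] F'') (h : Φ'' ε = f)
    (i a : ℤ) :
    Tot (tensorMapC (LComplex (LinearMap.fst R F' F'' ∘ₗ blockSum Φ' Φ'')
      (Module.finrank R (F' × F'') - i - 1) (Module.finrank R (G' × G'') - a)) (kosTwist Φ'')) ⟶
    CComplex (blockSum Φ' Φ'') i a :=
  mkHom (fun j => inclDagger hF i a j) (fun _ _ hj x =>
    (CComplex_d (blockSum Φ' Φ'') i a hj _).trans (inclDagger_d he hf hF Φ' Φ'' h i a hj x))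

/-- The map of complexes `quot†`. -/
def quotDaggerC (he : LineBasis e ε) (hf : LineBasis f φ) (hF : Module.finrank R F'' = 1)
    (hG : Module.finrank R G'' = 1) (Φ' : Module.Dual R G' →ₗ[R] F')
    (Φ'' : Module.Dual R G'' →ₗ[R] F'') (h : Φ'' ε = f) (i a : ℤ)
    (hag : a ≤ Module.finrank R (G' × G'') - 1) :
    CComplex (blockSum Φ' Φ'') i a ⟶ DComplex he hf hF hG Φ' Φ'' h i a hag :=
  mkHom (B := DComplex he hf hF hG Φ' Φ'' h i a hag) (fun j => quotDagger hF hG i a j)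
    (fun j _ hj x => (DComplex_d he hf hF hG Φ' Φ'' h i a hag hj _).trans
      ((quotDagger_cDiff he hf hF hG Φ' Φ'' h i a hj x).symm.trans
        (congrArg (quotDagger hF hG i a j) (CComplex_d (blockSum Φ' Φ'') i a hj x).symm)))

lemma quotDagger_inclDagger (he : LineBasis e ε) (hf : LineBasis f φ)
    (hF : Module.finrank R F'' = 1) (hG : Module.finrank R G'' = 1) (i a j : ℤ)
    (z : (LMod R (G' × G'') F' (Module.finrank R (F' × F'') - i - 1)
        (Module.finrank R (G' × G'') - a) (j - 1) ⊗[R] R) ×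
      (LMod R (G' × G'') F' (Module.finrank R (F' × F'') - i - 1)
        (Module.finrank R (G' × G'') - a) j ⊗[R] (F'' ⊗[R] G''))) :
    quotDagger hF hG i a j (inclDagger hF i a j z) = 0 := by
  obtain ⟨x, y, hz⟩ := exists_pair_tmul hf he z
  refine (congrArg (fun t => quotDagger hF hG i a j t) ((congrArg (inclDagger hF i a j) hz).trans
    (inclDagger_apply e f hF i a j x y))).trans ?_
  refine (quotDagger_apply hF hG i a j _).trans ?_
  refine Prod.ext rfl (Prod.ext rfl (Prod.ext ?_ ?_))
  · exact (quotMap_apply hf hF hG i a j _).trans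
      ((congrArg (· ⊗ₜ[R] f) (quotMapOne_incl he hf hF hG i a j x y)).trans (zero_tmul _ _))
  · exact (quotCo_apply he hf hF hG i a j _).trans
      ((congrArg (· ⊗ₜ[R] (f ⊗ₜ[R] e)) (quotCoOne_incl he hf hF hG i a j x y)).trans
        (zero_tmul _ _))

lemma inclDagger_injective (he : LineBasis e ε) (hf : LineBasis f φ)
    (hF : Module.finrank R F'' = 1) (i a j : ℤ) :
    Function.Injective (inclDagger (R := R) (F' := F') (G' := G') (G'' := G'') hF i a j) := by
  intro z z' hz
  obtain ⟨x, y, hxy⟩ := exists_pair_tmul hf he z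
  obtain ⟨x', y', hxy'⟩ := exists_pair_tmul hf he z'
  have h1 := ((congrArg (inclDagger hF i a j) hxy).trans
    (inclDagger_apply e f hF i a j x y)).symm.trans
    (hz.trans ((congrArg (inclDagger hF i a j) hxy').trans
      (inclDagger_apply e f hF i a j x' y')))
  have h2 := incl_injective he hf hF i a j (congrArg (fun t => t.2.2) h1)
  exact hxy.trans ((Prod.ext (congrArg (· ⊗ₜ[R] (1 : R)) h2.1)
    (congrArg (· ⊗ₜ[R] (f ⊗ₜ[R] e)) h2.2)).trans hxy'.symm)

lemma exists_inclDagger (he : LineBasis e ε) (hf : LineBasis f φ)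
    (hF : Module.finrank R F'' = 1) (hG : Module.finrank R G'' = 1) (i a j : ℤ)
    (hag : a ≤ Module.finrank R (G' × G'') - 1) (z : CMod R (G' × G'') (F' × F'') i a j)
    (hz : quotDagger hF hG i a j z = 0) : ∃ w, inclDagger hF i a j w = z := by
  have h1 := (quotDagger_apply hF hG i a j z).symm.trans hz
  have h2 : quotMapOne φ hF hG i a j z.2.2 = 0 := hf.tmul_injective
    ((quotMap_apply hf hF hG i a j z.2.2).symm.trans
      ((congrArg (fun t => t.2.2.1) h1).trans (zero_tmul _ f).symm))
  have h3 : quotCoOne φ ε hF hG i a j z.2.2 = 0 := (hf.tensor he).tmul_injective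
    ((quotCo_apply he hf hF hG i a j z.2.2).symm.trans
      ((congrArg (fun t => t.2.2.2) h1).trans (zero_tmul _ (f ⊗ₜ[R] e)).symm))
  obtain ⟨x, y, hxy⟩ := exists_incl he hf hF hG i a j hag z.2.2 h2 h3
  refine ⟨_, (inclDagger_apply e f hF i a j x y).trans ?_⟩
  exact Prod.ext (congrArg Prod.fst h1).symm (Prod.ext (congrArg (fun t => t.2.1) h1).symm hxy)

lemma inclDaggerC_quotDaggerC (he : LineBasis e ε) (hf : LineBasis f φ)
    (hF : Module.finrank R F'' = 1)
    (hG : Module.finrank R G'' = 1) (Φ' : Module.Dual R G' →ₗ[R] F')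
    (Φ'' : Module.Dual R G'' →ₗ[R] F'') (h : Φ'' ε = f) (i a : ℤ)
    (hag : a ≤ Module.finrank R (G' × G'') - 1) :
    inclDaggerC he hf hF Φ' Φ'' h i a ≫ quotDaggerC he hf hF hG Φ' Φ'' h i a hag = 0 :=
  HomologicalComplex.hom_ext _ _ fun j => ModuleCat.hom_ext (LinearMap.ext fun x =>
    quotDagger_inclDagger he hf hF hG i a j x)

lemma dagger_shortExact (he : LineBasis e ε) (hf : LineBasis f φ)
    (hF : Module.finrank R F'' = 1)
    (hG : Module.finrank R G'' = 1) (Φ' : Module.Dual R G' →ₗ[R] F')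
    (Φ'' : Module.Dual R G'' →ₗ[R] F'') (h : Φ'' ε = f) (i a : ℤ)
    (hag : a ≤ Module.finrank R (G' × G'') - 1) :
    (ShortComplex.mk _ _ (inclDaggerC_quotDaggerC he hf hF hG Φ' Φ'' h i a hag)).ShortExact :=
  shortExact_mk _ _ _ (fun j => inclDagger_injective he hf hF i a j)
    (fun j x hx => exists_inclDagger he hf hF hG i a j hag x hx)
    (fun j => quotDagger_surjective he hf hF hG i a j hag)

/-- The map of complexes `incl‡`. -/
def inclDdaggerC (he : LineBasis e ε) (hf : LineBasis f φ) (hF : Module.finrank R F'' = 1)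
    (hG : Module.finrank R G'' = 1) (Φ' : Module.Dual R G' →ₗ[R] F')
    (Φ'' : Module.Dual R G'' →ₗ[R] F'') (h : Φ'' ε = f) (i a : ℤ)
    (hag : a ≤ Module.finrank R (G' × G'') - 1) :
    prodC (CComplex Φ' i a) (tensorC (CComplex Φ' i (a - 1)) (Module.Dual R G'')) ⟶
      DComplex he hf hF hG Φ' Φ'' h i a hag :=
  mkHom (A := prodC (CComplex Φ' i a) (tensorC (CComplex Φ' i (a - 1)) (Module.Dual R G'')))
    (B := DComplex he hf hF hG Φ' Φ'' h i a hag)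
    (fun j => inclDdagger Φ'' hF hG i a j)
    (fun j _ hj x => (DComplex_d he hf hF hG Φ' Φ'' h i a hag hj _).trans
      ((dDiff_inclDdagger he hf hF hG Φ' Φ'' h i a hag hj x).trans
        (congrArg (inclDdagger Φ'' hF hG i a j) (prodC_CComplex_d Φ' i a hj x).symm)))

/-- The map of complexes `quot‡`. -/
def quotDdaggerC (he : LineBasis e ε) (hf : LineBasis f φ) (hF : Module.finrank R F'' = 1)
    (hG : Module.finrank R G'' = 1) (Φ' : Module.Dual R G' →ₗ[R] F')
    (Φ'' : Module.Dual R G'' →ₗ[R] F'') (h : Φ'' ε = f) (i a : ℤ)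
    (hag : a ≤ Module.finrank R (G' × G'') - 1) :
    DComplex he hf hF hG Φ' Φ'' h i a hag ⟶
    Tot (tensorMapC (shiftC (KComplex (LinearMap.fst R F' F'' ∘ₗ blockSum Φ' Φ'')
      (Module.finrank R (F' × F'') - Module.finrank R (G' × G'') - i - 2) a) (-i - 2)) Φ'') :=
  mkHom (A := DComplex he hf hF hG Φ' Φ'' h i a hag)
    (fun j => quotDdagger (R := R) (F' := F') (F'' := F'') (G' := G') (G'' := G'') i a j)
    (fun j _ hj x => (quotDdagger_dDiff he hf hF hG Φ' Φ'' h i a hj x).symm.trans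
      (congrArg (quotDdagger (R := R) (F' := F') (F'' := F'') (G' := G') (G'' := G'') i a j)
        (DComplex_d he hf hF hG Φ' Φ'' h i a hag hj x).symm))

lemma inclDdaggerC_quotDdaggerC (he : LineBasis e ε) (hf : LineBasis f φ)
    (hF : Module.finrank R F'' = 1)
    (hG : Module.finrank R G'' = 1) (Φ' : Module.Dual R G' →ₗ[R] F')
    (Φ'' : Module.Dual R G'' →ₗ[R] F'') (h : Φ'' ε = f) (i a : ℤ)
    (hag : a ≤ Module.finrank R (G' × G'') - 1) :
    inclDdaggerC he hf hF hG Φ' Φ'' h i a hag ≫ quotDdaggerC he hf hF hG Φ' Φ'' h i a hag = 0 :=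
  HomologicalComplex.hom_ext _ _ fun j => ModuleCat.hom_ext (LinearMap.ext fun x =>
    quotDdagger_comp_inclDdagger he hf Φ'' h hF hG i a j x)

lemma ddagger_shortExact (he : LineBasis e ε) (hf : LineBasis f φ)
    (hF : Module.finrank R F'' = 1)
    (hG : Module.finrank R G'' = 1) (Φ' : Module.Dual R G' →ₗ[R] F')
    (Φ'' : Module.Dual R G'' →ₗ[R] F'') (h : Φ'' ε = f) (i a : ℤ) (ha : 1 ≤ a)
    (hag : a ≤ Module.finrank R (G' × G'') - 1) :
    (ShortComplex.mk _ _ (inclDdaggerC_quotDdaggerC he hf hF hG Φ' Φ'' h i a hag)).ShortExact :=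
  shortExact_mk _ _ _ (fun j => inclDdagger_injective he hf Φ'' h hF hG i a j)
    (fun j x hx => exists_inclDdagger he hf Φ'' h hF hG i a j ha x hx)
    (fun j => quotDdagger_surjective he hf i a j ha)

end Complexes

end HookEN.Internal

end

theorem mainTheorem4 {R : Type u} [CommRing R] [IsNoetherianRing R] [Nontrivial R]
    {F' F'' G' G'' : Type u}
    [AddCommGroup F'] [Module R F'] [Module.Free R F'] [Module.Finite R F']
    [AddCommGroup F''] [Module R F''] [Module.Free R F''] [Module.Finite R F'']
    [AddCommGroup G'] [Module R G'] [Module.Free R G'] [Module.Finite R G']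
    [AddCommGroup G''] [Module R G''] [Module.Free R G''] [Module.Finite R G'']
    (hF : Module.finrank R F'' = 1) (hG : Module.finrank R G'' = 1)
    (hgf : Module.finrank R (G' × G'') ≤ Module.finrank R (F' × F''))
    (Φ' : Module.Dual R G' →ₗ[R] F') (Φ'' : Module.Dual R G'' ≃ₗ[R] F'')
    (i a : ℤ) (ha : 1 ≤ a) (hag : a ≤ Module.finrank R (G' × G'') - 1) :
    let f : ℤ := Module.finrank R (F' × F'')
    let g : ℤ := Module.finrank R (G' × G'')
    let C : ChainComplex (ModuleCat.{u} R) ℤ :=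
      HookEN.CComplex (HookEN.blockSum Φ' Φ''.toLinearMap) i a
    let C' : ChainComplex (ModuleCat.{u} R) ℤ := HookEN.CComplex Φ' i a
    let C'' : ChainComplex (ModuleCat.{u} R) ℤ := HookEN.CComplex Φ' i (a - 1)
    let C''G : ChainComplex (ModuleCat.{u} R) ℤ := HookEN.tensorC C'' (Module.Dual R G'')
    let TL : ChainComplex (ModuleCat.{u} R) ℤ := HookEN.Tot
      (HookEN.tensorMapC
        (HookEN.LComplex (LinearMap.fst R F' F'' ∘ₗ HookEN.blockSum Φ' Φ''.toLinearMap)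
          (f - i - 1) (g - a))
        (HookEN.kosTwist Φ''.toLinearMap))
    let TK : ChainComplex (ModuleCat.{u} R) ℤ := HookEN.Tot
      (HookEN.tensorMapC
        (HookEN.shiftC
          (HookEN.KComplex (LinearMap.fst R F' F'' ∘ₗ HookEN.blockSum Φ' Φ''.toLinearMap)
            (f - g - i - 2) a) (-i - 2))
        Φ''.toLinearMap)
    ∃ (D : ChainComplex (ModuleCat.{u} R) ℤ)
      (θ : ∀ j, D.X j ≃ₗ[R] HookEN.DMod R F' F'' G' G'' i a j)
      (incl₁ : TL ⟶ C) (quot₁ : C ⟶ D)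
      (incl₂ : HookEN.prodC C' C''G ⟶ D) (quot₂ : D ⟶ TK)
      (z₁ : incl₁ ≫ quot₁ = 0) (z₂ : incl₂ ≫ quot₂ = 0),
      (∀ j, Module.Free R (D.X j)) ∧
      (∀ j x, (incl₁.f j).hom x = HookEN.inclDagger hF i a j x) ∧
      (∀ j x, θ j ((quot₁.f j).hom x) = HookEN.quotDagger hF hG i a j x) ∧
      (∀ j x y, θ j ((incl₂.f j).hom (x, y)) =
        HookEN.inclDdagger₁ Φ''.toLinearMap hF hG i a j x +
          HookEN.inclDdagger₂ Φ''.toLinearMap hF hG i a j y) ∧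
      (∀ j x, (quot₂.f j).hom x =
        HookEN.quotDdagger (R := R) (F' := F') (F'' := F'') (G' := G') (G'' := G'') i a j (θ j x)) ∧
      (ShortComplex.mk incl₁ quot₁ z₁).ShortExact ∧
      (ShortComplex.mk incl₂ quot₂ z₂).ShortExact ∧
      TL.Acyclic ∧ TK.Acyclic ∧
      ∀ j, ∃ e : ((C'.homology j) × ((C''.homology j) ⊗[R] Module.Dual R G'')) ≃ₗ[R] C.homology j,
        ∀ (x : C'.homology j) (y : C''.homology j) (γ : Module.Dual R G''),
          (HomologicalComplex.homologyMap quot₁ j).hom (e (x, y ⊗ₜ[R] γ)) =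
            (HomologicalComplex.homologyMap (HookEN.prodInl C' C''G ≫ incl₂) j).hom x +
            (HomologicalComplex.homologyMap
              (HookEN.tensorBy C'' γ ≫ HookEN.prodInr C' C''G ≫ incl₂) j).hom y := by
  intro f g C C' C'' C''G TL TK
  -- Bases `e` of `G''` and `Φ''(e*)` of `F''`.
  have h₀ := HookEN.Internal.exists_lineBasis hG
  have he := h₀.choose_spec.choose_spec
  have hf := he.dual.map Φ''
  have hTL : TL.Acyclic := HookEN.Internal.Tot_acyclic _ fun j =>
    HookEN.Internal.tensorMapC_bijective _ (HookEN.Internal.kosTwist_bijective he hf Φ''.toLinearMap rfl) j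
  have hTK : TK.Acyclic := HookEN.Internal.Tot_acyclic _ fun j =>
    HookEN.Internal.tensorMapC_bijective _ Φ''.bijective j
  have hS₁ := HookEN.Internal.dagger_shortExact he hf hF hG Φ' Φ''.toLinearMap rfl i a hag
  have hS₂ := HookEN.Internal.ddagger_shortExact he hf hF hG Φ' Φ''.toLinearMap rfl i a ha hag
  -- The modules of `D` are the direct sums `DMod` themselves, so that `θ` is the identity.
  exact ⟨HookEN.Internal.DComplex he hf hF hG Φ' Φ''.toLinearMap rfl i a hag,
    fun j => LinearEquiv.refl R (HookEN.DMod R F' F'' G' G'' i a j),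
    HookEN.Internal.inclDaggerC he hf hF Φ' Φ''.toLinearMap rfl i a,
    HookEN.Internal.quotDaggerC he hf hF hG Φ' Φ''.toLinearMap rfl i a hag,
    HookEN.Internal.inclDdaggerC he hf hF hG Φ' Φ''.toLinearMap rfl i a hag,
    HookEN.Internal.quotDdaggerC he hf hF hG Φ' Φ''.toLinearMap rfl i a hag,
    HookEN.Internal.inclDaggerC_quotDaggerC he hf hF hG Φ' Φ''.toLinearMap rfl i a hag,
    HookEN.Internal.inclDdaggerC_quotDdaggerC he hf hF hG Φ' Φ''.toLinearMap rfl i a hag,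
    fun j => HookEN.Internal.dMod_free hG i a j ha hag, fun j x => rfl, fun j x => rfl,
    fun j x y => rfl, fun j x => rfl, hS₁, hS₂, hTL, hTK,
    fun j => HookEN.Internal.exists_homology_equiv he.dual.coeff_self he.dual.decomp _ _ j
      (HookEN.Internal.bijective_homologyMap_g hS₁ hTL j) (HookEN.Internal.bijective_homologyMap_f hS₂ hTK j)⟩
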